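/- **Setting.** Fix $\tilde C\in(0,1)$, an integer $N\ge 1$ and a constant $A>0$; "$\lesssim\epsilon$" means "$\le A\epsilon$", and $\mathring{g}$ is the unit round metric on $\mathbb S^2$. A Lorentzian metric $g$ on $\mathcal M=I\times(-\infty,0)\times\mathbb S^2\ni(q,s,\theta)$, with $I=(-c,c)$ for some $c>0$, is *$\epsilon$-twisted self-similar* if 1. there is a smooth vector field $K$ with $\mathcal L_Kg=2g$ whose orbits are complete and are the curves of constant $(q,\theta)$; 2. $g\in C^0_qC^2_{s,\theta}$, $g$ is $C^2$ on $\{q\ne0\}$, and $|q|^{\tilde C}\mathcal L_{\partial_q}g$ extends to $\{q=0\}$ by $0$ as a $C^0_qC^1_{s,\theta}$ tensor; 3. $\mathcal H_0=\{q=0\}$ is a null hypersurface; 4. for some $s_0<0$, on the sphere $\mathcal S=\{q=0,\ s=s_0\}$ the induced metric $\slashed g$ satisfies $\|\slashed g-\mathring{g}\|_{C^N(\mathcal S)}\lesssim\epsilon$, and the orthogonal projection of $K$ to $T\mathcal S$ satisfies $\|\Pi_{T\mathcal S}K\|_{C^N(\mathcal S)}\lesssim\epsilon$ (norms with respect to $\mathring{g}$).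 It is *one-sided* if instead $I=[0,c)$ or $I=(-c,0]$. An open set $\tilde{\mathcal M}\supset\mathcal H_0$ is in the *homothetic gauge* if it is covered by a $C^1$ coordinate system $(\rho,t,\theta)\in(-\tilde c,\tilde c)\times(-\infty,0)\times\mathbb S^2$, $\tilde c>0$ (in the one-sided case $\rho\in[0,\tilde c)$ or $\rho\in(-\tilde c,0]$), such that $\mathcal H_0=\{\rho=0\}$, $K=t\partial_t$, and $$g=P\,dt^2+2t(dt\otimes d\rho+d\rho\otimes dt)-h_A(dt\otimes d\theta^A+d\theta^A\otimes dt)+\slashed g_{AB}\,d\theta^A\otimes d\theta^B ,$$ where $P$ is a function, $h$ is a one-form and $\slashed g$ a Riemannian metric on the spheres of constant $(\rho,t)$, and $P=|h|^2_{\slashed g}$ on $\{\rho=0\}$. **Proposition.** There is $\epsilon_0>0$, depending only on $\tilde C,N,A$, such that the following holds for every $\epsilon\in(0,\epsilon_0)$ and every $\epsilon$-twisted self-similar spacetime $(\mathcal M,g)$, one-sided or not. There is a (relatively) open set $\tilde{\mathcal M}\subset\mathcal M$ which contains $\mathcal H_0$, is invariant under the flow of $K$, and can be put in the homothetic gauge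 by the following procedure. 1. There is a unique function $t:\mathcal H_0\to(-\infty,0)$ with $t|_{\mathcal S}=-1$ and $K\log(-t)=1$. Together with $\theta$, which satisfies $K\theta=0$, it gives a smooth coordinate system $(t,\theta)\in(-\infty,0)\times\mathbb S^2$ on $\mathcal H_0$, in which the induced metric has the form $$-b_A(dt\otimes d\theta^A+d\theta^A\otimes dt)+|b|^2_{\slashed g}\,dt\otimes dt+\slashed g_{AB}\,d\theta^A\otimes d\theta^B ,$$ with $b$ a one-form and $\slashed g$ a Riemannian metric on the spheres $\mathcal S_t$ of constant $t$. 2. There is a unique $C^1$ vector field $V$ along $\mathcal H_0$, tangent to $\mathcal M$, with $g(V,V)=0$ and $\mathcal L_KV=0$ on $\mathcal H_0$, and with $g(V,K)=2$ and $V\perp T\mathcal S$ on $\mathcal S=\{t=-1\}$. It extends to a continuous vector field $V$ on $\tilde{\mathcal M}$ with $D_VV=0$ weakly, i.e. in local coordinates $(q,s,\theta^A)$ every integral curve $x(\tau)$ of $V$, with velocity $y$, satisfies $$x^\lambda(\tau)=x^\lambda(a)+\int_a^\tau y^\lambda\,dw,\qquad y^\lambda(\tau)=y^\lambda(a)-\int_a^\tau\Gamma^\lambda_{\mu\nu}(x(w))\,y^\mu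 y^\nu\,dw .$$ The extension is determined by its values on $\mathcal H_0$: a curve in $\tilde{\mathcal M}$ that satisfies these equations and starts at a point of $\mathcal H_0$ with velocity $V$ is an integral curve of $V$. 3. There is a $C^1$ coordinate system $(\rho,t,\theta)$ on $\tilde{\mathcal M}$ with $\rho=0$ on $\mathcal H_0$ and $V\rho=1$, in which $t$ and $\theta$ extend the coordinates of step 1 with $Vt=0$ and $V\theta=0$. In these coordinates $\tilde{\mathcal M}$ is in the homothetic gauge. Moreover, the form of the metric in the homothetic gauge is unique once the coordinates $(t,\theta)$ on $\mathcal H_0$, and with them the form of the induced metric there, are fixed: if two open sets containing $\mathcal H_0$ are in the homothetic gauge with coordinates that agree on $\mathcal H_0$, then their coefficients $P$, $h$ and $\slashed g$ agree, as functions of $(\rho,t,\theta)$, wherever both are defined. -/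

import Mathlib

open scoped ContDiff

noncomputable section

/-! ## The underlying manifold

The unit sphere is regarded as a subset of Euclidean three-space, and the spacetime as the subset
`{(q, s, θ)}` of `ℝ × ℝ × ℝ³` with `q` in an interval around `0`, `s < 0` and `‖θ‖ = 1`.
Tangent vectors at `(q, s, θ)` are the triples `(a, b, w)` with `w` orthogonal to `θ`. -/

/-- Euclidean three-space. -/
abbrev E3 : Type := EuclideanSpace ℝ (Fin 3)

/-- The ambient space of the product manifolds `interval × (-∞, 0) × S²`. -/
abbrev Amb : Type := ℝ × ℝ × E3

/-- Fields of bilinear forms; only the values on tangent vectors are ever used. -/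
abbrev BilinField : Type := Amb → Amb →L[ℝ] Amb →L[ℝ] ℝ

/-- The product `{q ∈ D : |q| < c} × (-∞, 0) × S²`. Here `D` is `ℝ` (two-sided case), `[0, ∞)` or
`(-∞, 0]` (one-sided cases), so the first factor is `(-c, c)`, `[0, c)` or `(-c, 0]`. -/
def cylinder (D : Set ℝ) (c : ℝ) : Set Amb :=
  {p | p.1 ∈ D ∧ |p.1| < c ∧ p.2.1 < 0 ∧ ‖p.2.2‖ = 1}

/-- The three kinds of first factor. -/
def IsSide (D : Set ℝ) : Prop := D = Set.univ ∨ D = Set.Ici 0 ∨ D = Set.Iic 0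

/-- The hypersurface `ℋ₀ = {q = 0}`. -/
def hypersurfaceZero : Set Amb := {p | p.1 = 0 ∧ p.2.1 < 0 ∧ ‖p.2.2‖ = 1}

/-- `u` is tangent to the product manifold at `p`. -/
def IsTangent (p u : Amb) : Prop := inner ℝ p.2.2 u.2.2 = 0

/-- `u` is tangent to `ℋ₀` at `p`. -/
def IsTangentZero (p u : Amb) : Prop := u.1 = 0 ∧ IsTangent p u

/-- The smooth retraction `(q, s, x) ↦ (q, s, x / ‖x‖)`. It is used to differentiate maps that are
defined on the product manifold. -/
def radial (p : Amb) : Amb := (p.1, p.2.1, ‖p.2.2‖⁻¹ • p.2.2)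

/-- `F` is `C^k` on the relatively open subset `A` of the product manifold (up to the boundary in
the one-sided case). -/
def IsCkOn {F : Type*} [NormedAddCommGroup F] [NormedSpace ℝ F] (k : WithTop ℕ∞) (f : Amb → F)
    (A : Set Amb) : Prop :=
  ContDiffOn ℝ k (f ∘ radial) (radial ⁻¹' A)

/-- The differential at `p ∈ A` of a map on the relatively open subset `A` of the product manifold,
applied to a tangent vector `u`. -/
def differential {F : Type*} [NormedAddCommGroup F] [NormedSpace ℝ F] (f : Amb → F)
    (A : Set Amb) (p u : Amb) : F :=
  fderivWithin ℝ (f ∘ radial) (radial ⁻¹' A) p u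

/-- The differential at `p ∈ ℋ₀` of a function `t` on `ℋ₀`, applied to a vector `u` tangent to
`ℋ₀`. -/
def differentialZero (t : Amb → ℝ) (p u : Amb) : ℝ :=
  fderiv ℝ (fun w : ℝ × E3 => t (radial (0, w))) p.2 u.2

/-! ## Local coordinates and tensor components -/

/-- A smooth local parametrization of the unit sphere, i.e. local coordinates `θ^A` on it. -/
structure SphereChart where
  /-- the range of the local coordinates -/
  U : Set (Fin 2 → ℝ)
  /-- the point with given local coordinates -/
  χ : (Fin 2 → ℝ) → E3
  isOpen : IsOpen U
  smooth : ContDiffOn ℝ ∞ χ U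
  norm_eq : ∀ y ∈ U, ‖χ y‖ = 1
  injOn : Set.InjOn χ U
  immersion : ∀ y ∈ U, Function.Injective (fderiv ℝ χ y)

namespace SphereChart

/-- The point with coordinates `z = (q, s, θ^1, θ^2)`. -/
def point (φ : SphereChart) (z : Fin 4 → ℝ) : Amb := (z 0, z 1, φ.χ ![z 2, z 3])

/-- The range of the coordinates `(q, s, θ^1, θ^2)` on `cylinder D c`. -/
def dom (φ : SphereChart) (D : Set ℝ) (c : ℝ) : Set (Fin 4 → ℝ) :=
  {z | z 0 ∈ D ∧ |z 0| < c ∧ z 1 < 0 ∧ ![z 2, z 3] ∈ φ.U}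

/-- The coordinate vector field `∂_μ`. -/
def frame (φ : SphereChart) (z : Fin 4 → ℝ) (μ : Fin 4) : Amb :=
  fderiv ℝ φ.point z (Pi.single μ 1)

/-- The components `g_{μν}`. -/
def metric (φ : SphereChart) (g : BilinField) (z : Fin 4 → ℝ) : Matrix (Fin 4) (Fin 4) ℝ :=
  Matrix.of fun μ ν => g (φ.point z) (φ.frame z μ) (φ.frame z ν)

/-- The components `X^μ` of a vector field: the coefficients with `X = ∑ X^μ ∂_μ`. -/
def vec (φ : SphereChart) (X : Amb → Amb) (z : Fin 4 → ℝ) : Fin 4 → ℝ :=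
  Function.invFun (fun a : Fin 4 → ℝ => ∑ μ, a μ • φ.frame z μ) (X (φ.point z))

/-- The partial derivative `∂_μ F` of a function of the coordinates (one-sided in `q` at a boundary
point of the coordinate range). -/
def partial_ (φ : SphereChart) (D : Set ℝ) (c : ℝ) (μ : Fin 4) (F : (Fin 4 → ℝ) → ℝ)
    (z : Fin 4 → ℝ) : ℝ :=
  lineDerivWithin ℝ F (φ.dom D c) z (Pi.single μ 1)

/-- The components `(ℒ_X g)_{μν}` of the Lie derivative of a metric. -/
def lieMetric (φ : SphereChart) (D : Set ℝ) (c : ℝ) (X : Amb → Amb) (g : BilinField)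
    (z : Fin 4 → ℝ) (μ ν : Fin 4) : ℝ :=
  ∑ σ, (φ.vec X z σ * φ.partial_ D c σ (fun z' => φ.metric g z' μ ν) z
    + φ.metric g z σ ν * φ.partial_ D c μ (fun z' => φ.vec X z' σ) z
    + φ.metric g z μ σ * φ.partial_ D c ν (fun z' => φ.vec X z' σ) z)

/-- The components `(ℒ_X Y)^μ` of the Lie derivative of a vector field. -/
def lieVec (φ : SphereChart) (D : Set ℝ) (c : ℝ) (X Y : Amb → Amb)
    (z : Fin 4 → ℝ) (μ : Fin 4) : ℝ :=
  ∑ σ, (φ.vec X z σ * φ.partial_ D c σ (fun z' => φ.vec Y z' μ) z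
    - φ.vec Y z σ * φ.partial_ D c σ (fun z' => φ.vec X z' μ) z)

/-- The Christoffel symbols `Γ^l_{μν}` of the Levi-Civita connection. -/
def christoffel (φ : SphereChart) (D : Set ℝ) (c : ℝ) (g : BilinField)
    (z : Fin 4 → ℝ) (l μ ν : Fin 4) : ℝ :=
  (1 / 2) * ∑ σ, (φ.metric g z)⁻¹ l σ *
    (φ.partial_ D c μ (fun z' => φ.metric g z' σ ν) z
      + φ.partial_ D c ν (fun z' => φ.metric g z' σ μ) z
      - φ.partial_ D c σ (fun z' => φ.metric g z' μ ν) z)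

end SphereChart

/-- `F(q, s, θ)` is of class `C^0_q C^k_{s,θ}` on `A`: all partial derivatives in `(s, θ)` up to
order `k` exist and are continuous in `(q, s, θ)`. -/
def IsC0Ck (k : ℕ) (F : (Fin 4 → ℝ) → ℝ) (A : Set (Fin 4 → ℝ)) : Prop :=
  (∀ q : ℝ, ContDiffOn ℝ k (fun w : Fin 3 → ℝ => F (Matrix.vecCons q w))
    {w | Matrix.vecCons q w ∈ A}) ∧
  ∀ j ≤ k, ContinuousOn (fun z : Fin 4 → ℝ =>
    iteratedFDeriv ℝ j (fun w : Fin 3 → ℝ => F (Matrix.vecCons (z 0) w)) (Matrix.vecTail z)) A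

/-- `g` is, at `p`, a symmetric bilinear form of signature `(-,+,+,+)` on the tangent space. -/
def IsLorentzianAt (g : BilinField) (p : Amb) : Prop :=
  (∀ u v, IsTangent p u → IsTangent p v → g p u v = g p v u) ∧
  ∃ τ, IsTangent p τ ∧ g p τ τ < 0 ∧
    ∀ v, IsTangent p v → g p τ v = 0 → v ≠ 0 → 0 < g p v v

/-! ## `C^N` norms on the round sphere -/

/-- Orthogonal projection of `ℝ³` to the tangent plane of the unit sphere at the unit vector `x`. -/
def tanProj (x : E3) : E3 →L[ℝ] E3 :=
  ContinuousLinearMap.id ℝ E3 - (innerSL ℝ x).smulRight x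

/-- The covariant derivative, for the round metric, of a covariant tensor field on the unit sphere.
A covariant tensor at `x` is a multilinear form on `ℝ³` which depends only on the tangential parts
of its arguments, and the covariant derivative is the tangential part of the derivative in `ℝ³`. -/
def roundCov {k : ℕ} (T : E3 → E3 [×k]→L[ℝ] ℝ) (x : E3) : E3 [×(k + 1)]→L[ℝ] ℝ :=
  ((fderiv ℝ (fun y : E3 => T (‖y‖⁻¹ • y)) x).uncurryLeft).compContinuousLinearMap
    fun _ => tanProj x

/-- Iterated covariant derivatives for the round metric. -/
def roundCovIter {k : ℕ} (T : E3 → E3 [×k]→L[ℝ] ℝ) : (j : ℕ) → E3 → E3 [×(k + j)]→L[ℝ] ℝ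
  | 0 => T
  | j + 1 => roundCov (roundCovIter T j)

/-- `T` is a `C^N` tensor field on the unit sphere and its covariant derivatives up to order `N` are
bounded by `δ`, with respect to the round metric. -/
def CNormLE (N : ℕ) {k : ℕ} (T : E3 → E3 [×k]→L[ℝ] ℝ) (δ : ℝ) : Prop :=
  ContDiffOn ℝ N (fun y : E3 => T (‖y‖⁻¹ • y)) {0}ᶜ ∧
  ∀ j ≤ N, ∀ x : E3, ‖x‖ = 1 → ‖roundCovIter T j x‖ ≤ δ

/-! ## Twisted self-similar spacetimes -/

/-- The Lorentzian manifold `(cylinder D c, g)` is an `ε`-twisted self-similar spacetime, with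
homothetic vector field `K` and with the sphere `𝒮 = {q = 0, s = s₀}`. The number `Ct` is the small
exponent in the regularity condition, `N` is the order of differentiability on `𝒮`, and `A` is the
implied constant in the bounds by `ε`. -/
structure IsTwistedSelfSimilar (D : Set ℝ) (Ct : ℝ) (N : ℕ) (A ε c : ℝ) (g : BilinField)
    (K : Amb → Amb) (s₀ : ℝ) : Prop where
  c_pos : 0 < c
  lorentzian : ∀ p ∈ cylinder D c, IsLorentzianAt g p
  /-- `K` is a smooth vector field. -/
  K_tangent : ∀ p ∈ cylinder D c, IsTangent p (K p)
  K_smooth : IsCkOn ∞ K (cylinder D c)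
  /-- `ℒ_K g = 2 g`. -/
  homothetic : ∀ φ : SphereChart, ∀ z ∈ φ.dom D c, ∀ μ ν,
    φ.lieMetric D c K g z μ ν = 2 * φ.metric g z μ ν
  /-- The orbits of `K` are complete and are the curves of constant `q` and `θ`. -/
  orbits : ∀ p ∈ cylinder D c, ∃ γ : ℝ → Amb, γ 0 = p ∧ (∀ τ, HasDerivAt γ (K (γ τ)) τ) ∧
    Set.range γ = {p' : Amb | p'.1 = p.1 ∧ p'.2.1 < 0 ∧ p'.2.2 = p.2.2}
  /-- `g` is of class `C^0_q C^2_{s,θ}`. -/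
  regular : ∀ φ : SphereChart, ∀ μ ν, IsC0Ck 2 (fun z => φ.metric g z μ ν) (φ.dom D c)
  /-- `g` is `C^2` away from `{q = 0}`. -/
  regular_off : ∀ φ : SphereChart, ∀ μ ν, ContDiffOn ℝ 2 (fun z => φ.metric g z μ ν)
    (φ.dom D c ∩ {z | z 0 ≠ 0})
  /-- `|q|^Ct ℒ_{∂_q} g` extends to `{q = 0}` by zero as a `C^0_q C^1_{s,θ}` tensor. -/
  regular_q : ∀ φ : SphereChart, ∀ μ ν, IsC0Ck 1
    (fun z => if z 0 = 0 then 0 else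
      |z 0| ^ Ct * φ.partial_ D c 0 (fun z' => φ.metric g z' μ ν) z) (φ.dom D c)
  /-- `ℋ₀` is a null hypersurface: the induced metric is degenerate at each point. -/
  null_zero : ∀ p ∈ hypersurfaceZero, ∃ L, L ≠ 0 ∧ IsTangentZero p L ∧
    ∀ w, IsTangentZero p w → g p L w = 0
  s₀_neg : s₀ < 0
  /-- The induced metric on `𝒮` differs from the round metric by at most `A ε` in `C^N`. -/
  sphere_metric : ∃ T : E3 → E3 [×2]→L[ℝ] ℝ,
    (∀ θ : E3, ‖θ‖ = 1 → ∀ u : Fin 2 → E3,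
      T θ u = g (0, s₀, θ) (0, 0, tanProj θ (u 0)) (0, 0, tanProj θ (u 1))
        - inner ℝ (tanProj θ (u 0)) (tanProj θ (u 1))) ∧
    CNormLE N T (A * ε)
  /-- The orthogonal projection `Y` of `K` to `T𝒮` is at most `A ε` in `C^N`; the norms of `Y` are
  those of its dual one-form for the round metric. -/
  sphere_K : ∃ Y : E3 → E3,
    (∀ θ : E3, ‖θ‖ = 1 → inner ℝ θ (Y θ) = 0 ∧
      ∀ w : E3, inner ℝ θ w = 0 → g (0, s₀, θ) (K (0, s₀, θ) - (0, 0, Y θ)) (0, 0, w) = 0) ∧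
    ∃ T : E3 → E3 [×1]→L[ℝ] ℝ,
      (∀ θ : E3, ‖θ‖ = 1 → ∀ u : Fin 1 → E3, T θ u = inner ℝ (Y θ) (u 0)) ∧
      CNormLE N T (A * ε)

/-! ## Weak geodesics -/

/-- The curve `γ` in `cylinder D c` is a weak solution of the (affinely parametrized) geodesic
equation on the interval `J`: in local coordinates `z = (q, s, θ^A)`, with `y = dz/dτ`,
`z^l(τ) = z^l(a) + ∫_a^τ y^l` and `y^l(τ) = y^l(a) - ∫_a^τ Γ^l_{μν}(z) y^μ y^ν`. -/
def IsWeakGeodesic (D : Set ℝ) (c : ℝ) (g : BilinField) (γ : ℝ → Amb) (J : Set ℝ) : Prop :=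
  (∀ τ ∈ J, γ τ ∈ cylinder D c) ∧ ContinuousOn γ J ∧
  ∀ (φ : SphereChart) (a b : ℝ), a < b → Set.Icc a b ⊆ J →
    ∀ z : ℝ → Fin 4 → ℝ, (∀ τ ∈ Set.Icc a b, z τ ∈ φ.dom D c ∧ φ.point (z τ) = γ τ) →
      ∃ y : ℝ → Fin 4 → ℝ, ContinuousOn y (Set.Icc a b) ∧
        ∀ l : Fin 4,
          (∀ τ ∈ Set.Icc a b, z τ l = z a l + ∫ w in a..τ, y w l) ∧
          IntervalIntegrable
            (fun w => ∑ μ, ∑ ν, φ.christoffel D c g (z w) l μ ν * y w μ * y w ν)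
            MeasureTheory.volume a b ∧
          ∀ τ ∈ Set.Icc a b, y τ l = y a l -
            ∫ w in a..τ, ∑ μ, ∑ ν, φ.christoffel D c g (z w) l μ ν * y w μ * y w ν

/-- `γ` is an integral curve in `B`, on the interval `J`, of the vector field `V`. -/
def IsIntegralCurveIn (V : Amb → Amb) (B : Set Amb) (γ : ℝ → Amb) (J : Set ℝ) : Prop :=
  ∀ τ ∈ J, γ τ ∈ B ∧ HasDerivWithinAt γ (V (γ τ)) J τ

/-- `D_V V = 0` holds weakly in `B`: the integral curves of `V` are weak geodesics. -/
def IsWeaklyGeodesicField (D : Set ℝ) (c : ℝ) (g : BilinField) (V : Amb → Amb) (B : Set Amb) :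
    Prop :=
  ∀ (J : Set ℝ) (γ : ℝ → Amb), J.OrdConnected → IsIntegralCurveIn V B γ J →
    IsWeakGeodesic D c g γ J

/-! ## The homothetic gauge -/

/-- `B` is a relatively open subset of `cylinder D c`. -/
def IsOpenIn (D : Set ℝ) (c : ℝ) (B : Set Amb) : Prop :=
  ∃ O : Set Amb, IsOpen O ∧ B = cylinder D c ∩ O

/-- `B` is invariant under the flow of `K`. -/
def IsFlowInvariant (D : Set ℝ) (c : ℝ) (K : Amb → Amb) (B : Set Amb) : Prop :=
  ∀ γ : ℝ → Amb, IsIntegralCurveIn K (cylinder D c) γ Set.univ → γ 0 ∈ B → ∀ τ, γ τ ∈ B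

/-- The bilinear form `m` is symmetric and positive definite on the tangent plane of the unit
sphere at `θ`. -/
def IsRiemannianAt (m : E3 →L[ℝ] E3 →L[ℝ] ℝ) (θ : E3) : Prop :=
  (∀ u v : E3, inner ℝ θ u = 0 → inner ℝ θ v = 0 → m u v = m v u) ∧
  ∀ u : E3, inner ℝ θ u = 0 → u ≠ 0 → 0 < m u u

/-- `r = |h|²_m` for the one-form `h` on the tangent plane of the unit sphere at `θ`; here `b` is
the vector `m`-dual to `h`. -/
def IsNormSq (m : E3 →L[ℝ] E3 →L[ℝ] ℝ) (h : E3 →L[ℝ] ℝ) (θ : E3) (r : ℝ) : Prop :=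
  ∃ b : E3, inner ℝ θ b = 0 ∧ (∀ w : E3, inner ℝ θ w = 0 → m b w = h w) ∧ r = m b b

/-- The value on `u = (u^ρ, u^t, u^θ)` and `v` of
`P dt² + 2 t (dt ⊗ dρ + dρ ⊗ dt) - h_A (dt ⊗ dθ^A + dθ^A ⊗ dt) + m_{AB} dθ^A ⊗ dθ^B`. -/
def homotheticForm (P t : ℝ) (h : E3 →L[ℝ] ℝ) (m : E3 →L[ℝ] E3 →L[ℝ] ℝ) (u v : Amb) : ℝ :=
  P * (u.2.1 * v.2.1) + 2 * t * (u.2.1 * v.1 + u.1 * v.2.1)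
    - (u.2.1 * h v.2.2 + h u.2.2 * v.2.1) + m u.2.2 v.2.2

/-- `X` is a `C^1` coordinate system on `B` with range `cylinder D' c'`. -/
def IsCoordinateSystem (D' : Set ℝ) (c' : ℝ) (B : Set Amb) (X : Amb → Amb) : Prop :=
  Set.MapsTo X B (cylinder D' c') ∧ IsCkOn 1 X B ∧
  ∃ Ψ : Amb → Amb, Set.MapsTo Ψ (cylinder D' c') B ∧ IsCkOn 1 Ψ (cylinder D' c') ∧
    (∀ p ∈ B, Ψ (X p) = p) ∧ ∀ x ∈ cylinder D' c', X (Ψ x) = x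

/-- The open neighbourhood `B` of `ℋ₀` in `(cylinder D c, g)` is in the homothetic gauge with the
coordinates `X = (ρ, t, θ)`, which range over `(-c', c') × (-∞, 0) × S²` (or over the one-sided
analogue), and with the metric coefficients `P`, `h`, `m`, which are functions of `(ρ, t, θ)`. -/
structure IsHomotheticGauge (D : Set ℝ) (c : ℝ) (g : BilinField) (K : Amb → Amb)
    (D' : Set ℝ) (c' : ℝ) (B : Set Amb) (X : Amb → Amb)
    (P : Amb → ℝ) (h : Amb → E3 →L[ℝ] ℝ) (m : Amb → E3 →L[ℝ] E3 →L[ℝ] ℝ) : Prop where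
  c'_pos : 0 < c'
  /-- In the one-sided cases `ρ` may have either sign. -/
  side : D' = D ∨ D' = {r | -r ∈ D}
  isOpenIn : IsOpenIn D c B
  zero_subset : hypersurfaceZero ⊆ B
  coordinates : IsCoordinateSystem D' c' B X
  /-- `K = t ∂_t`. -/
  K_eq : ∀ p ∈ B, differential X B p (K p) = (0, (X p).2.1, 0)
  metric_eq : ∀ p ∈ B, ∀ u v, IsTangent p u → IsTangent p v →
    g p u v = homotheticForm (P (X p)) (X p).2.1 (h (X p)) (m (X p))
      (differential X B p u) (differential X B p v)
  riemannian : ∀ x ∈ cylinder D' c', IsRiemannianAt (m x) x.2.2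
  /-- `ℋ₀` is `{ρ = 0}`. -/
  zero_iff : ∀ p ∈ B, p ∈ hypersurfaceZero ↔ (X p).1 = 0
  /-- `P = |h|²` on `{ρ = 0}`. -/
  P_zero : ∀ x ∈ cylinder D' c', x.1 = 0 → IsNormSq (m x) (h x) x.2.2 (P x)

/-! ## The data along `ℋ₀` -/

/-- The function `t : ℋ₀ → (-∞, 0)` satisfies `t = -1` on `𝒮` and `K log (-t) = 1`. -/
def IsHomotheticTime (K : Amb → Amb) (s₀ : ℝ) (t : Amb → ℝ) : Prop :=
  (∀ p ∈ hypersurfaceZero, t p < 0) ∧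
  (∀ p ∈ hypersurfaceZero, p.2.1 = s₀ → t p = -1) ∧
  ∀ p ∈ hypersurfaceZero, HasLineDerivAt ℝ (fun p' => Real.log (-t p')) 1 p (K p)

/-- `(t, θ)` is a smooth coordinate system on `ℋ₀` with range `(-∞, 0) × S²`. Since the orbits of
`K` have constant `θ`, the map `p ↦ θ` is the identity on `𝒮` and satisfies `K θ = 0`. -/
def IsZeroCoordinates (t : Amb → ℝ) : Prop :=
  ContDiffOn ℝ ∞ (fun w : ℝ × E3 => t (radial (0, w))) {w | w.1 < 0 ∧ w.2 ≠ 0} ∧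
  Set.BijOn (fun p : Amb => (t p, p.2.2)) hypersurfaceZero
    (Set.Iio (0 : ℝ) ×ˢ {θ : E3 | ‖θ‖ = 1}) ∧
  ∀ p ∈ hypersurfaceZero, ∀ u, IsTangentZero p u → differentialZero t p u = 0 → u.2.2 = 0 → u = 0

/-- The metric induced on `ℋ₀` is
`- b_A (dt ⊗ dθ^A + dθ^A ⊗ dt) + |b|² dt ⊗ dt + m_{AB} dθ^A ⊗ dθ^B`, with a one-form `b` and a
Riemannian metric `m` on the spheres of constant `t`. -/
def HasInducedForm (g : BilinField) (t : Amb → ℝ) : Prop :=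
  ∀ p ∈ hypersurfaceZero, ∃ (b : E3 →L[ℝ] ℝ) (m : E3 →L[ℝ] E3 →L[ℝ] ℝ) (r : ℝ),
    IsRiemannianAt m p.2.2 ∧ IsNormSq m b p.2.2 r ∧
    ∀ u v, IsTangentZero p u → IsTangentZero p v →
      g p u v = -(differentialZero t p u * b v.2.2 + b u.2.2 * differentialZero t p v)
        + r * (differentialZero t p u * differentialZero t p v) + m u.2.2 v.2.2

/-- `V` is a `C^1` vector field along `ℋ₀`, in general transversal to it, with `g(V, V) = 0` and
`ℒ_K V = 0` on `ℋ₀`, and with `g(V, K) = 2` and `V ⊥ T𝒮` on `𝒮 = {t = -1}`. -/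
structure IsNullTransversal (D : Set ℝ) (c : ℝ) (g : BilinField) (K : Amb → Amb) (s₀ : ℝ)
    (V : Amb → Amb) : Prop where
  tangent : ∀ p ∈ hypersurfaceZero, IsTangent p (V p)
  regular : ∀ (φ : SphereChart) (μ : Fin 4), ContDiffOn ℝ 1
    (fun w : Fin 3 → ℝ => φ.vec V (Matrix.vecCons 0 w) μ) {w | Matrix.vecCons 0 w ∈ φ.dom D c}
  null : ∀ p ∈ hypersurfaceZero, g p (V p) (V p) = 0
  orthogonal : ∀ p ∈ hypersurfaceZero, p.2.1 = s₀ → ∀ w : E3, inner ℝ p.2.2 w = 0 →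
    g p (V p) (0, 0, w) = 0
  normalized : ∀ p ∈ hypersurfaceZero, p.2.1 = s₀ → g p (V p) (K p) = 2
  lie : ∀ φ : SphereChart, ∀ z ∈ φ.dom D c, z 0 = 0 → ∀ μ, φ.lieVec D c K V z μ = 0

end

set_option maxSynthPendingDepth 3

section Development

open Set Filter Topology
open ContinuousLinearMap (fst snd inr inl proj smulRightL compL lsmul)
open Real (exp log exp_pos exp_log exp_add exp_ne_zero exp_zero)
open Matrix (vecCons vecTail)

noncomputable section

local notation "R4" => Fin 4 → ℝ

/-! ## Flows of ordinary differential equations that are merely continuous in time -/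

section Flow

variable {Y : Type*} [NormedAddCommGroup Y] [NormedSpace ℝ Y]

/-- The primitive vanishing at `0` of a continuous function on `[-δ, δ]`. -/
def primitiveCLM [CompleteSpace Y] (δ : ℝ) (hδ : 0 ≤ δ) :
    C(Icc (-δ) δ, Y) →L[ℝ] C(Icc (-δ) δ, Y) :=
  LinearMap.mkContinuous
    { toFun := fun v =>
        ⟨fun s => ∫ σ in (0 : ℝ)..s, v (projIcc (-δ) δ (by linarith) σ), by
          have : Continuous fun s : ℝ => ∫ σ in (0 : ℝ)..s, v (projIcc (-δ) δ (by linarith) σ) :=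
            intervalIntegral.continuous_primitive
              (fun a b => (v.continuous.comp continuous_projIcc).intervalIntegrable a b) 0
          exact this.comp continuous_subtype_val⟩
      map_add' := by
        intro u v
        ext s
        simp only [ContinuousMap.add_apply, ContinuousMap.coe_mk]
        exact intervalIntegral.integral_add
          ((u.continuous.comp continuous_projIcc).intervalIntegrable _ _)
          ((v.continuous.comp continuous_projIcc).intervalIntegrable _ _)
      map_smul' := by
        intro c v
        ext s
        simp only [ContinuousMap.smul_apply, ContinuousMap.coe_mk, RingHom.id_apply]
        exact intervalIntegral.integral_smul c _ }
    δ (by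
      intro v
      refine (ContinuousMap.norm_le _ (by positivity)).2 fun s => ?_
      have h := intervalIntegral.norm_integral_le_of_norm_le_const (a := 0) (b := (s : ℝ))
        (f := fun σ => v (projIcc (-δ) δ (by linarith) σ)) (C := ‖v‖)
        (fun x _ => v.norm_coe_le_norm _)
      have hs : |(s : ℝ) - 0| ≤ δ := by rw [sub_zero]; exact abs_le.2 s.2
      calc _ ≤ ‖v‖ * |(s : ℝ) - 0| := h
        _ ≤ ‖v‖ * δ := by gcongr
        _ = δ * ‖v‖ := mul_comm _ _)

lemma primitiveCLM_apply [CompleteSpace Y] (δ : ℝ) (hδ : 0 ≤ δ) (v : C(Icc (-δ) δ, Y))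
    (s : Icc (-δ) δ) :
    primitiveCLM δ hδ v s = ∫ σ in (0 : ℝ)..s, v (projIcc (-δ) δ (by linarith) σ) := rfl

lemma norm_primitiveCLM_le [CompleteSpace Y] (δ : ℝ) (hδ : 0 ≤ δ) :
    ‖(primitiveCLM δ hδ : C(Icc (-δ) δ, Y) →L[ℝ] _)‖ ≤ δ := LinearMap.mkContinuous_norm_le _ hδ _

/-- A continuous family of operators acts on continuous functions. -/
def pointwiseCLM (δ : ℝ) :
    C(Icc (-δ) δ, Y →L[ℝ] Y) →L[ℝ] C(Icc (-δ) δ, Y) →L[ℝ] C(Icc (-δ) δ, Y) :=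
  LinearMap.mkContinuous₂
    (LinearMap.mk₂ ℝ (fun (a : C(Icc (-δ) δ, Y →L[ℝ] Y)) (v : C(Icc (-δ) δ, Y)) =>
        (⟨fun s => a s (v s), a.continuous.clm_apply v.continuous⟩ : C(Icc (-δ) δ, Y)))
      (by intros; ext; simp) (by intros; ext; simp) (by intros; ext; simp) (by intros; ext; simp))
    1 (by
      intro a v
      refine (ContinuousMap.norm_le _ (by positivity)).2 fun s => ?_
      rw [one_mul]
      exact (a s).le_of_opNorm_le (a.norm_coe_le_norm s) _ |>.trans
        (by gcongr; exact v.norm_coe_le_norm s))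

lemma norm_pointwiseCLM_le (δ : ℝ) (a : C(Icc (-δ) δ, Y →L[ℝ] Y)) :
    ‖pointwiseCLM δ a‖ ≤ ‖a‖ := by
  refine ContinuousLinearMap.opNorm_le_bound _
    (norm_nonneg a) fun v => ?_
  refine (ContinuousMap.norm_le _ (by positivity)).2 fun s => ?_
  exact (a s).le_of_opNorm_le (a.norm_coe_le_norm s) _ |>.trans
    (by gcongr; exact v.norm_coe_le_norm s)

/-- The superposition operator `u ↦ F(·, u(·))`. -/
def superposition {Z : Type*} [TopologicalSpace Z] (δ : ℝ) (F : ℝ × Y → Z) (hF : Continuous F)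
    (u : C(Icc (-δ) δ, Y)) : C(Icc (-δ) δ, Z) :=
  ⟨fun s => F (s, u s), hF.comp (continuous_subtype_val.prodMk u.continuous)⟩

omit [NormedSpace ℝ Y] in
lemma continuous_superposition {Z : Type*} [TopologicalSpace Z] (δ : ℝ) (F : ℝ × Y → Z)
    (hF : Continuous F) : Continuous (superposition δ F hF) := by
  refine ContinuousMap.continuous_of_continuous_uncurry _ ?_
  change Continuous fun p : C(Icc (-δ) δ, Y) × Icc (-δ) δ => F (p.2, p.1 p.2)
  fun_prop

lemma hasFDerivAt_superposition (δ : ℝ) (F : ℝ × Y → Y) (F' : ℝ × Y → Y →L[ℝ] Y)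
    (hF : Continuous F) (hF' : Continuous F')
    (hd : ∀ r y, HasFDerivAt (fun y => F (r, y)) (F' (r, y)) y) (u : C(Icc (-δ) δ, Y)) :
    HasFDerivAt (superposition δ F hF) (pointwiseCLM δ (superposition δ F' hF' u)) u := by
  rw [hasFDerivAt_iff_isLittleO, Asymptotics.isLittleO_iff]
  intro ε hε
  have hc := (continuous_superposition δ F' hF').continuousAt (x := u)
  obtain ⟨η, hη, hc⟩ := (Metric.continuousAt_iff (α := C(Icc (-δ) δ, Y))
    (β := C(Icc (-δ) δ, Y →L[ℝ] Y))).1 hc ε hε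
  filter_upwards [Metric.ball_mem_nhds u hη] with v hv
  refine (ContinuousMap.norm_le _ (by positivity)).2 fun s => ?_
  have hvs : ∀ y ∈ segment ℝ (u s) (v s), ‖F' (s, y) - F' (s, u s)‖ ≤ ε := by
    intro y hy
    have hy' : ‖y - u s‖ < η := by
      have h1 : ‖y - u s‖ ≤ ‖v s - u s‖ := by
        rw [segment_eq_image_lineMap] at hy
        obtain ⟨t, ht, rfl⟩ := hy
        rw [AffineMap.lineMap_apply, vsub_eq_sub, vadd_eq_add, add_sub_cancel_right, norm_smul,
          Real.norm_of_nonneg ht.1]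
        exact mul_le_of_le_one_left (norm_nonneg _) ht.2
      have h2 : ‖v s - u s‖ ≤ ‖v - u‖ := (v - u).norm_coe_le_norm s
      rw [mem_ball_iff_norm] at hv
      linarith
    have := hc (x := u + ContinuousMap.const _ (y - u s)) (by
      rw [dist_eq_norm, add_sub_cancel_left]
      refine lt_of_le_of_lt ?_ hy'
      exact (ContinuousMap.norm_le _ (norm_nonneg _)).2 fun _ => le_rfl)
    have h3 := (ContinuousMap.dist_apply_le_dist s).trans this.le
    rw [dist_eq_norm] at h3
    simpa [superposition] using h3
  have := (convex_segment (𝕜 := ℝ) (u s) (v s)).norm_image_sub_le_of_norm_hasFDerivWithin_le'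
    (f := fun y => F (s, y)) (φ := F' (s, u s))
    (fun y _ => (hd s y).hasFDerivWithinAt) hvs (left_mem_segment ℝ _ _) (right_mem_segment ℝ _ _)
  refine this.trans ?_
  gcongr
  exact (v - u).norm_coe_le_norm s

theorem exists_flow_of_bounded [FiniteDimensional ℝ Y] (F : ℝ × Y → Y) (F' : ℝ × Y → Y →L[ℝ] Y)
    (hF : Continuous F) (hF' : Continuous F')
    (hd : ∀ r y, HasFDerivAt (fun y => F (r, y)) (F' (r, y)) y) (M : ℝ) (hM : ∀ p, ‖F' p‖ ≤ M)
    (δ : ℝ) (hδ : 0 < δ) (hδM : δ * M ≤ 1 / 2) :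
    ∃ (Z : ℝ → Y → Y) (Z' : ℝ → Y → Y →L[ℝ] Y),
      (∀ y, Z 0 y = y) ∧ Continuous (fun p : ℝ × Y => Z p.1 p.2) ∧
      Continuous (fun p : ℝ × Y => Z' p.1 p.2) ∧
      (∀ r y, HasFDerivAt (Z r) (Z' r y) y) ∧
      (∀ r ∈ Ioo (-δ) δ, ∀ y, HasDerivAt (fun r => Z r y) (F (r, Z r y)) r) ∧
      (∀ r ∈ Ioo (-δ) δ, ∀ y v,
        HasDerivAt (fun r => Z' r y v) (F' (r, Z r y) (Z' r y v)) r) := by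
  have : CompleteSpace Y := FiniteDimensional.complete ℝ Y
  set X := C(Icc (-δ) δ, Y)
  have hle : -δ ≤ δ := by linarith
  set 𝓘 : X →L[ℝ] X := primitiveCLM δ hδ.le with h𝓘
  set N : X → X := superposition δ F hF with hN
  set DN : X → X →L[ℝ] X := fun u => 𝓘.comp (pointwiseCLM δ (superposition δ F' hF' u)) with hDN
  have hM0 : 0 ≤ M := (norm_nonneg _).trans (hM 0)
  have hDNb : ∀ u, ‖DN u‖ ≤ 1 / 2 := by
    intro u
    have h1 : ‖superposition δ F' hF' u‖ ≤ M := (ContinuousMap.norm_le _ hM0).2 fun s => hM _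
    calc ‖DN u‖ ≤ ‖𝓘‖ * ‖pointwiseCLM δ (superposition δ F' hF' u)‖ :=
          ContinuousLinearMap.opNorm_comp_le _ _
      _ ≤ δ * M := by
          gcongr
          · exact norm_primitiveCLM_le δ hδ.le
          · exact (norm_pointwiseCLM_le δ _).trans h1
      _ ≤ 1 / 2 := hδM
  set f : X → X := fun u => u - 𝓘 (N u) with hf
  have hIN : ∀ u, HasFDerivAt (fun u => 𝓘 (N u)) (DN u) u := fun u =>
    𝓘.hasFDerivAt.comp u (hasFDerivAt_superposition δ F F' hF hF' hd u)
  have hfd : ∀ u, HasFDerivAt f (ContinuousLinearMap.id ℝ X - DN u) u := fun u =>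
    (hasFDerivAt_id u).sub (hIN u)
  have hDNc : Continuous DN := by
    have h1 : Continuous fun u : X => pointwiseCLM δ (superposition δ F' hF' u) :=
      (pointwiseCLM δ).continuous.comp (continuous_superposition δ F' hF')
    exact continuous_const.clm_comp h1
  have hfC : ContDiff ℝ 1 f := by
    rw [contDiff_one_iff_hasFDerivAt]
    exact ⟨_, continuous_const.sub hDNc, hfd⟩
  have happ : ApproximatesLinearOn f (ContinuousLinearEquiv.refl ℝ X : X →L[ℝ] X) univ
      (1 / 2) := by
    intro u _ v _
    have h := (convex_univ (𝕜 := ℝ)).norm_image_sub_le_of_norm_hasFDerivWithin_le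
      (f := fun u => 𝓘 (N u)) (f' := DN) (C := 1 / 2)
      (fun x _ => (hIN x).hasFDerivWithinAt) (fun x _ => hDNb x) (mem_univ u) (mem_univ v)
    have : f u - f v - (ContinuousLinearEquiv.refl ℝ X : X →L[ℝ] X) (u - v)
        = 𝓘 (N v) - 𝓘 (N u) := by change u - 𝓘 (N u) - (v - 𝓘 (N v)) - (u - v) = _; abel
    rw [this]
    refine h.trans ?_
    rw [norm_sub_rev]
    norm_num
  have hcond : Subsingleton X ∨
      (1 / 2 : NNReal) < ‖((ContinuousLinearEquiv.refl ℝ X).symm : X →L[ℝ] X)‖₊⁻¹ := by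
    rcases subsingleton_or_nontrivial X with h | h
    · exact Or.inl h
    · right
      have : ‖((ContinuousLinearEquiv.refl ℝ X).symm : X →L[ℝ] X)‖₊ = 1 := by
        have := ContinuousLinearMap.norm_id (𝕜 := ℝ) (E := X)
        exact NNReal.eq this
      rw [this, inv_one]
      rw [← NNReal.coe_lt_coe]; norm_num
  set e : X ≃ₜ X := happ.toHomeomorph f hcond with he
  have hef : ∀ u, e u = f u := fun u => rfl
  have hequiv : ∀ u : X, ∃ E : X ≃L[ℝ] X, (E : X →L[ℝ] X) = ContinuousLinearMap.id ℝ X - DN u := by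
    intro u
    have hlt : ‖DN u‖ < 1 := (hDNb u).trans_lt (by norm_num)
    refine ⟨ContinuousLinearEquiv.unitsEquiv ℝ X (Units.oneSub (DN u) hlt), ?_⟩
    ext v
    rfl
  choose E hE using hequiv
  have heC : ContDiff ℝ 1 e.symm := by
    refine e.contDiff_symm (f₀' := E) ?_ hfC
    intro u
    rw [hE]
    exact hfd u
  set c : Y →L[ℝ] X := LinearMap.mkContinuous
    { toFun := fun y => ContinuousMap.const _ y
      map_add' := fun _ _ => rfl
      map_smul' := fun _ _ => rfl } 1 (by
        intro y
        rw [one_mul]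
        exact (ContinuousMap.norm_le _ (norm_nonneg _)).2 fun _ => le_rfl) with hc
  have hcy : ∀ y s, c y s = y := fun y s => rfl
  set π : ℝ → Icc (-δ) δ := projIcc (-δ) δ hle with hπ
  have hπc : Continuous π := continuous_projIcc
  have hπr : ∀ r ∈ Icc (-δ) δ, (π r : ℝ) = r := fun r hr => by rw [hπ, projIcc_of_mem hle hr]
  set D : Y → Y →L[ℝ] X := fun y => (fderiv ℝ e.symm (c y)).comp c with hD
  have hDd : ∀ y, HasFDerivAt (fun y => e.symm (c y)) (D y) y := fun y =>
    ((heC.differentiable one_ne_zero (c y)).hasFDerivAt).comp y c.hasFDerivAt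
  have hDc : Continuous D :=
    ((heC.continuous_fderiv one_ne_zero).comp c.continuous).clm_comp continuous_const
  have hsol : ∀ y, e.symm (c y) = c y + 𝓘 (N (e.symm (c y))) := by
    intro y
    have : f (e.symm (c y)) = c y := e.apply_symm_apply (c y)
    rw [hf] at this
    exact sub_eq_iff_eq_add.1 this
  have hvar : ∀ y v, D y v = c v + DN (e.symm (c y)) (D y v) := by
    intro y v
    have h1 : HasFDerivAt (fun y => c y + 𝓘 (N (e.symm (c y))))
        (c + (DN (e.symm (c y))).comp (D y)) y :=
      c.hasFDerivAt.add ((hIN _).comp y (hDd y))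
    have h2 : HasFDerivAt (fun y => c y + 𝓘 (N (e.symm (c y)))) (D y) y := by
      exact (hDd y).congr_of_eventuallyEq (Eventually.of_forall fun y => (hsol y).symm)
    exact DFunLike.congr_fun (h2.unique h1) v
  have h0 : (0 : ℝ) ∈ Icc (-δ) δ := ⟨by linarith, hδ.le⟩
  have hprim : ∀ (v : X) (r : ℝ), r ∈ Ioo (-δ) δ →
      HasDerivAt (fun r => 𝓘 v (π r)) (v (π r)) r := by
    intro v r hr
    have hcont : Continuous fun σ => v (π σ) := v.continuous.comp hπc
    have := (hcont.integral_hasStrictDerivAt 0 r).hasDerivAt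
    refine this.congr_of_eventuallyEq ?_
    filter_upwards [isOpen_Ioo.mem_nhds hr] with σ hσ
    rw [h𝓘, primitiveCLM_apply, hπr σ ⟨hσ.1.le, hσ.2.le⟩]
  refine ⟨fun r y => e.symm (c y) (π r), fun r y => (ContinuousMap.evalCLM ℝ (π r)).comp (D y),
    ?_, ?_, ?_, ?_, ?_, ?_⟩
  · intro y
    dsimp only
    rw [hsol, ContinuousMap.add_apply, hcy, h𝓘, primitiveCLM_apply, hπr 0 h0]
    simp
  · have h1 : Continuous fun p : ℝ × Y => e.symm (c p.2) :=
      e.symm.continuous.comp (c.continuous.comp continuous_snd)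
    have h2 : Continuous fun p : ℝ × Y => π p.1 := hπc.comp continuous_fst
    exact h1.eval h2
  · rw [continuous_clm_apply]
    intro v
    have h1 : Continuous fun p : ℝ × Y => D p.2 v :=
      (hDc.comp continuous_snd).clm_apply continuous_const
    have h2 : Continuous fun p : ℝ × Y => π p.1 := hπc.comp continuous_fst
    exact h1.eval h2
  · intro r y; exact (ContinuousMap.evalCLM ℝ (π r)).hasFDerivAt.comp y (hDd y)
  · intro r hr y
    dsimp only
    have h1 := (hprim (N (e.symm (c y))) r hr).const_add y
    have h2 : N (e.symm (c y)) (π r) = F (r, e.symm (c y) (π r)) := by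
      change F ((π r : ℝ), _) = _
      rw [hπr r ⟨hr.1.le, hr.2.le⟩]
    rw [h2] at h1
    refine h1.congr_of_eventuallyEq (Eventually.of_forall fun σ => ?_)
    dsimp only
    conv_lhs => rw [hsol]
    rfl
  · intro r hr y v
    have h1 := (hprim (pointwiseCLM δ (superposition δ F' hF' (e.symm (c y))) (D y v)) r
      hr).const_add v
    have h2 : pointwiseCLM δ (superposition δ F' hF' (e.symm (c y))) (D y v) (π r)
        = F' (r, e.symm (c y) (π r)) (D y v (π r)) := by
      change F' ((π r : ℝ), _) _ = _
      rw [hπr r ⟨hr.1.le, hr.2.le⟩]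
    rw [h2] at h1
    refine h1.congr_of_eventuallyEq (Eventually.of_forall fun σ => ?_)
    change D y v (π σ) = _
    conv_lhs => rw [hvar]
    rfl

end Flow

section PartialRegularity

variable {Y F : Type*} [NormedAddCommGroup Y] [NormedSpace ℝ Y]
  [NormedAddCommGroup F] [NormedSpace ℝ F]

/-- `f(r, y)` is continuous on `Ω` and has a continuous derivative in `y`. -/
structure IsC0C1On (f : ℝ × Y → F) (Ω : Set (ℝ × Y)) : Prop where
  cont : ContinuousOn f Ω
  diff : ∀ p ∈ Ω, DifferentiableAt ℝ (fun y => f (p.1, y)) p.2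
  cont_fderiv : ContinuousOn (fun p : ℝ × Y => fderiv ℝ (fun y => f (p.1, y)) p.2) Ω

lemma IsC0C1On.of_hasFDerivAt {f : ℝ × Y → F} {f' : ℝ × Y → Y →L[ℝ] F} {Ω : Set (ℝ × Y)}
    (hf : ContinuousOn f Ω) (hf' : ContinuousOn f' Ω)
    (h : ∀ p ∈ Ω, HasFDerivAt (fun y => f (p.1, y)) (f' p) p.2) : IsC0C1On f Ω :=
  ⟨hf, fun p hp => (h p hp).differentiableAt, hf'.congr fun p hp => (h p hp).fderiv⟩

lemma IsC0C1On.hasFDerivAt {f : ℝ × Y → F} {Ω : Set (ℝ × Y)} (h : IsC0C1On f Ω) {p : ℝ × Y}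
    (hp : p ∈ Ω) :
    HasFDerivAt (fun y => f (p.1, y)) (fderiv ℝ (fun y => f (p.1, y)) p.2) p.2 :=
  (h.diff p hp).hasFDerivAt

lemma IsC0C1On.mono {f : ℝ × Y → F} {Ω Ω' : Set (ℝ × Y)} (h : IsC0C1On f Ω) (h' : Ω' ⊆ Ω) :
    IsC0C1On f Ω' := ⟨h.cont.mono h', fun p hp => h.diff p (h' hp), h.cont_fderiv.mono h'⟩

theorem exists_flow [FiniteDimensional ℝ Y] (F : ℝ × Y → Y) (Ω : Set (ℝ × Y)) (hΩ : IsOpen Ω)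
    (hF : IsC0C1On F Ω) (C : Set Y) (hC : IsCompact C) (hCΩ : ({0} : Set ℝ) ×ˢ C ⊆ Ω) :
    ∃ (Z : ℝ → Y → Y) (Z' : ℝ → Y → Y →L[ℝ] Y) (δ : ℝ) (U : Set Y), 0 < δ ∧ IsOpen U ∧ C ⊆ U ∧
      (∀ y, Z 0 y = y) ∧ Continuous (fun p : ℝ × Y => Z p.1 p.2) ∧
      Continuous (fun p : ℝ × Y => Z' p.1 p.2) ∧
      (∀ r y, HasFDerivAt (Z r) (Z' r y) y) ∧
      ∀ r ∈ Ioo (-δ) δ, ∀ y ∈ U, (r, Z r y) ∈ Ω ∧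
        HasDerivAt (fun r => Z r y) (F (r, Z r y)) r ∧
        ∀ v, HasDerivAt (fun r => Z' r y v) (fderiv ℝ (fun y => F (r, y)) (Z r y) (Z' r y v))
            r := by
  obtain ⟨u, V, huo, hVo, h0u, hCV, huV⟩ :=
    generalized_tube_lemma (isCompact_singleton) hC hΩ hCΩ
  obtain ⟨δ0, hδ0, hδu⟩ := Metric.isOpen_iff.1 huo 0 (h0u rfl)
  set η := δ0 / 2 with hη
  have hηp : 0 < η := by positivity
  have hle : -η ≤ η := by linarith
  have hIu : Icc (-η) η ⊆ u := fun r hr => hδu (by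
    rw [Metric.mem_ball, dist_zero_right, Real.norm_eq_abs]
    exact lt_of_le_of_lt (abs_le.2 hr) (by linarith))
  obtain ⟨K1, hK1, hCK1, hK₁V⟩ := exists_compact_between hC hVo hCV
  obtain ⟨K2, hK2, hK₁₂, hK₂V⟩ := exists_compact_between hK1 hVo hK₁V
  obtain ⟨χ, hχ, hχr, hχs, hχ1⟩ := exists_contMDiff_support_eq_eq_one_iff
    (modelWithCornersSelf ℝ Y) isOpen_interior hK1.isClosed hK₁₂
  have hχd : ContDiff ℝ ∞ χ := hχ.contDiff
  set π : ℝ → ℝ := fun r => (projIcc (-η) η hle r : ℝ) with hπ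
  have hπc : Continuous π := continuous_subtype_val.comp continuous_projIcc
  have hπI : ∀ r, π r ∈ Icc (-η) η := fun r => (projIcc (-η) η hle r).2
  have hπe : ∀ r ∈ Icc (-η) η, π r = r := fun r hr => by rw [hπ]; simp [projIcc_of_mem hle hr]
  have hΩm : ∀ r, ∀ y ∈ V, (π r, y) ∈ Ω := fun r y hy => huV ⟨hIu (hπI r), hy⟩
  set F' : ℝ × Y → Y →L[ℝ] Y := fun p => fderiv ℝ (fun y => F (p.1, y)) p.2 with hF'
  set Ft : ℝ × Y → Y := fun p => χ p.2 • F (π p.1, p.2) with hFt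
  set Ft' : ℝ × Y → Y →L[ℝ] Y := fun p =>
    χ p.2 • F' (π p.1, p.2) + (fderiv ℝ χ p.2).smulRight (F (π p.1, p.2)) with hFt'
  have hχ0 : ∀ y ∉ K2, χ =ᶠ[𝓝 y] 0 := by
    intro y hy
    filter_upwards [hK2.isClosed.isOpen_compl.mem_nhds hy] with z hz
    by_contra h
    have : z ∈ Function.support χ := h
    rw [hχs] at this
    exact hz (interior_subset this)
  have hmap : Continuous fun p : ℝ × Y => (π p.1, p.2) :=
    (hπc.comp continuous_fst).prodMk continuous_snd
  have hnear : ∀ p : ℝ × Y, p.2 ∉ K2 → ∀ᶠ q in 𝓝 p, χ q.2 = 0 ∧ fderiv ℝ χ q.2 = 0 := by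
    intro p hp
    have h1 := (hχ0 p.2 hp).eventuallyEq_nhds
    have h2 := (continuous_snd).continuousAt |>.eventually h1
    filter_upwards [h2] with q hq
    refine ⟨hq.eq_of_nhds, ?_⟩
    rw [hq.fderiv_eq]
    exact fderiv_const_apply 0
  have hFc : Continuous Ft := by
    rw [continuous_iff_continuousAt]
    intro p
    by_cases hp : p.2 ∈ K2
    · have h1 : ContinuousAt (fun p : ℝ × Y => F (π p.1, p.2)) p :=
        ContinuousAt.comp'
          (hF.cont.continuousAt (hΩ.mem_nhds (hΩm p.1 p.2 (hK₂V hp)))) hmap.continuousAt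
      exact (hχd.continuous.comp continuous_snd).continuousAt.smul h1
    · have h0 : Ft =ᶠ[𝓝 p] fun _ => 0 := by filter_upwards [hnear p hp] with q hq; simp [hFt, hq.1]
      exact continuousAt_const.congr h0.symm
  have hF'c : Continuous Ft' := by
    rw [continuous_iff_continuousAt]
    intro p
    by_cases hp : p.2 ∈ K2
    · have hn := hΩ.mem_nhds (hΩm p.1 p.2 (hK₂V hp))
      have h1 : ContinuousAt (fun p : ℝ × Y => F (π p.1, p.2)) p :=
        ContinuousAt.comp'
          (hF.cont.continuousAt hn) hmap.continuousAt
      have h2 : ContinuousAt (fun p : ℝ × Y => F' (π p.1, p.2)) p :=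
        ContinuousAt.comp'
          (hF.cont_fderiv.continuousAt hn) hmap.continuousAt
      have h3 : Continuous (fun p : ℝ × Y => fderiv ℝ χ p.2) :=
        (hχd.continuous_fderiv (by simp)).comp continuous_snd
      refine ((hχd.continuous.comp continuous_snd).continuousAt.smul h2).add ?_
      exact (smulRightL ℝ Y Y).continuous₂.continuousAt.comp₂
        h3.continuousAt h1
    · have h0 : Ft' =ᶠ[𝓝 p] fun _ => 0 := by
        filter_upwards [hnear p hp] with q hq
        simp [hFt', hq.1, hq.2]
      exact continuousAt_const.congr h0.symm
  have hFd : ∀ r y, HasFDerivAt (fun y => Ft (r, y)) (Ft' (r, y)) y := by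
    intro r y
    by_cases hp : y ∈ K2
    · have h1 := hF.hasFDerivAt (hΩm r y (hK₂V hp))
      exact (hχd.differentiable (by simp) y).hasFDerivAt.smul h1
    · have h0 : (fun y => Ft (r, y)) =ᶠ[𝓝 y] fun _ => 0 := by
        filter_upwards [hχ0 y hp] with z hz
        simp [hFt, hz]
      have h1 : Ft' (r, y) = 0 := by
        have := (hnear (r, y) hp).self_of_nhds
        simp [hFt', this.1, this.2]
      rw [h1]
      exact (hasFDerivAt_const (0 : Y) y).congr_of_eventuallyEq h0
  obtain ⟨M, hM⟩ : ∃ M, ∀ p, ‖Ft' p‖ ≤ M := by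
    obtain ⟨M, hM⟩ := ((isCompact_Icc).prod hK2).exists_bound_of_continuousOn
      hF'c.continuousOn
    refine ⟨max M 0, fun p => ?_⟩
    by_cases hp : p.2 ∈ K2
    · have h1 : Ft' p = Ft' (π p.1, p.2) := by simp [hFt', hπe _ (hπI p.1)]
      rw [h1]
      exact (hM (π p.1, p.2) ⟨hπI p.1, hp⟩).trans (le_max_left _ _)
    · have := (hnear p hp).self_of_nhds
      have h1 : Ft' p = 0 := by simp [hFt', this.1, this.2]
      rw [h1, norm_zero]
      exact le_max_right _ _
  have hM0 := (norm_nonneg _).trans (hM 0)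
  set δ1 := min η (1 / (2 * (M + 1))) with hδ1
  have hδ₁p : 0 < δ1 := by positivity
  have hδ₁M : δ1 * M ≤ 1 / 2 := by
    calc δ1 * M ≤ 1 / (2 * (M + 1)) * (M + 1) := by
          gcongr
          · exact min_le_right _ _
          · linarith
      _ = 1 / 2 := by field_simp
  obtain ⟨Z, Z', hZ0, hZc, hZ'c, hZd, hZode, hZvar⟩ :=
    exists_flow_of_bounded Ft Ft' hFc hF'c hFd M hM δ1 hδ₁p hδ₁M
  have hopen : IsOpen {p : ℝ × Y | Z p.1 p.2 ∈ interior K1} := isOpen_interior.preimage hZc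
  obtain ⟨u2, U, hu₂o, hUo, h0u₂, hCU, hu₂U⟩ := generalized_tube_lemma
    (isCompact_singleton) hC hopen (by
      rintro ⟨r, y⟩ ⟨rfl, hy⟩
      change Z 0 y ∈ interior K1
      rw [hZ0]
      exact hCK1 hy)
  obtain ⟨δ2, hδ2, hδ₂u⟩ := Metric.isOpen_iff.1 hu₂o 0 (h0u₂ rfl)
  refine ⟨Z, Z', min δ1 δ2, U, lt_min hδ₁p hδ2, hUo, hCU, hZ0, hZc, hZ'c, hZd, ?_⟩
  intro r hr y hy
  have hr1 : r ∈ Ioo (-δ1) δ1 :=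
    ⟨by have := hr.1; have := min_le_left δ1 δ2; linarith, hr.2.trans_le (min_le_left _ _)⟩
  have hr2 := hδ₂u (by
    rw [Metric.mem_ball, dist_zero_right, Real.norm_eq_abs]
    exact (abs_lt.2 hr).trans_le (min_le_right _ _))
  have hZK := hu₂U (show (r, y) ∈ u2 ×ˢ U from ⟨hr2, hy⟩)
  have hrη : r ∈ Icc (-η) η :=
    ⟨by have := hr1.1; have := min_le_left η (1 / (2 * (M + 1))); linarith,
      hr1.2.le.trans (min_le_left _ _)⟩
  have hF1 : ∀ z ∈ interior K1, Ft (r, z) = F (r, z) := by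
    intro z hz
    have := (hχ1 z).1 (interior_subset hz)
    simp [hFt, this, hπe r hrη]
  have hev : (fun z => F (r, z)) =ᶠ[𝓝 (Z r y)] fun z => Ft (r, z) := by
    filter_upwards [isOpen_interior.mem_nhds hZK] with z hz
    exact (hF1 z hz).symm
  refine ⟨?_, ?_, fun v => ?_⟩
  · have := hΩm r (Z r y) (hK₁V (interior_subset hZK)); rwa [hπe r hrη] at this
  · rw [← hF1 _ hZK]; exact hZode r hr1 y
  · rw [hev.fderiv_eq, (hFd r _).fderiv]; exact hZvar r hr1 y v

theorem ode_unique_locally [FiniteDimensional ℝ Y] (F : ℝ × Y → Y) (Ω : Set (ℝ × Y))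
    (hΩ : IsOpen Ω) (hF : IsC0C1On F Ω) {f g : ℝ → Y} {I : Set ℝ} (hI : I.OrdConnected) {r0 : ℝ}
    (hr0 : r0 ∈ I) (hf : ∀ r ∈ I, HasDerivWithinAt f (F (r, f r)) I r)
    (hg : ∀ r ∈ I, HasDerivWithinAt g (F (r, g r)) I r) (h0 : f r0 = g r0)
    (hΩ0 : (r0, f r0) ∈ Ω) : ∀ᶠ r in 𝓝[I] r0, f r = g r := by
  have hp := hΩ0
  obtain ⟨M, hM⟩ : ∃ M : ℝ, ∀ᶠ p in 𝓝 (r0, f r0),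
      ‖fderiv ℝ (fun y => F (p.1, y)) p.2‖ ≤ M := by
    have := (hF.cont_fderiv.continuousAt (hΩ.mem_nhds hp)).norm
    exact ⟨_, this.eventually_le_const (lt_add_one _)⟩
  have hev :=
    hM.and (hΩ.mem_nhds hp)
  obtain ⟨ε, hε, hball⟩ := Metric.eventually_nhds_iff_ball.1 hev
  have hfε : ∀ᶠ r in 𝓝[I] r0, f r ∈ Metric.ball (f r0) ε :=
    (hf r0 hr0).continuousWithinAt (Metric.ball_mem_nhds _ hε)
  have hgε : ∀ᶠ r in 𝓝[I] r0, g r ∈ Metric.ball (f r0) ε := by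
    have := (hg r0 hr0).continuousWithinAt
    rw [ContinuousWithinAt, ← h0] at this
    exact this (Metric.ball_mem_nhds _ hε)
  obtain ⟨η, hη, hηb⟩ := Metric.mem_nhdsWithin_iff.1 (hfε.and hgε)
  set d := min (η / 2) (ε / 2) with hd
  have hdp : 0 < d := by positivity
  have hnear : ∀ r, |r - r0| ≤ d → r ∈ I →
      f r ∈ Metric.ball (f r0) ε ∧ g r ∈ Metric.ball (f r0) ε := by
    intro r hr hrI
    refine hηb ⟨?_, hrI⟩
    rw [Metric.mem_ball, Real.dist_eq]
    have := min_le_left (η / 2) (ε / 2)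
    linarith
  have hLip : ∀ r, |r - r0| ≤ d →
      LipschitzOnWith M.toNNReal (fun y => F (r, y)) (Metric.ball (f r0) ε) := by
    intro r hr
    have hrε : dist r r0 < ε := by rw [Real.dist_eq]; have := min_le_right (η / 2) (ε / 2); linarith
    have hmem : ∀ y ∈ Metric.ball (f r0) ε, (r, y) ∈ Metric.ball (r0, f r0) ε := by
      intro y hy
      exact max_lt hrε hy
    refine (convex_ball (f r0) ε).lipschitzOnWith_of_nnnorm_hasFDerivWithin_le
      (f' := fun y => fderiv ℝ (fun y => F (r, y)) y) (fun y hy => ?_) (fun y hy => ?_)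
    · exact (hF.hasFDerivAt (hball _ (hmem y hy)).2).hasFDerivWithinAt
    · have := (hball _ (hmem y hy)).1
      exact NNReal.coe_le_coe.1 (by rw [coe_nnnorm]; exact this.trans (Real.le_coe_toNNReal M))
  rw [Filter.Eventually, Metric.mem_nhdsWithin_iff]
  refine ⟨d, hdp, fun r hr => ?_⟩
  obtain ⟨hrd, hrI⟩ := hr
  rw [Metric.mem_ball, Real.dist_eq] at hrd
  rcases le_total r0 r with hle | hle
  · have hsub := hI.out hr0 hrI
    have hdist : ∀ t ∈ Icc r0 r, |t - r0| ≤ d := by grind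
    have hderiv : ∀ k : ℝ → Y, (∀ r ∈ I, HasDerivWithinAt k (F (r, k r)) I r) →
        ∀ t ∈ Ico r0 r, HasDerivWithinAt k (F (t, k t)) (Ici t) t := by
      intro k hk t ht
      have h1 := (hk t (hsub ⟨ht.1, ht.2.le⟩)).mono
        ((Icc_subset_Icc_left ht.1).trans hsub)
      exact h1.mono_of_mem_nhdsWithin (Icc_mem_nhdsGE ht.2)
    exact ODE_solution_unique_of_mem_Icc_right
      (fun t ht => hLip t (hdist t ⟨ht.1, ht.2.le⟩))
      (fun t ht => ((hf t (hsub ht)).continuousWithinAt).mono hsub)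
      (hderiv f hf) (fun t ht => (hnear t (hdist t ⟨ht.1, ht.2.le⟩) (hsub ⟨ht.1, ht.2.le⟩)).1)
      (fun t ht => ((hg t (hsub ht)).continuousWithinAt).mono hsub)
      (hderiv g hg) (fun t ht => (hnear t (hdist t ⟨ht.1, ht.2.le⟩) (hsub ⟨ht.1, ht.2.le⟩)).2)
      h0 ⟨hle, le_rfl⟩
  · have hsub := hI.out hrI hr0
    have hdist : ∀ t ∈ Icc r r0, |t - r0| ≤ d := by
      intro t ht
      rw [abs_of_nonpos (by linarith [ht.2])]
      rw [abs_of_nonpos (by linarith)] at hrd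
      linarith [ht.1]
    have hderiv : ∀ k : ℝ → Y, (∀ r ∈ I, HasDerivWithinAt k (F (r, k r)) I r) →
        ∀ t ∈ Ioc r r0, HasDerivWithinAt k (F (t, k t)) (Iic t) t := by
      intro k hk t ht
      have h1 := (hk t (hsub ⟨ht.1.le, ht.2⟩)).mono
        ((Icc_subset_Icc_right ht.2).trans hsub)
      exact h1.mono_of_mem_nhdsWithin (Icc_mem_nhdsLE ht.1)
    exact ODE_solution_unique_of_mem_Icc_left
      (fun t ht => hLip t (hdist t ⟨ht.1.le, ht.2⟩))
      (fun t ht => ((hf t (hsub ht)).continuousWithinAt).mono hsub)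
      (hderiv f hf) (fun t ht => (hnear t (hdist t ⟨ht.1.le, ht.2⟩) (hsub ⟨ht.1.le, ht.2⟩)).1)
      (fun t ht => ((hg t (hsub ht)).continuousWithinAt).mono hsub)
      (hderiv g hg) (fun t ht => (hnear t (hdist t ⟨ht.1.le, ht.2⟩) (hsub ⟨ht.1.le, ht.2⟩)).2)
      h0 ⟨le_rfl, hle⟩

end PartialRegularity

section PartialRegularityAlgebra

variable {X Y E F G : Type*} [NormedAddCommGroup X] [NormedSpace ℝ X]
  [NormedAddCommGroup Y] [NormedSpace ℝ Y] [NormedAddCommGroup E] [NormedSpace ℝ E]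
  [NormedAddCommGroup F] [NormedSpace ℝ F] [NormedAddCommGroup G] [NormedSpace ℝ G]

lemma hasFDerivAt_prodMk_right' (r : ℝ) (y : Y) :
    HasFDerivAt (fun y : Y => (r, y)) (inr ℝ ℝ Y) y := hasFDerivAt_prodMk_right r y

lemma IsC0C1On.of_contDiffOn {f : ℝ × Y → F} {Ω : Set (ℝ × Y)} (hΩ : IsOpen Ω)
    (hf : ContDiffOn ℝ 1 f Ω) : IsC0C1On f Ω := by
  refine IsC0C1On.of_hasFDerivAt (f' := fun p => (fderiv ℝ f p).comp (inr ℝ ℝ Y)) hf.continuousOn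
    ((hf.continuousOn_fderiv_of_isOpen hΩ le_rfl).clm_comp continuousOn_const) fun p hp => ?_
  exact HasFDerivAt.comp p.2 ((hf.differentiableOn one_ne_zero).differentiableAt
      (hΩ.mem_nhds hp)).hasFDerivAt
    (hasFDerivAt_prodMk_right' p.1 p.2)

lemma IsC0C1On.of_continuousOn_fst {w : ℝ → F} {Ω : Set (ℝ × Y)} (hw : Continuous w) :
    IsC0C1On (fun p : ℝ × Y => w p.1) Ω :=
  IsC0C1On.of_hasFDerivAt (hw.comp continuous_fst).continuousOn
    continuousOn_const fun p _ => hasFDerivAt_const (w p.1) p.2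

lemma IsC0C1On.congr {f g : ℝ × Y → F} {Ω : Set (ℝ × Y)} (hΩ : IsOpen Ω) (hf : IsC0C1On f Ω)
    (h : EqOn g f Ω) : IsC0C1On g Ω := by
  refine IsC0C1On.of_hasFDerivAt
    (hf.cont.congr h) hf.cont_fderiv fun p hp => (hf.hasFDerivAt hp).congr_of_eventuallyEq ?_
  have : Continuous fun y : Y => (p.1, y) := by fun_prop
  filter_upwards [(hΩ.preimage this).mem_nhds hp] with y hy
  exact h hy

lemma IsC0C1On.bilin {f : ℝ × Y → E} {g : ℝ × Y → F} {Ω : Set (ℝ × Y)} (B : E →L[ℝ] F →L[ℝ] G)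
    (hf : IsC0C1On f Ω) (hg : IsC0C1On g Ω) : IsC0C1On (fun p => B (f p) (g p)) Ω := by
  refine IsC0C1On.of_hasFDerivAt
    (f' := fun p => B.precompR Y (f p) (fderiv ℝ (fun y => g (p.1, y)) p.2)
      + B.precompL Y (fderiv ℝ (fun y => f (p.1, y)) p.2) (g p)) ?_ ?_ fun p hp => ?_
  · exact (continuousOn_const.clm_apply hf.cont).clm_apply hg.cont
  · have h1 :=
      ((B.precompR Y).continuous.comp_continuousOn hf.cont).clm_apply hg.cont_fderiv
    have h2 :=
      ((B.precompL Y).continuous.comp_continuousOn hf.cont_fderiv).clm_apply hg.cont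
    exact h1.add h2
  · obtain ⟨r, y⟩ := p
    have h1 := hf.hasFDerivAt hp
    have h2 := hg.hasFDerivAt hp
    dsimp only at h1 h2 ⊢
    exact B.hasFDerivAt_of_bilinear h1 h2

lemma IsC0C1On.clm {f : ℝ × Y → E} {Ω : Set (ℝ × Y)} (B : E →L[ℝ] F) (hf : IsC0C1On f Ω) :
    IsC0C1On (fun p => B (f p)) Ω := IsC0C1On.of_hasFDerivAt
    (B.continuous.comp_continuousOn hf.cont) (continuousOn_const.clm_comp hf.cont_fderiv)
    fun p hp => B.hasFDerivAt.comp p.2 (hf.hasFDerivAt hp)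

lemma IsC0C1On.add {f g : ℝ × Y → E} {Ω : Set (ℝ × Y)} (hf : IsC0C1On f Ω)
    (hg : IsC0C1On g Ω) : IsC0C1On (fun p => f p + g p) Ω :=
  IsC0C1On.of_hasFDerivAt (hf.cont.add hg.cont) (hf.cont_fderiv.add hg.cont_fderiv)
    fun p hp => (hf.hasFDerivAt hp).add (hg.hasFDerivAt hp)

lemma IsC0C1On.prodMk {f : ℝ × Y → E} {g : ℝ × Y → F} {Ω : Set (ℝ × Y)} (hf : IsC0C1On f Ω)
    (hg : IsC0C1On g Ω) : IsC0C1On (fun p => (f p, g p)) Ω := by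
  have := (hf.clm (inl ℝ E F)).add (hg.clm (inr ℝ E F))
  simpa using this

lemma IsC0C1On.comp {f : ℝ × Y → F} {m : ℝ × X → Y} {Ω : Set (ℝ × Y)} {Ω' : Set (ℝ × X)}
    (hf : IsC0C1On f Ω) (hm : IsC0C1On m Ω') (h : ∀ p ∈ Ω', (p.1, m p) ∈ Ω) :
    IsC0C1On (fun p => f (p.1, m p)) Ω' := by
  have hc := continuousOn_fst.prodMk hm.cont
  refine IsC0C1On.of_hasFDerivAt (f' := fun p => (fderiv ℝ (fun y => f (p.1, y)) (m p)).comp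
      (fderiv ℝ (fun x => m (p.1, x)) p.2)) (hf.cont.comp hc h) ?_ fun p hp => ?_
  · exact (hf.cont_fderiv.comp hc h).clm_comp hm.cont_fderiv
  · exact HasFDerivAt.comp p.2 (hf.hasFDerivAt (h p hp)) (hm.hasFDerivAt hp)

/-- `f(r, y)` is `C^1`, and its derivative has continuous derivatives in `y`. -/
structure IsRegOn (f : ℝ × Y → F) (Ω : Set (ℝ × Y)) : Prop where
  contDiffOn : ContDiffOn ℝ 1 f Ω
  fderiv : IsC0C1On (fderiv ℝ f) Ω

lemma IsRegOn.hasFDerivAt {f : ℝ × Y → F} {Ω : Set (ℝ × Y)} (hΩ : IsOpen Ω) (h : IsRegOn f Ω)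
    {p : ℝ × Y} (hp : p ∈ Ω) : HasFDerivAt f (_root_.fderiv ℝ f p) p :=
  ((h.contDiffOn.differentiableOn one_ne_zero).differentiableAt (hΩ.mem_nhds hp)).hasFDerivAt

lemma IsRegOn.of_hasFDerivAt {f : ℝ × Y → F} {f' : ℝ × Y → ℝ × Y →L[ℝ] F} {Ω : Set (ℝ × Y)}
    (hΩ : IsOpen Ω) (h : ∀ p ∈ Ω, HasFDerivAt f (f' p) p) (hf' : IsC0C1On f' Ω) :
    IsRegOn f Ω := by
  have he := fun p hp => (h p hp).fderiv
  refine ⟨?_, hf'.congr hΩ he⟩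
  have := (contDiffOn_succ_iff_fderiv_of_isOpen (𝕜 := ℝ) hΩ).2
    ⟨fun p hp => (h p hp).differentiableAt.differentiableWithinAt, by simp,
      contDiffOn_zero.2 (hf'.cont.congr he)⟩
  exact this

lemma IsRegOn.of_contDiffOn {f : ℝ × Y → F} {Ω : Set (ℝ × Y)} (hΩ : IsOpen Ω)
    (h : ContDiffOn ℝ 2 f Ω) : IsRegOn f Ω :=
  ⟨h.of_le (by norm_num), IsC0C1On.of_contDiffOn hΩ (h.fderiv_of_isOpen hΩ (by norm_num))⟩

lemma IsRegOn.congr {f g : ℝ × Y → F} {Ω : Set (ℝ × Y)} (hΩ : IsOpen Ω) (hf : IsRegOn f Ω)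
    (h : EqOn g f Ω) : IsRegOn g Ω :=
  IsRegOn.of_hasFDerivAt hΩ (fun _ hp => (hf.hasFDerivAt hΩ hp).congr_of_eventuallyEq
    (h.eventuallyEq_of_mem (hΩ.mem_nhds hp))) hf.fderiv

lemma IsRegOn.bilin {f : ℝ × Y → E} {g : ℝ × Y → F} {Ω : Set (ℝ × Y)} (hΩ : IsOpen Ω)
    (B : E →L[ℝ] F →L[ℝ] G) (hf : IsRegOn f Ω) (hg : IsRegOn g Ω) :
    IsRegOn (fun p => B (f p) (g p)) Ω := by
  refine IsRegOn.of_hasFDerivAt hΩ (fun p hp => B.hasFDerivAt_of_bilinear (hf.hasFDerivAt hΩ hp)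
    (hg.hasFDerivAt hΩ hp)) ?_
  exact ((IsC0C1On.of_contDiffOn hΩ hf.contDiffOn).bilin (B.precompR (ℝ × Y)) hg.fderiv).add
    (hf.fderiv.bilin (B.precompL (ℝ × Y)) (IsC0C1On.of_contDiffOn hΩ hg.contDiffOn))

lemma IsRegOn.add {f g : ℝ × Y → E} {Ω : Set (ℝ × Y)} (hΩ : IsOpen Ω) (hf : IsRegOn f Ω)
    (hg : IsRegOn g Ω) : IsRegOn (fun p => f p + g p) Ω :=
  IsRegOn.of_hasFDerivAt hΩ (fun _ hp => (hf.hasFDerivAt hΩ hp).add (hg.hasFDerivAt hΩ hp))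
    (hf.fderiv.add hg.fderiv)

lemma IsRegOn.sum {ι : Type*} (s : Finset ι) {f : ι → ℝ × Y → E} {Ω : Set (ℝ × Y)}
    (hΩ : IsOpen Ω) (hf : ∀ i ∈ s, IsRegOn (f i) Ω) : IsRegOn (fun p => ∑ i ∈ s, f i p) Ω := by
  classical induction s using Finset.induction_on with
  | empty =>
    exact IsRegOn.of_contDiffOn hΩ contDiffOn_const
  | insert a s ha ih =>
    simp [Finset.sum_insert ha]
    exact (hf a (Finset.mem_insert_self a s)).add hΩ
      (ih fun i hi => hf i (Finset.mem_insert_of_mem hi))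

lemma IsRegOn.comp {f : ℝ × Y → F} {m : ℝ × X → Y} {Ω : Set (ℝ × Y)} {Ω' : Set (ℝ × X)}
    (hΩ : IsOpen Ω) (hΩ' : IsOpen Ω') (hf : IsRegOn f Ω) (hm : ContDiffOn ℝ 2 m Ω')
    (h : ∀ p ∈ Ω', (p.1, m p) ∈ Ω) : IsRegOn (fun p => f (p.1, m p)) Ω' := by
  set φ : ℝ × X → ℝ × Y := fun p => (p.1, m p) with hφ
  have hφ2 := contDiffOn_fst.prodMk hm
  have hφd : ∀ p ∈ Ω', HasFDerivAt φ (_root_.fderiv ℝ φ p) p := fun p hp =>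
    ((hφ2.differentiableOn (by norm_num)).differentiableAt (hΩ'.mem_nhds hp)).hasFDerivAt
  refine IsRegOn.of_hasFDerivAt hΩ' (fun p hp => (hf.hasFDerivAt hΩ (h p hp)).comp p (hφd p hp)) ?_
  exact (hf.fderiv.comp (IsC0C1On.of_contDiffOn hΩ' (hm.of_le (by norm_num))) h).bilin
      (compL ℝ (ℝ × X) (ℝ × Y) F) (IsC0C1On.of_contDiffOn hΩ' (hφ2.fderiv_of_isOpen hΩ'
          (by norm_num)))

lemma IsRegOn.of_locally {f : ℝ × Y → F} {Ω : Set (ℝ × Y)}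
    (h : ∀ p ∈ Ω, ∃ Ω' : Set (ℝ × Y), IsOpen Ω' ∧ p ∈ Ω' ∧ IsRegOn f Ω') : IsRegOn f Ω := by
  refine ⟨fun p hp => ?_, fun p hp => ?_, fun p hp => ?_, fun p hp => ?_⟩
  · obtain ⟨Ω', ho, hp', hr⟩ := h p hp
    exact (hr.contDiffOn.contDiffAt (ho.mem_nhds hp')).contDiffWithinAt
  · obtain ⟨Ω', ho, hp', hr⟩ := h p hp
    exact (hr.fderiv.cont.continuousAt (ho.mem_nhds hp')).continuousWithinAt
  · obtain ⟨Ω', ho, hp', hr⟩ := h p hp; exact hr.fderiv.diff p hp'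
  · obtain ⟨Ω', ho, hp', hr⟩ := h p hp
    exact (hr.fderiv.cont_fderiv.continuousAt (ho.mem_nhds hp')).continuousWithinAt

end PartialRegularityAlgebra

section Inverse

variable {E F : Type*} [NormedAddCommGroup E] [NormedSpace ℝ E] [CompleteSpace E]
  [NormedAddCommGroup F] [NormedSpace ℝ F]

theorem contDiffOn_invFunOn [Nonempty E] {f : E → F} {O : Set E} (hO : IsOpen O) {n : WithTop ℕ∞}
    (hn : n ≠ 0) (hf : ContDiffOn ℝ n f O) (hinj : InjOn f O)
    (hder : ∀ x ∈ O, ∃ e : E ≃L[ℝ] F, HasFDerivAt f (e : E →L[ℝ] F) x) :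
    IsOpen (f '' O) ∧ ContDiffOn ℝ n (Function.invFunOn f O) (f '' O) := by
  have hloc : ∀ x ∈ O, ∃ g : F → E, ContDiffAt ℝ n g (f x) ∧
      ∀ᶠ y in 𝓝 (f x), y ∈ f '' O ∧ Function.invFunOn f O y = g y := by
    intro x hx
    obtain ⟨e, he⟩ := hder x hx
    have hcd := hf.contDiffAt (hO.mem_nhds hx)
    refine ⟨hcd.localInverse he hn, hcd.to_localInverse he hn, ?_⟩
    have h2 : ∀ᶠ y in 𝓝 (f x), hcd.localInverse he hn y ∈ O := by
      exact (hcd.to_localInverse he hn).continuousAt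
          (by rw [hcd.localInverse_apply_image he hn]; exact hO.mem_nhds hx)
    filter_upwards [(hcd.hasStrictFDerivAt' he hn).eventually_right_inverse, h2] with y hy1 hy2
    refine ⟨⟨_, hy2, hy1⟩, ?_⟩
    exact hinj (Function.invFunOn_mem ⟨_, hy2, hy1⟩) hy2 ((Function.invFunOn_eq ⟨_, hy2,
        hy1⟩).trans hy1.symm)
  constructor
  · rw [isOpen_iff_mem_nhds]
    rintro _ ⟨x, hx, rfl⟩
    obtain ⟨g, -, hg⟩ := hloc x hx
    filter_upwards [hg] with y hy using hy.1
  · rintro _ ⟨x, hx, rfl⟩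
    obtain ⟨g, hg1, hg2⟩ := hloc x hx
    exact (hg1.congr_of_eventuallyEq (hg2.mono fun y hy => hy.2)).contDiffWithinAt

end Inverse

section ParametricIntegral

lemma hasFDerivWithinAt_parametric {E F : Type} [NormedAddCommGroup E] [NormedSpace ℝ E]
    [NormedAddCommGroup F] [NormedSpace ℝ F] [CompleteSpace F] {Ω : Set E}
    (hconv : ∀ z ∈ Ω, ∃ r > 0, Convex ℝ (Ω ∩ Metric.ball z r)) {Λ : E × ℝ → F}
    {Λ' : E × ℝ → E →L[ℝ] F} (hΛ : ContinuousOn Λ (Ω ×ˢ Icc 0 1))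
    (hΛ' : ContinuousOn Λ' (Ω ×ˢ Icc 0 1))
    (hd : ∀ z ∈ Ω, ∀ v ∈ Icc (0 : ℝ) 1, HasFDerivWithinAt (fun z => Λ (z, v)) (Λ' (z, v)) Ω z)
    {z0 : E} (hz0 : z0 ∈ Ω) :
    HasFDerivWithinAt (fun z => ∫ v in (0 : ℝ)..1, Λ (z, v)) (∫ v in (0 : ℝ)..1, Λ' (z0, v)) Ω
      z0 := by
  have hsl : ∀ {H : Type} [NormedAddCommGroup H] [NormedSpace ℝ H] {f : E × ℝ → H} {z : E},
      z ∈ Ω → ContinuousOn f (Ω ×ˢ Icc 0 1) →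
      IntervalIntegrable (fun v => f (z, v)) MeasureTheory.volume 0 1 := by
    intro H _ _ f z hz hf
    refine ContinuousOn.intervalIntegrable ?_
    rw [uIcc_of_le zero_le_one]
    exact hf.comp (by fun_prop) fun v hv => ⟨hz, hv⟩
  rw [hasFDerivWithinAt_iff_isLittleO, Asymptotics.isLittleO_iff]
  intro ε hε
  have h1 : ∀ᶠ z in 𝓝 z0, ∀ v ∈ Icc (0 : ℝ) 1,
      z ∈ Ω → v ∈ Icc (0 : ℝ) 1 → ‖Λ' (z, v) - Λ' (z0, v)‖ ≤ ε := by
    refine isCompact_Icc.eventually_forall_of_forall_eventually fun v hv => ?_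
    obtain ⟨η, hη, hc⟩ := (Metric.continuousWithinAt_iff.1 (hΛ' (z0, v) ⟨hz0, hv⟩)) (ε / 2)
      (by positivity)
    filter_upwards [Metric.ball_mem_nhds (z0, v) hη] with p hp hpΩ hpI
    have h2 : dist (z0, p.2) (z0, v) < η := by
      rw [Prod.dist_eq, dist_self]
      exact max_lt hη (lt_of_le_of_lt (le_max_right _ _) hp)
    have h3 := hc ⟨hpΩ, hpI⟩ hp
    have h4 := hc (x := (z0, p.2)) ⟨hz0, hpI⟩ h2
    rw [← dist_eq_norm]
    have := dist_triangle_right (Λ' (p.1, p.2)) (Λ' (z0, p.2)) (Λ' (z0, v))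
    linarith
  obtain ⟨r, hr, hcv⟩ := hconv z0 hz0
  obtain ⟨η, hη, hηb⟩ := Metric.eventually_nhds_iff_ball.1 h1
  rw [Filter.Eventually, Metric.mem_nhdsWithin_iff]
  refine ⟨min r η, lt_min hr hη, fun z hz => ?_⟩
  obtain ⟨hzb, hzΩ⟩ := hz
  have hcv' : Convex ℝ (Ω ∩ Metric.ball z0 (min r η)) := by
    have : Ω ∩ Metric.ball z0 (min r η)
        = (Ω ∩ Metric.ball z0 r) ∩ Metric.ball z0 (min r η) := by
      rw [inter_assoc, inter_eq_right.2 (Metric.ball_subset_ball (min_le_left _ _))]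
    rw [this]
    exact hcv.inter (convex_ball _ _)
  have hz₀m : z0 ∈ Ω ∩ Metric.ball z0 (min r η) := ⟨hz0, Metric.mem_ball_self (lt_min hr hη)⟩
  have hkey : ∀ v ∈ Icc (0 : ℝ) 1, ‖Λ (z, v) - Λ (z0, v) - Λ' (z0, v) (z - z0)‖
      ≤ ε * ‖z - z0‖ := by
    intro v hv
    exact hcv'.norm_image_sub_le_of_norm_hasFDerivWithin_le'
      (f' := fun z => Λ' (z, v)) (fun x hx => (hd x hx.1 v hv).mono inter_subset_left)
      (fun x hx => hηb x (Metric.ball_subset_ball (min_le_right _ _) hx.2) v hv hx.1 hv) hz₀m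
      ⟨hzΩ, hzb⟩
  change ‖(∫ v in (0 : ℝ)..1, Λ (z, v)) - (∫ v in (0 : ℝ)..1, Λ (z0, v))
    - (∫ v in (0 : ℝ)..1, Λ' (z0, v)) (z - z0)‖ ≤ _
  have hi1 := hsl hzΩ hΛ
  have hi2 := hsl hz0 hΛ
  have hi3 := hsl hz0 hΛ'
  have hap : (∫ v in (0 : ℝ)..1, Λ' (z0, v)) (z - z0)
      = ∫ v in (0 : ℝ)..1, Λ' (z0, v) (z - z0) :=
    ContinuousLinearMap.intervalIntegral_apply hi3 _
  rw [hap, ← intervalIntegral.integral_sub hi1 hi2,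
    ← intervalIntegral.integral_sub (hi1.sub hi2)
      (hsl hz0 (hΛ'.clm_apply continuousOn_const))]
  have := intervalIntegral.norm_integral_le_of_norm_le_const
    (fun v hv => hkey v (by rw [uIoc_of_le zero_le_one] at hv; exact ⟨hv.1.le, hv.2⟩))
  simpa using this

theorem contDiffOn_parametric_nat {E : Type} [NormedAddCommGroup E] [NormedSpace ℝ E]
    {Ω : Set E} (hconv : ∀ z ∈ Ω, ∃ r > 0, Convex ℝ (Ω ∩ Metric.ball z r))
    (hu : UniqueDiffOn ℝ Ω) (n : ℕ) : ∀ {F : Type} [NormedAddCommGroup F] [NormedSpace ℝ F]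
    [CompleteSpace F] {Λ : E × ℝ → F}, ContDiffOn ℝ n Λ (Ω ×ˢ Icc 0 1) →
    ContDiffOn ℝ n (fun z => ∫ v in (0 : ℝ)..1, Λ (z, v)) Ω := by induction n with
  | zero =>
    intro F _ _ _ Λ hΛ
    simp
    rw [continuousOn_iff_continuous_domRestrict]
    set f : Ω → ℝ → F := fun z v => Λ (z, projIcc 0 1 zero_le_one v) with hf
    have hfc : Continuous (Function.uncurry f) := by
      refine hΛ.continuousOn.comp_continuous ?_ fun p => ⟨p.1.2, Subtype.coe_prop _⟩
      fun_prop
    have h1 := intervalIntegral.continuous_parametric_intervalIntegral_of_continuous'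
      (μ := MeasureTheory.volume) hfc 0 1
    refine h1.congr fun z => ?_
    refine intervalIntegral.integral_congr fun v hv => ?_
    rw [uIcc_of_le zero_le_one] at hv
    simp [hf, projIcc_of_mem zero_le_one hv]
  | succ n ih =>
    intro F _ _ _ Λ hΛ
    rw [(by push_cast; rfl : ((n + 1 : ℕ)) = (n : WithTop ℕ∞) + 1)] at hΛ ⊢
    rw [contDiffOn_succ_iff_hasFDerivWithinAt_of_uniqueDiffOn hu]
    set Λ' : E × ℝ → E →L[ℝ] F := fun p =>
      (fderivWithin ℝ Λ (Ω ×ˢ Icc 0 1) p).comp (inl ℝ E ℝ) with hΛ'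
    have h1 : ContDiffOn ℝ n Λ' (Ω ×ˢ Icc 0 1) :=
      (hΛ.fderivWithin (hu.prod (uniqueDiffOn_Icc zero_lt_one)) le_rfl).clm_comp contDiffOn_const
    refine ⟨by simp, fun z => ∫ v in 0..1, Λ' (z, v), ih h1, fun z hz => ?_⟩
    refine hasFDerivWithinAt_parametric hconv hΛ.continuousOn h1.continuousOn ?_ hz
    intro z hz v hv
    exact HasFDerivWithinAt.comp z ((hΛ.differentiableOn (by simp)) (z, v) ⟨hz,
        hv⟩).hasFDerivWithinAt
      (hasFDerivAt_prodMk_left z v).hasFDerivWithinAt fun x hx => ⟨hx, hv⟩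

theorem contDiffOn_parametric {E : Type} [NormedAddCommGroup E] [NormedSpace ℝ E]
    {Ω : Set E} (hconv : ∀ z ∈ Ω, ∃ r > 0, Convex ℝ (Ω ∩ Metric.ball z r))
    (hu : UniqueDiffOn ℝ Ω) {F : Type} [NormedAddCommGroup F] [NormedSpace ℝ F]
    [CompleteSpace F] {Λ : E × ℝ → F} (hΛ : ContDiffOn ℝ ∞ Λ (Ω ×ˢ Icc 0 1)) :
    ContDiffOn ℝ ∞ (fun z => ∫ v in (0 : ℝ)..1, Λ (z, v)) Ω := by
  rw [contDiffOn_infty] at hΛ ⊢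
  exact fun n => contDiffOn_parametric_nat hconv hu n (hΛ n)

end ParametricIntegral

/-- Covectors on the ambient space. -/
abbrev Cov : Type := Amb →L[ℝ] ℝ

/-- Bilinear forms on the ambient space. -/
abbrev Bil : Type := Amb →L[ℝ] Amb →L[ℝ] ℝ

/-- The dilation of the last factor. -/
def dilation (a : ℝ) : Amb →L[ℝ] Amb :=
  (ContinuousLinearMap.id ℝ ℝ).prodMap
    ((ContinuousLinearMap.id ℝ ℝ).prodMap (a • ContinuousLinearMap.id ℝ E3))

@[simp] lemma dilation_apply (a : ℝ) (u : Amb) : dilation a u = (u.1, u.2.1, a • u.2.2) := rfl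

/-- A field of nondegenerate symmetric bilinear forms on `ℝ × ℝ × (ℝ³ ∖ 0)` that does not depend
on the second variable and is invariant under dilations of the third factor. -/
structure IsRedMetric (A : ℝ × E3 → Bil) (r0 : ℝ) : Prop where
  pos : 0 < r0
  reg : IsRegOn A {p | |p.1| < r0 ∧ p.2 ≠ 0}
  symm : ∀ p : ℝ × E3, |p.1| < r0 → p.2 ≠ 0 → ∀ u v, A p u v = A p v u
  nondeg : ∀ p : ℝ × E3, |p.1| < r0 → p.2 ≠ 0 → ∀ u, (∀ v, A p u v = 0) → u = 0
  homog : ∀ (p : ℝ × E3), |p.1| < r0 → p.2 ≠ 0 → ∀ a : ℝ, 0 < a → ∀ u v,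
    A (p.1, a • p.2) (dilation a u) (dilation a v) = A p u v
  radial : ∀ (p : ℝ × E3), |p.1| < r0 → p.2 ≠ 0 → ∀ u : Amb,
    A p u (0, 0, p.2) = inner ℝ p.2 u.2.2 / ‖p.2‖ ^ 2

/-- The conformal metric `e^{2x} A(r, θ)`. -/
def confM (A : ℝ × E3 → Bil) (p : Amb) : Bil := exp (2 * p.2.1) • A (p.1, p.2.2)

/-- The vector dual to a covector. -/
def sharp (A : ℝ × E3 → Bil) (p : Amb) (P : Cov) : Amb := (confM A p).inverse P

/-- The domain of a reduced metric. -/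
def redDom (r0 : ℝ) : Set Amb := {p | |p.1| < r0 ∧ p.2.2 ≠ 0}

lemma isOpen_redDom (r0 : ℝ) : IsOpen (redDom r0) :=
  (isOpen_lt (g := fun _ => r0) (by fun_prop) (by fun_prop)).inter
    (isOpen_ne_fun (by fun_prop) (by fun_prop))

lemma isOpen_redDom' (r0 : ℝ) : IsOpen {p : ℝ × E3 | |p.1| < r0 ∧ p.2 ≠ 0} :=
  (isOpen_lt (g := fun _ => r0) (by fun_prop) (by fun_prop)).inter
    (isOpen_ne_fun (by fun_prop) (by fun_prop))

lemma finrank_cov : Module.finrank ℝ Amb = Module.finrank ℝ Cov := by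
  rw [(LinearMap.toContinuousLinearMap (𝕜 := ℝ)).finrank_eq.symm, Subspace.dual_finrank_eq]

lemma exists_equiv_of_nondeg (B : Bil) (h : ∀ u, (∀ v, B u v = 0) → u = 0) :
    ∃ e : Amb ≃L[ℝ] Cov, (e : Amb →L[ℝ] Cov) = B := by
  have hinj : Function.Injective (B : Amb →ₗ[ℝ] Cov) := by
    rw [← LinearMap.ker_eq_bot, LinearMap.ker_eq_bot']
    intro u hu
    exact h u fun v => by have : B u = 0 := hu; rw [this]; rfl
  refine ⟨(LinearEquiv.ofInjectiveOfFinrankEq (B : Amb →ₗ[ℝ] Cov) hinj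
    (finrank_cov )).toContinuousLinearEquiv, ?_⟩
  exact ContinuousLinearMap.ext fun u => rfl

section

variable {A : ℝ × E3 → Bil} {r0 : ℝ} (hA : IsRedMetric A r0)
include hA

lemma IsRedMetric.conf_equiv {p : Amb} (hp : p ∈ redDom r0) :
    ∃ e : Amb ≃L[ℝ] Cov, (e : Amb →L[ℝ] Cov) = confM A p := by
  refine exists_equiv_of_nondeg _ fun u hu => ?_
  refine hA.nondeg (p.1, p.2.2) hp.1 hp.2 u fun v => ?_
  have := hu v
  exact (mul_eq_zero.1 this).resolve_left (exp_pos _).ne'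

lemma IsRedMetric.conf_symm {p : Amb} (hp : p ∈ redDom r0) (u v : Amb) :
    confM A p u v = confM A p v u := by
  simp [confM]
  rw [hA.symm (p.1, p.2.2) hp.1 hp.2]

lemma IsRedMetric.conf_sharp {p : Amb} (hp : p ∈ redDom r0) (P : Cov) :
    confM A p (sharp A p P) = P := by
  obtain ⟨e, he⟩ := hA.conf_equiv hp
  rw [sharp, ← he]
  simp

lemma IsRedMetric.sharp_conf {p : Amb} (hp : p ∈ redDom r0) (u : Amb) :
    sharp A p (confM A p u) = u := by
  obtain ⟨e, he⟩ := hA.conf_equiv hp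
  rw [sharp, ← he]
  simp

lemma IsRedMetric.conf_reg : IsRegOn (confM A) (redDom r0) := by
  exact (IsRegOn.of_contDiffOn (isOpen_redDom r0) (by fun_prop)).bilin (isOpen_redDom r0) (lsmul ℝ
      ℝ) (IsRegOn.comp (isOpen_redDom' r0) (isOpen_redDom r0) hA.reg (by fun_prop) fun p hp => hp)

lemma IsRedMetric.hasFDerivAt_conf {p : Amb} (hp : p ∈ redDom r0) :
    HasFDerivAt (confM A) (fderiv ℝ (confM A) p) p := hA.conf_reg.hasFDerivAt (isOpen_redDom r0) hp

lemma IsRedMetric.contDiffAt_sharp {p : Amb} (hp : p ∈ redDom r0) (P : Cov) :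
    ContDiffAt ℝ 1 (fun x : Amb × Cov => sharp A x.1 x.2) (p, P) := by
  obtain ⟨e, he⟩ := hA.conf_equiv hp
  have h1 :=
    hA.conf_reg.contDiffOn.contDiffAt ((isOpen_redDom r0).mem_nhds hp)
  have h2 : ContDiffAt ℝ 1 ContinuousLinearMap.inverse (confM A p) := by
    rw [← he]
    exact contDiffAt_map_inverse e
  have h3 :=
    ContDiffAt.comp (p, P) h2
      (h1.comp (p, P) contDiffAt_fst)
  exact h3.clm_apply contDiffAt_snd

end

/-- The state `(ρ, (x, θ), P)` of a null geodesic: affine parameter, position, momentum. -/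
abbrev St : Type :=  ℝ × (ℝ × E3) × Cov

/-- The velocity. -/
def stVel (A : ℝ × E3 → Bil) (r : ℝ) (y : St) : Amb := sharp A (r, y.2.1) y.2.2

/-- Multiplication of the last two factors by a scalar. -/
def sndScale (a : ℝ) : Amb →L[ℝ] Amb :=
  (ContinuousLinearMap.id ℝ ℝ).prodMap (a • ContinuousLinearMap.id ℝ (ℝ × E3))

@[simp] lemma sndScale_apply (a : ℝ) (u : Amb) : sndScale a u = (u.1, a • u.2) := rfl

/-- The covector `v ↦ D(v1, a v2)(ζ, ζ)`. -/
def forceCov (D : Amb →L[ℝ] Bil) (a : ℝ) (ζ : Amb) : Cov := ((D.comp (sndScale a)).flip ζ).flip ζ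

@[simp] lemma forceCov_apply (D : Amb →L[ℝ] Bil) (a : ℝ) (ζ v : Amb) :
    forceCov D a ζ v = D (v.1, a • v.2) ζ ζ := rfl

/-- The equation of null geodesics, parametrized by `r` where `dq = w(r) dr`. -/
def charField (A : ℝ × E3 → Bil) (w : ℝ → ℝ) (p : ℝ × St) : St :=
  (w p.1 / (stVel A p.1 p.2).1, (w p.1 / (stVel A p.1 p.2).1) • (stVel A p.1 p.2).2,
    (2 * (stVel A p.1 p.2).1)⁻¹ •
      forceCov (fderiv ℝ (confM A) (p.1, p.2.2.1)) (w p.1) (stVel A p.1 p.2))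

/-- The domain of the equation of null geodesics. -/
def charDom (A : ℝ × E3 → Bil) (r0 : ℝ) : Set (ℝ × St) :=
  {p | (p.1, p.2.2.1) ∈ redDom r0 ∧ (stVel A p.1 p.2).1 ≠ 0}

section

variable {A : ℝ × E3 → Bil} {r0 : ℝ} (hA : IsRedMetric A r0)
include hA

lemma IsRedMetric.contDiffAt_stVel {p : ℝ × St} (hp : (p.1, p.2.2.1) ∈ redDom r0) :
    ContDiffAt ℝ 1 (fun p : ℝ × St => stVel A p.1 p.2) p := by
  exact ContDiffAt.comp p (hA.contDiffAt_sharp hp p.2.2.2) (by fun_prop : ContDiffAt ℝ 1 (fun p =>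
      (((p.1, p.2.2.1)), p.2.2.2)) p)

lemma IsRedMetric.isOpen_charDom : IsOpen (charDom A r0) := by
  rw [isOpen_iff_mem_nhds]
  intro p hp
  have h1 : ∀ᶠ q : ℝ × St in 𝓝 p, (q.1, q.2.2.1) ∈ redDom r0 := by
    have : Continuous fun q : ℝ × St => ((q.1, q.2.2.1)) := by fun_prop
    exact this.continuousAt ((isOpen_redDom r0).mem_nhds hp.1)
  filter_upwards [h1, (hA.contDiffAt_stVel hp.1).continuousAt.fst.eventually_ne hp.2] with q hq1
      hq2 using ⟨hq1, hq2⟩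

lemma IsRedMetric.charField_reg {w : ℝ → ℝ} (hw : Continuous w) :
    IsC0C1On (charField A w) (charDom A r0) := by
  have hO := hA.isOpen_charDom
  have hv : ContDiffOn ℝ 1 (fun p : ℝ × St => stVel A p.1 p.2) (charDom A r0) :=
    fun p hp => (hA.contDiffAt_stVel hp.1).contDiffWithinAt
  have hv1 :=
    contDiff_fst.comp_contDiffOn hv
  have hv2 :=
    contDiff_snd.comp_contDiffOn hv
  have hinv :=
    hv1.inv fun p hp => hp.2
  have hwc : IsC0C1On (fun p : ℝ × St => w p.1) (charDom A r0) := IsC0C1On.of_continuousOn_fst hw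
  have h1 : IsC0C1On (fun p : ℝ × St => w p.1 / (stVel A p.1 p.2).1) (charDom A r0) := by
    have := hwc.bilin (ContinuousLinearMap.mul ℝ ℝ) (IsC0C1On.of_contDiffOn hO hinv)
    simpa [div_eq_mul_inv] using this
  have h2 := h1.bilin (lsmul ℝ ℝ) (IsC0C1On.of_contDiffOn hO hv2)
  have hD :=
    IsC0C1On.comp
      hA.conf_reg.fderiv (IsC0C1On.of_contDiffOn hO (by fun_prop)) fun p hp => hp.1
  have hsc : IsC0C1On (fun p : ℝ × St => sndScale (w p.1)) (charDom A r0) := by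
    refine IsC0C1On.of_continuousOn_fst (w := fun r => sndScale (w r)) ?_
    rw [continuous_clm_apply]
    intro v
    simp only [sndScale_apply]
    fun_prop
  have hc := hD.bilin (compL ℝ Amb Amb Bil) hsc
  have hvv := IsC0C1On.of_contDiffOn hO hv
  have hf1 := hc.bilin
    (ContinuousLinearMap.flipₗᵢ ℝ Amb Amb Cov).toContinuousLinearEquiv.toContinuousLinearMap hvv
  have hf2 := hf1.bilin
    (ContinuousLinearMap.flipₗᵢ ℝ Amb Amb ℝ).toContinuousLinearEquiv.toContinuousLinearMap hvv
  have hinv2 :=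
    (contDiffOn_const.mul hv1).inv fun p hp => mul_ne_zero two_ne_zero hp.2
  have h3 := (IsC0C1On.of_contDiffOn hO hinv2).bilin (lsmul ℝ ℝ) hf2
  exact h1.prodMk (h2.prodMk h3)

omit hA in
lemma charField_pos {w : ℝ → ℝ} {y : ℝ → St} {r : ℝ}
    (hy : HasDerivAt y (charField A w (r, y r)) r) :
    HasDerivAt (fun r => (y r).2.1) ((w r / (stVel A r (y r)).1) • (stVel A r (y r)).2) r :=
  HasFDerivAt.comp_hasDerivAt r
    (fst ℝ (ℝ × E3) Cov ∘L
      snd ℝ ℝ ((ℝ × E3) × Cov)).hasFDerivAt hy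

omit hA in
lemma charField_mom {w : ℝ → ℝ} {y : ℝ → St} {r : ℝ}
    (hy : HasDerivAt y (charField A w (r, y r)) r) :
    HasDerivAt (fun r => (y r).2.2) ((2 * (stVel A r (y r)).1)⁻¹ •
      forceCov (fderiv ℝ (confM A) (r, (y r).2.1)) (w r) (stVel A r (y r))) r :=
  HasFDerivAt.comp_hasDerivAt r (snd ℝ (ℝ × E3) Cov ∘L snd ℝ ℝ ((ℝ × E3) × Cov)).hasFDerivAt hy

lemma char_null {w : ℝ → ℝ} {y : ℝ → St} {r : ℝ} (hp : (r, y r) ∈ charDom A r0)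
    (hy : HasDerivAt y (charField A w (r, y r)) r) :
    HasDerivAt (fun r => (y r).2.2 (stVel A r (y r))) 0 r := by
  obtain ⟨hp1, hp2⟩ := hp
  have hp1' := hp1
  set ζ := stVel A r (y r) with hζ
  have hξ := charField_pos hy
  have hP := charField_mom hy
  have hvel : ∃ ζ', HasDerivAt (fun r => stVel A r (y r)) ζ' r := by
    have h1 := ((hA.contDiffAt_stVel hp1).differentiableAt one_ne_zero).hasFDerivAt
    exact ⟨_, HasFDerivAt.comp_hasDerivAt (f := fun r => (r, y r)) r h1
      ((hasDerivAt_id r).prodMk hy)⟩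
  obtain ⟨ζ', hζ'⟩ := hvel
  have hG : HasDerivAt (fun r => confM A (r, (y r).2.1))
      (fderiv ℝ (confM A) (r, (y r).2.1) (1, (w r / ζ.1) • ζ.2)) r :=
    HasFDerivAt.comp_hasDerivAt r
      (hA.hasFDerivAt_conf hp1') ((hasDerivAt_id r).prodMk hξ)
  have hev : (fun r => confM A (r, (y r).2.1) (stVel A r (y r))) =ᶠ[𝓝 r]
      fun r => (y r).2.2 := by
    have :=
      (((hasDerivAt_id r).prodMk hξ).continuousAt).eventually
        ((isOpen_redDom r0).mem_nhds hp1')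
    filter_upwards [this] with t ht
    exact hA.conf_sharp ht _
  have hGζ := (hG.clm_apply hζ').congr_of_eventuallyEq hev.symm
  have hPe := hP.unique hGζ
  have h1 := DFunLike.congr_fun hPe ζ
  have hGP : confM A (r, (y r).2.1) ζ = (y r).2.2 := hA.conf_sharp hp1' _
  have h2 : (y r).2.2 ζ' = confM A (r, (y r).2.1) ζ' ζ := by rw [hA.conf_symm hp1', hGP]
  have hsc : ((ζ.1, w r • ζ.2) : Amb) = ζ.1 • ((1, (w r / ζ.1) • ζ.2) : Amb) := by
    ext1
    · simp
    · simp only [Prod.smul_mk, smul_smul]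
      congr 1
      have := hp2
      field_simp
  simp only [smul_apply, forceCov_apply, hsc, map_smul, smul_eq_mul, add_apply] at h1
  refine (hP.clm_apply hζ').congr_deriv ?_
  rw [show stVel A r (y r) = ζ from rfl] at h1 ⊢
  simp only [smul_apply, forceCov_apply, hsc, map_smul, smul_eq_mul]
  rw [h2]
  have hne := hp2
  have h3 : (2 * ζ.1)⁻¹ * (ζ.1 * (fderiv ℝ (confM A) (r, (y r).2.1)
      (1, (w r / ζ.1) • ζ.2)) ζ ζ) = 1 / 2 * (fderiv ℝ (confM A) (r, (y r).2.1)
      (1, (w r / ζ.1) • ζ.2)) ζ ζ := by field_simp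
  rw [h3] at h1 ⊢
  linarith


omit hA in
lemma hasDerivAt_dilation_inv (u : Amb) :
    HasDerivAt (fun a : ℝ => dilation a⁻¹ u) ((0, 0, -u.2.2) : Amb) 1 := by
  have h1 : HasDerivAt (fun a : ℝ => a⁻¹) (-1) 1 := by
    have := hasDerivAt_inv (one_ne_zero (α := ℝ))
    simpa using this
  have h2 : HasDerivAt (fun a : ℝ => a⁻¹ • u.2.2) (-u.2.2) 1 := by simpa using h1.smul_const u.2.2
  exact (hasDerivAt_const 1 u.1).prodMk ((hasDerivAt_const 1 u.2.1).prodMk h2)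

lemma IsRedMetric.fderiv_conf_x {p : Amb} (hp : p ∈ redDom r0) (a : ℝ) :
    fderiv ℝ (confM A) p (0, a, 0) = (2 * a) • confM A p := by
  have h1 : HasDerivAt (fun s : ℝ => p + s • ((0, a, 0) : Amb)) ((0, a, 0) : Amb) 0 := by
    simpa using ((hasDerivAt_id (0 : ℝ)).smul_const ((0, a, 0) : Amb)).const_add p
  have hp' : p + (0 : ℝ) • ((0, a, 0) : Amb) ∈ redDom r0 := by simpa using hp
  have h2 := HasFDerivAt.comp_hasDerivAt 0 (hA.hasFDerivAt_conf hp') h1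
  have h3 : HasDerivAt (confM A ∘ fun s : ℝ => p + s • ((0, a, 0) : Amb))
      ((2 * a) • confM A p) 0 := by
    have h4 : (confM A ∘ fun s : ℝ => p + s • ((0, a, 0) : Amb))
        = fun s => exp (2 * (p.2.1 + s * a)) • A (p.1, p.2.2) := by funext s; simp [confM]
    rw [h4]
    have h5 : HasDerivAt (fun s : ℝ => 2 * (p.2.1 + s * a)) (2 * a) 0 := by
      have := (((hasDerivAt_id (0 : ℝ)).mul_const a).const_add p.2.1).const_mul 2
      simpa using this
    have h6 := h5.exp.smul_const (A (p.1, p.2.2))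
    refine h6.congr_deriv ?_
    simp only [confM, smul_smul, zero_mul, add_zero]
    congr 1
    ring
  have h7 := h2.unique h3
  simpa using h7

lemma IsRedMetric.fderiv_conf_radial {p : Amb} (hp : p ∈ redDom r0) (u v : Amb) :
    fderiv ℝ (confM A) p (0, 0, p.2.2) u v
      = -confM A p (0, 0, u.2.2) v - confM A p u (0, 0, v.2.2) := by
  have h1 : HasDerivAt (fun a : ℝ => ((p.1, p.2.1, a • p.2.2) : Amb)) ((0, 0, p.2.2) : Amb) 1 := by
    have := (hasDerivAt_id (1 : ℝ)).smul_const p.2.2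
    rw [one_smul] at this
    exact (hasDerivAt_const 1 p.1).prodMk ((hasDerivAt_const 1 p.2.1).prodMk this)
  have hp' : ((p.1, p.2.1, (1 : ℝ) • p.2.2) : Amb) = p := by simp
  have h2 := HasFDerivAt.comp_hasDerivAt 1
    (by rw [hp']; exact hA.hasFDerivAt_conf hp) h1
  have h3 := (h2.clm_apply (hasDerivAt_const 1 u)).clm_apply (hasDerivAt_const 1 v)
  have h4 : ∀ᶠ a : ℝ in 𝓝 1, confM A (p.1, p.2.1, a • p.2.2) u v
      = confM A p (dilation a⁻¹ u) (dilation a⁻¹ v) := by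
    filter_upwards [lt_mem_nhds (zero_lt_one (α := ℝ))] with a ha
    have := hA.homog (p.1, p.2.2) hp.1 hp.2 a ha (dilation a⁻¹ u) (dilation a⁻¹ v)
    simp only [confM, smul_apply]
    rw [← this]
    simp [smul_smul, ha.ne']
  have h5 := (((hasDerivAt_const 1 (confM A p)).clm_apply
    (hasDerivAt_dilation_inv u)).clm_apply (hasDerivAt_dilation_inv v))
  have h6 := (h5.congr_of_eventuallyEq h4).unique h3
  have hneg : ∀ z : E3, ((0, 0, -z) : Amb) = -((0, 0, z) : Amb) := fun z => by simp
  have hu1 : dilation (1 : ℝ)⁻¹ u = u := by simp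
  have hv1 : dilation (1 : ℝ)⁻¹ v = v := by simp
  simp only [hu1, hv1, zero_apply, zero_add, map_zero, add_zero, hneg, map_neg, neg_apply] at h6
  rw [← h6]
  ring

lemma char_momentum_x {w : ℝ → ℝ} {y : ℝ → St} {r : ℝ} (hp : (r, y r) ∈ charDom A r0)
    (hy : HasDerivAt y (charField A w (r, y r)) r)
    (h0 : (y r).2.2 (stVel A r (y r)) = 0) :
    HasDerivAt (fun r => (y r).2.2 (0, 1, 0)) 0 r := by
  obtain ⟨hp1, hp2⟩ := hp
  have hp1' := hp1
  refine ((charField_mom hy).clm_apply (hasDerivAt_const r ((0, 1, 0) : Amb))).congr_deriv ?_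
  have h1 : confM A (r, (y r).2.1) (stVel A r (y r)) (stVel A r (y r)) = 0 := by
    rw [stVel, hA.conf_sharp hp1']
    exact h0
  simp only [smul_apply, forceCov_apply, add_zero]
  rw [(by simp : (w r • ((1, 0) : ℝ × E3)) = (w r, 0)), hA.fderiv_conf_x hp1', smul_apply,
      smul_apply, h1]
  simp

lemma char_momentum_radial {w : ℝ → ℝ} {y : ℝ → St} {r : ℝ} (hp : (r, y r) ∈ charDom A r0)
    (hy : HasDerivAt y (charField A w (r, y r)) r) :
    HasDerivAt (fun r => (y r).2.2 (0, 0, (y r).2.1.2)) 0 r := by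
  obtain ⟨hp1, hp2⟩ := hp
  have hp1' := hp1
  have hθ := (hasDerivAt_const r (0 : ℝ)).prodMk
    ((hasDerivAt_const r (0 : ℝ)).prodMk (charField_pos hy).snd)
  refine ((charField_mom hy).clm_apply hθ).congr_deriv ?_
  set ζ := stVel A r (y r) with hζ
  have hGP : confM A (r, (y r).2.1) ζ = (y r).2.2 := hA.conf_sharp hp1' _
  have h2 : (w r • ((0, (y r).2.1.2) : ℝ × E3)) = (0, w r • (y r).2.1.2) := by simp
  have h3 : ((0, 0, w r • (y r).2.1.2) : Amb) = w r • ((0, 0, (y r).2.1.2) : Amb) := by simp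
  have h4 : ((0, 0, ((w r / ζ.1) • ζ.2).2) : Amb) = (w r / ζ.1) • ((0, 0, ζ.2.2) : Amb) := by simp
  have h5 := hA.fderiv_conf_radial hp1' ζ ζ
  rw [hA.conf_symm hp1' (0, 0, ζ.2.2) ζ, hGP] at h5
  simp only [smul_apply, forceCov_apply]
  rw [h2, h3, h4, map_smul, map_smul, smul_apply, smul_apply, h5]
  field_simp
  ring

lemma char_norm {w : ℝ → ℝ} {y : ℝ → St} {r : ℝ} (hp : (r, y r) ∈ charDom A r0)
    (hy : HasDerivAt y (charField A w (r, y r)) r) (h0 : (y r).2.2 (0, 0, (y r).2.1.2) = 0) :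
    HasDerivAt (fun r => ‖(y r).2.1.2‖ ^ 2) 0 r := by
  obtain ⟨hp1, hp2⟩ := hp
  have hp1' := hp1
  set ζ := stVel A r (y r) with hζ
  have hd : HasDerivAt (fun r => (y r).2.1.2) ((w r / ζ.1) • ζ.2).2 r := (charField_pos hy).snd
  refine hd.norm_sq.congr_deriv ?_
  have hGP : confM A (r, (y r).2.1) ζ = (y r).2.2 := hA.conf_sharp hp1' _
  rw [← hGP] at h0
  have h1 := hA.radial (r, (y r).2.1.2) hp1'.1 hp1'.2 ζ
  simp only [confM, smul_apply] at h0
  have hne := hp1'.2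
  have h2 : inner ℝ (y r).2.1.2 ζ.2.2 = 0 := by simp_all
  simp [inner_smul_right, h2]

lemma char_gauss {w : ℝ → ℝ} {y δ : ℝ → St} {r : ℝ} (hp : (r, y r) ∈ charDom A r0)
    (hw : Continuous w) (hy : HasDerivAt y (charField A w (r, y r)) r)
    (hδ : HasDerivAt δ (fderiv ℝ (fun y => charField A w (r, y)) (y r) (δ r)) r)
    (h0 : (y r).2.2 (stVel A r (y r)) = 0)
    (hN : fderiv ℝ (fun y : St => y.2.2 (stVel A r y)) (y r) (δ r) = 0) :
    HasDerivAt (fun r => (y r).2.2 (0, (δ r).2.1)) 0 r := by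
  have hpd := hp
  obtain ⟨hp1, hp2⟩ := hp
  have hp1' := hp1
  set ℓ : ℝ → St := fun s => y r + s • δ r with hℓ
  have hℓ0 : ℓ 0 = y r := by simp [hℓ]
  have hℓd : HasDerivAt ℓ (δ r) 0 := by
    exact (((hasDerivAt_id (0 : ℝ)).smul_const (δ r)).const_add (y r)).congr_deriv (one_smul _ _)
  have hvd : DifferentiableAt ℝ (fun y => stVel A r y) (y r) := by
    have h1 := (hA.contDiffAt_stVel hp1).differentiableAt one_ne_zero
    exact DifferentiableAt.comp (y r) h1 (hasFDerivAt_prodMk_right' r (y r)).differentiableAt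
  set ζ := stVel A r (y r) with hζ
  set δζ := fderiv ℝ (fun y => stVel A r y) (y r) (δ r) with hδζ
  have hv : HasDerivAt (fun s => stVel A r (ℓ s)) δζ 0 :=
    HasFDerivAt.comp_hasDerivAt (l := fun y => stVel A r y) 0
      (by rw [hℓ0]; exact hvd.hasFDerivAt) hℓd
  have hPs : HasDerivAt (fun s => (ℓ s).2.2) (δ r).2.2 0 := hℓd.snd.snd
  have hG : HasDerivAt (fun s => confM A (r, (ℓ s).2.1))
      (fderiv ℝ (confM A) (r, (y r).2.1) (0, (δ r).2.1)) 0 :=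
    HasFDerivAt.comp_hasDerivAt (l := confM A) 0
      (by rw [hℓ0]; exact hA.hasFDerivAt_conf hp1')
      ((hasDerivAt_const 0 r).prodMk hℓd.snd.fst)
  have hev : (fun s => confM A (r, (ℓ s).2.1) (stVel A r (ℓ s))) =ᶠ[𝓝 0]
      fun s => (ℓ s).2.2 := by
    have : ∀ᶠ s in 𝓝 (0 : ℝ), ((r, (ℓ s).2.1) : Amb) ∈ redDom r0 :=
      (((hasDerivAt_const (0 : ℝ) r).prodMk hℓd.snd.fst).continuousAt).eventually
        ((isOpen_redDom r0).mem_nhds (by simpa [hℓ0] using hp1'))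
    filter_upwards [this] with t ht
    exact hA.conf_sharp ht _
  have hPe := hPs.unique ((hG.clm_apply hv).congr_of_eventuallyEq hev.symm)
  have hN' : (δ r).2.2 ζ + (y r).2.2 δζ = 0 := by
    have h1 := hPs.clm_apply hv
    have hd : DifferentiableAt ℝ (fun y : St => y.2.2 (stVel A r y)) (y r) := by
      have : DifferentiableAt ℝ (fun y : St => y.2.2) (y r) := by fun_prop
      exact this.clm_apply hvd
    have h2 := HasFDerivAt.comp_hasDerivAt 0
      (by rw [hℓ0]; exact hd.hasFDerivAt) hℓd
    have h3 := h1.unique h2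
    rw [hN, hℓ0] at h3
    exact h3
  have hGP : confM A (r, (y r).2.1) ζ = (y r).2.2 := hA.conf_sharp hp1' _
  have hvar := DFunLike.congr_fun hPe ζ
  rw [hℓ0, add_apply, hA.conf_symm hp1' δζ ζ, hGP] at hvar
  have hne : ζ.1 ≠ 0 := hp2
  have hpos : ((0, ((fderiv ℝ (fun y => charField A w (r, y)) (y r)) (δ r)).2.1) : Amb)
      = (-(w r * δζ.1) / ζ.1 ^ 2) • ζ + (w r / ζ.1) • δζ := by
    have h1 := HasFDerivAt.comp_hasDerivAt 0
      (by rw [hℓ0]; exact (hA.charField_reg hw).hasFDerivAt hpd) hℓd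
    have h2 : HasDerivAt (fun s => (charField A w (r, ℓ s)).2.1)
        ((fderiv ℝ (fun y => charField A w (r, y)) (y r)) (δ r)).2.1 0 := h1.snd.fst
    have h3 : HasDerivAt (fun s => w r / (stVel A r (ℓ s)).1) (-(w r * δζ.1) / ζ.1 ^ 2) 0 := by
      have := (hasDerivAt_const (0 : ℝ) (w r)).div hv.fst (by rw [hℓ0]; exact hne)
      refine this.congr_deriv ?_
      rw [hℓ0]
      simp [hζ]
    have hv2 : HasDerivAt (fun s => (stVel A r (ℓ s)).2) δζ.2 0 := hv.snd
    have h4 := h3.smul hv2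
    have h5 := h2.unique h4
    simp only [hℓ0] at h5
    refine Prod.ext ?_ ?_
    · simp only [Prod.fst_add, Prod.smul_fst, smul_eq_mul]; field_simp; ring
    · simp only [Prod.snd_add, Prod.smul_snd]; rw [h5, add_comm]
  refine ((charField_mom hy).clm_apply
    ((hasDerivAt_const r (0 : ℝ)).prodMk hδ.snd.fst)).congr_deriv ?_
  rw [hpos]
  have h3 : ((0, w r • (δ r).2.1) : Amb) = w r • ((0, (δ r).2.1) : Amb) := by simp
  simp only [smul_apply, forceCov_apply, map_add, map_smul, smul_eq_mul]
  rw [h3, map_smul, smul_apply, smul_apply, h0, mul_zero, zero_add]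
  rw [show stVel A r (y r) = ζ from rfl]
  simp only [smul_eq_mul]
  have h6 : (y r).2.2 δζ = -(1 / 2) * fderiv ℝ (confM A) (r, (y r).2.1) (0, (δ r).2.1) ζ ζ := by
    linarith
  rw [h6]
  field_simp
  ring

end

/-- The differential of the first variable. -/
def covq : Cov := fst ℝ ℝ (ℝ × E3)

/-- The differential of the second variable. -/
def covx : Cov := fst ℝ ℝ E3 ∘L snd ℝ ℝ (ℝ × E3)

@[simp] lemma covq_apply (u : Amb) : covq u = u.1 := rfl
@[simp] lemma covx_apply (u : Amb) : covx u = u.2.1 := rfl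

/-- Radial projection to the unit sphere. -/
def nrm (θ : E3) : E3 := ‖θ‖⁻¹ • θ

lemma norm_nrm {θ : E3} (h : θ ≠ 0) : ‖nrm θ‖ = 1 := by
  rw [nrm, norm_smul, norm_inv, norm_norm, inv_mul_cancel₀ (norm_ne_zero_iff.2 h)]

lemma nrm_of_norm {θ : E3} (h : ‖θ‖ = 1) : nrm θ = θ := by rw [nrm, h, inv_one, one_smul]

lemma contDiffAt_nrm {n : WithTop ℕ∞} {θ : E3} (h : θ ≠ 0) : ContDiffAt ℝ n nrm θ := by
  exact ((contDiffAt_norm ℝ h).inv (norm_ne_zero_iff.2 h)).smul contDiffAt_id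

/-- The momentum, at `(0, 0, θ)`, of the null geodesic orthogonal to the sphere. -/
def initMom (A : ℝ × E3 → Bil) (θ : E3) : Cov :=
  (-(sharp A (0, 0, θ) covx).2.1 / (sharp A (0, 0, θ) covx).1) • covq + (2 : ℝ) • covx

/-- The level set `r = 0` is a null hypersurface with a generator transversal to the spheres. -/
def IsNullAtZero (A : ℝ × E3 → Bil) : Prop :=
  ∀ θ : E3, ‖θ‖ = 1 → ∃ ℓ : Amb, ℓ.1 = 0 ∧ ℓ.2.1 ≠ 0 ∧ ∀ v, A (0, θ) ℓ v = v.1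

/-- A family of null geodesics emanating from the sphere. -/
structure IsNullFlow (A : ℝ × E3 → Bil) (w : ℝ → ℝ) (r0 δ : ℝ) (y : ℝ → E3 → St) : Prop where
  pos : 0 < δ
  le : δ ≤ r0
  init : ∀ θ : E3, ‖θ‖ = 1 → (y 0 θ).1 = 0 ∧ (y 0 θ).2.1 = (0, θ)
  init_vel : ∀ θ : E3, θ ≠ 0 → y 0 θ = y 0 (nrm θ)
  init_mom : ∀ θ : E3, ‖θ‖ = 1 → (y 0 θ).2.2 = initMom A θ
  reg : IsC0C1On (fun p : ℝ × E3 => y p.1 p.2) {p | |p.1| < δ ∧ p.2 ≠ 0}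
  dom : ∀ r θ, |r| < δ → θ ≠ 0 → (r, y r θ) ∈ charDom A r0
  ode : ∀ r θ, |r| < δ → θ ≠ 0 → HasDerivAt (fun r => y r θ) (charField A w (r, y r θ)) r
  null : ∀ r θ, |r| < δ → θ ≠ 0 → (y r θ).2.2 (stVel A r (y r θ)) = 0
  momentum_x : ∀ r θ, |r| < δ → θ ≠ 0 → (y r θ).2.2 (0, 1, 0) = 2
  norm : ∀ r θ, |r| < δ → θ ≠ 0 → ‖(y r θ).2.1.2‖ = 1
  gauss : ∀ r θ, |r| < δ → θ ≠ 0 → ∀ v, (y r θ).2.2 (0, (fderiv ℝ (y r) θ v).2.1) = 0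

section

variable {A : ℝ × E3 → Bil} {r0 : ℝ} (hA : IsRedMetric A r0)
include hA

lemma IsRedMetric.sharp_symm {p : Amb} (hp : p ∈ redDom r0) (P P' : Cov) :
    P (sharp A p P') = P' (sharp A p P) := by
  conv_lhs => rw [← hA.conf_sharp hp P]
  conv_rhs => rw [← hA.conf_sharp hp P']
  exact hA.conf_symm hp _ _

omit hA in
lemma confM_zero (A : ℝ × E3 → Bil) (θ : E3) : confM A (0, 0, θ) = A (0, θ) := by simp [confM]

omit hA in
lemma sharp_add (p : Amb) (P P' : Cov) : sharp A p (P + P') = sharp A p P + sharp A p P' :=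
  map_add _ _ _

omit hA in
lemma sharp_smul (p : Amb) (a : ℝ) (P : Cov) : sharp A p (a • P) = a • sharp A p P := map_smul _ _ _

lemma IsRedMetric.zero_mem {θ : E3} (h : θ ≠ 0) : ((0, 0, θ) : Amb) ∈ redDom r0 :=
  ⟨by simpa using hA.pos, h⟩

lemma IsRedMetric.sharp_covx_ne (hn : IsNullAtZero A) {θ : E3} (h : ‖θ‖ = 1) :
    (sharp A (0, 0, θ) covq).1 = 0 ∧ (sharp A (0, 0, θ) covx).1 ≠ 0 := by
  have hm := hA.zero_mem (norm_ne_zero_iff.1 (by rw [h]; exact one_ne_zero))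
  obtain ⟨ℓ, h1, h2, h3⟩ := hn θ h
  have h4 : sharp A (0, 0, θ) covq = ℓ := by
    rw [← hA.sharp_conf hm ℓ, confM_zero]
    congr 1
    refine ContinuousLinearMap.ext fun v => ?_
    rw [h3, covq_apply]
  have h5 := hA.sharp_symm hm covq covx
  simp_all

lemma IsRedMetric.initMom_spec (hn : IsNullAtZero A) {θ : E3} (h : ‖θ‖ = 1) :
    (sharp A (0, 0, θ) (initMom A θ)).1 ≠ 0 ∧
      initMom A θ (sharp A (0, 0, θ) (initMom A θ)) = 0 := by
  obtain ⟨h1, h2⟩ := hA.sharp_covx_ne hn h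
  rw [initMom, sharp_add, sharp_smul, sharp_smul]
  refine ⟨by simpa [h1] using h2, ?_⟩
  simp [map_add, smul_eq_mul, h1,
      ← hA.sharp_symm (hA.zero_mem (norm_ne_zero_iff.1 (by rw [h]; exact one_ne_zero))) covq covx]
  field_simp
  ring

lemma IsRedMetric.contDiffAt_init (hn : IsNullAtZero A) {θ : E3} (h : ‖θ‖ = 1) :
    ContDiffAt ℝ 1 (fun θ : E3 => (((0 : ℝ), ((0 : ℝ), θ), initMom A θ) : St)) θ := by
  have h1 : ContDiffAt ℝ 1 (fun θ => sharp A (0, 0, θ) covx) θ := by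
    exact ContDiffAt.comp (f := fun θ => (((0, 0, θ)), covx)) θ (hA.contDiffAt_sharp
        (hA.zero_mem (norm_ne_zero_iff.1 (by rw [h]; exact one_ne_zero))) covx) (by fun_prop)
  have h4 : ContDiffAt ℝ 1 (fun θ => initMom A θ) θ := by
    exact (((contDiff_fst.contDiffAt.comp θ (contDiff_snd.contDiffAt.comp θ h1)).neg.div
        (contDiff_fst.contDiffAt.comp θ h1) (hA.sharp_covx_ne hn h).2).smul contDiffAt_const).add
            contDiffAt_const
  exact contDiffAt_const.prodMk ((contDiffAt_const.prodMk contDiffAt_id).prodMk h4)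

omit hA in
lemma eq_of_deriv_zero {f : ℝ → ℝ} {δ : ℝ} (h : ∀ r, |r| < δ → HasDerivAt f 0 r)
    {r : ℝ} (hr : |r| < δ) : f r = f 0 := by
  have hδ := (abs_nonneg r).trans_lt hr
  refine (convex_Ioo _ _).is_const_of_fderivWithin_eq_zero (𝕜 := ℝ) ?_ ?_ (abs_lt.1 hr)
    ⟨by linarith, hδ⟩
  · intro x hx; exact (h x (abs_lt.2 hx)).differentiableAt.differentiableWithinAt
  · intro x hx
    rw [fderivWithin_of_isOpen isOpen_Ioo hx, (h x (abs_lt.2 hx)).hasFDerivAt.fderiv]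
    simp

theorem IsRedMetric.exists_nullFlow (hn : IsNullAtZero A) {w : ℝ → ℝ} (hw : Continuous w) :
    ∃ (δ : ℝ) (y : ℝ → E3 → St), IsNullFlow A w r0 δ y := by
  set y0 : E3 → St := fun θ => (0, (0, θ), initMom A θ) with hy₀
  have hS : IsCompact (Metric.sphere (0 : E3) 1) := isCompact_sphere 0 1
  have hcont : ContinuousOn y0 (Metric.sphere (0 : E3) 1) := fun θ hθ =>
    (hA.contDiffAt_init hn (by simpa using hθ)).continuousAt.continuousWithinAt
  have hdom : ∀ θ : E3, ‖θ‖ = 1 → ((0 : ℝ), y0 θ) ∈ charDom A r0 := fun θ h =>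
    ⟨hA.zero_mem (norm_ne_zero_iff.1 (by rw [h]; exact one_ne_zero)), (hA.initMom_spec hn h).1⟩
  obtain ⟨Z, Z', δ, U, hδ, hU, hCU, hZ0, hZc, hZ'c, hZd, hZ⟩ :=
    exists_flow (charField A w) (charDom A r0) hA.isOpen_charDom (hA.charField_reg hw)
      (y0 '' Metric.sphere (0 : E3) 1) (hS.image_of_continuousOn hcont) (by
        rintro ⟨a, b⟩ ⟨ha, θ, hθ, rfl⟩
        obtain rfl : a = 0 := ha
        exact hdom θ (by simpa using hθ))
  have hmem := fun {θ} h =>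
    hCU ⟨nrm θ, by simpa using norm_nrm h, rfl⟩
  set y : ℝ → E3 → St := fun r θ => Z r (y0 (nrm θ)) with hy
  have hy₀d := fun θ h => by
    have := ContDiffAt.comp θ (hA.contDiffAt_init hn (norm_nrm h))
      (contDiffAt_nrm h)
    exact this
  have hder : ∀ r (θ : E3), θ ≠ 0 → HasFDerivAt (y r)
      ((Z' r (y0 (nrm θ))).comp (fderiv ℝ (fun θ => y0 (nrm θ)) θ)) θ := fun r θ h => by
    have := HasFDerivAt.comp θ (hZd r _)
      ((hy₀d θ h).differentiableAt one_ne_zero).hasFDerivAt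
    exact this
  set I : Set (ℝ × E3) := {p | p.2 ≠ 0} with hI
  have hIo : IsOpen I := isOpen_ne_fun
    (by fun_prop) (by fun_prop)
  have hc1 : ContinuousOn (fun p : ℝ × E3 => y0 (nrm p.2)) I := fun p hp =>
    (ContinuousAt.comp
      (hy₀d p.2 hp).continuousAt continuousAt_snd).continuousWithinAt
  have hc2 : ContinuousOn (fun p : ℝ × E3 => fderiv ℝ (fun θ => y0 (nrm θ)) p.2) I := by
    intro p hp
    have h1 : ContinuousAt (fderiv ℝ (fun θ => y0 (nrm θ))) p.2 :=
      (hy₀d p.2 hp).continuousAt_fderiv one_ne_zero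
    exact (ContinuousAt.comp h1
      continuousAt_snd).continuousWithinAt
  have hreg : IsC0C1On (fun p : ℝ × E3 => y p.1 p.2) I := by
    refine IsC0C1On.of_hasFDerivAt
      ?_ ?_ fun p hp => hder p.1 p.2 hp
    · exact hZc.comp_continuousOn (continuous_fst.continuousOn.prodMk hc1)
    · exact (hZ'c.comp_continuousOn (continuous_fst.continuousOn.prodMk hc1)).clm_comp hc2
  have hIoo : ∀ {r : ℝ}, |r| < min δ r0 → r ∈ Ioo (-δ) δ := fun h =>
    abs_lt.1 (h.trans_le (min_le_left _ _))
  have hode : ∀ r (θ : E3), |r| < min δ r0 → θ ≠ 0 →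
      HasDerivAt (fun r => y r θ) (charField A w (r, y r θ)) r := fun r θ hr h =>
    (hZ r (hIoo hr) _ (hmem h)).2.1
  have hdom' : ∀ r (θ : E3), |r| < min δ r0 → θ ≠ 0 → (r, y r θ) ∈ charDom A r0 :=
    fun r θ hr h => (hZ r (hIoo hr) _ (hmem h)).1
  have hy0 : ∀ θ : E3, y 0 θ = y0 (nrm θ) := fun θ => hZ0 _
  have hnull : ∀ r (θ : E3), |r| < min δ r0 → θ ≠ 0 →
      (y r θ).2.2 (stVel A r (y r θ)) = 0 := fun r θ hr h => by
    rw [eq_of_deriv_zero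
      (fun r hr => char_null hA (hdom' r θ hr h) (hode r θ hr h)) hr]
    simp only [hy0]
    exact (hA.initMom_spec hn (norm_nrm h)).2
  have hrad : ∀ r (θ : E3), |r| < min δ r0 → θ ≠ 0 →
      (y r θ).2.2 (0, 0, (y r θ).2.1.2) = 0 := fun r θ hr h => by
    rw [eq_of_deriv_zero
      (fun r hr => char_momentum_radial hA (hdom' r θ hr h) (hode r θ hr h)) hr]
    simp [hy0, hy₀, initMom]
  have hnm : ∀ r (θ : E3), |r| < min δ r0 → θ ≠ 0 → ‖(y r θ).2.1.2‖ = 1 := fun r θ hr h => by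
    have h1 := eq_of_deriv_zero
      (fun r hr => char_norm hA (hdom' r θ hr h) (hode r θ hr h) (hrad r θ hr h)) hr
    simp only [hy0, hy₀, norm_nrm h] at h1
    exact (sq_eq_sq₀ (norm_nonneg _) zero_le_one).1 h1
  refine ⟨min δ r0, y, lt_min hδ hA.pos, min_le_right _ _, fun θ h => ?_, fun θ h => ?_,
    fun θ h => ?_, hreg.mono fun p hp => hp.2, hdom', hode, hnull, fun r θ hr h => ?_, hnm,
    fun r θ hr h v => ?_⟩
  · simp [hy0, hy₀, nrm_of_norm h]
  · rw [hy0, hy0, nrm_of_norm (norm_nrm h)]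
  · simp [hy0, hy₀, nrm_of_norm h]
  · rw [eq_of_deriv_zero
      (fun r hr => char_momentum_x hA (hdom' r θ hr h) (hode r θ hr h) (hnull r θ hr h)) hr]
    simp [hy0, hy₀, initMom]
  · have hv : ∀ r, fderiv ℝ (y r) θ v = Z' r (y0 (nrm θ))
        (fderiv ℝ (fun θ => y0 (nrm θ)) θ v) := fun r => by rw [(hder r θ h).fderiv]; rfl
    simp only [hv]
    set v0 := fderiv ℝ (fun θ => y0 (nrm θ)) θ v with hv0
    rw [eq_of_deriv_zero (f := fun r => (y r θ).2.2 (0, (Z' r (y0 (nrm θ)) v0).2.1))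
      (fun r hr => ?_) hr]
    · have h1 : Z' 0 (y0 (nrm θ)) v0 = v0 := by
        have h2 : HasFDerivAt (Z 0) (ContinuousLinearMap.id ℝ St) (y0 (nrm θ)) :=
          (hasFDerivAt_id (𝕜 := ℝ) (y0 (nrm θ))).congr_of_eventuallyEq
            (Eventually.of_forall fun y => hZ0 y)
        rw [(hZd 0 _).unique h2]
        rfl
      have h2 : v0.2.1.1 = 0 := by
        have h3 : HasFDerivAt (fun θ => (y0 (nrm θ)).2.1.1) (_ ∘L _) θ :=
          HasFDerivAt.comp (f := fun θ => y0 (nrm θ)) θ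
            (fst ℝ ℝ E3 ∘L fst ℝ (ℝ × E3) Cov ∘L
              snd ℝ ℝ ((ℝ × E3) × Cov)).hasFDerivAt
            ((hy₀d θ h).differentiableAt one_ne_zero).hasFDerivAt
        have h4 : HasFDerivAt (fun θ => (y0 (nrm θ)).2.1.1) (0 : E3 →L[ℝ] ℝ) θ :=
          hasFDerivAt_const 0 θ
        exact DFunLike.congr_fun (h3.unique h4) v
      rw [h1, hy0]
      simp [hy₀, initMom, h2]
    · refine char_gauss hA (δ := fun r => Z' r (y0 (nrm θ)) v0) (hdom' r θ hr h) hw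
        (hode r θ hr h) ((hZ r (hIoo hr) _ (hmem h)).2.2 v0) (hnull r θ hr h) ?_
      have hd : DifferentiableAt ℝ (fun y : St => y.2.2 (stVel A r y)) (y r θ) := by
        have h1 := (hA.contDiffAt_stVel (hdom' r θ hr h).1).differentiableAt one_ne_zero
        have h2 := DifferentiableAt.comp
          (f := fun y => (r, y)) (y r θ) h1 (hasFDerivAt_prodMk_right' r (y r θ)).differentiableAt
        have h3 : DifferentiableAt ℝ (fun y : St => y.2.2) (y r θ) := by fun_prop
        exact h3.clm_apply h2
      have h3 := HasFDerivAt.comp θ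
        hd.hasFDerivAt (hder r θ h)
      have h4 : HasFDerivAt ((fun y : St => y.2.2 (stVel A r y)) ∘ y r) (0 : E3 →L[ℝ] ℝ) θ := by
        refine (hasFDerivAt_const (0 : ℝ) θ).congr_of_eventuallyEq ?_
        filter_upwards [isOpen_ne.mem_nhds h] with θ' hθ'
        exact hnull r θ' hr hθ'
      exact DFunLike.congr_fun (h3.unique h4) v

end

lemma hasDerivAt_of_eventually_ne {E : Type*} [NormedAddCommGroup E] [NormedSpace ℝ E]
    {f g : ℝ → E} {x : ℝ} (h : ∀ᶠ y in 𝓝[≠] x, HasDerivAt f (g y) y) (hf : ContinuousAt f x)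
    (hg : ContinuousAt g x) : HasDerivAt f (g x) x := by
  have hR := h.filter_mono (nhdsWithin_mono _ fun y hy => ne_of_gt hy)
  have hL := h.filter_mono (nhdsWithin_mono _ fun y hy => ne_of_lt hy)
  simpa using (hasDerivWithinAt_Iic_of_tendsto_deriv (fun y hy =>
      hy.differentiableAt.differentiableWithinAt) hf.continuousWithinAt hL ((tendsto_inf_left
          hg).congr' (hL.mono fun y hy => hy.deriv.symm))).union
              (hasDerivWithinAt_Ici_of_tendsto_deriv (fun y hy =>
                  hy.differentiableAt.differentiableWithinAt) hf.continuousWithinAt hR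
                      ((tendsto_inf_left hg).congr' (hR.mono fun y hy => hy.deriv.symm)))

lemma IsC0C1On.contDiffOn_of_hasDerivAt {Y F : Type*} [NormedAddCommGroup Y] [NormedSpace ℝ Y]
    [NormedAddCommGroup F] [NormedSpace ℝ F] {f g : ℝ × Y → F} {Ω : Set (ℝ × Y)} (hΩ : IsOpen Ω)
    (hf : IsC0C1On f Ω) (hg : ContinuousOn g Ω)
    (h : ∀ p ∈ Ω, HasDerivAt (fun q => f (q, p.2)) (g p) p.1) :
    ContDiffOn ℝ 1 f Ω ∧ ∀ p ∈ Ω, HasFDerivAt f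
      (((1 : ℝ →L[ℝ] ℝ).smulRight (g p)).coprod (fderiv ℝ (fun y => f (p.1, y)) p.2)) p := by
  have hd : ∀ p ∈ Ω, HasFDerivAt f
      (((1 : ℝ →L[ℝ] ℝ).smulRight (g p)).coprod (fderiv ℝ (fun y => f (p.1, y)) p.2)) p := by
    intro p hp
    have hc1 :=
      (smulRightL ℝ ℝ F (1 : ℝ →L[ℝ] ℝ)).continuous.comp_continuousOn hg
    exact (hasStrictFDerivAt_uncurry_coprod (f := fun q y => f (q, y))
      (f₁ := fun q y => (1 : ℝ →L[ℝ] ℝ).smulRight (g (q, y)))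
      (f₂ := fun q y => fderiv ℝ (fun y => f (q, y)) y)
      (Filter.Eventually.mono (hΩ.mem_nhds hp) fun v hv => (h v hv).hasFDerivAt)
      (Filter.Eventually.mono (hΩ.mem_nhds hp) fun v hv => hf.hasFDerivAt hv)
      (hc1.continuousAt (hΩ.mem_nhds hp))
      (hf.cont_fderiv.continuousAt (hΩ.mem_nhds hp))).hasFDerivAt
  refine ⟨fun p hp => ContDiffAt.contDiffWithinAt (contDiffAt_one_iff.2
    ⟨_, Ω, hΩ.mem_nhds hp, ?_, hd⟩), hd⟩
  have hc1 : ContinuousOn (fun p => ((1 : ℝ →L[ℝ] ℝ).smulRight (g p)).comp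
      (fst ℝ ℝ Y)) Ω :=
    ((smulRightL ℝ ℝ F (1 : ℝ →L[ℝ] ℝ)).continuous.comp_continuousOn hg).clm_comp
      continuousOn_const
  have hc2 : ContinuousOn (fun p : ℝ × Y => (fderiv ℝ (fun y => f (p.1, y)) p.2).comp
      (snd ℝ ℝ Y)) Ω := hf.cont_fderiv.clm_comp continuousOn_const
  exact hc1.add hc2

/-- `rt` is a change of variables `q ↦ r` with `dq = w(r) dr`, smooth away from zero. -/
structure IsRoot (w rt : ℝ → ℝ) : Prop where
  cont : Continuous rt
  zero : rt 0 = 0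
  mono : StrictMono rt
  deriv : ∀ q, q ≠ 0 → w (rt q) ≠ 0 ∧ HasDerivAt rt (w (rt q))⁻¹ q

/-- Affine parameter and position of a family of null geodesics, as a function of `q`. -/
def geoPos (y : ℝ → E3 → St) (rt : ℝ → ℝ) (p : ℝ × E3) : Amb :=
  ((y (rt p.1) p.2).1, (y (rt p.1) p.2).2.1)

/-- The velocity. -/
def geoVel (A : ℝ × E3 → Bil) (y : ℝ → E3 → St) (rt : ℝ → ℝ) (p : ℝ × E3) : Amb :=
  stVel A (rt p.1) (y (rt p.1) p.2)

/-- The domain of the family. -/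
def geoDom (rt : ℝ → ℝ) (δ : ℝ) : Set (ℝ × E3) := {p | |rt p.1| < δ ∧ p.2 ≠ 0}

section

variable {A : ℝ × E3 → Bil} {r0 : ℝ} (hA : IsRedMetric A r0) {w rt : ℝ → ℝ}
  (hrt : IsRoot w rt) {δ : ℝ} {y : ℝ → E3 → St} (hy : IsNullFlow A w r0 δ y)
include hrt

lemma isOpen_geoDom : IsOpen (geoDom rt δ) := (isOpen_lt
    (hrt.cont.comp continuous_fst).abs continuous_const).inter
    (isOpen_ne_fun (by fun_prop) (by fun_prop))

include hy

lemma continuousOn_state :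
    ContinuousOn (fun p : ℝ × E3 => y (rt p.1) p.2) (geoDom rt δ) := hy.reg.cont.comp
    ((hrt.cont.comp continuous_fst).prodMk continuous_snd).continuousOn fun _ hp => hp

lemma geoPos_regC0C1 : IsC0C1On (geoPos y rt) (geoDom rt δ) := by
  have h : IsC0C1On (fun p => y (rt p.1) p.2) (geoDom rt δ) := by
    refine IsC0C1On.of_hasFDerivAt (f' := fun p => fderiv ℝ (y (rt p.1)) p.2)
      (continuousOn_state hrt hy) ?_ fun p hp => ?_
    · exact hy.reg.cont_fderiv.comp
        ((hrt.cont.comp continuous_fst).prodMk continuous_snd).continuousOn fun p hp => hp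
    · exact hy.reg.hasFDerivAt (p := (rt p.1, p.2)) hp
  exact h.clm ((fst ℝ ℝ ((ℝ × E3) × Cov)).prod
    (fst ℝ (ℝ × E3) Cov ∘L snd ℝ ℝ ((ℝ × E3) × Cov)))

include hA

lemma continuousOn_geoVel : ContinuousOn (geoVel A y rt) (geoDom rt δ) := fun p hp => by
  exact (ContinuousAt.comp (f := fun p : ℝ × E3 =>
      (rt p.1, y (rt p.1) p.2)) (hA.contDiffAt_stVel (hy.dom (rt p.1) p.2 hp.1 hp.2).1).continuousAt
    ((hrt.cont.comp continuous_fst).continuousAt.prodMk ((continuousOn_state hrt hy).continuousAt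
        ((isOpen_geoDom hrt).mem_nhds hp)))).continuousWithinAt

omit hA hrt in
lemma geoVel_ne {p : ℝ × E3} (hp : p ∈ geoDom rt δ) : (geoVel A y rt p).1 ≠ 0 :=
  (hy.dom (rt p.1) p.2 hp.1 hp.2).2

lemma hasDerivAt_geoPos {p : ℝ × E3} (hp : p ∈ geoDom rt δ) :
    HasDerivAt (fun q => geoPos y rt (q, p.2))
      ((geoVel A y rt p).1⁻¹ • ((1, (geoVel A y rt p).2) : Amb)) p.1 := by
  obtain ⟨q, θ⟩ := p
  have hslice : ∀ᶠ q' in 𝓝 q, (q', θ) ∈ geoDom rt δ :=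
    (by fun_prop : Continuous fun q' : ℝ => (q', θ)).continuousAt
      ((isOpen_geoDom hrt).mem_nhds hp)
  have hne : ∀ q', q' ≠ 0 → (q', θ) ∈ geoDom rt δ → HasDerivAt (fun q => geoPos y rt (q, θ))
      ((geoVel A y rt (q', θ)).1⁻¹ • ((1, (geoVel A y rt (q', θ)).2) : Amb)) q' := by
    intro q' h0 h1
    obtain ⟨h2, h3⟩ := hrt.deriv q' h0
    have h5 := (hy.ode (rt q') θ h1.1 h1.2).scomp q' h3
    have h6 : HasDerivAt (fun q => (y (rt q) θ).1)
      ((w (rt q'))⁻¹ • charField A w (rt q', y (rt q') θ)).1 q' := h5.fst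
    refine (h6.prodMk h5.snd.fst).congr_deriv ?_
    have h8 : (w (rt q'))⁻¹ * (w (rt q') / (geoVel A y rt (q', θ)).1)
        = (geoVel A y rt (q', θ)).1⁻¹ := by field_simp
    refine Prod.ext ?_ ?_
    · change (w (rt q'))⁻¹ * (w (rt q') / (geoVel A y rt (q', θ)).1) = _; rw [h8]; simp
    · change (w (rt q'))⁻¹ • (w (rt q') / (geoVel A y rt (q', θ)).1) • (geoVel A y rt (q', θ)).2 = _
      rw [smul_smul, h8]
      rfl
  have hfc : ContinuousAt (fun q => geoPos y rt (q, θ)) q :=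
    ContinuousAt.comp (g := geoPos y rt)
      ((geoPos_regC0C1 hrt hy).cont.continuousAt ((isOpen_geoDom hrt).mem_nhds hp))
      (by fun_prop)
  have hvc : ContinuousAt (fun q => geoVel A y rt (q, θ)) q :=
    ContinuousAt.comp (g := geoVel A y rt)
      ((continuousOn_geoVel hA hrt hy).continuousAt ((isOpen_geoDom hrt).mem_nhds hp))
      (by fun_prop)
  have hgc : ContinuousAt (fun q => (geoVel A y rt (q, θ)).1⁻¹ •
      ((1, (geoVel A y rt (q, θ)).2) : Amb)) q :=
    (hvc.fst.inv₀ (geoVel_ne hy hp)).smul (continuousAt_const.prodMk hvc.snd)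
  by_cases h0 : q = 0
  · refine hasDerivAt_of_eventually_ne ?_ hfc hgc
    filter_upwards [hslice.filter_mono nhdsWithin_le_nhds, self_mem_nhdsWithin] with q' h1 h2
    refine hne q' ?_ h1
    rw [← h0]
    exact h2
  · exact hne q h0 hp

lemma geoPos_smooth : ContDiffOn ℝ 1 (geoPos y rt) (geoDom rt δ) ∧
    ∀ p ∈ geoDom rt δ, ∀ a v, fderiv ℝ (geoPos y rt) p (a, v)
      = (a * (geoVel A y rt p).1⁻¹) • ((1, (geoVel A y rt p).2) : Amb)
        + ((fderiv ℝ (y (rt p.1)) p.2 v).1, (fderiv ℝ (y (rt p.1)) p.2 v).2.1) := by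
  have hvc := continuousOn_geoVel hA hrt hy
  have h := (geoPos_regC0C1 hrt hy).contDiffOn_of_hasDerivAt (isOpen_geoDom hrt)
    ((hvc.fst.inv₀ fun p hp => geoVel_ne hy hp).smul (continuousOn_const.prodMk hvc.snd))
    fun p hp => hasDerivAt_geoPos hA hrt hy hp
  refine ⟨h.1, fun p hp a v => ?_⟩
  have h1 : HasFDerivAt (fun θ => geoPos y rt (p.1, θ))
      (((fst ℝ ℝ ((ℝ × E3) × Cov)).prod
        (fst ℝ (ℝ × E3) Cov ∘L
          snd ℝ ℝ ((ℝ × E3) × Cov))) ∘L fderiv ℝ (y (rt p.1)) p.2) p.2 :=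
    HasFDerivAt.comp
      (g := (fst ℝ ℝ ((ℝ × E3) × Cov)).prod
        (fst ℝ (ℝ × E3) Cov ∘L
          snd ℝ ℝ ((ℝ × E3) × Cov))) p.2
      (ContinuousLinearMap.hasFDerivAt _) (hy.reg.hasFDerivAt (p := (rt p.1, p.2)) hp)
  rw [(h.2 p hp).fderiv, h1.fderiv]
  simp [smul_smul]

end

/-- The closed neighbourhood of the sphere used for compactness arguments. -/
def annulus : Set E3 := {θ | 1 / 2 ≤ ‖θ‖ ∧ ‖θ‖ ≤ 2}

lemma isCompact_annulus : IsCompact annulus := by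
  have h1 : annulus = Metric.closedBall 0 2 ∩ {θ | 1 / 2 ≤ ‖θ‖} := by
    ext θ
    simp [annulus, and_comm]
  rw [h1]
  exact (isCompact_closedBall _ _).inter_right (isClosed_le continuous_const continuous_norm)

lemma ne_of_mem_annulus {θ : E3} (h : θ ∈ annulus) : θ ≠ 0 := by
  rintro rfl
  have := h.1
  norm_num at this

/-- The domain of the coordinates `(ρ, τ, θ)`. -/
def gDom (c' : ℝ) : Set Amb := {x | |x.1| < c' ∧ 1 / 2 < ‖x.2.2‖ ∧ ‖x.2.2‖ < 2}

lemma gDom_annulus {c' : ℝ} {x : Amb} (h : x ∈ gDom c') : x.2.2 ∈ annulus := ⟨h.2.1.le, h.2.2.le⟩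

lemma isOpen_gDom (c' : ℝ) : IsOpen (gDom c') :=
  (isOpen_lt (g := fun _ => c') (by fun_prop) (by fun_prop)).inter
    ((isOpen_lt (f := fun _ => (1 / 2 : ℝ)) (by fun_prop) (by fun_prop)).inter
    (isOpen_lt (f := fun p : Amb => ‖p.2.2‖) (by fun_prop) (by fun_prop)))

/-- `(q, θ)` to the position at `q` of the geodesic from `θ`, without the second variable. -/
def angMap (y : ℝ → E3 → St) (rt : ℝ → ℝ) (p : ℝ × E3) : ℝ × E3 :=
  (p.1, ‖p.2‖ • (geoPos y rt p).2.2)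

/-- `(q, τ, θ)` to the position at `q` of the geodesic from `(τ, θ)`. -/
def geoMap (y : ℝ → E3 → St) (rt : ℝ → ℝ) (p : Amb) : Amb :=
  (p.1, p.2.1 + (geoPos y rt (p.1, p.2.2)).2.1, ‖p.2.2‖ • (geoPos y rt (p.1, p.2.2)).2.2)

/-- `(q, τ, θ)` to `(ρ, τ, θ)` where `ρ` is the affine parameter. -/
def parMap (y : ℝ → E3 → St) (rt : ℝ → ℝ) (p : Amb) : Amb := ((geoPos y rt (p.1, p.2.2)).1, p.2)

/-- The parametrization `Φ` of a neighbourhood of `q = 0` by `(ρ, τ, θ)`. -/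
structure IsReducedGauge (A : ℝ × E3 → Bil) (y : ℝ → E3 → St) (rt : ℝ → ℝ) (δ δ' c' σ : ℝ)
    (Φ Φi : Amb → Amb) : Prop where
  pos : 0 < c'
  dom : ∀ q, |q| < δ' → |rt q| < δ
  sign : σ = 1 ∨ σ = -1
  isOpen_range : IsOpen (Φ '' gDom c')
  smooth : ContDiffOn ℝ 1 Φ (gDom c')
  smooth_inv : ContDiffOn ℝ 1 Φi (Φ '' gDom c')
  left_inv : ∀ x ∈ gDom c', Φi (Φ x) = x
  spec : ∀ x ∈ gDom c', |(Φ x).1| < δ' ∧ parMap y rt ((Φ x).1, x.2) = x ∧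
    Φ x = geoMap y rt ((Φ x).1, x.2)
  spec_inv : ∀ q τ θ, |q| < δ' → 1 / 2 < ‖θ‖ → ‖θ‖ < 2 →
    geoMap y rt (q, τ, θ) ∈ Φ '' gDom c' →
    Φi (geoMap y rt (q, τ, θ)) = parMap y rt (q, τ, θ)
  pos_iff : ∀ x ∈ gDom c', (0 < (Φ x).1 ↔ 0 < σ * x.1)
  zero_iff : ∀ x ∈ gDom c', ((Φ x).1 = 0 ↔ x.1 = 0)
  deriv_fst : ∀ x ∈ gDom c', ‖x.2.2‖ = 1 →
    fderiv ℝ Φ x (1, 0, 0) = geoVel A y rt ((Φ x).1, x.2.2)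
  deriv_snd : ∀ x ∈ gDom c', fderiv ℝ Φ x (0, 1, 0) = (0, 1, 0)
  deriv_thd : ∀ x ∈ gDom c', ‖x.2.2‖ = 1 → ∀ v : E3, inner ℝ x.2.2 v = 0 →
    (y (rt (Φ x).1) x.2.2).2.2 (fderiv ℝ Φ x (0, 0, v)) = 0

lemma pos_or_neg {X : Type*} [TopologicalSpace X] {s : Set X}
    (hs : IsPreconnected s) {f : X → ℝ} (hf : ContinuousOn f s) (h0 : ∀ x ∈ s, f x ≠ 0) :
    ∃ σ : ℝ, (σ = 1 ∨ σ = -1) ∧ ∀ x ∈ s, 0 < σ * f x := by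
  by_cases h : ∀ x ∈ s, 0 < f x
  · exact ⟨1, Or.inl rfl, fun x hx => by simpa using h x hx⟩
  · push Not at h
    obtain ⟨a, ha, ha'⟩ := h
    refine ⟨-1, Or.inr rfl, fun x hx => ?_⟩
    by_contra hx'
    obtain ⟨z, hz, hz'⟩ := hs.intermediate_value ha hx hf ⟨ha', by linarith⟩
    exact h0 z hz hz'

lemma hasFDerivAt_norm_of_ne {θ : E3} (h : θ ≠ 0) :
    HasFDerivAt (fun θ : E3 => ‖θ‖) (‖θ‖⁻¹ • innerSL ℝ θ) θ := by
  refine (((hasStrictFDerivAt_norm_sq θ).hasFDerivAt.sqrt (by positivity)).congr_of_eventuallyEq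
      (Eventually.of_forall fun x => ?_)).congr_fderiv ?_
  · simp
  · have := norm_ne_zero_iff.2 h
    ext v
    simp
    field_simp

lemma exists_equiv_of_injective {E : Type*} [NormedAddCommGroup E] [NormedSpace ℝ E]
    [FiniteDimensional ℝ E] (f : E →L[ℝ] E) (h : ∀ u, f u = 0 → u = 0) :
    ∃ e : E ≃L[ℝ] E, (e : E →L[ℝ] E) = f := by
  have hinj : Function.Injective (f : E →ₗ[ℝ] E) := by
    rw [← LinearMap.ker_eq_bot, LinearMap.ker_eq_bot']
    exact h
  exact ⟨(LinearEquiv.ofInjectiveEndo f hinj).toContinuousLinearEquiv,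
    ContinuousLinearMap.ext fun u => rfl⟩

section

variable {A : ℝ × E3 → Bil} {r0 : ℝ} (hA : IsRedMetric A r0) {w rt : ℝ → ℝ}
  (hrt : IsRoot w rt) {δ : ℝ} {y : ℝ → E3 → St} (hy : IsNullFlow A w r0 δ y)
include hA hrt hy

omit hA in
lemma geoPos_zero {θ : E3} (h : θ ≠ 0) : geoPos y rt (0, θ) = (0, 0, nrm θ) := by
  have h1 := hy.init (nrm θ) (norm_nrm h)
  rw [← hy.init_vel θ h] at h1
  simp [geoPos, hrt.zero, h1.1, h1.2]

omit hA in
lemma zero_mem_geoDom {θ : E3} (h : θ ≠ 0) : ((0, θ) : ℝ × E3) ∈ geoDom rt δ :=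
  ⟨by simpa [hrt.zero] using hy.pos, h⟩

omit hA in
lemma angMap_zero {θ : E3} (h : θ ≠ 0) : angMap y rt (0, θ) = (0, θ) := by
  have := norm_ne_zero_iff.2 h
  simp [angMap, geoPos_zero hrt hy h, nrm, this]

omit hA in
lemma geoMap_zero {τ : ℝ} {θ : E3} (h : θ ≠ 0) : geoMap y rt (0, τ, θ) = (0, τ, θ) := by
  have := norm_ne_zero_iff.2 h
  simp [geoMap, geoPos_zero hrt hy h, nrm, this]

lemma hasFDerivAt_geoPos {p : ℝ × E3} (hp : p ∈ geoDom rt δ) :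
    HasFDerivAt (geoPos y rt) (fderiv ℝ (geoPos y rt) p) p :=
  (((geoPos_smooth hA hrt hy).1.differentiableOn one_ne_zero).differentiableAt
    ((isOpen_geoDom hrt).mem_nhds hp)).hasFDerivAt

lemma contDiffOn_angMap : ContDiffOn ℝ 1 (angMap y rt) (geoDom rt δ) := by
  have h1 : ContDiffOn ℝ 1 (fun p => ‖p.2‖) (geoDom rt δ) := fun p hp =>
    ((contDiffAt_norm ℝ hp.2).comp p contDiffAt_snd).contDiffWithinAt
  exact contDiff_fst.contDiffOn.prodMk (h1.smul
    (contDiff_snd.comp_contDiffOn (contDiff_snd.comp_contDiffOn (geoPos_smooth hA hrt hy).1)))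

lemma contDiffOn_geoMap : ContDiffOn ℝ 1 (geoMap y rt) {p | (p.1, p.2.2) ∈ geoDom rt δ} := by
  have h0 : ContDiffOn ℝ 1 (fun p => geoPos y rt (p.1, p.2.2))
      {p : Amb | (p.1, p.2.2) ∈ geoDom rt δ} := (geoPos_smooth hA hrt hy).1.comp
      (by fun_prop) fun p hp => hp
  have h1 : ContDiffOn ℝ 1 (fun p => ‖p.2.2‖) {p : Amb | (p.1, p.2.2) ∈ geoDom rt δ} :=
    fun p hp => ((contDiffAt_norm ℝ hp.2).comp p (by fun_prop)).contDiffWithinAt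
  exact contDiff_fst.contDiffOn.prodMk (((by fun_prop : ContDiffOn ℝ 1 (fun p =>
      p.2.1) {p : Amb | (p.1, p.2.2) ∈ geoDom rt δ}).add (contDiff_fst.comp_contDiffOn
    (contDiff_snd.comp_contDiffOn h0))).prodMk (h1.smul
    (contDiff_snd.comp_contDiffOn (contDiff_snd.comp_contDiffOn h0))))

lemma contDiffOn_parMap : ContDiffOn ℝ 1 (parMap y rt) {p | (p.1, p.2.2) ∈ geoDom rt δ} := by
  exact (contDiff_fst.comp_contDiffOn ((geoPos_smooth hA hrt hy).1.comp (by fun_prop)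
      fun p hp => hp : ContDiffOn ℝ 1 (fun p => geoPos y rt (p.1, p.2.2)) {p : Amb | (p.1,
          p.2.2) ∈ geoDom rt δ})).prodMk contDiff_snd.contDiffOn

omit hA hy in
lemma isOpen_geoDom' : IsOpen {p : Amb | (p.1, p.2.2) ∈ geoDom rt δ} :=
  (isOpen_geoDom hrt).preimage (by fun_prop)

lemma hasFDerivAt_geoPos' {p : Amb} (hp : (p.1, p.2.2) ∈ geoDom rt δ) :
    HasFDerivAt (fun p : Amb => geoPos y rt (p.1, p.2.2))
      ((fderiv ℝ (geoPos y rt) (p.1, p.2.2)).comp ((fst ℝ ℝ (ℝ × E3)).prod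
        (snd ℝ ℝ E3 ∘L snd ℝ ℝ (ℝ × E3)))) p := HasFDerivAt.comp p (hasFDerivAt_geoPos hA hrt hy hp)
    ((fst ℝ ℝ (ℝ × E3)).prod (snd ℝ ℝ E3 ∘L snd ℝ ℝ (ℝ × E3))).hasFDerivAt

lemma fderiv_parMap {p : Amb} (hp : (p.1, p.2.2) ∈ geoDom rt δ) (u : Amb) :
    fderiv ℝ (parMap y rt) p u
      = ((fderiv ℝ (geoPos y rt) (p.1, p.2.2) (u.1, u.2.2)).1, u.2) := by
  have h2 : HasFDerivAt (parMap y rt) _ p :=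
      (hasFDerivAt_geoPos' hA hrt hy hp).fst.prodMk (snd ℝ ℝ (ℝ × E3)).hasFDerivAt
  rw [h2.fderiv]
  rfl

lemma fderiv_geoMap {p : Amb} (hp : (p.1, p.2.2) ∈ geoDom rt δ) (u : Amb) :
    fderiv ℝ (geoMap y rt) p u
      = (u.1, u.2.1 + (fderiv ℝ (geoPos y rt) (p.1, p.2.2) (u.1, u.2.2)).2.1,
        ‖p.2.2‖ • (fderiv ℝ (geoPos y rt) (p.1, p.2.2) (u.1, u.2.2)).2.2
          + (‖p.2.2‖⁻¹ * inner ℝ p.2.2 u.2.2) • (geoPos y rt (p.1, p.2.2)).2.2) := by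
  have hg := hasFDerivAt_geoPos' hA hrt hy hp
  have h2 : HasFDerivAt (geoMap y rt) _ p :=
    (fst ℝ ℝ (ℝ × E3)).hasFDerivAt.prodMk (((fst ℝ ℝ E3 ∘L snd ℝ ℝ (ℝ × E3)).hasFDerivAt.add
        hg.snd.fst).prodMk ((HasFDerivAt.comp p (hasFDerivAt_norm_of_ne hp.2)
            (snd ℝ ℝ E3 ∘L snd ℝ ℝ (ℝ × E3)).hasFDerivAt).smul hg.snd.snd))
  rw [h2.fderiv]
  simp

lemma fderiv_angMap {p : ℝ × E3} (hp : p ∈ geoDom rt δ) (u : ℝ × E3) :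
    fderiv ℝ (angMap y rt) p u = (u.1,
        (fderiv ℝ (geoMap y rt) (p.1, 0, p.2) (u.1, 0, u.2)).2.2) := by
  have h3 :=
    HasFDerivAt.comp p (((contDiffOn_geoMap hA hrt hy).differentiableOn
        one_ne_zero).differentiableAt ((isOpen_geoDom' hrt).mem_nhds hp)).hasFDerivAt
    ((fst ℝ ℝ E3).prod ((0 : ℝ × E3 →L[ℝ] ℝ).prod (snd ℝ ℝ E3))).hasFDerivAt
  have h4 : HasFDerivAt (angMap y rt) _ p := h3.fst.prodMk h3.snd.snd
  rw [h4.fderiv]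
  change ((fderiv ℝ (geoMap y rt) (p.1, 0, p.2) (u.1, 0, u.2)).1,
    (fderiv ℝ (geoMap y rt) (p.1, 0, p.2) (u.1, 0, u.2)).2.2) = _
  rw [fderiv_geoMap hA hrt hy hp]

lemma angMap_inv_zero {θ : E3} (h : θ ≠ 0) (u : ℝ × E3)
    (hu : fderiv ℝ (angMap y rt) (0, θ) u = 0) : u = 0 := by
  have hm := zero_mem_geoDom hrt hy h
  have h1 : u.1 = 0 := by
    have := congrArg Prod.fst hu
    rw [fderiv_angMap hA hrt hy hm] at this
    exact this
  have h3 :=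
    (hasFDerivAt_prodMk_right' (0 : ℝ) θ).congr_of_eventuallyEq (by
      filter_upwards [isOpen_ne.mem_nhds h] with θ' hθ'
      exact angMap_zero hrt hy hθ')
  have h4 := DFunLike.congr_fun ((HasFDerivAt.comp θ (((contDiffOn_angMap hA hrt
      hy).differentiableOn one_ne_zero).differentiableAt ((isOpen_geoDom hrt).mem_nhds
          hm)).hasFDerivAt (hasFDerivAt_prodMk_right' (0 : ℝ) θ)).unique h3) u.2
  have h5 : u = (0, u.2) := Prod.ext h1 rfl
  rw [h5] at hu
  change fderiv ℝ (angMap y rt) (0, θ) (0, u.2) = (0, u.2) at h4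
  rw [h5, ← h4, hu]

lemma exists_angMap_inj : ∃ δ1 > 0, ∀ δ' ≤ δ1,
    (∀ q, |q| < δ' → |rt q| < δ) ∧
    InjOn (angMap y rt) {p | |p.1| < δ' ∧ p.2 ∈ annulus} ∧
    ∀ p : ℝ × E3, |p.1| < δ' → p.2 ∈ annulus → ∀ u, fderiv ℝ (angMap y rt) p u = 0 → u = 0 := by
  have hO := isOpen_geoDom (δ := δ) hrt
  have hcd := contDiffOn_angMap hA hrt hy
  set K : Set (ℝ × E3) := {0} ×ˢ annulus with hK
  have hKmem : ∀ p ∈ K, p.1 = 0 ∧ p.2 ≠ 0 ∧ p ∈ geoDom rt δ := by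
    rintro ⟨q, θ⟩ ⟨hq, hθ⟩
    obtain rfl : q = 0 := hq
    exact ⟨rfl, ne_of_mem_annulus hθ, zero_mem_geoDom hrt hy (ne_of_mem_annulus hθ)⟩
  have hequiv : ∀ p ∈ K, ∃ e : (ℝ × E3) ≃L[ℝ] (ℝ × E3),
      (e : (ℝ × E3) →L[ℝ] (ℝ × E3)) = fderiv ℝ (angMap y rt) p := by
    intro p hp
    obtain ⟨h1, h2, -⟩ := hKmem p hp
    refine exists_equiv_of_injective _ fun u hu => ?_
    have h5 : p = (0, p.2) := Prod.ext h1 rfl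
    rw [h5] at hu
    exact angMap_inv_zero hA hrt hy h2 u hu
  have hloc : ∀ p ∈ K, ∃ u ∈ 𝓝 p, InjOn (angMap y rt) u := by
    intro p hp
    obtain ⟨e, he⟩ := hequiv p hp
    have h2 : HasStrictFDerivAt (angMap y rt) (e : (ℝ × E3) →L[ℝ] (ℝ × E3)) p := by
      rw [he]
      exact (hcd.contDiffAt (hO.mem_nhds (hKmem p hp).2.2)).hasStrictFDerivAt one_ne_zero
    exact ⟨_, (h2.toOpenPartialHomeomorph _).open_source.mem_nhds
      h2.mem_toOpenPartialHomeomorph_source, (h2.toOpenPartialHomeomorph _).injOn⟩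
  have hinjK : InjOn (angMap y rt) K := by
    intro p hp p' hp' h
    have h5 : p = (0, p.2) := Prod.ext (hKmem p hp).1 rfl
    have h6 : p' = (0, p'.2) := Prod.ext (hKmem p' hp').1 rfl
    rw [h5, h6, angMap_zero hrt hy (hKmem p hp).2.1, angMap_zero hrt hy (hKmem p' hp').2.1] at h
    rw [h5, h6, h]
  obtain ⟨t, ht, htinj⟩ := hinjK.exists_mem_nhdsSet (isCompact_singleton.prod isCompact_annulus)
    (fun p hp => (hcd.contDiffAt (hO.mem_nhds (hKmem p hp).2.2)).continuousAt) hloc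
  obtain ⟨t', ht'o, hKt', ht't⟩ := mem_nhdsSet_iff_exists.1 ht
  obtain ⟨V, W, hV, -, hV0, hW, hVW⟩ := generalized_tube_lemma (isCompact_singleton)
    isCompact_annulus (ht'o.inter ((hcd.continuousOn_fderiv_of_isOpen hO
        le_rfl).isOpen_inter_preimage hO ContinuousLinearEquiv.isOpen)) fun p hp =>
            ⟨hKt' hp, (hKmem p hp).2.2, hequiv p hp⟩
  have hrt0 : ∀ᶠ q in 𝓝 (0 : ℝ), |rt q| < δ := by
    have := hrt.cont.abs.continuousAt (x := 0)
    refine this.eventually_lt_const ?_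
    simpa [hrt.zero] using hy.pos
  obtain ⟨δ1, hδ1, hball⟩ := Metric.mem_nhds_iff.1 (inter_mem (hV.mem_nhds (hV0 rfl)) hrt0)
  refine ⟨δ1, hδ1, fun δ' hδ' => ?_⟩
  have hin : ∀ q : ℝ, |q| < δ' → q ∈ V ∧ |rt q| < δ := fun q hq =>
    hball (by simpa using hq.trans_le hδ')
  refine ⟨fun q hq => (hin q hq).2, htinj.mono fun p hp => ht't
    (hVW (show p ∈ V ×ˢ W from ⟨(hin _ hp.1).1, hW hp.2⟩)).1, fun p hp hp' u hu => ?_⟩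
  obtain ⟨-, -, e, he⟩ := hVW (show p ∈ V ×ˢ W from ⟨(hin _ hp).1, hW hp'⟩)
  rw [← he] at hu
  exact e.map_eq_zero_iff.1 hu

end

lemma isPreconnected_ne_zero : IsPreconnected {θ : E3 | θ ≠ 0} := by
  exact (isConnected_compl_singleton_of_one_lt_rank (by rw [← Module.finrank_eq_rank]; simp)
      0).isPreconnected

/-- The part of the coordinate domain `(q, τ, θ)` that is parametrized by `(ρ, τ, θ)`. -/
def geoPart (y : ℝ → E3 → St) (rt : ℝ → ℝ) (δ' c' : ℝ) : Set Amb :=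
  {p | |p.1| < δ' ∧ 1 / 2 < ‖p.2.2‖ ∧ ‖p.2.2‖ < 2 ∧ |(geoPos y rt (p.1, p.2.2)).1| < c'}

section

variable {A : ℝ × E3 → Bil} {r0 : ℝ} (hA : IsRedMetric A r0) {w rt : ℝ → ℝ}
  (hrt : IsRoot w rt) {δ : ℝ} {y : ℝ → E3 → St} (hy : IsNullFlow A w r0 δ y)
include hA hrt hy

lemma exists_sign {δ' : ℝ} (hδ' : ∀ q, |q| < δ' → |rt q| < δ) :
    ∃ σ : ℝ, (σ = 1 ∨ σ = -1) ∧ ∀ θ : E3, θ ≠ 0 →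
      StrictMonoOn (fun q => σ * (geoPos y rt (q, θ)).1) (Ioo (-δ') δ') := by
  have hmem : ∀ {q : ℝ} {θ : E3}, q ∈ Ioo (-δ') δ' → θ ≠ 0 → (q, θ) ∈ geoDom rt δ :=
    fun hq hθ => ⟨hδ' _ (abs_lt.2 hq), hθ⟩
  obtain ⟨σ, hσ, hpos⟩ := pos_or_neg (isPreconnected_Ioo.prod isPreconnected_ne_zero)
    (((continuousOn_geoVel hA hrt hy).mono fun p hp => hmem hp.1 hp.2).fst)
    fun p hp => geoVel_ne hy (hmem hp.1 hp.2)
  refine ⟨σ, hσ, fun θ hθ => ?_⟩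
  have hd : ∀ q ∈ Ioo (-δ') δ', HasDerivAt (fun q => σ * (geoPos y rt (q, θ)).1)
      (σ * (geoVel A y rt (q, θ)).1⁻¹) q := by
    intro q hq
    have h1 : HasDerivAt (fun q => (geoPos y rt (q, θ)).1) _ q :=
      (hasDerivAt_geoPos hA hrt hy (hmem hq hθ)).fst
    refine (h1.const_mul σ).congr_deriv ?_
    simp
  refine strictMonoOn_of_deriv_pos (convex_Ioo _ _)
    (fun q hq => (hd q hq).continuousAt.continuousWithinAt) fun q hq => ?_
  rw [interior_Ioo] at hq
  rw [(hd q hq).deriv]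
  have h1 := hpos (q, θ) ⟨hq, hθ⟩
  have h2 : σ * (geoVel A y rt (q, θ)).1⁻¹
      = (σ * (geoVel A y rt (q, θ)).1) * ((geoVel A y rt (q, θ)).1⁻¹) ^ 2 := by field_simp
  rw [h2]
  have := geoVel_ne hy (hmem hq hθ)
  positivity

theorem exists_reducedGauge {δ0 : ℝ} (hδ0 : 0 < δ0) : ∃ (δ' c' σ : ℝ) (Φ Φi : Amb → Amb),
    δ' ≤ δ0 ∧ IsReducedGauge A y rt δ δ' c' σ Φ Φi := by
  obtain ⟨δ1, hδ1, hδ₁'⟩ := exists_angMap_inj hA hrt hy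
  set δ2 := min δ0 δ1 with hδ2
  have hδ₂pos := lt_min hδ0 hδ1
  obtain ⟨hdom, hinj, hinv⟩ := hδ₁' δ2 (min_le_right _ _)
  obtain ⟨σ, hσ, hmono⟩ := exists_sign hA hrt hy hdom
  have hσ2 : σ * σ = 1 := by rcases hσ with rfl | rfl <;> norm_num
  have hσa : |σ| = 1 := by rcases hσ with rfl | rfl <;> norm_num
  set δ' := δ2 / 2 with hδ'
  have hδ'pos := half_pos hδ₂pos
  have hδ'lt := half_lt_self hδ₂pos
  have hIcc : Icc (-δ') δ' ⊆ Ioo (-δ2) δ2 := fun q hq => ⟨by linarith [hq.1], by linarith [hq.2]⟩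
  have habs : ∀ {q : ℝ}, |q| < δ' → q ∈ Ioo (-δ2) δ2 := fun h =>
    hIcc ⟨(abs_lt.1 h).1.le, (abs_lt.1 h).2.le⟩
  have hgeo : ∀ {q : ℝ} {θ : E3}, q ∈ Ioo (-δ2) δ2 → θ ∈ annulus → (q, θ) ∈ geoDom rt δ :=
    fun hq hθ => ⟨hdom _ (abs_lt.2 hq), ne_of_mem_annulus hθ⟩
  have hρ0 : ∀ {θ : E3}, θ ∈ annulus → (geoPos y rt (0, θ)).1 = 0 := fun hθ => by
    rw [geoPos_zero hrt hy (ne_of_mem_annulus hθ)]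
  have hρc :=
    (geoPos_smooth hA hrt hy).1.continuousOn.fst
  have h0mem : (0 : ℝ) ∈ Ioo (-δ2) δ2 := ⟨by linarith, hδ₂pos⟩
  have hpm : δ' ∈ Ioo (-δ2) δ2 := ⟨by linarith, hδ'lt⟩
  have hmm : -δ' ∈ Ioo (-δ2) δ2 := ⟨by linarith, by linarith⟩
  obtain ⟨c1, hc1, hc₁'⟩ := isCompact_annulus.exists_forall_le'
    (f := fun θ => σ * (geoPos y rt (δ', θ)).1)
    (continuousOn_const.mul (hρc.comp (by fun_prop)
      fun θ hθ => hgeo hpm hθ)) fun θ hθ => by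
        have := hmono θ (ne_of_mem_annulus hθ) h0mem hpm hδ'pos
        simpa [hρ0 hθ] using this
  obtain ⟨c2, hc2, hc₂'⟩ := isCompact_annulus.exists_forall_le'
    (f := fun θ => -(σ * (geoPos y rt (-δ', θ)).1)) (a := 0)
    ((continuousOn_const.mul (hρc.comp (by fun_prop)
      fun θ hθ => hgeo hmm hθ)).neg) fun θ hθ => by
        have := hmono θ (ne_of_mem_annulus hθ) hmm h0mem (by linarith)
        simpa [hρ0 hθ] using this
  set c' := min c1 c2 with hc'
  have hc'pos := lt_min hc1 hc2
  set W := geoPart y rt δ' c' with hW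
  have hWann : ∀ p ∈ W, p.2.2 ∈ annulus := fun p hp => ⟨hp.2.1.le, hp.2.2.1.le⟩
  have hWgeo : W ⊆ {p | (p.1, p.2.2) ∈ geoDom rt δ} := fun p hp => hgeo (habs hp.1) (hWann p hp)
  have hWo : IsOpen W := by
    have h1 :=
      (hρc.comp (f := fun p : Amb => (p.1, p.2.2)) (by fun_prop) fun p hp => hp).abs
    have h2 := (h1.isOpen_inter_preimage (isOpen_geoDom' hrt) (isOpen_Iio (a := c'))).inter
      (((isOpen_lt (f := fun p : Amb => |p.1|) (g := fun _ => δ') (by fun_prop)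
        (by fun_prop)).inter
      (isOpen_lt (f := fun _ : Amb => (1 / 2 : ℝ)) (g := fun p => ‖p.2.2‖) (by fun_prop)
      (by fun_prop))).inter
    (isOpen_lt (f := fun p : Amb => ‖p.2.2‖) (g := fun _ => 2) (by fun_prop) (by fun_prop)))
    convert h2 using 1
    ext p
    constructor
    · exact fun hp => ⟨⟨hWgeo hp, hp.2.2.2⟩, ⟨hp.1, hp.2.1⟩, hp.2.2.1⟩
    · exact fun hp => ⟨hp.2.1.1, hp.2.1.2, hp.2.2, hp.1.2⟩
  have hpar_mem : ∀ p ∈ W, parMap y rt p ∈ gDom c' := fun p hp => ⟨hp.2.2.2, hp.2.1, hp.2.2.1⟩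
  have hσc : ∀ {a b : ℝ}, |a| < b → |σ * a| < b := fun h => by rwa [abs_mul, hσa, one_mul]
  have hpar_img : parMap y rt '' W = gDom c' := by
    refine Subset.antisymm (image_subset_iff.2 hpar_mem) fun x hx => ?_
    have hxa := gDom_annulus hx
    have hcon : ContinuousOn (fun q => σ * (geoPos y rt (q, x.2.2)).1) (Icc (-δ') δ') :=
      continuousOn_const.mul (hρc.comp (by fun_prop)
        fun q hq => hgeo (hIcc hq) hxa)
    have h1 := abs_lt.1 (hσc hx.1)
    have h2 := hc₁' x.2.2 hxa
    have h3 := hc₂' x.2.2 hxa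
    have h4 : c' ≤ c1 := min_le_left _ _
    have h5 : c' ≤ c2 := min_le_right _ _
    obtain ⟨q, hq, hqx⟩ := intermediate_value_Ioo (by linarith) hcon
      (show σ * x.1 ∈ _ from ⟨by linarith, by linarith⟩)
    have hqx' : (geoPos y rt (q, x.2.2)).1 = x.1 := by
      have := congrArg (σ * ·) hqx
      simpa [← mul_assoc, hσ2] using this
    refine ⟨(q, x.2), ⟨abs_lt.2 hq, hx.2.1, hx.2.2, by rw [hqx']; exact hx.1⟩, ?_⟩
    exact Prod.ext hqx' rfl
  have hpar_inj : InjOn (parMap y rt) W := by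
    intro p hp p' hp' h
    have h2 : p.2 = p'.2 := (congrArg Prod.snd h :)
    have h1 : (geoPos y rt (p.1, p.2.2)).1 = (geoPos y rt (p'.1, p.2.2)).1 := by
      have := congrArg Prod.fst h
      simp only [parMap] at this
      rw [this, h2]
    refine Prod.ext ((hmono p.2.2 (ne_of_mem_annulus (hWann p hp))).injOn (habs hp.1)
      (habs hp'.1) ?_) h2
    simp only [h1]
  have hgeo_inj : ∀ p p' : Amb, |p.1| < δ' → |p'.1| < δ' → p.2.2 ∈ annulus → p'.2.2 ∈ annulus →
      geoMap y rt p = geoMap y rt p' → p = p' := by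
    intro p p' hp hp' ha ha' h
    have h1 : angMap y rt (p.1, p.2.2) = angMap y rt (p'.1, p'.2.2) :=
      Prod.ext (congrArg Prod.fst h :) (congrArg (fun z : Amb => z.2.2) h :)
    have h2 := hinj (x₁ := (p.1, p.2.2)) ⟨hp.trans hδ'lt, ha⟩ (x₂ := (p'.1, p'.2.2))
      ⟨hp'.trans hδ'lt, ha'⟩ h1
    have h3 : p.2.1 + (geoPos y rt (p.1, p.2.2)).2.1 = p'.2.1 + (geoPos y rt (p'.1, p'.2.2)).2.1 :=
      congrArg (fun z : Amb => z.2.1) h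
    rw [h2] at h3
    exact Prod.ext (congrArg Prod.fst h2 :) (Prod.ext (add_right_cancel h3)
      (congrArg Prod.snd h2 :))
  have hpar_cd := (contDiffOn_parMap hA hrt hy).mono hWgeo
  have hgeo_cd := (contDiffOn_geoMap hA hrt hy).mono hWgeo
  have hpar_d : ∀ p ∈ W, HasFDerivAt (parMap y rt) (fderiv ℝ (parMap y rt) p) p := fun p hp =>
    ((hpar_cd.differentiableOn one_ne_zero).differentiableAt (hWo.mem_nhds hp)).hasFDerivAt
  have hgeo_d : ∀ p ∈ W, HasFDerivAt (geoMap y rt) (fderiv ℝ (geoMap y rt) p) p := fun p hp =>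
    ((hgeo_cd.differentiableOn one_ne_zero).differentiableAt (hWo.mem_nhds hp)).hasFDerivAt
  have hpar_e : ∀ p ∈ W, ∃ e : Amb ≃L[ℝ] Amb, HasFDerivAt (parMap y rt) (e : Amb →L[ℝ] Amb) p := by
    intro p hp
    obtain ⟨e, he⟩ := exists_equiv_of_injective (fderiv ℝ (parMap y rt) p) fun u hu => by
      rw [fderiv_parMap hA hrt hy (hWgeo hp)] at hu
      have h2 : u.2 = 0 := congrArg Prod.snd hu
      have h1 := congrArg Prod.fst hu
      simp only [h2, Prod.snd_zero, Prod.fst_zero] at h1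
      rw [(geoPos_smooth hA hrt hy).2 _ (hWgeo hp)] at h1
      have h3 : (geoVel A y rt (p.1, p.2.2)).1 ≠ 0 := geoVel_ne hy (hWgeo hp)
      simp [h3] at h1
      exact Prod.ext h1 h2
    exact ⟨e, by rw [he]; exact hpar_d p hp⟩
  have hgeo_e : ∀ p ∈ W, ∃ e : Amb ≃L[ℝ] Amb, HasFDerivAt (geoMap y rt) (e : Amb →L[ℝ] Amb) p := by
    intro p hp
    obtain ⟨e, he⟩ := exists_equiv_of_injective (fderiv ℝ (geoMap y rt) p) fun u hu => by
      rw [fderiv_geoMap hA hrt hy (hWgeo hp)] at hu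
      have h2 := hinv (p.1, p.2.2) (hp.1.trans hδ'lt) (hWann p hp) (u.1, u.2.2) (by
        rw [fderiv_angMap hA hrt hy (hWgeo hp),
          fderiv_geoMap hA hrt hy (p := (p.1, 0, p.2.2)) (hWgeo hp)]
        exact Prod.ext (congrArg Prod.fst hu :) (congrArg (fun z : Amb => z.2.2) hu :))
      rw [h2] at hu
      have h3 := congrArg (fun z : Amb => z.2.1) hu
      simp at h3
      exact Prod.ext (congrArg Prod.fst h2 :) (Prod.ext h3 (congrArg Prod.snd h2 :))
    exact ⟨e, by rw [he]; exact hgeo_d p hp⟩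
  have hgeo_injW : InjOn (geoMap y rt) W := fun p hp p' hp' h =>
    hgeo_inj p p' hp.1 hp'.1 (hWann p hp) (hWann p' hp') h
  obtain ⟨-, hβ⟩ := contDiffOn_invFunOn hWo one_ne_zero hpar_cd hpar_inj hpar_e
  obtain ⟨hαo, hα⟩ := contDiffOn_invFunOn hWo one_ne_zero hgeo_cd hgeo_injW hgeo_e
  set βi := Function.invFunOn (parMap y rt) W with hβi
  set αi := Function.invFunOn (geoMap y rt) W with hαi
  rw [hpar_img] at hβ
  have hβmem : ∀ x ∈ gDom c', βi x ∈ W := fun x hx =>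
    Function.invFunOn_mem (by rw [← hpar_img] at hx; exact hx)
  have hβeq : ∀ x ∈ gDom c', parMap y rt (βi x) = x := fun x hx =>
    Function.invFunOn_eq (by rw [← hpar_img] at hx; exact hx)
  have hβl : ∀ p ∈ W, βi (parMap y rt p) = p := fun p hp => hpar_inj.leftInvOn_invFunOn hp
  have hαl : ∀ p ∈ W, αi (geoMap y rt p) = p := fun p hp => hgeo_injW.leftInvOn_invFunOn hp
  set Φ : Amb → Amb := fun x => geoMap y rt (βi x) with hΦ
  have himg : Φ '' gDom c' = geoMap y rt '' W := by
    ext z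
    constructor
    · rintro ⟨x, hx, rfl⟩; exact ⟨_, hβmem x hx, rfl⟩
    · rintro ⟨p, hp, rfl⟩; exact ⟨_, hpar_mem p hp, by simp only [hΦ, hβl p hp]⟩
  have hβ2 : ∀ x ∈ gDom c', (βi x).2 = x.2 := fun x hx => (congrArg Prod.snd (hβeq x hx) :)
  have hβform : ∀ x ∈ gDom c', ((Φ x).1, x.2) = βi x := fun x hx => Prod.ext rfl (hβ2 x hx).symm
  have hsm : ContDiffOn ℝ 1 Φ (gDom c') := hgeo_cd.comp hβ hβmem
  have hΦd : ∀ x ∈ gDom c', HasFDerivAt Φ (fderiv ℝ Φ x) x := fun x hx =>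
    ((hsm.differentiableOn one_ne_zero).differentiableAt
      ((isOpen_gDom c').mem_nhds hx)).hasFDerivAt
  have hchain : ∀ x ∈ gDom c', ∀ u, fderiv ℝ Φ x (fderiv ℝ (parMap y rt) (βi x) u)
      = fderiv ℝ (geoMap y rt) (βi x) u := by
    intro x hx u
    have h1 := HasFDerivAt.comp (βi x)
      (by rw [hβeq x hx]; exact hΦd x hx) (hpar_d _ (hβmem x hx))
    have h2 : Φ ∘ parMap y rt =ᶠ[𝓝 (βi x)] geoMap y rt := by
      filter_upwards [hWo.mem_nhds (hβmem x hx)] with p hp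
      simp only [Function.comp, hΦ, hβl p hp]
    exact DFunLike.congr_fun ((h1.congr_of_eventuallyEq h2.symm).unique
      (hgeo_d _ (hβmem x hx))) u
  refine ⟨δ', c', σ, Φ, fun p => parMap y rt (αi p), hδ'lt.le.trans (min_le_left _ _),
    hc'pos, fun q hq => hdom q (abs_lt.2 (habs hq)), hσ, ?_, hsm, ?_, ?_, ?_, ?_, ?_, ?_, ?_,
    ?_, ?_⟩
  · rw [himg]; exact hαo
  · rw [himg]; exact hpar_cd.comp hα fun z hz => Function.invFunOn_mem hz
  · intro x hx; simp only [hΦ, hαl _ (hβmem x hx), hβeq x hx]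
  · intro x hx; rw [hβform x hx]; exact ⟨(hβmem x hx).1, hβeq x hx, rfl⟩
  · intro q τ θ hq h1 h2 hmem
    rw [himg] at hmem
    obtain ⟨p, hp, hpe⟩ := hmem
    have h3 := hgeo_inj p (q, τ, θ) hp.1 hq (hWann p hp) ⟨h1.le, h2.le⟩ hpe
    rw [← h3]
    simp only [hαl p hp]
  · intro x hx
    have hm := hmono x.2.2 (ne_of_mem_annulus (gDom_annulus hx))
    have h1 := congrArg Prod.fst (hβeq x hx)
    have h2 : (geoPos y rt ((Φ x).1, x.2.2)).1 = x.1 := by rw [← hβ2 x hx]; exact h1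
    have h3 := hm.lt_iff_lt h0mem (habs (hβmem x hx).1)
    simp only [hρ0 (gDom_annulus hx), mul_zero] at h3
    rw [show (βi x).1 = (Φ x).1 from rfl, h2] at h3
    exact h3.symm
  · intro x hx
    have hm := hmono x.2.2 (ne_of_mem_annulus (gDom_annulus hx))
    have h1 := congrArg Prod.fst (hβeq x hx)
    have h2 : (geoPos y rt ((Φ x).1, x.2.2)).1 = x.1 := by rw [← hβ2 x hx]; exact h1
    have h3 := hm.injOn.eq_iff h0mem (habs (hβmem x hx).1)
    simp only [hρ0 (gDom_annulus hx), mul_zero] at h3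
    rw [show (βi x).1 = (Φ x).1 from rfl, h2] at h3
    have hσ0 : σ ≠ 0 := by rintro rfl; simp at hσ2
    constructor
    · intro h
      rw [h] at h3
      have := h3.2 rfl
      exact ((mul_eq_zero.1 this.symm).resolve_left hσ0)
    · intro h; rw [h, mul_zero] at h3; exact (h3.1 rfl).symm
  · intro x hx hn
    have hg := hWgeo (hβmem x hx)
    have hv := geoVel_ne hy hg
    have h1 := hchain x hx ((geoVel A y rt ((βi x).1, (βi x).2.2)).1, 0, 0)
    rw [fderiv_parMap hA hrt hy hg, fderiv_geoMap hA hrt hy hg,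
      (geoPos_smooth hA hrt hy).2 _ hg] at h1
    have hv' : (geoVel A y rt ((βi x).1, (βi x).2.2)).1 ≠ 0 := hv
    have hn' : ‖(βi x).2.2‖ = 1 := by rw [hβ2 x hx]; exact hn
    simp only [mul_inv_cancel₀ hv', one_smul, map_zero, Prod.fst_zero, Prod.snd_zero,
      inner_zero_right, mul_zero, zero_smul, hn', zero_add, add_zero] at h1
    rw [show (Φ x).1 = (βi x).1 from rfl, ← hβ2 x hx]
    have h2 : ((1, (geoVel A y rt ((βi x).1, (βi x).2.2)).2) : Amb) + (0, 0)
      = (1, (geoVel A y rt ((βi x).1, (βi x).2.2)).2) := by simp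
    rw [h2] at h1
    exact h1
  · intro x hx
    have hg := hWgeo (hβmem x hx)
    have h1 := hchain x hx (0, 1, 0)
    have h0 : ((0, 0) : ℝ × E3) = 0 := rfl
    rw [fderiv_parMap hA hrt hy hg, fderiv_geoMap hA hrt hy hg] at h1
    simpa [h0] using h1
  · intro x hx hn v hv
    have hg := hWgeo (hβmem x hx)
    have hv0 := geoVel_ne hy hg
    set ζ := geoVel A y rt ((βi x).1, (βi x).2.2) with hζ
    set η := fderiv ℝ (y (rt (βi x).1)) (βi x).2.2 v with hη
    have hn' : ‖(βi x).2.2‖ = 1 := by rw [hβ2 x hx]; exact hn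
    have hv' : inner ℝ (βi x).2.2 v = 0 := by rw [hβ2 x hx]; exact hv
    have h1 := hchain x hx (-(ζ.1 * η.1), 0, v)
    rw [fderiv_parMap hA hrt hy hg, fderiv_geoMap hA hrt hy hg,
      (geoPos_smooth hA hrt hy).2 _ hg] at h1
    simp only [hn', hv', one_smul, zero_smul, mul_zero, add_zero, zero_add] at h1
    have h2 : -(ζ.1 * η.1) * ζ.1⁻¹ = -η.1 := by field_simp
    rw [← hζ, ← hη, h2] at h1
    have h3 : ((((-η.1) • ((1, ζ.2) : Amb) + (η.1, η.2.1)).1, 0, v) : Amb) = (0, 0, v) := by simp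
    have h4 : ((-(ζ.1 * η.1), ((-η.1) • ((1, ζ.2) : Amb) + (η.1, η.2.1)).2.1,
        ((-η.1) • ((1, ζ.2) : Amb) + (η.1, η.2.1)).2.2) : Amb) = (-η.1) • ζ + (0, η.2.1) := by
      refine Prod.ext ?_ rfl
      simp [mul_comm]
    have h5 := (h3 ▸ h1).trans h4
    rw [h5, map_add, map_smul, show (Φ x).1 = (βi x).1 from rfl, ← hβ2 x hx]
    have h6 := hy.null (rt (βi x).1) (βi x).2.2 hg.1 hg.2
    have h7 := hy.gauss (rt (βi x).1) (βi x).2.2 hg.1 hg.2 v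
    rw [show stVel A (rt (βi x).1) (y (rt (βi x).1) (βi x).2.2) = ζ from rfl] at h6
    rw [h6, h7]
    simp

end

/-! ## Local coordinates on the sphere -/

lemma nrm_smul {a : ℝ} (ha : 0 < a) (θ : E3) : nrm (a • θ) = nrm θ := by
  rw [nrm, nrm, norm_smul, Real.norm_of_nonneg ha.le, smul_smul]
  field_simp

lemma norm_smul_nrm (θ : E3) : ‖θ‖ • nrm θ = θ := by
  by_cases h : θ = 0
  · simp [h]
  · rw [nrm, smul_smul, mul_inv_cancel₀ (norm_ne_zero_iff.2 h), one_smul]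

lemma vec2_eq (y : Fin 2 → ℝ) : ![y 0, y 1] = y := by funext i; fin_cases i <;> rfl

lemma exists_stereographic {θ : E3} (hθ : ‖θ‖ = 1) :
    ∃ (φ : SphereChart) (y : Fin 2 → ℝ), y ∈ φ.U ∧ φ.χ y = θ := by
  have hv : ‖-θ‖ = 1 := by rwa [norm_neg]
  have : Fact (Module.finrank ℝ E3 = 2 + 1) := ⟨by simp⟩
  let e : (Fin 2 → ℝ) ≃L[ℝ] (ℝ ∙ (-θ))ᗮ := ContinuousLinearEquiv.ofFinrankEq (by
    rw [Submodule.finrank_orthogonal_span_singleton (n :=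
        2) (norm_ne_zero_iff.1 (by rw [hv]; simp))]; simp)
  have hc : ContDiff ℝ ∞ fun y => stereoInvFunAux (-θ) (e y : E3) :=
    contDiff_stereoInvFunAux.comp
      ((ℝ ∙ (-θ))ᗮ.subtypeL.comp (e : (Fin 2 → ℝ) →L[ℝ] (ℝ ∙ (-θ))ᗮ)).contDiff
  have hi := fun y =>
    stereo_right_inv hv (e y)
  refine ⟨⟨univ, fun y => stereoInvFunAux (-θ) (e y : E3), isOpen_univ, hc.contDiffOn,
    fun y _ => by simpa using stereoInvFunAux_mem hv (e y).2,
    fun y _ y' _ h => e.injective (by rw [← hi y, ← hi y']; exact congrArg _ h),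
    fun y _ v v' h => ?_⟩, 0, mem_univ _, ?_⟩
  · have h1 : innerSL ℝ (-θ) (stereoInvFunAux (-θ) (e y : E3)) ≠ 1 := fun h =>
      stereoInvFun_ne_north_pole hv (e y) (Subtype.ext ((inner_eq_one_iff_of_norm_eq_one hv
        (by simpa using stereoInvFunAux_mem hv (e y).2)).1 h).symm)
    have h3 := HasFDerivAt.comp y
      (((contDiffOn_stereoToFun (n := 1)).contDiffAt ((isOpen_ne.preimage (innerSL ℝ
          (-θ)).continuous).mem_nhds h1)).differentiableAt one_ne_zero).hasFDerivAt
              (hc.differentiable (by simp) y).hasFDerivAt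
    have h4 := h3.unique (e.hasFDerivAt.congr_of_eventuallyEq (Eventually.of_forall hi))
    have h5 := DFunLike.congr_fun h4 v
    have h6 := DFunLike.congr_fun h4 v'
    exact e.injective (h5.symm.trans ((congrArg _ h).trans h6))
  · simp [stereoInvFunAux]

namespace SphereChart

variable (φ : SphereChart)

lemma inner_fderiv_eq_zero {y : Fin 2 → ℝ} (hy : y ∈ φ.U) (v : Fin 2 → ℝ) :
    inner ℝ (φ.χ y) (fderiv ℝ φ.χ y v) = 0 := by
  have h2 : HasFDerivAt (fun y => ‖φ.χ y‖ ^ 2) (0 : (Fin 2 → ℝ) →L[ℝ] ℝ) y := by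
    refine (hasFDerivAt_const 1 y).congr_of_eventuallyEq ?_
    filter_upwards [φ.isOpen.mem_nhds hy] with y' hy'
    rw [φ.norm_eq y' hy', one_pow]
  simpa using DFunLike.congr_fun (((φ.smooth.differentiableOn (by norm_num)).differentiableAt
      (φ.isOpen.mem_nhds hy)).hasFDerivAt.norm_sq.unique h2) v

lemma contDiffAt_χ {y : Fin 2 → ℝ} (hy : y ∈ φ.U) : ContDiffAt ℝ ∞ φ.χ y :=
  φ.smooth.contDiffAt (φ.isOpen.mem_nhds hy)

lemma hasFDerivAt_χ {y : Fin 2 → ℝ} (hy : y ∈ φ.U) : HasFDerivAt φ.χ (fderiv ℝ φ.χ y) y :=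
  ((φ.contDiffAt_χ hy).differentiableAt (by norm_num)).hasFDerivAt

theorem exists_inverse : ∃ (Y : E3 → Fin 2 → ℝ) (O : Set E3), IsOpen O ∧ ContDiffOn ℝ ∞ Y O ∧
    (∀ θ ∈ O, θ ≠ 0 ∧ Y θ ∈ φ.U ∧ φ.χ (Y θ) = nrm θ) ∧
    ∀ y ∈ φ.U, ∀ a : ℝ, 0 < a → a • φ.χ y ∈ O ∧ Y (a • φ.χ y) = y := by
  set F : (Fin 2 → ℝ) × ℝ → E3 := fun p => exp p.2 • φ.χ p.1 with hF
  have hnorm : ∀ p ∈ φ.U ×ˢ (univ : Set ℝ), ‖F p‖ = exp p.2 := fun p hp => by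
    rw [hF, norm_smul, φ.norm_eq _ hp.1, mul_one, Real.norm_of_nonneg (exp_pos _).le]
  have hinj : InjOn F (φ.U ×ˢ (univ : Set ℝ)) := by
    intro p hp p' hp' h
    have h1 : p.2 = p'.2 := by
      have := hnorm p hp
      rw [h, hnorm p' hp'] at this
      exact (Real.exp_injective this).symm
    have h2 : φ.χ p.1 = φ.χ p'.1 := by
      simp only [hF, h1] at h
      exact smul_right_injective E3 (exp_pos p'.2).ne' h
    exact Prod.ext (φ.injOn hp.1 hp'.1 h2) h1
  have hder : ∀ p ∈ φ.U ×ˢ (univ : Set ℝ), ∃ e : ((Fin 2 → ℝ) × ℝ) ≃L[ℝ] E3,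
      HasFDerivAt F (e : ((Fin 2 → ℝ) × ℝ) →L[ℝ] E3) p := by
    intro p hp
    have h4' : HasFDerivAt F _ p := (hasFDerivAt_snd (𝕜 := ℝ)).exp.smul
      (HasFDerivAt.comp p (φ.hasFDerivAt_χ hp.1) hasFDerivAt_fst)
    obtain ⟨L, hL⟩ : ∃ L, L = fderiv ℝ F p := ⟨_, rfl⟩
    refine ⟨(LinearEquiv.ofInjectiveOfFinrankEq (L : (Fin 2 → ℝ) × ℝ →ₗ[ℝ] E3)
      (LinearMap.ker_eq_bot.1 (LinearMap.ker_eq_bot'.2 fun u (hu : L u = 0) => ?_))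
      (by simp)).toContinuousLinearEquiv, hL ▸ h4'.differentiableAt.hasFDerivAt⟩
    rw [hL, h4'.fderiv] at hu
    replace hu : exp p.2 • (fderiv ℝ φ.χ p.1 u.1 + u.2 • φ.χ p.1) = 0 := by
      simpa [smul_smul] using hu
    have h5 := (smul_eq_zero.1 hu).resolve_left (exp_pos _).ne'
    have h6 : u.2 = 0 := by
      have := congrArg (inner ℝ (φ.χ p.1)) h5
      rw [inner_add_right, φ.inner_fderiv_eq_zero hp.1, inner_smul_right,
        real_inner_self_eq_norm_sq, φ.norm_eq _ hp.1] at this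
      simpa using this
    rw [h6, zero_smul, add_zero] at h5
    exact Prod.ext (φ.immersion _ hp.1 (h5.trans (map_zero _).symm)) h6
  obtain ⟨h1, h2⟩ := contDiffOn_invFunOn (φ.isOpen.prod isOpen_univ) (by norm_num) ((by fun_prop :
      ContDiff ℝ ∞ fun p : (Fin 2 → ℝ) × ℝ =>
          exp p.2).contDiffOn.smul (φ.smooth.comp contDiff_fst.contDiffOn fun p hp =>
              hp.1)) hinj hder
  refine ⟨fun θ => (Function.invFunOn F (φ.U ×ˢ (univ : Set ℝ)) θ).1, F '' (φ.U ×ˢ univ), h1,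
    contDiff_fst.comp_contDiffOn h2, ?_, ?_⟩
  · rintro _ ⟨p, hp, rfl⟩
    have h3 := hinj.leftInvOn_invFunOn hp
    refine ⟨norm_ne_zero_iff.1
        (by rw [hnorm p hp]; exact (exp_pos _).ne'), by simp only [h3]; exact hp.1, ?_⟩
    simp only [h3]
    simp only [hF]
    rw [nrm_smul (exp_pos _), nrm_of_norm (φ.norm_eq _ hp.1)]
  · intro y hy a ha
    have hm : (y, log a) ∈ φ.U ×ˢ (univ : Set ℝ) := ⟨hy, mem_univ _⟩
    have h3 : F (y, log a) = a • φ.χ y := by simp [hF, exp_log ha]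
    exact ⟨⟨_, hm, h3⟩, by simp only [← h3, hinj.leftInvOn_invFunOn hm]⟩

/-- The angular part of the coordinates. -/
def ang : R4 →L[ℝ] (Fin 2 → ℝ) :=
  ContinuousLinearMap.pi ![proj 2, proj 3]

omit φ in
lemma ang_apply (z : R4) : ang z = ![z 2, z 3] := by funext i; fin_cases i <;> rfl

lemma hasFDerivAt_point {z : R4} (hz : ![z 2, z 3] ∈ φ.U) :
    HasFDerivAt φ.point ((proj 0).prod ((proj 1).prod
      ((fderiv ℝ φ.χ ![z 2, z 3]).comp ang))) z := by
  have h1 : HasFDerivAt (fun z => φ.χ ![z 2, z 3]) ((fderiv ℝ φ.χ ![z 2, z 3]).comp ang) z := by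
    have h2 : (fun z => φ.χ ![z 2, z 3]) = φ.χ ∘ ang := by
      funext z
      rw [Function.comp, ang_apply]
    rw [h2]
    exact HasFDerivAt.comp z (by rw [ang_apply]; exact φ.hasFDerivAt_χ hz) ang.hasFDerivAt
  exact (proj (φ := fun _ => ℝ) 0).hasFDerivAt.prodMk
    ((proj (φ := fun _ => ℝ) 1).hasFDerivAt.prodMk h1)

lemma fderiv_point {z : R4} (hz : ![z 2, z 3] ∈ φ.U) (v : R4) :
    fderiv ℝ φ.point z v = (v 0, v 1, fderiv ℝ φ.χ ![z 2, z 3] ![v 2, v 3]) := by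
  rw [(φ.hasFDerivAt_point hz).fderiv, ← ang_apply v]
  rfl

lemma sum_frame (z v : R4) : ∑ μ, v μ • φ.frame z μ = fderiv ℝ φ.point z v := by
  conv_rhs => rw [← Finset.univ_sum_single v, map_sum]
  refine Finset.sum_congr rfl fun μ _ => ?_
  rw [frame, ← map_smul, ← Pi.single_smul, smul_eq_mul, mul_one]

lemma fderiv_point_injective {z : R4} (hz : ![z 2, z 3] ∈ φ.U) :
    Function.Injective (fderiv ℝ φ.point z) := by
  intro v v' h
  rw [φ.fderiv_point hz, φ.fderiv_point hz] at h
  have h2 := φ.immersion _ hz (congrArg (fun u => u.2.2) h)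
  funext i
  fin_cases i
  · exact congrArg Prod.fst h
  · simp_all
  · exact congrFun h2 0
  · exact congrFun h2 1

lemma isTan_point {z : R4} (hz : ![z 2, z 3] ∈ φ.U) (v : R4) :
    IsTangent (φ.point z) (fderiv ℝ φ.point z v) := by
  rw [φ.fderiv_point hz]
  exact φ.inner_fderiv_eq_zero hz _

lemma exists_fderiv_χ {y : Fin 2 → ℝ} (hy : y ∈ φ.U) {w : E3} (hw : inner ℝ (φ.χ y) w = 0) :
    ∃ v, fderiv ℝ φ.χ y v = w := by
  obtain ⟨Y, O, hO, hY, h1, h2⟩ := φ.exists_inverse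
  have h3 := h2 y hy 1 one_pos
  rw [one_smul] at h3
  have h5 : HasFDerivAt (fun θ : E3 => ‖θ‖ • (φ.χ ∘ Y) θ) (ContinuousLinearMap.id ℝ E3)
      (φ.χ y) := by
    refine (hasFDerivAt_id (𝕜 := ℝ) (φ.χ y)).congr_of_eventuallyEq ?_
    filter_upwards [hO.mem_nhds h3.1] with θ hθ
    simp only [Function.comp, (h1 θ hθ).2.2, norm_smul_nrm, id]
  refine ⟨fderiv ℝ Y (φ.χ y) w, ?_⟩
  simpa [hw, φ.norm_eq y hy] using DFunLike.congr_fun (((hasFDerivAt_norm_of_ne (h1 _ h3.1).1).smul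
      (HasFDerivAt.comp (φ.χ y) (by rw [h3.2]; exact φ.hasFDerivAt_χ hy) ((hY.differentiableOn
          (by norm_num)).differentiableAt (hO.mem_nhds h3.1)).hasFDerivAt)).unique h5) w

lemma exists_fderiv {z : R4} (hz : ![z 2, z 3] ∈ φ.U) {u : Amb}
    (hu : IsTangent (φ.point z) u) : ∃ v, fderiv ℝ φ.point z v = u := by
  obtain ⟨v, hv⟩ := φ.exists_fderiv_χ hz hu
  refine ⟨![u.1, u.2.1, v 0, v 1], ?_⟩
  rw [φ.fderiv_point hz]
  simp [vec2_eq, hv]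

lemma vec_of_eq {X : Amb → Amb} {z v : R4} (hz : ![z 2, z 3] ∈ φ.U)
    (h : fderiv ℝ φ.point z v = X (φ.point z)) : φ.vec X z = v := by
  rw [vec, funext fun a => φ.sum_frame z a, ← h]
  exact Function.leftInverse_invFun (φ.fderiv_point_injective hz) v

lemma exists_coord : ∃ (H : Amb → R4) (O : Set Amb), IsOpen O ∧ ContDiffOn ℝ ∞ H O ∧
    (∀ z : R4, ![z 2, z 3] ∈ φ.U → φ.point z ∈ O ∧ H (φ.point z) = z) ∧
    ∀ p ∈ O, ‖p.2.2‖ = 1 → φ.point (H p) = p ∧ ![H p 2, H p 3] ∈ φ.U := by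
  obtain ⟨Y, O, hO, hY, h1, h2⟩ := φ.exists_inverse
  have hY' : ContDiffOn ℝ ∞ (fun p : Amb => Y p.2.2) {p | p.2.2 ∈ O} :=
    hY.comp (contDiff_snd.comp contDiff_snd).contDiffOn fun p hp => hp
  refine ⟨fun p => ![p.1, p.2.1, Y p.2.2 0, Y p.2.2 1], {p | p.2.2 ∈ O},
    hO.preimage (by fun_prop), contDiffOn_pi.2 fun i => ?_,
    fun z hz => ?_, fun p hp h => ?_⟩
  · fin_cases i
    exacts [contDiff_fst.contDiffOn, (contDiff_fst.comp contDiff_snd).contDiffOn,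
      contDiffOn_pi.1 hY' 0, contDiffOn_pi.1 hY' 1]
  · have h3 := h2 _ hz 1 one_pos
    rw [one_smul] at h3
    refine ⟨h3.1, ?_⟩
    simp [point, h3.2]
    funext i
    fin_cases i <;> rfl
  · obtain ⟨-, h4, h5⟩ := h1 _ hp
    simpa [point, vec2_eq, h5, nrm_of_norm h] using h4

lemma vec_eq {H : Amb → R4} {O : Set Amb} (hO : IsOpen O) (hH : ContDiffOn ℝ ∞ H O)
    (h : ∀ z : R4, ![z 2, z 3] ∈ φ.U → φ.point z ∈ O ∧ H (φ.point z) = z)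
    {X : Amb → Amb} {z : R4} (hz : ![z 2, z 3] ∈ φ.U)
    (hX : IsTangent (φ.point z) (X (φ.point z))) :
    φ.vec X z = fderiv ℝ H (φ.point z) (X (φ.point z)) := by
  obtain ⟨v, hv⟩ := φ.exists_fderiv hz hX
  have h2 := (HasFDerivAt.comp z ((hH.contDiffAt (hO.mem_nhds (h z hz).1)).differentiableAt (by
      simp)).hasFDerivAt (φ.hasFDerivAt_point hz)).unique ((hasFDerivAt_id z).congr_of_eventuallyEq
          (by
    filter_upwards [(φ.isOpen.preimage ang.continuous).mem_nhds
      (by rwa [mem_preimage, ang_apply])] with z' hz'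
    rw [mem_preimage, ang_apply] at hz'
    exact (h z' hz').2))
  rw [← (φ.hasFDerivAt_point hz).fderiv] at h2
  rw [φ.vec_of_eq hz hv, ← hv]
  exact (DFunLike.congr_fun h2 v).symm

lemma metric_sum (g : BilinField) (z v v' : R4) :
    g (φ.point z) (fderiv ℝ φ.point z v) (fderiv ℝ φ.point z v')
      = ∑ μ, ∑ ν, φ.metric g z μ ν * v μ * v' ν := by
  rw [← φ.sum_frame, ← φ.sum_frame]
  simp [map_sum, map_smul, sum_apply, smul_apply, smul_eq_mul, metric,
    Matrix.of_apply, Finset.mul_sum]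
  rw [Finset.sum_comm]
  refine Finset.sum_congr rfl fun μ _ => Finset.sum_congr rfl fun ν _ => ?_
  ring

end SphereChart

lemma exists_chart {D : Set ℝ} {c : ℝ} {p : Amb} (hp : p ∈ cylinder D c) :
    ∃ (φ : SphereChart) (z : R4), z ∈ φ.dom D c ∧ φ.point z = p := by
  obtain ⟨h1, h2, h3, h4⟩ := hp
  obtain ⟨φ, y, hy, hyp⟩ := exists_stereographic h4
  refine ⟨φ, ![p.1, p.2.1, y 0, y 1], ⟨h1, h2, h3, ?_⟩, ?_⟩
  · simpa [vec2_eq] using hy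
  · simp [SphereChart.point, vec2_eq, hyp]

variable {D : Set ℝ} {Ct : ℝ} {N : ℕ} {A ε c : ℝ} {g : BilinField} {K : Amb → Amb} {s0 : ℝ}
variable {w rt Q : ℝ → ℝ} {r0 δ δ' c' σ : ℝ} {y : ℝ → E3 → St} {Φ Φi : Amb → Amb}

/-! ## The homothetic vector field and its time function -/

lemma two_le_infty : (2 : WithTop ℕ∞) ≤ ∞ := WithTop.coe_le_coe.2 le_top

lemma IsSide.convex (hD : IsSide D) : Convex ℝ D := by
  rcases hD with rfl | rfl | rfl
  exacts [convex_univ, convex_Ici 0, convex_Iic 0]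

lemma IsSide.zero_mem (hD : IsSide D) : (0 : ℝ) ∈ D := by rcases hD with rfl | rfl | rfl <;> simp

/-- The interval of values of `q`. -/
def qInt (D : Set ℝ) (c : ℝ) : Set ℝ := D ∩ Ioo (-c) c

lemma IsSide.convex_qInt (hD : IsSide D) : Convex ℝ (qInt D c) := hD.convex.inter (convex_Ioo _ _)

lemma IsSide.interior_nonempty (hD : IsSide D) (hc : 0 < c) :
    (interior (qInt D c)).Nonempty := by
  rcases hD with rfl | rfl | rfl <;> simp only [qInt, interior_inter, interior_univ, interior_Ici,
    interior_Iic, interior_Ioo]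
  exacts [⟨0, trivial, by simpa, hc⟩, ⟨c / 2, half_pos hc, by linarith, by linarith⟩,
    ⟨-(c / 2), by grind⟩]

lemma IsSide.uniqueDiffOn (hD : IsSide D) (hc : 0 < c) :
    UniqueDiffOn ℝ (qInt D c) := uniqueDiffOn_convex hD.convex_qInt (hD.interior_nonempty hc)

/-- The open cone over the spacetime. -/
def cDom (D : Set ℝ) (c : ℝ) : Set Amb := qInt D c ×ˢ (Iio 0 ×ˢ {θ : E3 | θ ≠ 0})

/-- The range of `(q, τ, θ)`. -/
def timeDom (D : Set ℝ) (c : ℝ) : Set Amb := qInt D c ×ˢ (univ ×ˢ {θ : E3 | θ ≠ 0})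

lemma radial_apply (p : Amb) : radial p = (p.1, p.2.1, nrm p.2.2) := rfl

lemma radial_of_norm {p : Amb} (h : ‖p.2.2‖ = 1) : radial p = p := by
  rw [radial_apply, nrm_of_norm h]

lemma norm_nrm_iff {θ : E3} : ‖nrm θ‖ = 1 ↔ θ ≠ 0 := by
  refine ⟨fun h h0 => ?_, norm_nrm⟩
  simp [nrm, h0] at h

lemma preimage_cylinder (D : Set ℝ) (c : ℝ) : radial ⁻¹' cylinder D c = cDom D c := by
  ext p
  simp [cylinder, cDom, qInt, radial_apply, norm_nrm_iff, abs_lt]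
  tauto

lemma cyl_subset : cylinder D c ⊆ cDom D c := fun p hp => by
  rw [← preimage_cylinder, mem_preimage, radial_of_norm hp.2.2.2]
  exact hp

lemma radial_mem {p : Amb} (hp : p ∈ cDom D c) :
    radial p ∈ cylinder D c := by rw [← preimage_cylinder] at hp; exact hp

lemma isOpen_ne_zero : IsOpen {θ : E3 | θ ≠ 0} := isOpen_ne

lemma contDiffAt_radial {n : WithTop ℕ∞} {p : Amb} (hp : p.2.2 ≠ 0) :
    ContDiffAt ℝ n radial p := by
  exact contDiffAt_fst.prodMk ((contDiff_fst.comp contDiff_snd).contDiffAt.prodMk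
      ((contDiffAt_nrm hp).comp p (f := fun p => p.2.2) (by fun_prop)))

section

variable (hD : IsSide D) (hc : 0 < c)
include hD hc

lemma uniqueDiff_cone : UniqueDiffOn ℝ (cDom D c) :=
  (hD.uniqueDiffOn hc).prod (isOpen_Iio.uniqueDiffOn.prod isOpen_ne_zero.uniqueDiffOn)

lemma uniqueDiffOn_timeDom : UniqueDiffOn ℝ (timeDom D c) :=
  (hD.uniqueDiffOn hc).prod (isOpen_univ.uniqueDiffOn.prod isOpen_ne_zero.uniqueDiffOn)

omit hc in
lemma cDom_locally_convex : ∀ z ∈ cDom D c, ∃ r > 0,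
    Convex ℝ (cDom D c ∩ Metric.ball z r) := by
  intro z hz
  obtain ⟨r, hr, hb⟩ := Metric.isOpen_iff.1
    (isOpen_ne_zero.preimage (by fun_prop : Continuous fun p : Amb => p.2.2)) z hz.2.2
  refine ⟨r, hr, ?_⟩
  convert (hD.convex_qInt.prod ((convex_Iio 0).prod convex_univ)).inter (convex_ball z r) using 1
  ext p
  exact ⟨fun hp => ⟨⟨hp.1.1, hp.1.2.1, trivial⟩, hp.2⟩, fun hp => ⟨⟨hp.1.1, hp.1.2.1, hb hp.2⟩,
      hp.2⟩⟩

end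

lemma eq_of_hasDerivAt_zero_neg {F : Type*} [NormedAddCommGroup F] [NormedSpace ℝ F] {f : ℝ → F}
    (h : ∀ s < 0, HasDerivAt f 0 s) {s s' : ℝ} (hs : s < 0) (hs' : s' < 0) : f s = f s' := by
  refine (convex_Iio 0).is_const_of_fderivWithin_eq_zero (𝕜 := ℝ)
    (fun s hs => (h s hs).differentiableAt.differentiableWithinAt) (fun s hs => ?_) hs hs'
  rw [fderivWithin_of_isOpen isOpen_Iio hs, (h s hs).hasFDerivAt.fderiv]
  simp

lemma hasDerivAt_slice {F : Type*} [NormedAddCommGroup F] [NormedSpace ℝ F] {f : Amb → F}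
    {f' : Amb →L[ℝ] F} {D : Set ℝ} {c q s : ℝ} {θ : E3} (hp : (q, s, θ) ∈ cDom D c)
    (h : HasFDerivWithinAt f f' (cDom D c) (q, s, θ)) :
    HasDerivAt (fun s => f (q, s, θ)) (f' (0, 1, 0)) s := by
  exact (HasFDerivWithinAt.comp_hasDerivWithinAt (f := fun s => ((q, s, θ)))
    (s := Iio 0) s h ((hasDerivAt_const _ _).prodMk ((hasDerivAt_id _).prodMk (hasDerivAt_const _
        _)) : HasDerivAt (fun s => ((q, s, θ) : Amb)) ((0, 1, 0) : Amb) s).hasDerivWithinAt fun s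
            hs => ⟨hp.1, hs, hp.2.2⟩).hasDerivAt
    (isOpen_Iio.mem_nhds hp.2.1)

/-- The `s`-component of the vector field `K`. -/
def kap (K : Amb → Amb) (p : Amb) : ℝ := (K (radial p)).2.1

/-- The function with `K T = 1` that vanishes at `s = s0`. -/
def timeFn (K : Amb → Amb) (s0 : ℝ) (p : Amb) : ℝ := ∫ u in s0..p.2.1, (kap K (p.1, u, p.2.2))⁻¹

/-- The coordinates `(q, T, θ)`. -/
def timeMap (K : Amb → Amb) (s0 : ℝ) (p : Amb) : Amb := (p.1, timeFn K s0 p, p.2.2)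

/-- The inverse of `timeMap`. -/
def timeInv (K : Amb → Amb) (s0 : ℝ) (p : Amb) : Amb :=
  (p.1, Function.invFunOn (fun s => timeFn K s0 (p.1, s, p.2.2)) (Iio 0) p.2.1, p.2.2)

section

variable (hD : IsSide D) (hg : IsTwistedSelfSimilar D Ct N A ε c g K s0)
include hg

lemma K_eq_kap {p : Amb} (hp : p ∈ cylinder D c) : K p = (0, kap K p, 0) := by
  obtain ⟨γ, h0, h1, h2⟩ := hg.orbits p hp
  have hmem := fun τ => by
    have : γ τ ∈ range γ := ⟨τ, rfl⟩
    rw [h2] at this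
    exact this
  have h3 : HasDerivAt (fun τ => (γ τ).1) (K (γ 0)).1 0 := (h1 0).fst
  have h4 : HasDerivAt (fun τ => (γ τ).2.2) (K (γ 0)).2.2 0 := (h1 0).snd.snd
  have h5 := h3.unique
    ((hasDerivAt_const 0 p.1).congr_of_eventuallyEq (Eventually.of_forall fun τ => (hmem τ).1))
  have h6 := h4.unique
    ((hasDerivAt_const 0 p.2.2).congr_of_eventuallyEq
      (Eventually.of_forall fun τ => (hmem τ).2.2))
  rw [h0] at h5 h6
  rw [kap, radial_of_norm hp.2.2.2]
  exact Prod.ext h5 (Prod.ext rfl h6)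

lemma kap_contDiffOn : ContDiffOn ℝ ∞ (kap K) (cDom D c) := by
  have h := hg.K_smooth
  rw [IsCkOn, preimage_cylinder] at h
  exact contDiff_fst.comp_contDiffOn (contDiff_snd.comp_contDiffOn h)

lemma exists_orbit {q s : ℝ} {θ : E3} (hp : (q, s, θ) ∈ cDom D c) : ∃ σ : ℝ → ℝ, σ 0 = s ∧
    (∀ τ, σ τ < 0 ∧ HasDerivAt σ (kap K (q, σ τ, θ)) τ) ∧ ∀ s' < 0, ∃ τ, σ τ = s' := by
  obtain ⟨γ, h0, h1, h2⟩ := hg.orbits _ (radial_mem hp)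
  have hmem := fun τ => by
    have : γ τ ∈ range γ := ⟨τ, rfl⟩
    rw [h2] at this
    exact this
  refine ⟨fun τ => (γ τ).2.1, by simp [h0]; rfl, fun τ => ⟨(hmem τ).2.1, ?_⟩, fun s' hs' => ?_⟩
  · have h3 : HasDerivAt (fun τ => (γ τ).2.1) (K (γ τ)).2.1 τ := (h1 τ).snd.fst
    have h4 : radial (q, (γ τ).2.1, θ) = γ τ := by
      exact Prod.ext (hmem τ).1.symm (Prod.ext rfl (hmem τ).2.2.symm)
    simpa [kap, h4] using h3
  · have : ((q, s', nrm θ)) ∈ range γ := by rw [h2]; exact ⟨rfl, hs', rfl⟩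
    obtain ⟨τ, hτ⟩ := this
    exact ⟨τ, by simp [hτ]⟩

omit hg in
lemma slice_mem {q s : ℝ} {θ : E3} (hp : (q, s, θ) ∈ cDom D c) {s' : ℝ} (hs' : s' < 0) :
    (q, s', θ) ∈ cDom D c := ⟨hp.1, hs', hp.2.2⟩

lemma kap_slice {q s : ℝ} {θ : E3} (hp : (q, s, θ) ∈ cDom D c) :
    ContDiffOn ℝ ∞ (fun s => kap K (q, s, θ)) (Iio 0) := (kap_contDiffOn hg).comp (by fun_prop)
    fun _ hs' => slice_mem hp hs'

lemma kap_ne {p : Amb} (hp : p ∈ cDom D c) : kap K p ≠ 0 := by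
  obtain ⟨q, s, θ⟩ := p
  intro h0
  obtain ⟨σ, h1, h2, h3⟩ := exists_orbit hg hp
  have hF : IsC0C1On (fun p : ℝ × ℝ => kap K (q, p.2, θ)) (univ ×ˢ Iio 0) := by
    refine IsC0C1On.of_contDiffOn (isOpen_univ.prod isOpen_Iio) ?_
    exact ((kap_slice hg hp).of_le (by norm_num)).comp contDiff_snd.contDiffOn fun x hx => hx.2
  have hconst : ∀ τ, σ τ = s := by
    have hop : IsOpen {τ | σ τ = s} := by
      rw [isOpen_iff_mem_nhds]
      intro τ hτ
      have := ode_unique_locally (fun p : ℝ × ℝ => kap K (q, p.2, θ)) (univ ×ˢ Iio 0)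
        (isOpen_univ.prod isOpen_Iio) hF (g := fun _ => s)
        ordConnected_univ (mem_univ _) (fun r _ => (h2 r).2.hasDerivWithinAt)
        (fun r _ => by
          simp only [h0]
          exact (hasDerivAt_const r s).hasDerivWithinAt) hτ ⟨mem_univ _, (h2 τ).1⟩
      rw [nhdsWithin_univ] at this
      exact this
    have := IsClopen.eq_univ ⟨isClosed_eq (continuous_iff_continuousAt.2 fun τ =>
        (h2 τ).2.continuousAt) continuous_const, hop⟩ ⟨0, h1⟩
    exact fun τ => by have h4 := this ▸ mem_univ τ; exact h4
  obtain ⟨τ, hτ⟩ := h3 (s - 1) (by have := hp.2.1; simp at this; linarith)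
  have := hconst τ
  linarith

include hD in
lemma exists_kap_sign : ∃ σ : ℝ, (σ = 1 ∨ σ = -1) ∧ ∀ p ∈ cDom D c, 0 < σ * kap K p := pos_or_neg
    (hD.convex_qInt.isPreconnected.prod
      (isPreconnected_Iio.prod isPreconnected_ne_zero)) (kap_contDiffOn hg).continuousOn
    fun _ hp => kap_ne hg hp

include hD in
lemma timeFn_smooth : ContDiffOn ℝ ∞ (timeFn K s0) (cDom D c) := by
  have h1 : timeFn K s0 = fun p => ∫ v in 0..1,
      (p.2.1 - s0) * (kap K (p.1, s0 + v * (p.2.1 - s0), p.2.2))⁻¹ := by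
    funext p
    rw [timeFn, intervalIntegral.integral_const_mul]
    have := intervalIntegral.smul_integral_comp_add_mul
      (fun u => (kap K (p.1, u, p.2.2))⁻¹) (p.2.1 - s0) s0 (a := 0) (b := 1)
    simp at this
    rw [← this]
    simp [mul_comm]
  rw [h1]
  refine contDiffOn_parametric (cDom_locally_convex hD) (uniqueDiff_cone hD hg.c_pos)
    (Λ := fun x => (x.1.2.1 - s0) *
      (kap K (x.1.1, s0 + x.2 * (x.1.2.1 - s0), x.1.2.2))⁻¹) ?_
  have hmaps : MapsTo (fun x =>
      ((x.1.1, s0 + x.2 * (x.1.2.1 - s0), x.1.2.2)))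
      (cDom D c ×ˢ Icc 0 1) (cDom D c) := by
    rintro ⟨p, v⟩ ⟨hp, hv⟩
    refine slice_mem hp ?_
    have h3 := hg.s₀_neg
    have h4 : (1 - v) * s0 ≤ 0 := mul_nonpos_of_nonneg_of_nonpos (by linarith [hv.2]) h3.le
    rcases eq_or_lt_of_le hv.1 with h6 | h6
    · have h8 : v = 0 := h6.symm; simp [h8]; linarith
    · have h7 := mul_neg_of_pos_of_neg h6 hp.2.1; simp only; linarith
  exact (by fun_prop : ContDiffOn ℝ ∞ (fun x : Amb × ℝ => x.1.2.1 - s0) (cDom D c ×ˢ Icc 0 1)).mul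
      (((kap_contDiffOn hg).comp (by fun_prop) hmaps).inv fun x hx => kap_ne hg (hmaps hx))

lemma hasDerivAt_timeFn {q s : ℝ} {θ : E3} (hp : (q, s, θ) ∈ cDom D c) :
    HasDerivAt (fun s => timeFn K s0 (q, s, θ)) (kap K (q, s, θ))⁻¹ s := by
  have hc := (kap_slice hg hp).continuousOn.inv₀ fun s' hs' => kap_ne hg (slice_mem hp hs')
  have hs := hp.2.1
  exact intervalIntegral.integral_hasDerivAt_right
      (hc.mono ((convex_Iio (0 : ℝ)).ordConnected.uIcc_subset hg.s₀_neg hs)).intervalIntegrable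
    (hc.stronglyMeasurableAtFilter isOpen_Iio s hs) (hc.continuousAt (isOpen_Iio.mem_nhds hs))

omit hg in
lemma timeFn_zero (q : ℝ) (θ : E3) : timeFn K s0 (q, s0, θ) = 0 := by simp [timeFn]

omit hg in
lemma kap_smul (q s : ℝ) (θ : E3) {a : ℝ} (ha : 0 < a) : kap K (q, s, a • θ) = kap K (q, s, θ) := by
  simp [kap, radial_apply, nrm_smul ha]

omit hg in
lemma timeFn_nrm (q s : ℝ) {θ : E3} (h : θ ≠ 0) :
    timeFn K s0 (q, s, nrm θ) = timeFn K s0 (q, s, θ) := by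
  simp [timeFn, nrm, kap_smul _ _ _ (inv_pos.2 (norm_pos_iff.2 h))]

lemma timeFn_surj {q : ℝ} {θ : E3} (hq : q ∈ qInt D c) (hθ : θ ≠ 0) (τ : ℝ) :
    ∃ s < 0, timeFn K s0 (q, s, θ) = τ := by
  have hp : (q, s0, θ) ∈ cDom D c := ⟨hq, hg.s₀_neg, hθ⟩
  obtain ⟨σ, h1, h2, -⟩ := exists_orbit hg hp
  have hd : ∀ r, HasDerivAt (fun r => timeFn K s0 (q, σ r, θ) - r) 0 r := by
    intro r
    have hm := slice_mem hp (h2 r).1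
    refine (((hasDerivAt_timeFn hg hm).comp r (h2 r).2).sub (hasDerivAt_id r)).congr_deriv ?_
    rw [inv_mul_cancel₀ (kap_ne hg hm), sub_self]
  have h3 := eq_of_deriv_zero (δ := |τ| + 1) (fun r _ => hd r) (by linarith)
  simp [h1, timeFn_zero] at h3
  grind

lemma timeFn_strictMono {σ : ℝ} (hσ : ∀ p ∈ cDom D c, 0 < σ * kap K p) {q : ℝ} {θ : E3}
    (hq : q ∈ qInt D c) (hθ : θ ≠ 0) :
    StrictMonoOn (fun s => σ * timeFn K s0 (q, s, θ)) (Iio 0) := by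
  have hp : ∀ s < 0, (q, s, θ) ∈ cDom D c := fun s hs => ⟨hq, hs, hθ⟩
  refine strictMonoOn_of_deriv_pos (convex_Iio 0) (fun s hs =>
    ((hasDerivAt_timeFn hg (hp s hs)).const_mul σ).continuousAt.continuousWithinAt) fun s hs => ?_
  rw [interior_Iio] at hs
  rw [((hasDerivAt_timeFn hg (hp s hs)).const_mul σ).deriv]
  have h1 := hσ _ (hp s hs)
  have h2 := kap_ne hg (hp s hs)
  have h3 : σ * (kap K (q, s, θ))⁻¹ = (σ * kap K (q, s, θ)) * ((kap K (q, s, θ))⁻¹) ^ 2 := by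
    field_simp
  rw [h3]
  positivity

lemma timeInv_mem {p : Amb} (hp : p ∈ timeDom D c) : timeInv K s0 p ∈ cDom D c ∧
    timeMap K s0 (timeInv K s0 p) = p := by
  obtain ⟨s, hs, h⟩ := timeFn_surj hg hp.1 hp.2.2 p.2.1
  have h1 : p.2.1 ∈ (fun s => timeFn K s0 (p.1, s, p.2.2)) '' Iio 0 := ⟨s, hs, h⟩
  exact ⟨⟨hp.1, Function.invFunOn_mem h1, hp.2.2⟩,
    Prod.ext rfl (Prod.ext (Function.invFunOn_eq h1) rfl)⟩

omit hg in
lemma timeMap_mem {p : Amb} (hp : p ∈ cDom D c) : timeMap K s0 p ∈ timeDom D c :=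
  ⟨hp.1, mem_univ _, hp.2.2⟩

include hD in
lemma timeMap_injOn : InjOn (timeMap K s0) (cDom D c) := by
  intro p hp p' hp' h
  obtain ⟨σ, -, hσ⟩ := exists_kap_sign hD hg
  have h1 : p.1 = p'.1 := (congrArg Prod.fst h :)
  have h2 : p.2.2 = p'.2.2 := (congrArg (fun u => u.2.2) h)
  have h3 : timeFn K s0 p = timeFn K s0 p' := (congrArg (fun u => u.2.1) h)
  refine Prod.ext h1 (Prod.ext ((timeFn_strictMono hg hσ hp.1 hp.2.2).injOn hp.2.1 hp'.2.1 ?_) h2)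
  grind

include hD in
lemma timeInv_timeMap {p : Amb} (hp : p ∈ cDom D c) : timeInv K s0 (timeMap K s0 p) = p :=
  timeMap_injOn hD hg (timeInv_mem hg (timeMap_mem hp)).1 hp (timeInv_mem hg (timeMap_mem hp)).2

include hD in
lemma timeInv_continuousOn : ContinuousOn (timeInv K s0) (timeDom D c) := by
  obtain ⟨σ, -, hσ⟩ := exists_kap_sign hD hg
  refine fun z0 hz0 => continuous_fst.continuousWithinAt.prodMk
    (ContinuousWithinAt.prodMk ?_ (by fun_prop))
  have hcont : ∀ b < 0, ContinuousWithinAt (fun z => σ * timeFn K s0 (z.1, b, z.2.2))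
      (timeDom D c) z0 := fun b hb =>
    continuousWithinAt_const.mul (((timeFn_smooth hD hg).continuousOn _
      (show (z0.1, b, z0.2.2) ∈ cDom D c from ⟨hz0.1, hb, hz0.2.2⟩)).comp
      (f := fun z : Amb => (z.1, b, z.2.2)) (by fun_prop) fun z hz => ⟨hz.1, hb, hz.2.2⟩)
  have hτ : ContinuousWithinAt (fun z => σ * z.2.1) (timeDom D c) z0 := by fun_prop
  have hneg : ∀ z ∈ timeDom D c, (timeInv K s0 z).2.1 < 0 := fun z hz => (timeInv_mem hg hz).1.2.1
  have hmono : ∀ z ∈ timeDom D c, ∀ b < 0,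
      (σ * timeFn K s0 (z.1, b, z.2.2) < σ * z.2.1 ↔ b < (timeInv K s0 z).2.1) ∧
      (σ * z.2.1 < σ * timeFn K s0 (z.1, b, z.2.2) ↔ (timeInv K s0 z).2.1 < b) := by
    intro z hz b hb
    rw [← (congrArg (fun u => u.2.1) (timeInv_mem hg hz).2)]
    exact ⟨(timeFn_strictMono hg hσ hz.1 hz.2.2).lt_iff_lt hb (hneg z hz),
      (timeFn_strictMono hg hσ hz.1 hz.2.2).lt_iff_lt (hneg z hz) hb⟩
  refine tendsto_order.2 ⟨fun a ha => ?_, fun b hb => ?_⟩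
  · have ha0 := ha.trans (hneg z0 hz0)
    filter_upwards [(hcont a ha0).eventually_lt hτ ((hmono z0 hz0 a ha0).1.2 ha),
      self_mem_nhdsWithin] with z hz hzm using (hmono z hzm a ha0).1.1 hz
  · by_cases hb0 : b < 0
    · filter_upwards [hτ.eventually_lt (hcont b hb0) ((hmono z0 hz0 b hb0).2.2 hb),
        self_mem_nhdsWithin] with z hz hzm using (hmono z hzm b hb0).2.1 hz
    · filter_upwards [self_mem_nhdsWithin] with z hzm using (hneg z hzm).trans_le (not_lt.1 hb0)

/-- The derivative of the time function. -/
def timeDer (D : Set ℝ) (c : ℝ) (K : Amb → Amb) (s0 : ℝ) (p : Amb) : Amb →L[ℝ] ℝ :=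
  fderivWithin ℝ (timeFn K s0) (cDom D c) p

include hD in
lemma hasFDerivWithinAt_timeFn {p : Amb} (hp : p ∈ cDom D c) :
    HasFDerivWithinAt (timeFn K s0) (timeDer D c K s0 p) (cDom D c) p :=
  ((timeFn_smooth hD hg).differentiableOn (by norm_num) p hp).hasFDerivWithinAt

include hD in
lemma timeDer_s {p : Amb} (hp : p ∈ cDom D c) (a : ℝ) :
    timeDer D c K s0 p (0, a, 0) = a * (kap K p)⁻¹ := by
  rw [show ((0, a, 0)) = a • ((0, 1, 0) : Amb) by simp, map_smul,
      (hasDerivAt_slice hp (hasFDerivWithinAt_timeFn hD hg hp)).unique (hasDerivAt_timeFn hg hp)]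
  rfl

/-- The derivative of `timeInv` at `timeMap p`. -/
def tInvDer (D : Set ℝ) (c : ℝ) (K : Amb → Amb) (s0 : ℝ) (p : Amb) : Amb →L[ℝ] Amb :=
  (fst ℝ ℝ (ℝ × E3)).prod
    ((kap K p • (covx - (timeDer D c K s0 p).comp
      ((fst ℝ ℝ (ℝ × E3)).prod ((0 : Amb →L[ℝ] ℝ).prod
        (snd ℝ ℝ E3 ∘L snd ℝ ℝ (ℝ × E3)))))).prod
      (snd ℝ ℝ E3 ∘L snd ℝ ℝ (ℝ × E3)))

omit hg in
lemma tInvDer_apply (p u : Amb) : tInvDer D c K s0 p u =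
    (u.1, kap K p * (u.2.1 - timeDer D c K s0 p (u.1, 0, u.2.2)), u.2.2) := rfl

/-- The derivative of `timeMap`. -/
def tDer (D : Set ℝ) (c : ℝ) (K : Amb → Amb) (s0 : ℝ) (p : Amb) : Amb →L[ℝ] Amb :=
  (fst ℝ ℝ (ℝ × E3)).prod ((timeDer D c K s0 p).prod
    (snd ℝ ℝ E3 ∘L snd ℝ ℝ (ℝ × E3)))

omit hg in
lemma tDer_apply (p u : Amb) : tDer D c K s0 p u =
    (u.1, timeDer D c K s0 p u, u.2.2) := rfl

include hD in
lemma timeDer_split {p : Amb} (hp : p ∈ cDom D c) (u : Amb) :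
    timeDer D c K s0 p u = timeDer D c K s0 p (u.1, 0, u.2.2) + u.2.1 * (kap K p)⁻¹ := by
  rw [← timeDer_s hD hg hp, ← map_add]
  simp

include hD in
lemma tDer_tInvDer {p : Amb} (hp : p ∈ cDom D c) (u : Amb) :
    tDer D c K s0 p (tInvDer D c K s0 p u) = u := by
  refine Prod.ext rfl (Prod.ext ?_ rfl)
  have := kap_ne hg hp
  change timeDer D c K s0 p (tInvDer D c K s0 p u) = u.2.1
  rw [timeDer_split hD hg hp, tInvDer_apply]
  field_simp
  ring

include hD in
lemma tInvDer_tDer {p : Amb} (hp : p ∈ cDom D c) (u : Amb) :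
    tInvDer D c K s0 p (tDer D c K s0 p u) = u := by
  rw [tInvDer_apply, tDer_apply, timeDer_split hD hg hp u]
  have := kap_ne hg hp
  field_simp
  ring

include hD in
lemma hasFDeriv_timeMap {p : Amb} (hp : p ∈ cDom D c) :
    HasFDerivWithinAt (timeMap K s0) (tDer D c K s0 p) (cDom D c) p :=
  (fst ℝ ℝ (ℝ × E3)).hasFDerivWithinAt.prodMk ((hasFDerivWithinAt_timeFn hD hg hp).prodMk
    (snd ℝ ℝ E3 ∘L snd ℝ ℝ (ℝ × E3)).hasFDerivWithinAt)

include hD in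
lemma hasFDerivWithinAt_timeInv {z : Amb} (hz : z ∈ timeDom D c) :
    HasFDerivWithinAt (timeInv K s0) (tInvDer D c K s0 (timeInv K s0 z)) (timeDom D c) z := by
  have hp := (timeInv_mem hg hz).1
  set p := timeInv K s0 z with hpd
  let e : Amb ≃L[ℝ] Amb := ContinuousLinearEquiv.equivOfInverse (tDer D c K s0 p)
    (tInvDer D c K s0 p) (tInvDer_tDer hD hg hp) (tDer_tInvDer hD hg hp)
  have h1 : HasFDerivWithinAt (timeMap K s0) (e : Amb →L[ℝ] Amb) (cDom D c)
      (timeInv K s0 z) := hasFDeriv_timeMap hD hg hp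
  exact h1.of_local_left_inverse
    ((timeInv_continuousOn hD hg z hz).tendsto_nhdsWithin fun z' hz' => (timeInv_mem hg hz').1) hz
    (eventually_nhdsWithin_of_forall fun z' hz' => (timeInv_mem hg hz').2)

include hD in
lemma timeDer_continuousOn : ContinuousOn (timeDer D c K s0) (cDom D c) :=
  (timeFn_smooth hD hg).continuousOn_fderivWithin (uniqueDiff_cone hD hg.c_pos) (by norm_num)

include hD in
lemma tInvDer_continuousOn : ContinuousOn (tInvDer D c K s0) (cDom D c) := by
  rw [continuousOn_clm_apply]
  intro u
  exact continuousOn_const.prodMk (((kap_contDiffOn hg).continuousOn.mul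
    (continuousOn_const.sub ((timeDer_continuousOn hD hg).clm_apply continuousOn_const))).prodMk
        continuousOn_const)

include hD in
lemma timeInv_contDiffOn : ContDiffOn ℝ 1 (timeInv K s0) (timeDom D c) := by
  have hu := uniqueDiffOn_timeDom hD hg.c_pos
  rw [show (1 : WithTop ℕ∞) = 0 + 1 from rfl, contDiffOn_succ_iff_fderivWithin hu]
  refine ⟨fun z hz => (hasFDerivWithinAt_timeInv hD hg hz).differentiableWithinAt,
    by simp, contDiffOn_zero.2 ?_⟩
  exact ((tInvDer_continuousOn hD hg).comp (timeInv_continuousOn hD hg) fun z hz =>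
      (timeInv_mem hg hz).1).congr fun z hz =>
          (hasFDerivWithinAt_timeInv hD hg hz).fderivWithin (hu z hz)

end

/-! ## The metric in the coordinates `(q, T, θ)` -/

namespace SphereChart

variable (φ : SphereChart)

/-- The slice of the coordinate domain at constant `q`. -/
def slice : Set (Fin 3 → ℝ) := {w | w 0 < 0 ∧ ![w 1, w 2] ∈ φ.U}

lemma isOpen_slice : IsOpen φ.slice := (isOpen_lt (continuous_apply 0) continuous_const).inter
    (φ.isOpen.preimage (continuous_pi fun i => by fun_prop))

lemma vecCons_mem {q : ℝ} {w : Fin 3 → ℝ} :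
    vecCons q w ∈ φ.dom D c ↔ (q ∈ D ∧ |q| < c) ∧ w ∈ φ.slice := by
  simp [and_assoc]
  rfl

omit φ in
lemma vecCons_tail (z : R4) : vecCons (z 0) (vecTail z) = z := by
  funext i
  fin_cases i <;> rfl

lemma slice_eq {q : ℝ} (hq : q ∈ D ∧ |q| < c) :
    {w : Fin 3 → ℝ | vecCons q w ∈ φ.dom D c} = φ.slice := by ext w; simp [vecCons_mem, hq]

lemma tail_mem {z : R4} (hz : z ∈ φ.dom D c) : vecTail z ∈ φ.slice := by
  rw [← vecCons_tail z, vecCons_mem] at hz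
  exact hz.2

lemma dom_fst {z : R4} (hz : z ∈ φ.dom D c) : z 0 ∈ D ∧ |z 0| < c := ⟨hz.1, hz.2.1⟩

lemma point_mem {z : R4} (hz : z ∈ φ.dom D c) : φ.point z ∈ cylinder D c :=
  ⟨hz.1, hz.2.1, hz.2.2.1, φ.norm_eq _ hz.2.2.2⟩

omit φ in
lemma vecCons_add_single (z : R4) (i : Fin 3) (t : ℝ) :
    z + t • Pi.single i.succ 1
      = vecCons (z 0) (vecTail z + t • Pi.single i 1) := by
  funext j
  refine Fin.cases ?_ (fun k => ?_) j
  · simp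
  · simp [vecTail, Pi.single_apply]

lemma line_mem_nhds {z : R4} (hz : z ∈ φ.dom D c) (i : Fin 3) :
    (fun t : ℝ => z + t • (Pi.single i.succ 1 : R4)) ⁻¹' φ.dom D c ∈ 𝓝 (0 : ℝ) := by
  filter_upwards [(by fun_prop : Continuous fun t => vecTail z + t • (Pi.single i 1)).continuousAt
    (φ.isOpen_slice.mem_nhds (by simpa using φ.tail_mem hz))] with t ht
  rw [mem_preimage, vecCons_add_single, vecCons_mem]
  exact ⟨φ.dom_fst hz, ht⟩

lemma partial_succ {F : R4 → ℝ} {z : R4} (hz : z ∈ φ.dom D c)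
    (hF : DifferentiableAt ℝ (fun w : Fin 3 → ℝ => F (vecCons (z 0) w)) (vecTail z))
    (i : Fin 3) : φ.partial_ D c i.succ F z
      = fderiv ℝ (fun w : Fin 3 → ℝ => F (vecCons (z 0) w)) (vecTail z) (Pi.single i 1) := by
  have h2 : HasDerivAt (fun t : ℝ => F (z + t • Pi.single i.succ 1))
      (fderiv ℝ (fun w => F (vecCons (z 0) w)) (vecTail z) (Pi.single i 1)) 0 := by
    simp [vecCons_add_single]; exact hF.hasFDerivAt.hasLineDerivAt (Pi.single i 1)
  change derivWithin _ _ _ = _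
  rw [derivWithin_of_mem_nhds (φ.line_mem_nhds hz i), h2.deriv]

lemma uniqueDiff_line (hD : IsSide D) (hc : 0 < c) {z : R4} (hz : z ∈ φ.dom D c) (μ : Fin 4) :
    UniqueDiffWithinAt ℝ ((fun t : ℝ => z + t • (Pi.single μ 1 : R4)) ⁻¹' φ.dom D c) 0 := by
  refine Fin.cases ?_ (fun i => uniqueDiffWithinAt_of_mem_nhds (φ.line_mem_nhds hz i)) μ
  have h3 : (fun t => z + t • (Pi.single 0 1)) ⁻¹' φ.dom D c = (fun q => q - z 0) '' qInt D c := by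
    ext t
    simp_all [dom, qInt, abs_lt, add_comm t, sub_eq_iff_eq_add]
  rw [h3]
  simpa using ((hasFDerivWithinAt_id (z 0) (qInt D c)).sub_const (z 0)).uniqueDiffWithinAt
      (hD.uniqueDiffOn hc (z 0) ⟨hz.1, abs_lt.1 hz.2.1⟩) Function.surjective_id.denseRange

lemma partial_point (hD : IsSide D) (hc : 0 < c) {f : Amb → ℝ} {f' : Amb →L[ℝ] ℝ}
    {z : R4} (hz : z ∈ φ.dom D c)
    (hf : HasFDerivWithinAt f f' (cDom D c) (φ.point z)) {F : R4 → ℝ}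
    (hF : ∀ z ∈ φ.dom D c, F z = f (φ.point z)) (μ : Fin 4) :
    φ.partial_ D c μ F z = f' (φ.frame z μ) := by
  exact HasDerivWithinAt.derivWithin ((HasFDerivWithinAt.congr (HasFDerivWithinAt.comp z hf
      ((φ.hasFDerivAt_point hz.2.2.2).differentiableAt.hasFDerivAt).hasFDerivWithinAt fun z' hz' =>
          cyl_subset (φ.point_mem hz')) (fun z' hz' => hF z' hz') (hF z hz)).hasLineDerivWithinAt
              (Pi.single μ 1)) (φ.uniqueDiff_line hD hc hz μ)

end SphereChart

section

variable (hD : IsSide D) (hg : IsTwistedSelfSimilar D Ct N A ε c g K s0)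
include hg

/-- The derivative of the `s`-component of `K`. -/
def kapDer (D : Set ℝ) (c : ℝ) (K : Amb → Amb) (p : Amb) : Amb →L[ℝ] ℝ :=
  fderivWithin ℝ (kap K) (cDom D c) p

lemma hasFDerivWithinAt_kap {p : Amb} (hp : p ∈ cDom D c) :
    HasFDerivWithinAt (kap K) (kapDer D c K p) (cDom D c) p :=
  ((kap_contDiffOn hg).differentiableOn (by norm_num) p hp).hasFDerivWithinAt

lemma hasDerivAt_kap {q s : ℝ} {θ : E3} (hp : (q, s, θ) ∈ cDom D c) :
    HasDerivAt (fun s => kap K (q, s, θ)) (kapDer D c K (q, s, θ) (0, 1, 0)) s :=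
  hasDerivAt_slice hp (hasFDerivWithinAt_kap hg hp)

omit hg in
include hD in
lemma cDom_subset_closure (hc : 0 < c) : cDom D c ⊆ closure (interior (cDom D c)) := by
  rw [cDom, interior_prod_eq, closure_prod_eq, (isOpen_Iio.prod isOpen_ne_zero).interior_eq]
  refine prod_mono ?_ subset_closure
  rw [hD.convex_qInt.closure_interior_eq_closure_of_nonempty_interior (hD.interior_nonempty hc)]
  exact subset_closure

include hD in
lemma hasDerivAt_timeDer {q s : ℝ} {θ : E3} (hp : (q, s, θ) ∈ cDom D c) (η : Amb) :
    HasDerivAt (fun s => timeDer D c K s0 (q, s, θ) η)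
      (-(kapDer D c K (q, s, θ) η) / kap K (q, s, θ) ^ 2) s := by
  have hu := uniqueDiff_cone hD hg.c_pos
  have hcd := timeFn_smooth hD hg
  have hder : ContDiffOn ℝ ∞ (timeDer D c K s0) (cDom D c) := hcd.fderivWithin hu (by norm_num)
  have h2 := (hder.differentiableOn (by norm_num) _ hp).hasFDerivWithinAt
  have hsym := ((hcd _ hp).of_le two_le_infty).isSymmSndFDerivWithinAt (by simp) hu
    (cDom_subset_closure hD hg.c_pos hp) hp
  have h4 :=
    (hasDerivAt_slice hp h2).clm_apply (hasDerivAt_const s η)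
  refine h4.congr_deriv ?_
  rw [map_zero, add_zero]
  refine (hsym (0, 1, 0) η).trans ?_
  have h5 :=
    h2.clm_apply (hasFDerivWithinAt_const ((0, 1, 0) : Amb) _ _)
  have h6 : HasFDerivWithinAt (fun p => (kap K p)⁻¹) _ (cDom D c) (q, s, θ) :=
    HasFDerivWithinAt.comp (q, s, θ)
      (hasDerivAt_inv (kap_ne hg hp)).hasFDerivAt.hasFDerivWithinAt
      (hasFDerivWithinAt_kap hg hp) (mapsTo_univ _ _)
  have h7 := HasFDerivWithinAt.congr h6
    (fun p hp => by change timeDer D c K s0 p (0, 1, 0) = _; rw [timeDer_s hD hg hp, one_mul])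
    (by rw [timeDer_s hD hg hp, one_mul])
  have h8 := DFunLike.congr_fun ((hu _ hp).eq h5 h7) η
  simp at h8
  change fderivWithin ℝ (timeDer D c K s0) (cDom D c) (q, s, θ) η (0, 1, 0) = _
  rw [h8]
  ring

lemma vec_K (φ : SphereChart) {z : R4} (hz : z ∈ φ.dom D c) :
    φ.vec K z = ![0, kap K (φ.point z), 0, 0] := by
  refine φ.vec_of_eq hz.2.2.2 ?_
  rw [K_eq_kap hg (φ.point_mem hz), φ.fderiv_point hz.2.2.2]
  refine Prod.ext rfl (Prod.ext rfl ?_)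
  change fderiv ℝ φ.χ _ ![0, 0] = 0
  rw [show ![0, 0] = (0 : Fin 2 → ℝ) from vec2_eq 0, map_zero]

include hD in
lemma partial_vec_K (φ : SphereChart) {z : R4} (hz : z ∈ φ.dom D c) (σ ρ : Fin 4) :
    φ.partial_ D c ρ (fun z' => φ.vec K z' σ) z
      = if σ = 1 then kapDer D c K (φ.point z) (φ.frame z ρ) else 0 := by
  split_ifs with hσ
  · subst hσ
    exact φ.partial_point hD hg.c_pos hz (hasFDerivWithinAt_kap hg (cyl_subset (φ.point_mem hz)))
      (fun z' hz' => by rw [vec_K hg φ hz']; rfl) ρ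
  · rw [φ.partial_point hD hg.c_pos hz (f := fun _ => 0)
      (hasFDerivWithinAt_const _ _ _) (fun z' hz' => ?_) ρ]
    · rfl
    · rw [vec_K hg φ hz']
      fin_cases σ
      · rfl
      · exact absurd rfl hσ
      · rfl
      · rfl

include hD in
lemma lie_metric_apply (φ : SphereChart) {z : R4} (hz : z ∈ φ.dom D c) (μ ν : Fin 4) :
    kap K (φ.point z) * φ.partial_ D c 1 (fun z' => φ.metric g z' μ ν) z
      + φ.metric g z 1 ν * kapDer D c K (φ.point z) (φ.frame z μ)
      + φ.metric g z μ 1 * kapDer D c K (φ.point z) (φ.frame z ν) = 2 * φ.metric g z μ ν := by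
  have h2 := hg.homothetic φ z hz μ ν
  simp [SphereChart.lieMetric, Fin.sum_univ_four, partial_vec_K hD hg φ hz, vec_K hg φ hz] at h2
  exact h2

omit hg in
lemma IsC0Ck.differentiableAt {k : ℕ} (hk : k ≠ 0) {φ : SphereChart} {F : R4 → ℝ}
    (h : IsC0Ck k F (φ.dom D c)) {z : R4} (hz : z ∈ φ.dom D c) :
    DifferentiableAt ℝ (fun w : Fin 3 → ℝ => F (vecCons (z 0) w)) (vecTail z) := by
  have h1 := h.1 (z 0)
  rw [φ.slice_eq (φ.dom_fst hz)] at h1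
  exact (h1.differentiableOn (by exact_mod_cast hk)).differentiableAt
    (φ.isOpen_slice.mem_nhds (φ.tail_mem hz))

omit hg in
lemma hasDerivAt_partial_one (φ : SphereChart) {z : R4} (hz : z ∈ φ.dom D c)
    {F : R4 → ℝ}
    (hd : DifferentiableAt ℝ (fun w : Fin 3 → ℝ => F (vecCons (z 0) w)) (vecTail z)) :
    HasDerivAt (fun s => F ![z 0, s, z 2, z 3]) (φ.partial_ D c 1 F z) (z 1) := by
  have h1 := φ.partial_succ hz hd 0
  rw [show (Fin.succ 0) = 1 from rfl] at h1
  rw [h1]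
  have h2 : HasDerivAt (fun s => (![s, z 2, z 3])) (Pi.single 0 1) (z 1) := by
    rw [hasDerivAt_pi]
    intro i
    fin_cases i
    · exact hasDerivAt_id _
    · exact hasDerivAt_const _ _
    · exact hasDerivAt_const _ _
  exact HasFDerivAt.comp_hasDerivAt (z 1)
    (by rw [(by funext i; fin_cases i <;> rfl : (![z 1, z 2, z 3]) = vecTail z)];
        exact hd.hasFDerivAt) h2

lemma hasDerivAt_metric_s (φ : SphereChart) {z : R4} (hz : z ∈ φ.dom D c) (μ ν : Fin 4) :
    HasDerivAt (fun s => φ.metric g ![z 0, s, z 2, z 3] μ ν)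
      (φ.partial_ D c 1 (fun z' => φ.metric g z' μ ν) z) (z 1) :=
  hasDerivAt_partial_one (F := fun z' => φ.metric g z' μ ν) φ hz
    ((hg.regular φ μ ν).differentiableAt two_ne_zero hz)

include hD in
lemma hasDerivAt_tInvDer {q s : ℝ} {θ : E3} (hp : (q, s, θ) ∈ cDom D c) (x : Amb) :
    HasDerivAt (fun s => (tInvDer D c K s0 (q, s, θ) x).2.1)
      (kapDer D c K (q, s, θ) (tInvDer D c K s0 (q, s, θ) x) / kap K (q, s, θ)) s := by
  refine ((hasDerivAt_kap hg hp).mul ((hasDerivAt_timeDer hD hg hp (x.1, 0, x.2.2)).const_sub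
      x.2.1)).congr_deriv ?_
  have hk := kap_ne hg hp
  rw [(by rw [tInvDer_apply]; simp : tInvDer D c K s0 (q, s, θ) x = (x.1, 0,
      x.2.2) + (tInvDer D c K s0 (q, s, θ) x).2.1 • ((0, 1, 0))), map_add, map_smul, tInvDer_apply]
  field_simp
  ring

include hD in
lemma metric_conformal_aux {q s : ℝ} {θ : E3} (hp : (q, s, θ) ∈ cylinder D c) {x x' : Amb}
    (hx : inner ℝ θ x.2.2 = 0) (hx' : inner ℝ θ x'.2.2 = 0) : HasDerivAt (fun s =>
      exp (-(2 * timeFn K s0 (q, s, θ))) * g (q, s, θ) (tInvDer D c K s0 (q, s, θ) x)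
        (tInvDer D c K s0 (q, s, θ) x')) 0 s := by
  obtain ⟨φ, z, hz, hzp⟩ := exists_chart hp
  obtain ⟨rfl, rfl, rfl⟩ : z 0 = q ∧ z 1 = s ∧ φ.χ ![z 2, z 3] = θ := by
    simpa [SphereChart.point] using hzp
  set θ := φ.χ ![z 2, z 3]
  have hz' : (![z 0, z 1, z 2, z 3] : R4) = z := by funext i; fin_cases i <;> rfl
  set k := kap K (z 0, z 1, θ) with hk
  set κ := kapDer D c K (z 0, z 1, θ) with hκ
  have hkne : k ≠ 0 := kap_ne hg (cyl_subset hp)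
  have key : ∀ x : Amb, inner ℝ θ x.2.2 = 0 → ∃ α : ℝ → R4,
      (∀ s, fderiv ℝ φ.point ![z 0, s, z 2, z 3] (α s) = tInvDer D c K s0 (z 0, s, θ) x) ∧
      ∀ μ, HasDerivAt (fun s => α s μ) (((∑ σ, α (z 1) σ * κ (φ.frame z σ)) / k) *
        (Pi.single 1 1 : R4) μ) (z 1) := by
    intro x hx
    obtain ⟨a, ha⟩ := φ.exists_fderiv hz.2.2.2 hx
    refine ⟨fun s => ![a 0, (tInvDer D c K s0 (z 0, s, θ) x).2.1, a 2, a 3], ?_⟩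
    have h1 : ∀ s, fderiv ℝ φ.point ![z 0, s, z 2, z 3]
        ![a 0, (tInvDer D c K s0 (z 0, s, θ) x).2.1, a 2, a 3] = tInvDer D c K s0 (z 0, s, θ) x :=
      fun s => by
        rw [φ.fderiv_point hz.2.2.2] at ha
        rw [φ.fderiv_point (z := ![z 0, s, z 2, z 3]) hz.2.2.2, tInvDer_apply, ← ha]
        rfl
    refine ⟨h1, fun μ => ?_⟩
    have h2 : ∑ σ, (![a 0, (tInvDer D c K s0 (z 0, z 1, θ) x).2.1, a 2, a 3] : R4) σ *
        κ (φ.frame z σ) = κ (tInvDer D c K s0 (z 0, z 1, θ) x) := by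
      have h3 := congrArg κ (h1 (z 1))
      rw [hz', ← φ.sum_frame, map_sum] at h3
      simpa only [map_smul, smul_eq_mul] using h3
    simp only [h2]
    fin_cases μ
    · exact (hasDerivAt_const (z 1) (a 0)).congr_deriv (by simp)
    · exact (hasDerivAt_tInvDer hD hg (cyl_subset hp) x).congr_deriv (by simp [hk, hκ])
    · exact (hasDerivAt_const (z 1) (a 2)).congr_deriv (by simp)
    · exact (hasDerivAt_const (z 1) (a 3)).congr_deriv (by simp)
  obtain ⟨α, hα, hdα⟩ := key x hx
  obtain ⟨β, hβ, hdβ⟩ := key x' hx'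
  have hform : (fun s => exp (-(2 * timeFn K s0 (z 0, s, θ))) * g (z 0, s, θ)
      (tInvDer D c K s0 (z 0, s, θ) x) (tInvDer D c K s0 (z 0, s, θ) x'))
      = fun s => exp (-(2 * timeFn K s0 (z 0, s, θ))) * ∑ μ, ∑ ν,
        φ.metric g ![z 0, s, z 2, z 3] μ ν * α s μ * β s ν := by
    funext s
    rw [← φ.metric_sum, hα, hβ]
    rfl
  rw [hform]
  have hsum := HasDerivAt.fun_sum (u := Finset.univ) fun μ _ =>
    HasDerivAt.fun_sum (u := Finset.univ) fun ν _ =>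
      ((hasDerivAt_metric_s hg φ hz μ ν).mul (hdα μ)).mul (hdβ ν)
  have hexp := (((hasDerivAt_timeFn hg (cyl_subset hp)).const_mul 2).neg).exp
  refine (hexp.mul hsum).congr_deriv ?_
  have hE : ∑ μ, ∑ ν, (k * φ.partial_ D c 1 (fun z' => φ.metric g z' μ ν) z
      + φ.metric g z 1 ν * κ (φ.frame z μ) + φ.metric g z μ 1 * κ (φ.frame z ν)
        - 2 * φ.metric g z μ ν) * α (z 1) μ * β (z 1) ν = 0 :=
    Finset.sum_eq_zero fun μ _ => Finset.sum_eq_zero fun ν _ => by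
      have h : k * _ + _ * κ _ + _ * κ _ = _ := lie_metric_apply hD hg φ hz μ ν
      linear_combination (α (z 1) μ * β (z 1) ν) * h
  have e0 : (Pi.single 1 1 : R4) 0 = 0 := rfl
  have e1 : (Pi.single 1 1 : R4) 1 = 1 := rfl
  have e2 : (Pi.single 1 1 : R4) 2 = 0 := rfl
  have e3 : (Pi.single 1 1 : R4) 3 = 0 := rfl
  simp only [Pi.neg_apply, Pi.mul_apply, hz', Fin.sum_univ_four, e0, e1, e2, e3] at hE ⊢
  generalize exp _ = e
  rw [← hk]
  clear_value k κ
  clear * - hkne hE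
  field_simp
  linear_combination e * hE

include hD in
theorem metric_conformal {p : Amb} (hp : p ∈ cylinder D c) {u v : Amb} (hu : IsTangent p u)
    (hv : IsTangent p v) : g p u v = exp (2 * timeFn K s0 p) *
      g (p.1, s0, p.2.2)
        (tInvDer D c K s0 (p.1, s0, p.2.2) (tDer D c K s0 p u))
        (tInvDer D c K s0 (p.1, s0, p.2.2) (tDer D c K s0 p v)) := by
  have h := eq_of_hasDerivAt_zero_neg (fun s hs => metric_conformal_aux hD hg
    (q := p.1) (s := s) (θ := p.2.2) ⟨hp.1, hp.2.1, hs, hp.2.2.2⟩ (x := tDer D c K s0 p u)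
    (x' := tDer D c K s0 p v) hu hv) hp.2.2.1 hg.s₀_neg
  simp only [timeFn_zero, tInvDer_tDer hD hg (cyl_subset hp)] at h
  rw [mul_zero, neg_zero, exp_zero, one_mul] at h
  rw [← h, ← mul_assoc, ← exp_add]
  simp

end

/-! ## The change of variables in `q` -/

/-- `q = Q(r)` is a smooth substitution with `|dq/dr| = w`, for which `dq/dr = o(|q|^Ct)`. -/
structure IsSubst (D : Set ℝ) (Ct c : ℝ) (w rt Q : ℝ → ℝ) (r0 : ℝ) : Prop where
  root : IsRoot w rt
  w_cont : Continuous w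
  pos : 0 < r0
  smooth : ContDiff ℝ ∞ Q
  mem : ∀ r, |r| < r0 → Q r ∈ qInt D c
  zero_iff : ∀ r, Q r = 0 ↔ r = 0
  left : ∀ q ∈ D, Q (rt q) = q
  der : ∃ η : ℝ → ℝ, Continuous η ∧ ∀ r, r ≠ 0 → deriv Q r = η r * |Q r| ^ Ct

lemma exists_isRoot (n : ℕ) (hn : n ≠ 0) : ∃ rt : ℝ → ℝ,
    IsRoot (fun r => (n + 1) * |r| ^ n) rt ∧ ∀ q, rt q * |rt q| ^ n = q := by
  set f : ℝ → ℝ := fun r => r * |r| ^ n with hf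
  have hcont : Continuous f := by fun_prop
  have hmono : StrictMono f := by
    refine strictMono_of_odd_strictMonoOn_nonneg (fun x => by simp [hf]) fun x hx y hy hxy => ?_
    have hx' : (0 : ℝ) ≤ x := hx
    have hy' : (0 : ℝ) ≤ y := hy
    have h1 := pow_lt_pow_left₀ hxy hx' (Nat.succ_ne_zero n)
    simpa only [hf, abs_of_nonneg hx', abs_of_nonneg hy', ← pow_succ'] using h1
  have htop : Tendsto f atTop atTop := by
    refine tendsto_atTop_mono' _ ?_ tendsto_id
    filter_upwards [eventually_ge_atTop (1 : ℝ)] with x hx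
    exact le_mul_of_one_le_right (by simp; linarith) (one_le_pow₀ (by grind))
  have hbot : Tendsto f atBot atBot := by
    refine tendsto_atBot_mono' _ ?_ tendsto_id
    filter_upwards [eventually_le_atBot (-1 : ℝ)] with x hx
    have h1 : (1 : ℝ) ≤ |x| ^ n := one_le_pow₀ (by grind)
    simp only [hf, id]
    nlinarith
  have hsurj := hcont.surjective htop hbot
  set e := hmono.orderIsoOfSurjective f hsurj with he
  have hfe : ∀ q, f (e.symm q) = q := fun q => e.apply_symm_apply q
  have h0 : e.symm 0 = 0 := by rw [OrderIso.symm_apply_eq]; simp [he, hf]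
  have hd : ∀ r, r ≠ 0 → HasDerivAt f ((n + 1) * |r| ^ n) r := fun r hr => by
    have h1 := (hasDerivAt_id r).mul ((hasDerivAt_abs hr).pow n)
    refine h1.congr_deriv ?_
    obtain ⟨m, rfl⟩ := Nat.exists_eq_succ_of_ne_zero hn
    have h2 := self_mul_sign r
    simp only [id, Nat.succ_sub_one, Nat.succ_eq_add_one, Pi.pow_apply, Nat.cast_add, Nat.cast_one]
    have h3 : r * ((↑m + 1) * |r| ^ m * (SignType.sign r : ℝ)) = (m + 1) * |r| ^ (m + 1) := by
      rw [pow_succ, ← h2]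
      ring
    rw [h3]
    ring
  refine ⟨e.symm, ⟨e.symm.continuous, h0, e.symm.strictMono, fun q hq => ?_⟩, hfe⟩
  have hne : e.symm q ≠ 0 := fun h => hq (by grind)
  have hw : ((n : ℝ) + 1) * |e.symm q| ^ n ≠ 0 := by positivity
  exact ⟨hw, HasDerivAt.of_local_left_inverse e.symm.continuous.continuousAt (hd _ hne) hw
    (Eventually.of_forall hfe)⟩

lemma exists_isSubst (hD : IsSide D) {Ct c : ℝ} (hCt : 0 < Ct) (hCt1 : Ct < 1)
    (hc : 0 < c) : ∃ w rt Q r0, IsSubst D Ct c w rt Q r0 := by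
  obtain ⟨m, hm⟩ := exists_nat_gt (1 / (1 - Ct))
  have hCt' : 0 < 1 - Ct := by linarith
  have hm1 : 1 < (m : ℝ) * (1 - Ct) := by rwa [div_lt_iff₀ hCt'] at hm
  have hm0 : 1 ≤ m := by
    by_contra h
    have : m = 0 := by omega
    simp [this] at hm1
    linarith
  obtain ⟨e, n, he, hnm, hD1, hD2⟩ : ∃ (e : ℝ) (n : ℕ), |e| = 1 ∧ m ≤ n ∧
      (∀ r : ℝ, e * r ^ (n + 1) ∈ D) ∧
      ∀ r : ℝ, r * |r| ^ n ∈ D → e * r ^ (n + 1) = r * |r| ^ n := by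
    rcases hD with rfl | rfl | rfl
    · refine ⟨1, 2 * m, by simp, by omega, fun _ => mem_univ _, fun r _ => ?_⟩
      rw [Even.pow_abs ⟨m, by ring⟩]
      ring
    · refine ⟨1, 2 * m + 1, by simp, by omega, fun r => ?_, fun r hr => ?_⟩
      · simp only [one_mul, mem_Ici]; exact Even.pow_nonneg ⟨m + 1, by ring⟩ r
      · have hr' : 0 ≤ r * |r| ^ (2 * m + 1) := hr
        have h0 : 0 ≤ r := by
          by_contra hneg
          push Not at hneg
          have : 0 < |r| ^ (2 * m + 1) := pow_pos (abs_pos.2 hneg.ne) _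
          nlinarith
        rw [abs_of_nonneg h0]
        ring
    · refine ⟨-1, 2 * m + 1, by simp, by omega, fun r => ?_, fun r hr => ?_⟩
      · simp only [neg_mul, one_mul, mem_Iic, Left.neg_nonpos_iff]
        exact Even.pow_nonneg ⟨m + 1, by ring⟩ r
      · have hr' : r * |r| ^ (2 * m + 1) ≤ 0 := hr
        have h0 : r ≤ 0 := by
          by_contra hneg
          push Not at hneg
          have : 0 < |r| ^ (2 * m + 1) := pow_pos (abs_pos.2 hneg.ne') _
          nlinarith
        rw [abs_of_nonpos h0, Odd.neg_pow ⟨m, rfl⟩]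
        ring
  have he0 : e ≠ 0 := fun h => by simp [h] at he
  obtain ⟨rt, hrt, hrt'⟩ := exists_isRoot n (by omega)
  have hQd : ∀ r, deriv (fun r : ℝ => e * r ^ (n + 1)) r = e * ((n + 1) * r ^ n) := fun r => by simp
  have hn0 : n ≠ 0 := by omega
  set a : ℝ := n - (n + 1) * Ct with ha
  have ha0 : 0 < a := by
    have h1 : (m : ℝ) ≤ n := by exact_mod_cast hnm
    rw [ha]
    nlinarith
  refine ⟨_, rt, fun r => e * r ^ (n + 1), min 1 c, hrt, by fun_prop, lt_min one_pos hc,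
    by fun_prop, fun r hr => ⟨hD1 r, abs_lt.1 ?_⟩, fun r => by simp [he0], fun q hq => ?_,
    fun r => e * ((n + 1) * r ^ n) / |e * r ^ (n + 1)| ^ Ct, ?_, fun r hr => ?_⟩
  · rw [abs_mul, he, one_mul, abs_pow]
    have h1 := hr.trans_le (min_le_left _ _)
    exact (pow_le_of_le_one (abs_nonneg _) h1.le (Nat.succ_ne_zero n)).trans_lt
      (hr.trans_le (min_le_right _ _))
  · have h1 := hrt' q; change e * rt q ^ (n + 1) = q; rw [hD2 _ (by rw [h1]; exact hq), h1]
  · rw [continuous_iff_continuousAt]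
    intro r
    rcases eq_or_ne r 0 with rfl | hr
    · have h1 : ∀ r : ℝ, ‖e * ((n + 1) * r ^ n) / |e * r ^ (n + 1)| ^ Ct‖ ≤ (n + 1) * |r| ^ a := by
        intro r
        rcases eq_or_ne r 0 with rfl | hr
        · simp [hn0]; positivity
        · have hr' := abs_pos.2 hr
          have h2 : |r| ^ a = |r| ^ n / (|r| ^ (n + 1)) ^ Ct := by
            rw [ha, Real.rpow_sub hr', Real.rpow_natCast, Real.rpow_mul hr'.le]
            congr 2
            exact_mod_cast Real.rpow_natCast |r| (n + 1)
          have h3 : |((n : ℝ) + 1)| = n + 1 := abs_of_pos (by positivity)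
          rw [Real.norm_eq_abs, abs_div, abs_mul, he, one_mul, abs_mul, h3, abs_pow, h2,
            abs_of_nonneg (Real.rpow_nonneg (abs_nonneg _) _), abs_mul, he, one_mul, abs_pow,
            mul_div_assoc]
      have h4 : Tendsto (fun r : ℝ => ((n : ℝ) + 1) * |r| ^ a) (𝓝 0) (𝓝 0) := by
        have h5 : ContinuousAt (fun r : ℝ => ((n : ℝ) + 1) * |r| ^ a) 0 :=
          continuousAt_const.mul ((Real.continuous_rpow_const ha0.le).comp
              continuous_abs).continuousAt
        simpa [ContinuousAt, Real.zero_rpow ha0.ne'] using h5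
      have h6 := squeeze_zero_norm h1 h4
      simpa [ContinuousAt, hn0] using h6
    · have h1 : |e * r ^ (n + 1)| ≠ 0 := by simp [he0, hr]
      refine ContinuousAt.div (by fun_prop) (ContinuousAt.rpow_const (by fun_prop) (Or.inl h1)) ?_
      exact (Real.rpow_pos_of_pos (abs_pos.2 (abs_ne_zero.1 h1)) _).ne'
  · have h1 : |e * r ^ (n + 1)| ≠ 0 := by simp [he0, hr]
    rw [hQd, div_mul_cancel₀]
    exact (Real.rpow_pos_of_pos (abs_pos.2 (abs_ne_zero.1 h1)) _).ne'

/-! ## Regularity of the metric components after the change of variables -/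

section

/-- The coordinate domain after the substitution. -/
def substDom (φ : SphereChart) (r0 : ℝ) : Set (ℝ × (Fin 3 → ℝ)) := {p | |p.1| < r0 ∧ p.2 ∈ φ.slice}

lemma isOpen_substDom (φ : SphereChart) (r0 : ℝ) : IsOpen (substDom φ r0) :=
  (isOpen_lt (g := fun _ => r0)
    (by fun_prop) (by fun_prop)).inter (φ.isOpen_slice.preimage continuous_snd)

variable (hQ : IsSubst D Ct c w rt Q r0)
include hQ

lemma IsSubst.vecCons_mem {φ : SphereChart} {p : ℝ × (Fin 3 → ℝ)} (hp : p ∈ substDom φ r0) :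
    vecCons (Q p.1) p.2 ∈ φ.dom D c :=
  φ.vecCons_mem.2 ⟨⟨(hQ.mem _ hp.1).1, abs_lt.2 (hQ.mem _ hp.1).2⟩, hp.2⟩

lemma IsSubst.continuous_vecCons :
    Continuous fun p : ℝ × (Fin 3 → ℝ) => (vecCons (Q p.1) p.2 : R4) := by
  refine continuous_pi fun i => Fin.cases ?_ (fun j => ?_) i
  · exact hQ.smooth.continuous.comp continuous_fst
  · exact (continuous_apply j).comp continuous_snd

lemma IsC0Ck.isC0C1 {φ : SphereChart} {F : R4 → ℝ} (h : IsC0Ck 1 F (φ.dom D c)) :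
    IsC0C1On (fun p : ℝ × (Fin 3 → ℝ) => F (vecCons (Q p.1) p.2)) (substDom φ r0) := by
  have hm : MapsTo (fun p => (vecCons (Q p.1) p.2))
      (substDom φ r0) (φ.dom D c) := fun p hp => hQ.vecCons_mem hp
  refine ⟨?_, fun p hp => h.differentiableAt one_ne_zero (hQ.vecCons_mem hp), ?_⟩
  · exact (continuousMultilinearCurryFin0 ℝ (Fin 3 → ℝ) ℝ).continuous.comp_continuousOn
        ((h.2 0 (by norm_num)).comp hQ.continuous_vecCons.continuousOn hm)
  · refine ((continuousMultilinearCurryFin1 ℝ (Fin 3 → ℝ) ℝ).continuous.comp_continuousOn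
        ((h.2 1 le_rfl).comp hQ.continuous_vecCons.continuousOn hm)).congr fun p hp => ?_
    refine ContinuousLinearMap.ext fun v => ?_
    simp

lemma IsC0Ck.isC0C1_fderiv {φ : SphereChart} {F : R4 → ℝ} (h : IsC0Ck 2 F (φ.dom D c)) :
    IsC0C1On (fun p : ℝ × (Fin 3 → ℝ) => fderiv ℝ (fun w => F (vecCons (Q p.1) w)) p.2)
      (substDom φ r0) := by
  have h1 : IsC0Ck 1 F (φ.dom D c) :=
    ⟨fun q => (h.1 q).of_le (by norm_num), fun j hj => h.2 j (by omega)⟩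
  refine ⟨(h1.isC0C1 hQ).cont_fderiv, fun p hp => ?_, ?_⟩
  · have h3 := h.1 (Q p.1)
    rw [φ.slice_eq (q := Q p.1) (φ.dom_fst (hQ.vecCons_mem hp))] at h3
    exact ((h3.fderiv_of_isOpen φ.isOpen_slice (by norm_num)).differentiableOn
      one_ne_zero).differentiableAt (φ.isOpen_slice.mem_nhds hp.2)
  · set M := (continuousMultilinearCurryFin1 ℝ (Fin 3 → ℝ) ℝ) with hM
    have h5 : ContinuousOn (fun p : ℝ × (Fin 3 → ℝ) => fderiv ℝ (iteratedFDeriv ℝ 1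
          (fun w : Fin 3 → ℝ => F (vecCons (Q p.1) w))) p.2) (substDom φ r0) :=
      ((continuousMultilinearCurryLeftEquiv ℝ (fun _ : Fin 2 => Fin 3 → ℝ)
          ℝ).continuous.comp_continuousOn ((h.2 2 le_rfl).comp hQ.continuous_vecCons.continuousOn
              fun p hp => hQ.vecCons_mem hp)).congr fun p hp => by
        rfl
    refine (continuousOn_const.clm_comp
      (g := fun _ => (M.toContinuousLinearEquiv : _ →L[ℝ] _)) h5).congr fun p hp => ?_
    have h6 : (fderiv ℝ fun w => F (vecCons (Q p.1) w))
        = M ∘ iteratedFDeriv ℝ 1 (fun w : Fin 3 → ℝ => F (vecCons (Q p.1) w)) := by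
      funext x
      refine ContinuousLinearMap.ext fun v => ?_
      change _ = iteratedFDeriv ℝ 1 (fun w : Fin 3 → ℝ => F (vecCons (Q p.1) w)) x _
      rw [iteratedFDeriv_one_apply]
      rfl
    change fderiv ℝ (fderiv ℝ fun w => F (vecCons (Q p.1) w)) p.2 = _
    rw [h6]
    exact LinearIsometryEquiv.comp_fderiv M

omit hQ in
lemma IsSide.mem_nhds (hD : IsSide D) {q : ℝ} (hq : q ∈ D) (h0 : q ≠ 0) : D ∈ 𝓝 q := by
  rcases hD with rfl | rfl | rfl
  · exact univ_mem
  · exact Ici_mem_nhds (lt_of_le_of_ne hq h0.symm)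
  · exact Iic_mem_nhds (lt_of_le_of_ne hq h0)

omit hQ in
lemma SphereChart.off_mem_nhds (hD : IsSide D) (φ : SphereChart) {z : R4}
    (hz : z ∈ φ.dom D c) (h0 : z 0 ≠ 0) : φ.dom D c ∩ {z | z 0 ≠ 0} ∈ 𝓝 z := by
  filter_upwards [(continuous_apply 0).continuousAt.eventually (hD.mem_nhds hz.1 h0),
      (continuous_apply 0).abs.continuousAt.eventually (gt_mem_nhds hz.2.1), (continuous_pi fun i =>
          continuous_apply i.succ).continuousAt.eventually (φ.isOpen_slice.mem_nhds
              (φ.tail_mem hz)), (continuous_apply 0).continuousAt.eventually_ne h0] with z' a1 a2 a3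
                  a4
  refine ⟨?_, a4⟩
  rw [← SphereChart.vecCons_tail z', SphereChart.vecCons_mem]
  exact ⟨⟨a1, a2⟩, a3⟩

omit hQ in
lemma hasFDerivAt_metric (hD : IsSide D) {N : ℕ} {A ε : ℝ} {g : BilinField} {K : Amb → Amb}
    {s0 : ℝ} (hg : IsTwistedSelfSimilar D Ct N A ε c g K s0) (φ : SphereChart) {z : R4}
    (hz : z ∈ φ.dom D c) (h0 : z 0 ≠ 0) (μ ν : Fin 4) : ∃ L : R4 →L[ℝ] ℝ,
      HasFDerivAt (fun z' => φ.metric g z' μ ν) L z ∧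
      ∀ v, L v = ∑ σ, φ.partial_ D c σ (fun z' => φ.metric g z' μ ν) z * v σ := by
  have hopen := φ.off_mem_nhds hD hz h0
  have hd := ((hg.regular_off φ μ ν).differentiableOn (by norm_num)).differentiableAt hopen
  refine ⟨_, hd.hasFDerivAt, fun v => ?_⟩
  conv_lhs => rw [← Finset.univ_sum_single v, map_sum]
  refine Finset.sum_congr rfl fun σ _ => ?_
  have h5 : φ.partial_ D c σ (fun z' => φ.metric g z' μ ν) z
      = fderiv ℝ (fun z' => φ.metric g z' μ ν) z (Pi.single σ 1) := by
    change derivWithin _ _ _ = _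
    rw [derivWithin_of_mem_nhds]
    · exact HasDerivAt.deriv (hd.hasFDerivAt.hasLineDerivAt (Pi.single σ 1))
    · exact (by fun_prop : Continuous fun t =>
          z + t • (Pi.single σ 1)).continuousAt.preimage_mem_nhds (by simp_all)
  rw [h5, mul_comm, ← smul_eq_mul, ← map_smul, ← Pi.single_smul, smul_eq_mul, mul_one]

omit hQ in
lemma hasDerivAt_metric_q (hD : IsSide D) {N : ℕ} {A ε : ℝ} {g : BilinField} {K : Amb → Amb}
    {s0 : ℝ} (hg : IsTwistedSelfSimilar D Ct N A ε c g K s0) (φ : SphereChart) {z : R4}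
    (hz : z ∈ φ.dom D c) (h0 : z 0 ≠ 0) (μ ν : Fin 4) :
    HasDerivAt (fun q => φ.metric g (vecCons q (vecTail z)) μ ν)
      (φ.partial_ D c 0 (fun z' => φ.metric g z' μ ν) z) (z 0) := by
  obtain ⟨L, hL, h5⟩ := hasFDerivAt_metric hD hg φ hz h0 μ ν
  have h6 : HasDerivAt (fun q => (vecCons q (vecTail z))) (Pi.single 0 1) (z 0) := by
    rw [hasDerivAt_pi]
    intro i
    refine Fin.cases ?_ (fun j => ?_) i
    · exact hasDerivAt_id _
    · exact hasDerivAt_const (z 0) (vecTail z j)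
  refine (HasFDerivAt.comp_hasDerivAt (z 0)
    (by rw [SphereChart.vecCons_tail]; exact hL) h6).congr_deriv ?_
  rw [h5]
  simp [Pi.single_apply]

theorem IsSubst.metric_reg (hD : IsSide D) {N : ℕ} {A ε : ℝ} {g : BilinField}
    {K : Amb → Amb} {s0 : ℝ} (hg : IsTwistedSelfSimilar D Ct N A ε c g K s0) (φ : SphereChart)
    (μ ν : Fin 4) :
    IsRegOn (fun p : ℝ × (Fin 3 → ℝ) => φ.metric g (vecCons (Q p.1) p.2) μ ν)
      (substDom φ r0) := by
  obtain ⟨η, hη, hηQ⟩ := hQ.der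
  have hreg1 :=
    IsC0Ck.isC0C1 (F := fun z => φ.metric g z μ ν) hQ
      ⟨fun q => ((hg.regular φ μ ν).1 q).of_le (by norm_num),
        fun j hj => (hg.regular φ μ ν).2 j (by omega)⟩
  have hG :=
    (IsC0C1On.of_continuousOn_fst hη).bilin (ContinuousLinearMap.mul ℝ ℝ)
        ((hg.regular_q φ μ ν).isC0C1 hQ)
  have hoff : ∀ p ∈ substDom φ r0, p.1 ≠ 0 →
      HasDerivAt (fun r => φ.metric g (vecCons (Q r) p.2) μ ν)
        (η p.1 * (fun z : R4 =>
          if z 0 = 0 then 0 else |z 0| ^ Ct * φ.partial_ D c 0 (fun z' => φ.metric g z' μ ν) z)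
          (vecCons (Q p.1) p.2)) p.1 := by
    intro p hp h0
    have hQ0 : Q p.1 ≠ 0 := fun h => h0 ((hQ.zero_iff _).1 h)
    refine HasDerivAt.congr_deriv (HasDerivAt.comp p.1 (hasDerivAt_metric_q hD hg φ
        (hQ.vecCons_mem hp) hQ0 μ ν) (hQ.smooth.differentiable (by norm_num) p.1).hasDerivAt) ?_
    rw [hηQ _ h0]
    simp only [Matrix.cons_val_zero, hQ0, if_false]
    ring
  have hd : ∀ p ∈ substDom φ r0,
      HasDerivAt (fun r => φ.metric g (vecCons (Q r) p.2) μ ν)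
        (η p.1 * (fun z : R4 =>
          if z 0 = 0 then 0 else |z 0| ^ Ct * φ.partial_ D c 0 (fun z' => φ.metric g z' μ ν) z)
          (vecCons (Q p.1) p.2)) p.1 := by
    intro p hp
    rcases eq_or_ne p.1 0 with h0 | h0
    · have hcl : Continuous fun r : ℝ => (r, p.2) := by fun_prop
      have hpm := hp
      refine hasDerivAt_of_eventually_ne (g := fun r => η r * (fun z : R4 =>
          if z 0 = 0 then 0 else |z 0| ^ Ct * φ.partial_ D c 0 (fun z' => φ.metric g z' μ ν) z)
          (vecCons (Q r) p.2)) ?_ ?_ ?_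
      · filter_upwards [by rw [h0]; exact self_mem_nhdsWithin, mem_nhdsWithin_of_mem_nhds
            (hcl.continuousAt.preimage_mem_nhds ((isOpen_substDom φ r0).mem_nhds hpm))] with r hr
                hrm
        exact hoff (r, p.2) hrm hr
      · exact ContinuousAt.comp (f := fun r : ℝ => (r, p.2))
          (hreg1.cont.continuousAt ((isOpen_substDom φ r0).mem_nhds hpm)) hcl.continuousAt
      · exact ContinuousAt.comp (f := fun r : ℝ => (r, p.2)) (hG.cont.continuousAt
          ((isOpen_substDom φ r0).mem_nhds hpm)) hcl.continuousAt
    · exact hoff p hp h0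
  refine IsRegOn.of_hasFDerivAt (isOpen_substDom φ r0) (hreg1.contDiffOn_of_hasDerivAt
      (isOpen_substDom φ r0) hG.cont hd).2 ?_
  have h3 := ((hg.regular φ μ ν).isC0C1_fderiv hQ).clm
      ((compL ℝ (ℝ × (Fin 3 → ℝ)) (Fin 3 → ℝ) ℝ).flip
    (snd ℝ ℝ (Fin 3 → ℝ)))
  exact (hG.clm ((compL ℝ (ℝ × (Fin 3 → ℝ)) ℝ ℝ).flip (fst ℝ ℝ (Fin 3 → ℝ)) ∘L smulRightL ℝ ℝ ℝ
      (1 : ℝ →L[ℝ] ℝ))).add h3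

end

/-! ## The reduced metric of a twisted self-similar spacetime -/

lemma hasFDerivAt_nrm {θ : E3} (h : θ ≠ 0) : HasFDerivAt nrm (fderiv ℝ nrm θ) θ :=
  ((contDiffAt_nrm (n := 1) h).differentiableAt (by norm_num)).hasFDerivAt

lemma fderiv_nrm_eq {θ : E3} (h : θ ≠ 0) (u : E3) :
    u = (inner ℝ θ u / ‖θ‖) • nrm θ + ‖θ‖ • fderiv ℝ nrm θ u := by
  have h1 :=
    (hasFDerivAt_id (𝕜 := ℝ) θ).congr_of_eventuallyEq (by
      filter_upwards [isOpen_ne_zero.mem_nhds h] with θ hθ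
      exact norm_smul_nrm θ)
  have h2 := DFunLike.congr_fun (((hasFDerivAt_norm_of_ne h).smul (hasFDerivAt_nrm h)).unique h1) u
  simp only [add_apply, smul_apply, ContinuousLinearMap.smulRight_apply,
      ContinuousLinearMap.id_apply,
    innerSL_apply_apply] at h2
  rw [add_comm] at h2
  conv_lhs => rw [← h2]
  ring

lemma fderiv_nrm_self {θ : E3} (h : θ ≠ 0) : fderiv ℝ nrm θ θ = 0 := by
  have h1 := fderiv_nrm_eq h θ
  have h2 := norm_ne_zero_iff.2 h
  rw [real_inner_self_eq_norm_sq, pow_two, mul_div_cancel_right₀ _ h2, norm_smul_nrm] at h1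
  exact (smul_eq_zero.1 (left_eq_add.1 h1)).resolve_left h2

lemma fderiv_nrm_of_inner {θ u : E3} (h : θ ≠ 0) (hu : inner ℝ θ u = 0) :
    ‖θ‖ • fderiv ℝ nrm θ u = u := by
  have h1 := fderiv_nrm_eq h u
  rw [hu, zero_div, zero_smul, zero_add] at h1
  exact h1.symm

lemma inner_fderiv_nrm {θ : E3} (h : θ ≠ 0) (u : E3) : inner ℝ (nrm θ) (fderiv ℝ nrm θ u) = 0 := by
  have h1 := congrArg (fun v => inner ℝ (nrm θ) v) (fderiv_nrm_eq h u)
  simp [inner_add_right, inner_smul_right, norm_nrm h] at h1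
  have h3 : inner ℝ (nrm θ) u = inner ℝ θ u / ‖θ‖ := by rw [nrm, real_inner_smul_left]; ring
  simp_all

lemma fderiv_nrm_smul {θ : E3} (h : θ ≠ 0) {a : ℝ} (ha : 0 < a) (u : E3) :
    fderiv ℝ nrm (a • θ) (a • u) = fderiv ℝ nrm θ u := by
  have h1 : HasFDerivAt (fun θ => nrm (a • θ))
      ((fderiv ℝ nrm (a • θ)).comp (a • ContinuousLinearMap.id ℝ E3)) θ :=
    HasFDerivAt.comp θ (hasFDerivAt_nrm (smul_ne_zero ha.ne' h))
      ((hasFDerivAt_id θ).const_smul a)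
  simp only [nrm_smul ha] at h1
  exact DFunLike.congr_fun (h1.unique (hasFDerivAt_nrm h)) u

/-- The linear map to the tangent space at `s = s0` in the coordinates `(r, T, θ)`. -/
def redLin (Q : ℝ → ℝ) (K : Amb → Amb) (s0 : ℝ) (p : ℝ × E3) : Amb →L[ℝ] Amb :=
  covq.prod ((kap K (Q p.1, s0, p.2) • covx).prod
    (fderiv ℝ nrm p.2 ∘L snd ℝ ℝ E3 ∘L snd ℝ ℝ (ℝ × E3)))

/-- The radial covector. -/
def radCov (θ : E3) : Cov :=
  innerSL ℝ θ ∘L snd ℝ ℝ E3 ∘L snd ℝ ℝ (ℝ × E3)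

@[simp] lemma radCov_apply (θ : E3) (u : Amb) : radCov θ u = inner ℝ θ u.2.2 := rfl

/-- The metric at `s = s0` in the coordinates `(r, T, θ)`, extended to `ℝ × ℝ × (ℝ³ ∖ 0)`. -/
def redM (g : BilinField) (Q : ℝ → ℝ) (K : Amb → Amb) (s0 : ℝ) (p : ℝ × E3) : Bil :=
  (g (Q p.1, s0, nrm p.2)).bilinearComp (redLin Q K s0 p) (redLin Q K s0 p)
    + ((‖p.2‖ ^ 4)⁻¹ • radCov p.2).smulRight (radCov p.2)

section

variable (hD : IsSide D) (hQ : IsSubst D Ct c w rt Q r0) (hg : IsTwistedSelfSimilar D Ct N A ε c g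
  K s0)

lemma redLin_apply (p : ℝ × E3) (u : Amb) : redLin Q K s0 p u
    = (u.1, kap K (Q p.1, s0, p.2) * u.2.1, fderiv ℝ nrm p.2 u.2.2) := rfl

lemma redM_apply (p : ℝ × E3) (u v : Amb) : redM g Q K s0 p u v
    = g (Q p.1, s0, nrm p.2) (redLin Q K s0 p u) (redLin Q K s0 p v)
      + (‖p.2‖ ^ 4)⁻¹ * inner ℝ p.2 u.2.2 * inner ℝ p.2 v.2.2 := by simp [redM]

lemma isTangent_redLin {p : ℝ × E3} (hp : p.2 ≠ 0) (u : Amb) :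
    IsTangent (Q p.1, s0, nrm p.2) (redLin Q K s0 p u) := inner_fderiv_nrm hp _

include hQ hg in
lemma sphere_mem {p : ℝ × E3} (h1 : |p.1| < r0) (hp : p.2 ≠ 0) :
    (Q p.1, s0, nrm p.2) ∈ cylinder D c :=
  ⟨(hQ.mem _ h1).1, abs_lt.2 (hQ.mem _ h1).2, hg.s₀_neg, norm_nrm hp⟩

include hQ hg in
lemma sphere_mem_cone {p : ℝ × E3} (h1 : |p.1| < r0) (hp : p.2 ≠ 0) :
    (Q p.1, s0, p.2) ∈ cDom D c := ⟨hQ.mem _ h1, hg.s₀_neg, hp⟩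

omit hg in
lemma IsLorentzianAt.nondeg {p : Amb} (h : IsLorentzianAt g p) {u : Amb} (hu : IsTangent p u)
    (h0 : ∀ v, IsTangent p v → g p u v = 0) : u = 0 := by
  obtain ⟨hsymm, τ, hτ, -, hpos⟩ := h
  by_contra hne
  have h1 := hpos u hu (by rw [hsymm τ u hτ hu, h0 τ hτ]) hne
  rw [h0 u hu] at h1
  exact lt_irrefl _ h1

include hQ hg in
lemma redLin_surj {p : ℝ × E3} (h1 : |p.1| < r0) (hp : p.2 ≠ 0) {v : Amb}
    (hv : IsTangent (Q p.1, s0, nrm p.2) v) : redLin Q K s0 p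
      (v.1, (kap K (Q p.1, s0, p.2))⁻¹ * v.2.1, ‖p.2‖ • v.2.2) = v := by
  have hk := kap_ne hg (sphere_mem_cone hQ hg h1 hp)
  have h3 : inner ℝ p.2 v.2.2 = 0 := by
    have h4 : inner ℝ (‖p.2‖ • nrm p.2) v.2.2 = 0 := by
      rw [real_inner_smul_left, show inner ℝ (nrm p.2) v.2.2 = 0 from hv, mul_zero]
    rwa [norm_smul_nrm] at h4
  rw [redLin_apply]
  refine Prod.ext rfl (Prod.ext ?_ ?_)
  · grind
  · change fderiv ℝ nrm p.2 (‖p.2‖ • v.2.2) = v.2.2; rw [map_smul, fderiv_nrm_of_inner hp h3]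

include hD hQ hg in
lemma redM_reg :
    IsRegOn (redM g Q K s0) {p | |p.1| < r0 ∧ p.2 ≠ 0} := by
  refine IsRegOn.of_locally fun p hp => ?_
  have hp' := sphere_mem hQ hg hp.1 hp.2
  obtain ⟨φ, z, hz, hzp⟩ := exists_chart hp'
  obtain ⟨Y, O, hO, hY, h1, h2⟩ := φ.exists_inverse
  have hχ : φ.χ ![z 2, z 3] = nrm p.2 := (congrArg (fun u : Amb => u.2.2) hzp :)
  have hpO : p.2 ∈ O := by
    have := (h2 _ hz.2.2.2 ‖p.2‖ (norm_pos_iff.2 hp.2)).1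
    rwa [hχ, norm_smul_nrm] at this
  set Ω : Set (ℝ × E3) := {p | |p.1| < r0 ∧ p.2 ∈ O} with hΩ
  have hΩo : IsOpen Ω := (isOpen_lt (g := fun _ => r0)
    (by fun_prop) (by fun_prop)).inter (hO.preimage continuous_snd)
  refine ⟨Ω, hΩo, ⟨hp.1, hpO⟩, ?_⟩
  have hYs : ContDiffOn ℝ ∞ (fun p : ℝ × E3 => Y p.2) Ω := hY.comp contDiffOn_snd fun p hp => hp.2
  have hYi := fun i => contDiffOn_pi.1 hYs i
  have hY' : ContDiffOn ℝ ∞ (fun p : ℝ × E3 => fderiv ℝ Y p.2) Ω :=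
    (hY.fderiv_of_isOpen hO (by norm_num)).comp contDiffOn_snd fun p hp => hp.2
  have hκ : ContDiffOn ℝ ∞ (fun p : ℝ × E3 => kap K (Q p.1, s0, p.2)) Ω := by
    refine (kap_contDiffOn hg).comp ?_
      fun p hp => sphere_mem_cone hQ hg hp.1 (h1 _ hp.2).1
    exact ((hQ.smooth.comp contDiff_fst).prodMk (contDiff_const.prodMk contDiff_snd)).contDiffOn
  set η : Fin 4 → ℝ × E3 → Cov := ![fun _ => covq, fun p => kap K (Q p.1, s0, p.2) • covx,
    fun p => (proj 0 ∘L fderiv ℝ Y p.2) ∘L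
      (snd ℝ ℝ E3 ∘L snd ℝ ℝ (ℝ × E3)),
    fun p => (proj 1 ∘L fderiv ℝ Y p.2) ∘L
      (snd ℝ ℝ E3 ∘L snd ℝ ℝ (ℝ × E3))] with hη
  have hηr : ∀ μ, IsRegOn (η μ) Ω := fun μ => by
    refine IsRegOn.of_contDiffOn hΩo (ContDiffOn.of_le ?_
      two_le_infty)
    fin_cases μ
    · exact contDiffOn_const
    · exact hκ.smul contDiffOn_const
    · exact (contDiffOn_const.clm_comp hY').clm_comp contDiffOn_const
    · exact (contDiffOn_const.clm_comp hY').clm_comp contDiffOn_const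
  have hGr := fun μ ν => by
    refine IsRegOn.comp (isOpen_substDom φ r0) hΩo (hQ.metric_reg hD hg φ μ ν)
      (m := fun p : ℝ × E3 => ![s0, Y p.2 0, Y p.2 1]) ?_ fun p hp => ⟨hp.1, hg.s₀_neg, ?_⟩
    · refine ContDiffOn.of_le ?_
        two_le_infty
      rw [contDiffOn_pi]
      intro i
      fin_cases i
      · exact contDiffOn_const
      · exact hYi 0
      · exact hYi 1
    · have : (![Y p.2 0, Y p.2 1] : Fin 2 → ℝ) = Y p.2 := by funext i; fin_cases i <;> rfl
      change (![Y p.2 0, Y p.2 1] : Fin 2 → ℝ) ∈ φ.U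
      rw [this]
      exact (h1 _ hp.2).2.1
  have hrad : IsRegOn (fun p : ℝ × E3 => ((‖p.2‖ ^ 4)⁻¹ • radCov p.2).smulRight (radCov p.2))
      Ω := by
    refine IsRegOn.of_contDiffOn hΩo ?_
    have hn : ContDiffOn ℝ 2 (fun p : ℝ × E3 => (‖p.2‖ ^ 4)⁻¹) Ω := fun p hp => by
      refine ContDiffAt.contDiffWithinAt ?_
      have h3 : ContDiffAt ℝ 2 (fun p : ℝ × E3 => ‖p.2‖) p :=
        ContDiffAt.norm ℝ contDiffAt_snd (h1 _ hp.2).1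
      exact (h3.pow 4).inv (pow_ne_zero _ (norm_ne_zero_iff.2 (h1 _ hp.2).1))
    have hr : ContDiffOn ℝ 2 (fun p : ℝ × E3 => radCov p.2) Ω :=
      ContDiffOn.clm_comp (((innerSL ℝ).contDiff.comp contDiff_snd).contDiffOn) contDiffOn_const
    exact (hn.smul hr).smulRight hr
  have hsum : IsRegOn (fun p : ℝ × E3 => ∑ μ, ∑ ν, ((φ.metric g
      (vecCons (Q p.1) ![s0, Y p.2 0, Y p.2 1]) μ ν) • η μ p).smulRight (η ν p)) Ω := by
    refine IsRegOn.sum _ hΩo fun μ _ => IsRegOn.sum _ hΩo fun ν _ => ?_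
    have h3 := (hGr μ ν).bilin hΩo (lsmul ℝ ℝ) (hηr μ)
    exact h3.bilin hΩo (smulRightL ℝ Amb Cov) (hηr ν)
  refine (hsum.add hΩo hrad).congr hΩo fun p hp => ?_
  have hp0 := (h1 _ hp.2).1
  refine ContinuousLinearMap.ext fun u => ContinuousLinearMap.ext fun v => ?_
  set ζ : R4 := vecCons (Q p.1) ![s0, Y p.2 0, Y p.2 1] with hζ
  have hζY : ![ζ 2, ζ 3] = Y p.2 := by funext i; fin_cases i <;> rfl
  have hpt : φ.point ζ = (Q p.1, s0, nrm p.2) := by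
    change (Q p.1, s0, φ.χ ![ζ 2, ζ 3]) = _
    rw [hζY, (h1 _ hp.2).2.2]
  have hYd :=
    ((hY.differentiableOn (by norm_num)).differentiableAt (hO.mem_nhds hp.2)).hasFDerivAt
  have hcomp : (fderiv ℝ φ.χ (Y p.2)).comp (fderiv ℝ Y p.2) = fderiv ℝ nrm p.2 := by
    have h3 := HasFDerivAt.comp p.2 (φ.hasFDerivAt_χ (h1 _ hp.2).2.1) hYd
    refine h3.unique ((hasFDerivAt_nrm hp0).congr_of_eventuallyEq ?_)
    filter_upwards [hO.mem_nhds hp.2] with θ hθ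
    exact (h1 _ hθ).2.2
  have hL : ∀ u, fderiv ℝ φ.point ζ (fun μ => η μ p u) = redLin Q K s0 p u := fun u => by
    rw [φ.fderiv_point (by rw [hζY]; exact (h1 _ hp.2).2.1), hζY, redLin_apply, ← hcomp]
    refine Prod.ext rfl (Prod.ext rfl ?_)
    have : (![η 2 p u, η 3 p u] : Fin 2 → ℝ) = fderiv ℝ Y p.2 u.2.2 := by
      funext i
      fin_cases i <;> rfl
    change fderiv ℝ φ.χ (Y p.2) ![η 2 p u, η 3 p u] = _
    rw [this]
    rfl
  rw [redM_apply, ← hpt, ← hL, ← hL, φ.metric_sum]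
  simp only [add_apply, sum_apply, ContinuousLinearMap.smulRight_apply, smul_apply, smul_eq_mul,
    radCov_apply, mul_assoc]

include hD hQ hg in
theorem isRedMetric : IsRedMetric (redM g Q K s0) r0 where
  pos := hQ.pos
  reg := redM_reg hD hQ hg
  symm p h1 hp u v := by
    rw [redM_apply, redM_apply, (hg.lorentzian _ (sphere_mem hQ hg h1 hp)).1 _ _
      (isTangent_redLin hp _) (isTangent_redLin hp _)]
    ring
  nondeg p h1 hp u hu := by
    have h2 := hu (0, 0, p.2)
    have h3 : redLin Q K s0 p (0, 0, p.2) = 0 := by rw [redLin_apply, fderiv_nrm_self hp]; simp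
    rw [redM_apply, h3, map_zero, zero_add] at h2
    have h4 : inner ℝ p.2 u.2.2 = 0 := by simp_all
    have h5 : redLin Q K s0 p u = 0 := by
      refine IsLorentzianAt.nondeg (hg.lorentzian _ (sphere_mem hQ hg h1 hp))
        (isTangent_redLin hp _) fun v hv => ?_
      have h6 := hu (v.1, (kap K (Q p.1, s0, p.2))⁻¹ * v.2.1, ‖p.2‖ • v.2.2)
      rw [redM_apply, redLin_surj hQ hg h1 hp hv, h4] at h6
      simpa using h6
    rw [redLin_apply] at h5
    have h7 := (congrArg Prod.fst h5 :)
    have h8 := (congrArg (fun u : Amb => u.2.1) h5 :)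
    have h9 : fderiv ℝ nrm p.2 u.2.2 = 0 := (congrArg (fun u : Amb => u.2.2) h5 :)
    have h10 := fderiv_nrm_of_inner hp h4
    rw [h9, smul_zero] at h10
    exact Prod.ext h7 (Prod.ext
      ((mul_eq_zero.1 h8).resolve_left (kap_ne hg (sphere_mem_cone hQ hg h1 hp))) h10.symm)
  homog p h1 hp a ha u v := by
    have h2 : ∀ u, redLin Q K s0 (p.1, a • p.2) (dilation a u) = redLin Q K s0 p u := fun u => by
      rw [redLin_apply, redLin_apply]
      simp only [dilation_apply, fderiv_nrm_smul hp ha, kap_smul _ _ _ ha]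
    rw [redM_apply, redM_apply, h2, h2]
    simp only [dilation_apply, nrm_smul ha, norm_smul, real_inner_smul_left, real_inner_smul_right,
      Real.norm_eq_abs, abs_of_pos ha]
    have hn := norm_ne_zero_iff.2 hp
    field_simp
  radial p h1 hp u := by
    have hn := norm_ne_zero_iff.2 hp
    have h3 : redLin Q K s0 p (0, 0, p.2) = 0 := by rw [redLin_apply, fderiv_nrm_self hp]; simp
    rw [redM_apply, h3, map_zero, zero_add]
    simp only [real_inner_self_eq_norm_sq]
    field_simp

include hg in
lemma sphere_pos (hε : A * ε < 1) {θ : E3} (hθ : ‖θ‖ = 1) {v : E3} (hv : inner ℝ θ v = 0)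
    (hv0 : v ≠ 0) : 0 < g (0, s0, θ) (0, 0, v) (0, 0, v) := by
  obtain ⟨T, hT, -, hb⟩ := hg.sphere_metric
  have h1 := hT θ hθ ![v, v]
  simp only [Matrix.cons_val_zero, Matrix.cons_val_one,
      (by simp [tanProj, hv] : tanProj θ v = v)] at h1
  have h2 : ‖T θ‖ ≤ A * ε := hb 0 (Nat.zero_le _) θ hθ
  have h3 : ‖T θ ![v, v]‖ ≤ ‖T θ‖ * (‖v‖ * ‖v‖) := by
    have := (T θ).le_opNorm ![v, v]
    simpa using this
  rw [h1, real_inner_self_eq_norm_sq] at h3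
  have h4 := mul_pos (norm_pos_iff.2 hv0) (norm_pos_iff.2 hv0)
  have h5 := neg_le_of_abs_le h3
  nlinarith

include hg in
lemma exists_null_generator (hD : IsSide D) (hε : A * ε < 1) {θ : E3} (hθ : ‖θ‖ = 1) :
    ∃ L : Amb, IsTangentZero (0, s0, θ) L ∧ L.2.1 ≠ 0 ∧
      ∀ v, IsTangent (0, s0, θ) v → g (0, s0, θ) L v = v.1 := by
  have hmem : ((0, s0, θ) : Amb) ∈ cylinder D c :=
    ⟨hD.zero_mem, by simpa using hg.c_pos, hg.s₀_neg, hθ⟩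
  obtain ⟨L, hL0, hL, hn⟩ := hg.null_zero (0, s0, θ) ⟨rfl, hg.s₀_neg, hθ⟩
  set l := g (0, s0, θ) L (1, 0, 0) with hl
  have h1 : ∀ v, IsTangent (0, s0, θ) v → g (0, s0, θ) L v = l * v.1 := fun v hv => by
    have h2 : v = v.1 • ((1, 0, 0) : Amb) + (0, v.2.1, v.2.2) :=
      Prod.ext (by simp) (Prod.ext (by simp) (by simp))
    have h3 := hn (0, v.2.1, v.2.2) ⟨rfl, hv⟩
    rw [h2, map_add, map_smul, h3, add_zero, smul_eq_mul, mul_comm]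
    simp [hl]
  have hl0 : l ≠ 0 := fun h => hL0 (IsLorentzianAt.nondeg (hg.lorentzian _ hmem) hL.2 fun v hv => by
    rw [h1 v hv, h, zero_mul])
  refine ⟨l⁻¹ • L, ⟨?_, ?_⟩, ?_, fun v hv => ?_⟩
  · simp [hL.1]
  · have := hL.2; simp only [IsTangent] at this ⊢; simp [inner_smul_right, this]
  · intro h
    have h4 : L.2.1 = 0 := by simpa [hl0] using h
    have h5 : L = (0, 0, L.2.2) := Prod.ext hL.1 (Prod.ext h4 rfl)
    have h6 : L.2.2 ≠ 0 := fun h => hL0 (by rw [h5, h]; rfl)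
    have h7 := sphere_pos hg hε hθ hL.2 h6
    rw [← h5, hn L hL] at h7
    exact lt_irrefl _ h7
  · simp_all

include hD hQ hg in
theorem redM_isNullAtZero (hε : A * ε < 1) : IsNullAtZero (redM g Q K s0) := by
  intro θ hθ
  have hθ0 := norm_ne_zero_iff.1 (by rw [hθ]; exact one_ne_zero)
  have hr : |((0, θ)).1| < r0 := by simpa using hQ.pos
  obtain ⟨L, hL, hL1, hLv⟩ := exists_null_generator hg hD hε hθ
  have hL2 : inner ℝ θ L.2.2 = 0 := hL.2
  refine ⟨(L.1, (kap K (Q 0, s0, θ))⁻¹ * L.2.1, ‖θ‖ • L.2.2), hL.1,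
    mul_ne_zero (inv_ne_zero (kap_ne hg (sphere_mem_cone hQ hg hr hθ0))) hL1, fun v => ?_⟩
  rw [redM_apply, redLin_surj hQ hg hr hθ0 (by simp [nrm_of_norm hθ]; exact hL.2)]
  simp only [(hQ.zero_iff 0).2 rfl, nrm_of_norm hθ, inner_smul_right, hL2]
  have h3 := isTangent_redLin (Q := Q) (K := K) (s0 := s0) (p := (0, θ)) hθ0 v
  simp [nrm_of_norm hθ] at h3
  rw [hLv _ h3, redLin_apply]
  simp

include hD hg in
lemma timeDer_zero {q : ℝ} {θ : E3} (hq : q ∈ qInt D c) (hθ : θ ≠ 0) (u : Amb) :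
    timeDer D c K s0 (q, s0, θ) (u.1, 0, u.2.2) = 0 := by
  have h1 : HasFDerivWithinAt (fun p : ℝ × E3 => ((p.1, s0, p.2) : Amb))
      ((fst ℝ ℝ E3).prod ((0 : ℝ × E3 →L[ℝ] ℝ).prod
        (snd ℝ ℝ E3))) (qInt D c ×ˢ {θ : E3 | θ ≠ 0}) (q, θ) :=
    (hasFDerivAt_fst.prodMk ((hasFDerivAt_const s0 _).prodMk hasFDerivAt_snd)).hasFDerivWithinAt
  have h2 := HasFDerivWithinAt.comp (q, θ)
    (hasFDerivWithinAt_timeFn hD hg (p := (q, s0, θ)) ⟨hq, hg.s₀_neg, hθ⟩) h1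
    fun p (hp : p ∈ qInt D c ×ˢ {θ : E3 | θ ≠ 0}) => ⟨hp.1, hg.s₀_neg, hp.2⟩
  have h3 : HasFDerivWithinAt (fun _ : ℝ × E3 => (0 : ℝ)) (0 : ℝ × E3 →L[ℝ] ℝ)
      (qInt D c ×ˢ {θ : E3 | θ ≠ 0}) (q, θ) := hasFDerivWithinAt_const _ _ _
  have h4 : (timeFn K s0 ∘ fun p : ℝ × E3 => ((p.1, s0, p.2) : Amb)) = fun _ => (0 : ℝ) := by
    funext p
    exact timeFn_zero _ _
  rw [h4] at h2
  exact DFunLike.congr_fun ((((hD.uniqueDiffOn hg.c_pos).prod isOpen_ne_zero.uniqueDiffOn) (q, θ)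
    (mk_mem_prod hq hθ)).eq h2 h3) (u.1, u.2.2)

include hD hQ hg in
theorem metric_eq_conf {p : Amb} (hp : p ∈ cylinder D c) {u v : Amb}
    (hu : IsTangent p u) (hv : IsTangent p v) :
    g p u v = confM (redM g Q K s0) (rt p.1, timeFn K s0 p, p.2.2)
      (tDer D c K s0 p u) (tDer D c K s0 p v) := by
  have hθ := norm_ne_zero_iff.1 (by rw [hp.2.2.2]; exact one_ne_zero)
  have hq := hQ.left p.1 hp.1
  have h1 : ∀ x : Amb, inner ℝ p.2.2 x.2.2 = 0 → redLin Q K s0 (rt p.1, p.2.2) x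
      = tInvDer D c K s0 (p.1, s0, p.2.2) x := fun x hx => by
    rw [redLin_apply, tInvDer_apply, timeDer_zero hD hg (cyl_subset hp).1 hθ]
    have h2 := fderiv_nrm_of_inner hθ hx
    rw [hp.2.2.2, one_smul] at h2
    simp [hq, sub_zero, h2]
  rw [metric_conformal hD hg hp hu hv]
  have hu' : inner ℝ p.2.2 (tDer D c K s0 p u).2.2 = 0 := hu
  have hv' : inner ℝ p.2.2 (tDer D c K s0 p v).2.2 = 0 := hv
  simp [confM, smul_apply, smul_eq_mul]
  rw [redM_apply, h1 _ hu', h1 _ hv']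
  simp [hq, nrm_of_norm hp.2.2.2, hu', mul_zero, zero_mul, add_zero]

end

variable (hD : IsSide D) (hQ : IsSubst D Ct c w rt Q r0)
variable (hg : IsTwistedSelfSimilar D Ct N A ε c g K s0) (hε : A * ε < 1)

/-! ## The data along the null hypersurface -/

/-- The initial velocity of the null geodesics. -/
def initVel (A : ℝ × E3 → Bil) (θ : E3) : Amb := sharp A (0, 0, θ) (initMom A θ)

lemma ne_of_norm {θ : E3} (h : ‖θ‖ = 1) : θ ≠ 0 := norm_ne_zero_iff.1 (by rw [h]; exact one_ne_zero)

section

variable {A : ℝ × E3 → Bil} (hA : IsRedMetric A r0)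
include hA

lemma IsRedMetric.initVel_apply {θ : E3} (h : θ ≠ 0) : A (0, θ) (initVel A θ) = initMom A θ := by
  have h1 := hA.conf_sharp (hA.zero_mem h) (initMom A θ)
  rwa [confM_zero] at h1

lemma IsRedMetric.initVel_radial {θ : E3} (h : θ ≠ 0) : inner ℝ θ (initVel A θ).2.2 = 0 := by
  have h1 := hA.radial (0, θ) (by simpa using hA.pos) h (initVel A θ)
  rw [hA.initVel_apply h] at h1
  rw [(by simp [initMom] : initMom A θ (0, 0, θ) = 0)] at h1
  simpa [norm_ne_zero_iff.2 h] using h1.symm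

lemma IsRedMetric.contDiffAt_initVel (hn : IsNullAtZero A) {θ : E3} (h : ‖θ‖ = 1) :
    ContDiffAt ℝ 1 (initVel A) θ := by
  exact ContDiffAt.comp θ (hA.contDiffAt_sharp (hA.zero_mem (ne_of_norm h)) (initMom A θ))
    ((by fun_prop : ContDiffAt ℝ 1 (fun θ => ((0, 0, θ) : Amb)) θ).prodMk
        (contDiff_snd.contDiffAt.comp θ (contDiff_snd.contDiffAt.comp θ (hA.contDiffAt_init hn h))))

lemma IsRedMetric.isNormSq (hn : IsNullAtZero A) {θ : E3} (h : ‖θ‖ = 1) (τ : ℝ)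
    {m : E3 →L[ℝ] E3 →L[ℝ] ℝ} {b : E3 →L[ℝ] ℝ}
    (hm : ∀ u v, m u v = exp (2 * τ) * A (0, θ) (0, 0, u) (0, 0, v))
    (hb : ∀ v, b v = exp τ * A (0, θ) (0, 1, 0) (0, 0, v)) :
    IsNormSq m b θ (A (0, θ) (0, 1, 0) (0, 1, 0)) := by
  have hθ := ne_of_norm h
  have h0 : |((0, θ) : ℝ × E3).1| < r0 := by simpa using hA.pos
  obtain ⟨ℓ, h1, h2, h3⟩ := hn θ h
  set n : E3 := ℓ.2.1⁻¹ • ℓ.2.2 with hnd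
  have hx : ((0, 1, 0) : Amb) = ℓ.2.1⁻¹ • ℓ - (0, 0, n) := by
    refine Prod.ext ?_ (Prod.ext ?_ ?_) <;> simp [h1, h2, hnd]
  have hAx : ∀ v : Amb, v.1 = 0 → A (0, θ) (0, 1, 0) v = -A (0, θ) (0, 0, n) v := fun v hv => by
    rw [hx]
    simp [h3, hv]
  have hrad : inner ℝ θ n = 0 := by
    have h4 := hA.radial (0, θ) h0 hθ ℓ
    rw [h3] at h4
    have h5 : inner ℝ θ ℓ.2.2 = 0 := by simpa [h] using h4.symm
    rw [hnd, inner_smul_right, h5, mul_zero]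
  have hexp : exp (2 * τ) = exp τ * exp τ := by rw [← exp_add]; ring_nf
  have hne := (exp_pos τ).ne'
  refine ⟨-((exp τ)⁻¹ • n), by simp [inner_smul_right, hrad], fun w _ => ?_, ?_⟩
  · have h6 := hAx (0, 0, w) rfl
    simp only [map_neg, map_smul, neg_apply, smul_apply, smul_eq_mul]
    rw [hm, hb, h6, hexp]
    field_simp
  · have h6 := hAx (0, 1, 0) rfl
    rw [h6, hA.symm (0, θ) h0 hθ, hAx _ rfl]
    simp only [map_neg, map_smul, neg_apply, smul_apply, smul_eq_mul]
    rw [hm, hexp]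
    field_simp

end

section

include hD hg in
lemma hyp_subset : hypersurfaceZero ⊆ cylinder D c := fun p hp =>
  ⟨by rw [hp.1]; exact hD.zero_mem, by rw [hp.1]; simpa using hg.c_pos, hp.2.1, hp.2.2⟩

include hD hQ hg in
lemma metric_zero {p : Amb} (hp : p ∈ hypersurfaceZero) {u v : Amb}
    (hu : IsTangent p u) (hv : IsTangent p v) :
    g p u v = exp (2 * timeFn K s0 p) * redM g Q K s0 (0, p.2.2)
      (tDer D c K s0 p u) (tDer D c K s0 p v) := by
  rw [metric_eq_conf hD hQ hg (hyp_subset hD hg hp) hu hv, hp.1, hQ.root.zero]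
  rfl

/-- The function `t` on the null hypersurface. -/
def zeroTime (K : Amb → Amb) (s0 : ℝ) (p : Amb) : ℝ := -exp (timeFn K s0 p)

include hD hg

lemma zeroTime_isHomotheticTime : IsHomotheticTime K s0 (zeroTime K s0) := by
  refine ⟨fun p _ => neg_neg_of_pos (exp_pos _), fun p hp hs => ?_, fun p hp => ?_⟩
  · have : timeFn K s0 p = 0 := by rw [(by rw [← hs] : p = (p.1, s0, p.2.2)), timeFn_zero]
    simp [zeroTime, this]
  · have hc := hyp_subset hD hg hp
    simp [zeroTime, neg_neg, Real.log_exp]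
    rw [K_eq_kap hg hc]
    have h2 : HasDerivAt (fun τ => p.2.1 + τ * kap K p) (kap K p) 0 := by
      simpa using ((hasDerivAt_id (0 : ℝ)).mul_const (kap K p)).const_add p.2.1
    have h3 := HasDerivAt.comp 0
      (by simpa using hasDerivAt_timeFn hg (θ := p.2.2) (cyl_subset hc)) h2
    rw [inv_mul_cancel₀ (kap_ne hg (cyl_subset hc))] at h3
    have h4 : (fun τ => timeFn K s0 (p + τ • (0, kap K p, 0)))
        = (fun s => timeFn K s0 (p.1, s, p.2.2)) ∘ fun τ => p.2.1 + τ * kap K p := by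
      funext τ
      congr 1
      refine Prod.ext ?_ (Prod.ext ?_ ?_) <;> simp
    change HasDerivAt (fun τ => timeFn K s0 (p + τ • (0, kap K p, 0))) 1 0
    rw [h4]
    exact h3

lemma homotheticTime_unique {t : Amb → ℝ} (ht : IsHomotheticTime K s0 t) :
    EqOn t (zeroTime K s0) hypersurfaceZero := by
  intro p hp
  have hmem : ∀ s < 0, ((0, s, p.2.2)) ∈ hypersurfaceZero := fun s hs => ⟨rfl, hs, hp.2.2⟩
  have hd : ∀ s < 0, HasDerivAt (fun s => log (-t (0, s, p.2.2)) - timeFn K s0 (0, s, p.2.2))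
      0 s := fun s hs => by
    have hc := hyp_subset hD hg (hmem s hs)
    have h1 := ht.2.2 _ (hmem s hs)
    rw [K_eq_kap hg hc] at h1
    have h2 := h1.smul (kap K (0, s, p.2.2))⁻¹
    have h3 : (kap K (0, s, p.2.2))⁻¹ • ((0, kap K (0, s, p.2.2), 0) : Amb) = (0, 1, 0) := by
      simp [kap_ne hg (cyl_subset hc)]
    rw [h3] at h2
    refine ((HasDerivAt.sub ((by simpa [HasLineDerivAt] using h2 : HasDerivAt (fun τ => log (-t ((0,
        s, p.2.2) + τ • ((0, 1, 0))))) ((kap K (0, s, p.2.2))⁻¹ • 1) (s - s)).comp_sub_const s s)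
            (hasDerivAt_timeFn hg (cyl_subset hc))).congr_of_eventuallyEq
                (Eventually.of_forall fun s' => ?_)).congr_deriv (by simp)
    simp
  have h1 := eq_of_hasDerivAt_zero_neg hd hp.2.1 hg.s₀_neg
  simp [timeFn_zero, ht.2.1 _ (hmem s0 hg.s₀_neg) rfl] at h1
  rw [(Prod.ext hp.1.symm rfl : ((0, p.2.1, p.2.2)) = p)] at h1
  rw [zeroTime, ← (by simpa [sub_eq_zero] using h1 : log (-t p) = timeFn K s0 p),
      exp_log (neg_pos.2 (ht.1 p hp)), neg_neg]

omit hD hg in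
lemma zeroTime_radial {w : ℝ × E3} (hw : w.2 ≠ 0) :
    zeroTime K s0 (radial (0, w)) = zeroTime K s0 (0, w) := by
  simp [zeroTime, radial_apply]
  rw [timeFn_nrm _ _ hw]

lemma differentialZero_zeroTime {p : Amb} (hp : p ∈ hypersurfaceZero) {u : Amb} (hu : u.1 = 0) :
    differentialZero (zeroTime K s0) p u = -exp (timeFn K s0 p) * timeDer D c K s0 p u := by
  have hc := cyl_subset (hyp_subset hD hg hp)
  have hO : IsOpen {w : ℝ × E3 | w.1 < 0 ∧ w.2 ≠ 0} := isOpen_Iio.prod isOpen_ne_zero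
  have hm : p.2 ∈ {w : ℝ × E3 | w.1 < 0 ∧ w.2 ≠ 0} := ⟨hp.2.1, ne_of_norm hp.2.2⟩
  have hp0 : ((0, p.2) : Amb) = p := Prod.ext hp.1.symm rfl
  have h1 := HasFDerivWithinAt.comp p.2
    (by rw [hp0]; exact hasFDerivWithinAt_timeFn hD hg hc)
    (hasFDerivAt_prodMk_right' (0 : ℝ) p.2).hasFDerivWithinAt
    (t := cDom D c) (s := {w : ℝ × E3 | w.1 < 0 ∧ w.2 ≠ 0}) fun w hw => ⟨by
      simpa [hp.1] using hc.1, hw.1, hw.2⟩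
  have h3 := ((h1.hasFDerivAt (hO.mem_nhds hm)).exp).neg.congr_of_eventuallyEq (by
    filter_upwards [hO.mem_nhds hm] with w hw
    exact zeroTime_radial hw.2)
  rw [differentialZero, h3.fderiv]
  simp [hp0, (Prod.ext hu.symm rfl : ((0, u.2) : Amb) = u)]

lemma zeroTime_isZeroCoordinates : IsZeroCoordinates (zeroTime K s0) := by
  refine ⟨?_, ⟨fun p hp => ⟨neg_neg_of_pos (exp_pos _), hp.2.2⟩, fun p hp p' hp' h => ?_,
    fun x hx => ?_⟩, fun p hp u hu h0 h1 => ?_⟩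
  · exact (((timeFn_smooth hD hg).comp (by fun_prop) fun w hw => ⟨⟨hD.zero_mem, by constructor <;>
        linarith [hg.c_pos]⟩, hw.1, hw.2⟩).exp).neg.congr fun w hw => zeroTime_radial hw.2
  · have h2 := (congrArg Prod.snd h)
    refine timeMap_injOn hD hg (cyl_subset (hyp_subset hD hg hp))
      (cyl_subset (hyp_subset hD hg hp')) (Prod.ext (hp.1.trans hp'.1.symm) (Prod.ext ?_ h2))
    exact Real.exp_injective (neg_injective (congrArg Prod.fst h))
  · obtain ⟨hx1, hx2⟩ := hx
    obtain ⟨s, hs, h⟩ := timeFn_surj hg ⟨hD.zero_mem, by constructor <;> linarith [hg.c_pos]⟩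
        (ne_of_norm hx2) (log (-x.1))
    refine ⟨(0, s, x.2), ⟨rfl, hs, hx2⟩, Prod.ext ?_ rfl⟩
    change zeroTime K s0 (0, s, x.2) = x.1
    rw [zeroTime, h, exp_log (by simpa using hx1), neg_neg]
  · have hc := cyl_subset (hyp_subset hD hg hp)
    rw [differentialZero_zeroTime hD hg hp hu.1] at h0
    have h2 : u = (0, u.2.1, 0) := Prod.ext hu.1 (Prod.ext rfl h1)
    rw [h2, timeDer_s hD hg hc] at h0
    rw [h2, (by simpa [kap_ne hg hc] using h0 : u.2.1 = 0)]
    rfl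

omit hD in
include hQ in
lemma redM_sphere_pos (hε : A * ε < 1) {θ : E3} (hθ : ‖θ‖ = 1) {v : E3} (hv : inner ℝ θ v = 0)
    (hv0 : v ≠ 0) : 0 < redM g Q K s0 (0, θ) (0, 0, v) (0, 0, v) := by
  have h1 := fderiv_nrm_of_inner (ne_of_norm hθ) hv
  rw [hθ, one_smul] at h1
  rw [redM_apply, redLin_apply]
  simp [(hQ.zero_iff 0).2 rfl, nrm_of_norm hθ, h1, hv]
  exact sphere_pos hg hε hθ hv hv0

include hQ in
lemma zeroTime_hasInducedForm (hε : A * ε < 1) : HasInducedForm g (zeroTime K s0) := by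
  intro p hp
  set T := timeFn K s0 p with hT
  set G := redM g Q K s0 (0, p.2.2) with hG
  have hA := isRedMetric hD hQ hg
  have hn := redM_isNullAtZero hD hQ hg hε
  have hθ := ne_of_norm hp.2.2
  have hs := hA.symm (0, p.2.2) (by simpa using hQ.pos) hθ
  set i : E3 →L[ℝ] Amb := inr ℝ ℝ (ℝ × E3) ∘L inr ℝ ℝ E3
    with hi
  set m : E3 →L[ℝ] E3 →L[ℝ] ℝ := exp (2 * T) • G.bilinearComp i i with hm
  set b : E3 →L[ℝ] ℝ := exp T • (G (0, 1, 0)).comp i with hb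
  have hmv : ∀ u v, m u v = exp (2 * T) * G (0, 0, u) (0, 0, v) := fun u v => rfl
  have hbv : ∀ v, b v = exp T * G (0, 1, 0) (0, 0, v) := fun v => rfl
  refine ⟨b, m, G (0, 1, 0) (0, 1, 0), ⟨fun u v _ _ => by rw [hmv, hmv, hs], fun u hu hu0 => ?_⟩,
    hA.isNormSq hn hp.2.2 T hmv hbv, fun u v hu hv => ?_⟩
  · rw [hmv]; exact mul_pos (exp_pos _) (redM_sphere_pos hQ hg hε hp.2.2 hu hu0)
  · rw [metric_zero hD hQ hg hp hu.2 hv.2, differentialZero_zeroTime hD hg hp hu.1,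
      differentialZero_zeroTime hD hg hp hv.1, ← hG, ← hT, hmv, hbv, hbv]
    have h1 : ∀ u : Amb, u.1 = 0 → tDer D c K s0 p u
        = timeDer D c K s0 p u • ((0, 1, 0) : Amb) + (0, 0, u.2.2) := fun u hu => by
      rw [tDer_apply]
      simp [hu]
    rw [h1 u hu.1, h1 v hv.1]
    simp only [map_add, map_smul, add_apply, smul_apply, smul_eq_mul]
    rw [hs (0, 0, u.2.2) (0, 1, 0), show exp (2 * T) = exp T * exp T by
      rw [← exp_add]; ring_nf]
    ring

/-- The null vector field along the hypersurface. -/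
def zeroField (D : Set ℝ) (c : ℝ) (g : BilinField) (Q : ℝ → ℝ) (K : Amb → Amb) (s0 : ℝ)
    (p : Amb) : Amb := tInvDer D c K s0 p (initVel (redM g Q K s0) p.2.2)

omit hD hg in
lemma SphereChart.fderiv_vec (φ : SphereChart) {V : Amb → Amb} {z : R4}
    (hz : z ∈ φ.dom D c) (hV : IsTangent (φ.point z) (V (φ.point z))) :
    fderiv ℝ φ.point z (φ.vec V z) = V (φ.point z) := by
  obtain ⟨v, hv⟩ := φ.exists_fderiv hz.2.2.2 hV
  rw [φ.vec_of_eq hz.2.2.2 hv, hv]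

lemma lie_vec_apply {V : Amb → Amb} (φ : SphereChart) {z : R4} (hz : z ∈ φ.dom D c)
    (hV : IsTangent (φ.point z) (V (φ.point z))) (μ : Fin 4) :
    φ.lieVec D c K V z μ = kap K (φ.point z) * φ.partial_ D c 1 (fun z' => φ.vec V z' μ) z
      - if μ = 1 then kapDer D c K (φ.point z) (V (φ.point z)) else 0 := by
  simp [SphereChart.lieVec, partial_vec_K hD hg φ hz]
  congr 1
  · simp [Fin.sum_univ_four, vec_K hg φ hz]
  · split_ifs with h
    · rw [← φ.fderiv_vec hz hV, ← φ.sum_frame]; simp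
    · simp

omit hD hg in
lemma SphereChart.point_mem_zero (φ : SphereChart) {z : R4} (hz : z ∈ φ.dom D c)
    (h0 : z 0 = 0) : φ.point z ∈ hypersurfaceZero := ⟨h0, hz.2.2.1, φ.norm_eq _ hz.2.2.2⟩

lemma lieVec_eq_zero_iff {V : Amb → Amb} (hV : ∀ p ∈ hypersurfaceZero, IsTangent p (V p))
    (φ : SphereChart) (hreg : ∀ μ, ContDiffOn ℝ 1
      (fun w : Fin 3 → ℝ => φ.vec V (vecCons 0 w) μ) {w | vecCons 0 w ∈ φ.dom D c})
    {z : R4} (hz : z ∈ φ.dom D c) (h0 : z 0 = 0) : (∀ μ, φ.lieVec D c K V z μ = 0) ↔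
    HasDerivAt (fun s => V (z 0, s, φ.χ ![z 2, z 3]))
      (0, kapDer D c K (φ.point z) (V (φ.point z)) / kap K (φ.point z), 0) (z 1) := by
  have hk := kap_ne hg (cyl_subset (φ.point_mem hz))
  set l := kapDer D c K (φ.point z) (V (φ.point z)) with hl
  set v' : R4 := fun μ => φ.partial_ D c 1 (fun z' => φ.vec V z' μ) z with hv'
  have hd :=
    hasDerivAt_pi.2 fun μ => hasDerivAt_partial_one (F := fun z' => φ.vec V z' μ) φ hz (by
      have h1 := hreg μ
      rw [φ.slice_eq ⟨by rw [← h0]; exact hz.1, by rw [← h0]; exact hz.2.1⟩] at h1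
      rw [h0]
      exact (h1.differentiableOn one_ne_zero).differentiableAt
        (φ.isOpen_slice.mem_nhds (φ.tail_mem hz)))
  have hd' : HasDerivAt (fun s => V (z 0, s, φ.χ ![z 2, z 3])) (fderiv ℝ φ.point z v') (z 1) :=
    HasDerivAt.congr_of_eventuallyEq
      ((fderiv ℝ φ.point z).hasFDerivAt.comp_hasDerivAt (z 1) hd) (by
        filter_upwards [isOpen_Iio.mem_nhds hz.2.2.1] with s hs
        have hzs : (![z 0, s, z 2, z 3] : R4) ∈ φ.dom D c := ⟨hz.1, hz.2.1, hs, hz.2.2.2⟩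
        have h4 := φ.fderiv_vec hzs (hV _ (φ.point_mem_zero hzs h0))
        rw [φ.fderiv_point hzs.2.2.2] at h4
        change _ = fderiv ℝ φ.point z _
        rw [φ.fderiv_point hz.2.2.2]
        exact h4.symm)
  have he : fderiv ℝ φ.point z (Pi.single 1 (l / kap K (φ.point z)))
      = (0, l / kap K (φ.point z), 0) := by
    rw [φ.fderiv_point hz.2.2.2]
    refine Prod.ext rfl (Prod.ext rfl ?_)
    change fderiv ℝ φ.χ _ ![0, 0] = 0
    rw [show ![0, 0] = (0 : Fin 2 → ℝ) from vec2_eq 0, map_zero]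
  rw [← he]
  have h1 : (∀ μ, φ.lieVec D c K V z μ = 0) ↔ v' = Pi.single 1 (l / kap K (φ.point z)) := by
    rw [funext_iff]
    refine forall_congr' fun μ => ?_
    rw [lie_vec_apply hD hg φ hz (hV _ (φ.point_mem_zero hz h0)), sub_eq_zero, Pi.single_apply]
    split_ifs
    · rw [eq_div_iff hk, mul_comm]
    · simp [hk, hv']
  rw [h1]
  exact ⟨fun h => h ▸ hd', fun h => φ.fderiv_point_injective hz.2.2.2 (hd'.unique h)⟩

include hQ

lemma zeroField_isNullTransversal (hε : A * ε < 1) :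
    IsNullTransversal D c g K s0 (zeroField D c g Q K s0) := by
  have hA := isRedMetric hD hQ hg
  have hn := redM_isNullAtZero hD hQ hg hε
  set G := redM g Q K s0 with hG
  have hcone : ∀ p ∈ hypersurfaceZero, p ∈ cDom D c := fun p hp =>
    cyl_subset (hyp_subset hD hg hp)
  have htan : ∀ p ∈ hypersurfaceZero, IsTangent p (zeroField D c g Q K s0 p) := fun p hp =>
    hA.initVel_radial (ne_of_norm hp.2.2)
  have hmet : ∀ p ∈ hypersurfaceZero, ∀ u, IsTangent p u → g p (zeroField D c g Q K s0 p) u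
      = exp (2 * timeFn K s0 p) * initMom G p.2.2 (tDer D c K s0 p u) :=
    fun p hp u hu => by
      rw [metric_zero hD hQ hg hp (htan p hp) hu, zeroField,
        tDer_tInvDer hD hg (hcone p hp), hA.initVel_apply (ne_of_norm hp.2.2)]
  have hs0 : ∀ p : Amb, p.2.1 = s0 → timeFn K s0 p = 0 := fun p hs => by
    have h1 : p = (p.1, s0, p.2.2) := by rw [← hs]
    rw [h1, timeFn_zero]
  have hregular : ∀ (φ : SphereChart) (μ : Fin 4), ContDiffOn ℝ 1
      (fun w : Fin 3 → ℝ => φ.vec (zeroField D c g Q K s0) (vecCons 0 w) μ)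
      {w | vecCons 0 w ∈ φ.dom D c} := by
    intro φ μ
    rw [φ.slice_eq ⟨hD.zero_mem, by simpa using hg.c_pos⟩]
    obtain ⟨H, O, hO, hH, h1, -⟩ := φ.exists_coord
    have hχ : ContDiffOn ℝ ∞ (fun w : Fin 3 → ℝ => φ.χ ![w 1, w 2]) φ.slice := by
      refine φ.smooth.comp ?_ fun w hw => hw.2
      refine (contDiff_pi.2 fun i => ?_).contDiffOn
      fin_cases i
      exacts [contDiff_apply ℝ ℝ 1, contDiff_apply ℝ ℝ 2]
    set P : (Fin 3 → ℝ) → Amb := fun w => (0, w 0, φ.χ ![w 1, w 2]) with hP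
    have hPs : ContDiffOn ℝ 1 P φ.slice := contDiffOn_const.prodMk
      ((contDiff_apply ℝ ℝ 0).contDiffOn.prodMk (hχ.of_le (by norm_num)))
    have hP0 : ∀ w ∈ φ.slice, P w ∈ hypersurfaceZero := fun w hw => ⟨rfl, hw.1, φ.norm_eq _ hw.2⟩
    have hPm := fun w hw => hcone _ (hP0 w hw)
    have hv : ContDiffOn ℝ 1 (fun w => initVel G (P w).2.2) φ.slice := fun w hw =>
      (hA.contDiffAt_initVel hn (φ.norm_eq _ hw.2)).comp_contDiffWithinAt w
        (hχ.of_le (by norm_num) w hw)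
    have hV : ContDiffOn ℝ 1 (fun w => zeroField D c g Q K s0 (P w)) φ.slice := by
      have hT :=
        ((timeFn_smooth hD hg).fderivWithin (uniqueDiff_cone hD hg.c_pos)
          two_le_infty).comp hPs hPm
      have h2 := contDiff_snd.comp_contDiffOn hv
      have h3 := contDiff_snd.comp_contDiffOn h2
      have h4 := contDiff_fst.comp_contDiffOn hv
      exact h4.prodMk (((((kap_contDiffOn hg).of_le (by norm_num)).comp hPs hPm).mul
        ((contDiff_fst.comp_contDiffOn h2).sub
          (hT.clm_apply (h4.prodMk (contDiffOn_const.prodMk h3))))).prodMk h3)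
    exact (contDiffOn_pi.1 (((hH.fderiv_of_isOpen hO two_le_infty).comp hPs
      fun w hw => (h1 (vecCons 0 w) hw.2).1).clm_apply hV) μ).congr fun w hw => by
        rw [φ.vec_eq (z := vecCons 0 w) hO hH h1 hw.2 (htan _ (hP0 w hw))]; rfl
  refine ⟨htan, hregular, fun p hp => ?_, fun p hp hs u hu => ?_, fun p hp hs => ?_,
    fun φ z hz h0 μ => ?_⟩
  · rw [hmet p hp _ (htan p hp), zeroField, tDer_tInvDer hD hg (hcone p hp),
      initVel, (hA.initMom_spec hn hp.2.2).2, mul_zero]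
  · rw [hmet p hp (0, 0, u) hu, tDer_apply]
    have h1 := timeDer_zero hD hg (hcone p hp).1 (ne_of_norm hp.2.2) (0, 0, u)
    have h2 : p = (p.1, s0, p.2.2) := by rw [← hs]
    rw [← h2] at h1
    rw [h1]
    simp [initMom]
  · have hc := hyp_subset hD hg hp
    have hk := kap_ne hg (hcone p hp)
    rw [hmet p hp _ (hg.K_tangent p hc), K_eq_kap hg hc, tDer_apply,
      timeDer_s hD hg (hcone p hp), mul_inv_cancel₀ hk, hs0 p hs]
    simp [initMom]
  · refine (lieVec_eq_zero_iff hD hg htan φ (hregular φ) hz h0).2 ?_ μ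
    have h1 := hasDerivAt_tInvDer hD hg (hcone _ (φ.point_mem_zero hz h0))
      (initVel G (φ.χ ![z 2, z 3]))
    exact HasDerivAt.prodMk (hasDerivAt_const (z 1) (initVel G (φ.χ ![z 2, z 3])).1)
      (HasDerivAt.prodMk h1 (hasDerivAt_const (z 1) (initVel G (φ.χ ![z 2, z 3])).2.2))

omit hQ in
lemma nullTransversal_unique (hε : A * ε < 1) {V W : Amb → Amb}
    (hV : IsNullTransversal D c g K s0 V) (hW : IsNullTransversal D c g K s0 W)
    (hne : ∀ θ : E3, ‖θ‖ = 1 → (W (0, s0, θ)).1 ≠ 0) : EqOn V W hypersurfaceZero := by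
  have hS : ∀ θ : E3, ‖θ‖ = 1 → V (0, s0, θ) = W (0, s0, θ) := by
    intro θ hθ
    set p : Amb := (0, s0, θ) with hpd
    have hp : p ∈ hypersurfaceZero := ⟨rfl, hg.s₀_neg, hθ⟩
    have hc := hyp_subset hD hg hp
    have hl := hg.lorentzian p hc
    have hk := kap_ne hg (cyl_subset hc)
    obtain ⟨L, hL, hL1, hLv⟩ := exists_null_generator hg hD hε hθ
    replace hL : IsTangentZero p L := hL
    replace hLv : ∀ v, IsTangent p v → g p L v = v.1 := hLv
    have hV' := hV.tangent p hp
    have hW' := hW.tangent p hp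
    set U := V p - W p with hU
    set l := g p U (1, 0, 0) with hl'
    have h1 : ∀ v, IsTangent p v → g p U v = l * v.1 := fun v hv => by
      have hK := K_eq_kap hg hc
      have h2 : v = v.1 • ((1, 0, 0) : Amb) + ((v.2.1 * (kap K p)⁻¹) • K p + (0, 0, v.2.2)) := by
        rw [hK]
        refine Prod.ext ?_ (Prod.ext ?_ ?_) <;> simp [hk]
      have h3 : g p U (K p) = 0 := by
        rw [hU, map_sub, sub_apply, hV.normalized p hp rfl, hW.normalized p hp rfl, sub_self]
      have h4 : g p U (0, 0, v.2.2) = 0 := by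
        rw [hU, map_sub, sub_apply, hV.orthogonal p hp rfl _ hv, hW.orthogonal p hp rfl _ hv,
          sub_self]
      rw [h2, map_add, map_add, map_smul, map_smul, h3, h4, hK]
      simp [hl', mul_comm]
    have h5 : U - l • L = 0 := by
      refine IsLorentzianAt.nondeg hl (by
        have := hL.2
        simp only [IsTangent] at hV' hW' this ⊢
        simp [hU, inner_sub_right, inner_smul_right, hV', hW', this]) fun v hv => ?_
      rw [map_sub, sub_apply, h1 v hv, map_smul, smul_apply, hLv v hv, smul_eq_mul, sub_self]
    have h6 : V p = W p + l • L := by rw [← sub_eq_zero.1 h5, hU]; abel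
    have h7 := hV.null p hp
    rw [h6] at h7
    simp only [map_add, map_smul, add_apply, smul_apply, smul_eq_mul, hW.null p hp,
      hl.1 (W p) L hW' hL.2, hLv _ hW', hLv _ hL.2, hL.1] at h7
    have h8 : l = 0 := by
      have : 2 * l * (W p).1 = 0 := by linarith
      simpa [show (W p).1 ≠ 0 from hne θ hθ] using this
    rw [h6, h8, zero_smul, add_zero]
  intro p hp
  set E : ℝ → Amb := fun s => V (0, s, p.2.2) - W (0, s, p.2.2) with hE
  have hmem : ∀ s < 0, ((0, s, p.2.2) : Amb) ∈ cylinder D c := fun s hs =>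
    hyp_subset hD hg ⟨rfl, hs, hp.2.2⟩
  have hd : ∀ s < 0, HasDerivAt E
      (0, kapDer D c K (0, s, p.2.2) (E s) / kap K (0, s, p.2.2), 0) s := fun s hs => by
    obtain ⟨φ, z, hz, hzp⟩ := exists_chart (hmem s hs)
    obtain ⟨h0, rfl, hθ⟩ : z 0 = 0 ∧ z 1 = s ∧ φ.χ ![z 2, z 3] = p.2.2 := by
      simpa [SphereChart.point] using hzp
    have h1 := (lieVec_eq_zero_iff hD hg hV.tangent φ (hV.regular φ) hz h0).1 (hV.lie φ z hz h0)
    have h2 := (lieVec_eq_zero_iff hD hg hW.tangent φ (hW.regular φ) hz h0).1 (hW.lie φ z hz h0)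
    rw [h0, hθ, hzp] at h1 h2
    refine (HasDerivAt.sub h1 h2).congr_deriv ?_
    simp [hE, sub_div]
  have hE0 : E s0 = 0 := sub_eq_zero.2 (hS _ hp.2.2)
  have h1 : ∀ s < 0, (E s).1 = 0 := fun s hs =>
    (eq_of_hasDerivAt_zero_neg (fun s hs => (hd s hs).fst) hs hg.s₀_neg).trans (by rw [hE0]; rfl)
  have h2 : ∀ s < 0, (E s).2.2 = 0 := fun s hs =>
    (eq_of_hasDerivAt_zero_neg (fun s hs => (hd s hs).snd.snd) hs hg.s₀_neg).trans
      (by rw [hE0]; rfl)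
  have h3 : (E p.2.1).2.1 / kap K (0, p.2.1, p.2.2) = 0 := by
    refine (eq_of_hasDerivAt_zero_neg (f := fun s => (E s).2.1 / kap K (0, s, p.2.2))
      (fun s hs => ?_) hp.2.1 hg.s₀_neg).trans (by simp [hE0])
    have hc := cyl_subset (hmem s hs)
    have hk := kap_ne hg hc
    have h4 : HasDerivAt (fun s => (E s).2.1) _ s := (hd s hs).snd.fst
    refine (h4.div (hasDerivAt_kap hg hc) hk).congr_deriv ?_
    have h5 : E s = (E s).2.1 • ((0, 1, 0) : Amb) := by
      refine Prod.ext ?_ (Prod.ext ?_ ?_) <;> simp [h1 s hs, h2 s hs]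
    have h6 := congrArg (kapDer D c K (0, s, p.2.2)) h5
    rw [map_smul, smul_eq_mul] at h6
    rw [h6]
    field_simp
    ring
  have h4 : E p.2.1 = 0 := Prod.ext (h1 _ hp.2.1) (Prod.ext ((div_eq_zero_iff.1 h3).resolve_right
    (kap_ne hg (cyl_subset (hmem _ hp.2.1)))) (h2 _ hp.2.1))
  have h5 := sub_eq_zero.1 h4
  rwa [show ((0, p.2.1, p.2.2) : Amb) = p from Prod.ext hp.1.symm rfl] at h5

end

/-! ## The coordinates of the homothetic gauge -/

namespace IsReducedGauge

variable {A : ℝ × E3 → Bil} (hA : IsRedMetric A r0) (hrt : IsRoot w rt) (hy : IsNullFlow A w r0 δ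
  y) (hΦ : IsReducedGauge A y rt δ δ' c' σ Φ Φi)
include hΦ

omit hΦ in
lemma _root_.gDom_ne_zero {x : Amb} (hx : x ∈ gDom c') : x.2.2 ≠ 0 :=
  ne_of_mem_annulus (gDom_annulus hx)

lemma rt_lt {x : Amb} (hx : x ∈ gDom c') : |rt (Φ x).1| < δ := hΦ.dom _ (hΦ.spec x hx).1

lemma hasFDerivAt {x : Amb} (hx : x ∈ gDom c') : HasFDerivAt Φ (fderiv ℝ Φ x) x :=
  ((hΦ.smooth.differentiableOn one_ne_zero).differentiableAt
    ((isOpen_gDom c').mem_nhds hx)).hasFDerivAt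

lemma hasFDerivAt_inv {x : Amb} (hx : x ∈ gDom c') :
    HasFDerivAt Φi (fderiv ℝ Φi (Φ x)) (Φ x) :=
  ((hΦ.smooth_inv.differentiableOn one_ne_zero).differentiableAt
    (hΦ.isOpen_range.mem_nhds (mem_image_of_mem _ hx))).hasFDerivAt

lemma fderiv_inv {x : Amb} (hx : x ∈ gDom c') (u : Amb) :
    fderiv ℝ Φ x (fderiv ℝ Φi (Φ x) u) = u := by
  have h2 : HasFDerivAt (Φ ∘ Φi) (ContinuousLinearMap.id ℝ Amb) (Φ x) := by
    refine (hasFDerivAt_id (𝕜 := ℝ) (Φ x)).congr_of_eventuallyEq ?_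
    filter_upwards [hΦ.isOpen_range.mem_nhds (mem_image_of_mem _ hx)] with z hz
    obtain ⟨x', hx', rfl⟩ := hz
    simp [hΦ.left_inv x' hx']
  exact DFunLike.congr_fun ((HasFDerivAt.comp (Φ x)
      (by rw [hΦ.left_inv x hx]; exact hΦ.hasFDerivAt hx) (hΦ.hasFDerivAt_inv hx)).unique h2) u

lemma inv_fderiv {x : Amb} (hx : x ∈ gDom c') (u : Amb) :
    fderiv ℝ Φi (Φ x) (fderiv ℝ Φ x u) = u := by
  have h2 : HasFDerivAt (Φi ∘ Φ) (ContinuousLinearMap.id ℝ Amb) x := by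
    refine (hasFDerivAt_id (𝕜 := ℝ) x).congr_of_eventuallyEq ?_
    filter_upwards [(isOpen_gDom c').mem_nhds hx] with x' hx'
    exact hΦ.left_inv x' hx'
  exact DFunLike.congr_fun ((HasFDerivAt.comp x (hΦ.hasFDerivAt_inv hx) (hΦ.hasFDerivAt hx)).unique
      h2) u

lemma snd_eq {x : Amb} (hx : x ∈ gDom c') :
    (Φ x).2.1 = x.2.1 + (y (rt (Φ x).1) x.2.2).2.1.1 := by
  conv_lhs => rw [(hΦ.spec x hx).2.2]
  rfl

lemma thd_eq {x : Amb} (hx : x ∈ gDom c') :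
    (Φ x).2.2 = ‖x.2.2‖ • (y (rt (Φ x).1) x.2.2).2.1.2 := by
  conv_lhs => rw [(hΦ.spec x hx).2.2]
  rfl

include hy in
lemma norm_eq {x : Amb} (hx : x ∈ gDom c') : ‖(Φ x).2.2‖ = ‖x.2.2‖ := by
  rw [hΦ.thd_eq hx, norm_smul, norm_norm, hy.norm _ _ (hΦ.rt_lt hx) (gDom_ne_zero hx), mul_one]

include hy in
lemma mem_redDom {x : Amb} (hx : x ∈ gDom c') : (rt (Φ x).1, (Φ x).2) ∈ redDom r0 :=
  ⟨(hΦ.rt_lt hx).trans_le hy.le, norm_ne_zero_iff.1 (by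
    rw [hΦ.norm_eq hy hx]
    exact norm_ne_zero_iff.2 (gDom_ne_zero hx))⟩

include hy in
lemma inner_fderiv {x : Amb} (hx : x ∈ gDom c') (u : Amb) :
    inner ℝ (Φ x).2.2 (fderiv ℝ Φ x u).2.2 = inner ℝ x.2.2 u.2.2 := by
  have h2 : HasFDerivAt (fun x : Amb => x.2.2) (snd ℝ ℝ E3 ∘L
    snd ℝ ℝ (ℝ × E3)) x := (snd ℝ ℝ E3 ∘L
      snd ℝ ℝ (ℝ × E3)).hasFDerivAt
  have h4 : HasFDerivAt (fun x : Amb => ‖(Φ x).2.2‖ ^ 2) _ x :=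
    h2.norm_sq.congr_of_eventuallyEq (by
      filter_upwards [(isOpen_gDom c').mem_nhds hx] with x' hx'
      rw [hΦ.norm_eq hy hx'])
  simpa using DFunLike.congr_fun ((HasFDerivAt.comp x (snd ℝ ℝ E3 ∘L snd ℝ ℝ (ℝ × E3)).hasFDerivAt
      (hΦ.hasFDerivAt hx)).norm_sq.unique h4) u

include hrt hy in
lemma apply_zero {τ : ℝ} {θ : E3} (h : ((0, τ, θ) : Amb) ∈ gDom c') :
    Φ (0, τ, θ) = (0, τ, θ) := by
  rw [(hΦ.spec _ h).2.2, (hΦ.zero_iff _ h).2 rfl, geoMap_zero hrt hy (gDom_ne_zero h)]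

lemma zero_mem {τ : ℝ} {θ : E3} (h : ‖θ‖ = 1) : ((0, τ, θ) : Amb) ∈ gDom c' := by
  refine ⟨by simpa using hΦ.pos, ?_, ?_⟩ <;> simp [h] <;> norm_num

omit hΦ in
lemma _root_.gDom_add {x : Amb} (hx : x ∈ gDom c') (a : ℝ) :
    x + (0, a, 0) ∈ gDom c' := by simpa [gDom] using hx

lemma translate {x : Amb} (hx : x ∈ gDom c') (a : ℝ) :
    Φ (x + (0, a, 0)) = Φ x + (0, a, 0) := by
  have hd : ∀ a : ℝ, HasDerivAt (fun a : ℝ => ((0, a, 0) : Amb)) (0, 1, 0) a := fun a =>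
    (hasDerivAt_const _ _).prodMk ((hasDerivAt_id _).prodMk (hasDerivAt_const _ _))
  have h1 : ∀ a : ℝ, HasDerivAt (fun a : ℝ => Φ (x + (0, a, 0)) - (0, a, 0)) 0 a := fun a => by
    have h2 := HasFDerivAt.comp_hasDerivAt a
      (hΦ.hasFDerivAt (gDom_add hx a)) ((hd a).const_add x)
    rw [hΦ.deriv_snd _ (gDom_add hx a)] at h2
    have h3 := HasDerivAt.sub h2 (hd a)
    rw [sub_self] at h3
    exact h3
  have h4 := is_const_of_deriv_eq_zero (fun a => (h1 a).differentiableAt) (fun a =>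
      (h1 a).deriv) a 0
  simp only [Prod.mk_zero_zero, add_zero, sub_zero] at h4
  exact sub_eq_iff_eq_add.1 h4

include hA hy in
lemma conf_fst {x : Amb} (hx : x ∈ gDom c') (h1 : ‖x.2.2‖ = 1) (u : Amb) :
    confM A (rt (Φ x).1, (Φ x).2) (fderiv ℝ Φ x (1, 0, 0)) u
      = exp (2 * x.2.1) * (y (rt (Φ x).1) x.2.2).2.2 u := by
  rw [hΦ.deriv_fst x hx h1]
  rw [← DFunLike.congr_fun (hA.conf_sharp (hy.dom _ _ (hΦ.rt_lt hx) (gDom_ne_zero hx)).1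
      (y (rt (Φ x).1) x.2.2).2.2) u]
  simp [confM, hΦ.snd_eq hx, hΦ.thd_eq hx, h1, mul_add, exp_add, mul_assoc]
  rfl

end IsReducedGauge

/-- `(ρ, τ, θ) ↦ (ρ, -e^τ, θ)`. -/
def expMap (x : Amb) : Amb := (x.1, -exp x.2.1, x.2.2)

/-- `(ρ, t, θ) ↦ (ρ, log (-t), θ)`. -/
def logMap (x : Amb) : Amb := (x.1, log (-x.2.1), x.2.2)

lemma logMap_expMap (x : Amb) : logMap (expMap x) = x := by simp [logMap, expMap]

lemma expMap_logMap {x : Amb} (hx : x.2.1 < 0) : expMap (logMap x) = x := by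
  simp only [logMap, expMap, exp_log (neg_pos.2 hx), neg_neg]

/-- The domain of the gauge. -/
def gaugeSet (D : Set ℝ) (c : ℝ) (K : Amb → Amb) (s0 c' : ℝ) (Φ : Amb → Amb) : Set Amb :=
  {p | p ∈ cylinder D c ∧ timeMap K s0 p ∈ Φ '' gDom c'}

/-- The coordinates `(ρ, t, θ)`. -/
def gaugeCoord (K : Amb → Amb) (s0 : ℝ) (Φi : Amb → Amb) (p : Amb) : Amb :=
  expMap (Φi (timeMap K s0 p))

/-- The inverse of the coordinates. -/
def gaugeInv (K : Amb → Amb) (s0 : ℝ) (Φ : Amb → Amb) (x : Amb) : Amb := timeInv K s0 (Φ (logMap x))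

/-- The null geodesic vector field. -/
def gaugeField (D : Set ℝ) (c : ℝ) (K : Amb → Amb) (s0 : ℝ) (Φ Φi : Amb → Amb) (p : Amb) : Amb :=
  tInvDer D c K s0 p (fderiv ℝ Φ (Φi (timeMap K s0 p)) (1, 0, 0))

/-- The metric in the coordinates `(ρ, τ, θ)`. -/
def gaugeMetric (A : ℝ × E3 → Bil) (rt : ℝ → ℝ) (Φ : Amb → Amb) (x : Amb) : Bil :=
  (confM A (rt (Φ x).1, (Φ x).2)).bilinearComp (fderiv ℝ Φ x) (fderiv ℝ Φ x)

/-- The inclusion of the last factor. -/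
def inclE : E3 →L[ℝ] Amb := inr ℝ ℝ (ℝ × E3) ∘L inr ℝ ℝ E3

@[simp] lemma inclE_apply (v : E3) : inclE v = (0, 0, v) := rfl

lemma IsLorentzianAt.pos_of_orthogonal {g : BilinField} {p : Amb} (h : IsLorentzianAt g p)
    {v u : Amb} (hv : IsTangent p v) (hu : IsTangent p u) (hv0 : v ≠ 0) (hvv : g p v v = 0)
    (hvu : g p v u = 0) (hne : ∀ a : ℝ, u ≠ a • v) : 0 < g p u u := by
  obtain ⟨hs, τ, hτ, -, hpos⟩ := h
  have h1 := fun h0 => by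
    have := hpos v hv h0 hv0
    rw [hvv] at this
    exact lt_irrefl _ this
  set a := g p τ u / g p τ v with ha
  have ht : IsTangent p (u - a • v) := by
    simp only [IsTangent] at hu hv ⊢
    simp [inner_sub_right, inner_smul_right, hu, hv]
  have h2 := hpos (u - a • v) ht (by
    rw [map_sub, map_smul, smul_eq_mul, ha]
    field_simp
    ring) (sub_ne_zero.2 (hne a))
  simpa [hvv, hvu, hs u v hu hv] using h2

variable (hy : IsNullFlow (redM g Q K s0) w r0 δ y)
variable (hΦ : IsReducedGauge (redM g Q K s0) y rt δ δ' c' σ Φ Φi) (hδ : δ' ≤ c)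

section

include hΦ

lemma gaugeSet_spec {p : Amb} (hp : p ∈ gaugeSet D c K s0 c' Φ) :
    Φi (timeMap K s0 p) ∈ gDom c' ∧ Φ (Φi (timeMap K s0 p)) = timeMap K s0 p := by
  obtain ⟨-, x, hx, h⟩ := hp
  rw [← h, hΦ.left_inv x hx]
  exact ⟨hx, rfl⟩

include hy in
lemma gaugeSet_norm {p : Amb} (hp : p ∈ gaugeSet D c K s0 c' Φ) :
    ‖(Φi (timeMap K s0 p)).2.2‖ = 1 := by
  obtain ⟨h1, h2⟩ := gaugeSet_spec hΦ hp
  rw [← hΦ.norm_eq hy h1, h2]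
  exact hp.1.2.2.2

lemma mem_side_iff (hD : IsSide D) {x : Amb} (hx : x ∈ gDom c') :
    (Φ x).1 ∈ D ↔ σ * x.1 ∈ D := by
  have h1 := hΦ.pos_iff x hx
  rcases hD with rfl | rfl | rfl
  · simp
  · simp only [mem_Ici, le_iff_lt_or_eq, h1, eq_comm, hΦ.zero_iff x hx,
        (by rcases hΦ.sign with rfl | rfl <;> simp : σ * x.1 = 0 ↔ x.1 = 0)]
  · grind

include hD hg

lemma isOpenIn_gaugeSet : IsOpenIn D c (gaugeSet D c K s0 c' Φ) := by
  have h1 : ContinuousOn (timeMap K s0) (cylinder D c) := fun p hp =>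
    ((hasFDeriv_timeMap hD hg (cyl_subset hp)).continuousWithinAt).mono cyl_subset
  obtain ⟨O, hO, h2⟩ := continuousOn_iff'.1 h1 _ hΦ.isOpen_range
  refine ⟨O, hO, ?_⟩
  rw [inter_comm, ← h2]
  ext p
  exact and_comm

include hQ hy in
lemma hypersurfaceZero_subset_gaugeSet : hypersurfaceZero ⊆ gaugeSet D c K s0 c' Φ := by
  intro p hp
  have hm := hΦ.zero_mem (τ := timeFn K s0 p) hp.2.2
  refine ⟨hyp_subset hD hg hp, _, hm, ?_⟩
  rw [hΦ.apply_zero hQ.root hy hm, timeMap, hp.1]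

omit hD hg in
include hQ hy in
lemma gauge_inv_zero {p : Amb} (hp : p ∈ hypersurfaceZero) :
    Φi (timeMap K s0 p) = (0, timeFn K s0 p, p.2.2) := by
  have hm := hΦ.zero_mem (τ := timeFn K s0 p) hp.2.2
  have h1 := hΦ.left_inv _ hm
  rw [hΦ.apply_zero hQ.root hy hm] at h1
  rw [timeMap, hp.1, h1]

omit hΦ in
lemma timeMap_flow {γ : ℝ → Amb} (hγ : IsIntegralCurveIn K (cylinder D c) γ univ) (τ : ℝ) :
    timeMap K s0 (γ τ) = timeMap K s0 (γ 0) + (0, τ, 0) := by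
  have hd : ∀ τ, HasDerivAt (fun τ => timeMap K s0 (γ τ) - (0, τ, 0)) 0 τ := fun τ => by
    obtain ⟨hm, hder⟩ := hγ τ (mem_univ τ)
    have hc := cyl_subset hm
    have h2 : tDer D c K s0 (γ τ) (K (γ τ)) = (0, 1, 0) := by
      rw [K_eq_kap hg hm, tDer_apply, timeDer_s hD hg hc, mul_inv_cancel₀ (kap_ne hg hc)]
    have h4 := ((HasFDerivWithinAt.comp_hasDerivWithinAt τ (hasFDeriv_timeMap hD hg hc) hder fun τ
        _ => cyl_subset (hγ τ (mem_univ τ)).1).hasDerivAt univ_mem).sub ((hasDerivAt_const _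
            _).prodMk ((hasDerivAt_id _).prodMk (hasDerivAt_const _ _)) : HasDerivAt (fun a : ℝ =>
                ((0, a, 0) : Amb)) (0, 1, 0) τ)
    rw [h2, sub_self] at h4
    exact h4
  have h4 := is_const_of_deriv_eq_zero (fun a => (hd a).differentiableAt) (fun a =>
      (hd a).deriv) τ 0
  simp only [Prod.mk_zero_zero, sub_zero] at h4
  exact sub_eq_iff_eq_add.1 h4

lemma gaugeSet_flowInvariant : IsFlowInvariant D c K (gaugeSet D c K s0 c' Φ) := by
  intro γ hγ h0 τ
  obtain ⟨-, x, hx, hxe⟩ := h0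
  refine ⟨(hγ τ (mem_univ τ)).1, x + (0, τ, 0), gDom_add hx τ, ?_⟩
  rw [hΦ.translate hx, hxe, ← timeMap_flow hD hg hγ]

omit hD hg in
include hy in
lemma gaugeField_tangent {p : Amb} (hp : p ∈ gaugeSet D c K s0 c' Φ) :
    IsTangent p (gaugeField D c K s0 Φ Φi p) := by
  obtain ⟨h1, h2⟩ := gaugeSet_spec hΦ hp
  have h3 := hΦ.inner_fderiv hy h1 (1, 0, 0)
  rw [h2] at h3
  exact h3.trans (inner_zero_right _)

lemma gaugeField_continuousOn :
    ContinuousOn (gaugeField D c K s0 Φ Φi) (gaugeSet D c K s0 c' Φ) := by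
  have h1 : ContinuousOn (timeMap K s0) (gaugeSet D c K s0 c' Φ) := fun p hp =>
    ((hasFDeriv_timeMap hD hg (cyl_subset hp.1)).continuousWithinAt).mono
      fun p hp => cyl_subset hp.1
  exact ((tInvDer_continuousOn hD hg).mono fun p hp => cyl_subset hp.1).clm_apply
    (((hΦ.smooth.continuousOn_fderiv_of_isOpen (isOpen_gDom c') le_rfl).comp
        (hΦ.smooth_inv.continuousOn.comp h1 fun p hp => hp.2) fun p hp =>
            (gaugeSet_spec hΦ hp).1).clm_apply continuousOn_const)

omit hD hg in
include hQ hy in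
lemma gaugeField_zero : EqOn (gaugeField D c K s0 Φ Φi) (zeroField D c g Q K s0)
    hypersurfaceZero := by
  intro p hp
  have hm := hΦ.zero_mem (τ := timeFn K s0 p) hp.2.2
  rw [gaugeField, gauge_inv_zero hQ hy hΦ hp, hΦ.deriv_fst _ hm hp.2.2,
    hΦ.apply_zero hQ.root hy hm, geoVel, hQ.root.zero, stVel, (hy.init _ hp.2.2).2,
    hy.init_mom _ hp.2.2]
  rfl

omit hg in
include hy hδ in
lemma logMap_mem {x : Amb} (hx : x ∈ cylinder {r | σ * r ∈ D} c') : logMap x ∈ gDom c' ∧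
    Φ (logMap x) ∈ timeDom D c := by
  have h1 : logMap x ∈ gDom c' := by
    refine ⟨hx.2.1, ?_, ?_⟩ <;> simp [logMap, hx.2.2.2] <;> norm_num
  exact ⟨h1, ⟨(mem_side_iff hΦ hD h1).2 hx.1, abs_lt.1 ((hΦ.spec _ h1).1.trans_le hδ)⟩, mem_univ _,
      norm_ne_zero_iff.1 (by
    rw [hΦ.norm_eq hy h1]
    exact norm_ne_zero_iff.2 (gDom_ne_zero h1))⟩

end

variable (hy : IsNullFlow (redM g Q K s0) w r0 δ y)
variable (hΦ : IsReducedGauge (redM g Q K s0) y rt δ δ' c' σ Φ Φi) (hδ : δ' ≤ c)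

/-! ## The homothetic gauge -/

namespace IsOpenIn

variable {B : Set Amb}

lemma subset (h : IsOpenIn D c B) : B ⊆ cylinder D c := by
  obtain ⟨O, -, rfl⟩ := h
  exact inter_subset_left

lemma radial_subset (h : IsOpenIn D c B) : radial ⁻¹' B ⊆ cDom D c := fun p hp => by
  rw [← preimage_cylinder]
  exact h.subset hp

lemma mem_radial {p : Amb} (hp : ‖p.2.2‖ = 1) : p ∈ radial ⁻¹' B ↔ p ∈ B := by
  rw [mem_preimage, radial_of_norm hp]

lemma nhdsWithin (h : IsOpenIn D c B) {p : Amb} (hp : p ∈ radial ⁻¹' B) :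
    𝓝[radial ⁻¹' B] p = 𝓝[cDom D c] p := by
  obtain ⟨O, hO, rfl⟩ := h
  rw [preimage_inter, preimage_cylinder, nhdsWithin_inter_of_mem']
  exact nhdsWithin_le_nhds ((contDiffAt_radial (n :=
      0) (by rw [← preimage_cylinder]; exact hp.1 : p ∈ cDom D c).2.2).continuousAt
          (hO.mem_nhds hp.2))

lemma uniqueDiffOn (h : IsOpenIn D c B) (hD : IsSide D) (hc : 0 < c) :
    UniqueDiffOn ℝ (radial ⁻¹' B) := fun p hp =>
  (uniqueDiff_cone hD hc p (h.radial_subset hp)).mono_nhds (h.nhdsWithin hp).ge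

lemma fderiv_radial {p u : Amb} (hp : ‖p.2.2‖ = 1) (hu : IsTangent p u) :
    HasFDerivAt radial (fderiv ℝ radial p) p ∧ fderiv ℝ radial p u = u := by
  have h0 := ne_of_norm hp
  have h1 : HasFDerivAt radial ((fst ℝ ℝ (ℝ × E3)).prod
      ((fst ℝ ℝ E3 ∘L snd ℝ ℝ (ℝ × E3)).prod
      (fderiv ℝ nrm p.2.2 ∘L snd ℝ ℝ E3 ∘L
        snd ℝ ℝ (ℝ × E3)))) p :=
    (fst ℝ ℝ (ℝ × E3)).hasFDerivAt.prodMk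
      ((fst ℝ ℝ E3 ∘L snd ℝ ℝ (ℝ × E3)).hasFDerivAt.prodMk
      (HasFDerivAt.comp p (hasFDerivAt_nrm h0)
        (snd ℝ ℝ E3 ∘L snd ℝ ℝ (ℝ × E3)).hasFDerivAt))
  refine ⟨h1.differentiableAt.hasFDerivAt, ?_⟩
  rw [h1.fderiv]
  have h2 := fderiv_nrm_of_inner h0 hu
  rw [hp, one_smul] at h2
  exact Prod.ext rfl (Prod.ext rfl h2)

lemma differential_eq {F : Type*} [NormedAddCommGroup F] [NormedSpace ℝ F] (h : IsOpenIn D c B)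
    (hD : IsSide D) (hc : 0 < c) {f : Amb → F} {f' : Amb →L[ℝ] F} {p u : Amb} (hp : p ∈ B)
    (hf : HasFDerivWithinAt f f' (cDom D c) p) (hu : IsTangent p u) :
    differential f B p u = f' u := by
  have hn := (h.subset hp).2.2.2
  obtain ⟨h1, h2⟩ := fderiv_radial hn hu
  rw [differential, (HasFDerivWithinAt.comp p (by rw [radial_of_norm hn]; exact hf)
      h1.hasFDerivWithinAt fun p' hp' => cyl_subset (h.subset hp') : HasFDerivWithinAt (f ∘ radial)
          (f'.comp (fderiv ℝ radial p)) (radial ⁻¹' B) p).fderivWithin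
              (h.uniqueDiffOn hD hc p ((mem_radial hn).2 hp)), ContinuousLinearMap.comp_apply,
    h2]

end IsOpenIn

lemma mem_cylinder_of_cDom {p : Amb} (hp : p ∈ cDom D c)
    (h : ‖p.2.2‖ = 1) : p ∈ cylinder D c := by rw [← radial_of_norm h]; exact radial_mem hp

lemma contDiffOn_expMap : ContDiff ℝ 1 expMap := by unfold expMap; fun_prop

lemma hasFDerivAt_expMap (x : Amb) : HasFDerivAt expMap
    ((fst ℝ ℝ (ℝ × E3)).prod (((-exp x.2.1) • covx).prod
      (snd ℝ ℝ E3 ∘L snd ℝ ℝ (ℝ × E3)))) x := by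
  have h1 : HasFDerivAt (fun x => -exp x.2.1) ((-exp x.2.1) • covx) x := by
    rw [neg_smul]
    exact covx.hasFDerivAt.exp.neg
  exact (fst ℝ ℝ (ℝ × E3)).hasFDerivAt.prodMk (h1.prodMk
    (snd ℝ ℝ E3 ∘L snd ℝ ℝ (ℝ × E3)).hasFDerivAt)

/-- The coefficient of `dt²`. -/
def coefP (G : Amb → Bil) (x : Amb) : ℝ := (x.2.1 ^ 2)⁻¹ * G (logMap x) (0, 1, 0) (0, 1, 0)

/-- The mixed coefficient. -/
def coefH (G : Amb → Bil) (x : Amb) : E3 →L[ℝ] ℝ :=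
  (-(x.2.1)⁻¹) • (G (logMap x) (0, 1, 0)).comp inclE

/-- The metric on the spheres. -/
def coefM (G : Amb → Bil) (x : Amb) : E3 →L[ℝ] E3 →L[ℝ] ℝ := (G (logMap x)).bilinearComp inclE inclE

lemma IsReducedGauge.gaugeMetric_eq {A : ℝ × E3 → Bil} {w rt : ℝ → ℝ} {r0 δ δ' c' σ : ℝ}
    {y : ℝ → E3 → St} {Φ Φi : Amb → Amb} (hA : IsRedMetric A r0)
    (hy : IsNullFlow A w r0 δ y) (hΦ : IsReducedGauge A y rt δ δ' c' σ Φ Φi) {x : Amb}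
    (hx : x ∈ gDom c') (h1 : ‖x.2.2‖ = 1) :
    (∀ u v, gaugeMetric A rt Φ x u v = gaugeMetric A rt Φ x v u) ∧
    gaugeMetric A rt Φ x (1, 0, 0) (1, 0, 0) = 0 ∧
    gaugeMetric A rt Φ x (1, 0, 0) (0, 1, 0) = 2 * exp (2 * x.2.1) ∧
    ∀ v, inner ℝ x.2.2 v = 0 → gaugeMetric A rt Φ x (1, 0, 0) (0, 0, v) = 0 := by
  have hd := hΦ.rt_lt hx
  have h0 := gDom_ne_zero hx
  have h2 := hΦ.conf_fst hA hy hx h1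
  refine ⟨fun u v => hA.conf_symm (hΦ.mem_redDom hy hx) _ _, (h2 (fderiv ℝ Φ x (1, 0, 0))).trans ?_,
    (h2 (fderiv ℝ Φ x (0, 1, 0))).trans ?_, fun v hv => (h2 (fderiv ℝ Φ x (0, 0, v))).trans ?_⟩
  · rw [hΦ.deriv_fst x hx h1, geoVel, hy.null _ _ hd h0, mul_zero]
  · rw [hΦ.deriv_snd x hx, hy.momentum_x _ _ hd h0, mul_comm]
  · rw [hΦ.deriv_thd x hx h1 v hv, mul_zero]

lemma bilin_expand {G : Bil} (hs : ∀ u v, G u v = G v u) {t : ℝ} (ht : t ≠ 0) {θ : E3}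
    (h1 : G (1, 0, 0) (1, 0, 0) = 0) (h2 : G (1, 0, 0) (0, 1, 0) = 2 * t ^ 2)
    (h3 : ∀ v, inner ℝ θ v = 0 → G (1, 0, 0) (0, 0, v) = 0) {u v : Amb}
    (hu : inner ℝ θ u.2.2 = 0) (hv : inner ℝ θ v.2.2 = 0) :
    G u v = homotheticForm ((t ^ 2)⁻¹ * G (0, 1, 0) (0, 1, 0)) t
      ((-t⁻¹) • (G (0, 1, 0)).comp inclE) (G.bilinearComp inclE inclE)
      (u.1, t * u.2.1, u.2.2) (v.1, t * v.2.1, v.2.2) := by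
  have key : ∀ u : Amb, u = u.1 • ((1, 0, 0)) + u.2.1 • ((0, 1, 0)) + (0, 0, u.2.2) :=
    fun u => by ext1 <;> simp
  conv_lhs => rw [key u, key v]
  simp only [homotheticForm, map_add, map_smul, add_apply, smul_apply, smul_eq_mul, h1, h2, h3 _ hv,
    hs (0, 1, 0) (1, 0, 0), hs (0, 0, u.2.2) (1, 0, 0), h3 _ hu, hs (0, 0, u.2.2) (0, 1, 0),
    ContinuousLinearMap.comp_apply, inclE_apply, ContinuousLinearMap.bilinearComp_apply]
  field_simp
  ring

section

include hD hg hΦ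

omit hg in
include hy in
lemma gaugeCoord_mapsTo :
    MapsTo (gaugeCoord K s0 Φi) (gaugeSet D c K s0 c' Φ) (cylinder {r | σ * r ∈ D} c') := by
  intro p hp
  obtain ⟨h1, h2⟩ := gaugeSet_spec hΦ hp
  refine ⟨?_, h1.1, neg_neg_of_pos (exp_pos _), gaugeSet_norm hy hΦ hp⟩
  refine (mem_side_iff hΦ hD h1).1 ?_
  rw [h2]
  exact hp.1.1

include hy hδ in
lemma gaugeInv_mapsTo :
    MapsTo (gaugeInv K s0 Φ) (cylinder {r | σ * r ∈ D} c') (gaugeSet D c K s0 c' Φ) := by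
  intro x hx
  obtain ⟨h1, h2⟩ := logMap_mem hD hy hΦ hδ hx
  obtain ⟨h3, h4⟩ := timeInv_mem hg h2
  refine ⟨mem_cylinder_of_cDom h3 ((hΦ.norm_eq hy h1).trans hx.2.2.2), _, h1, h4.symm⟩

lemma gaugeInv_gaugeCoord {p : Amb} (hp : p ∈ gaugeSet D c K s0 c' Φ) :
    gaugeInv K s0 Φ (gaugeCoord K s0 Φi p) = p := by
  rw [gaugeInv, gaugeCoord, logMap_expMap, (gaugeSet_spec hΦ hp).2,
    timeInv_timeMap hD hg (cyl_subset hp.1)]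

include hy hδ in
lemma gaugeCoord_gaugeInv {x : Amb} (hx : x ∈ cylinder {r | σ * r ∈ D} c') :
    timeMap K s0 (gaugeInv K s0 Φ x) = Φ (logMap x) ∧
    gaugeCoord K s0 Φi (gaugeInv K s0 Φ x) = x := by
  obtain ⟨h1, h2⟩ := logMap_mem hD hy hΦ hδ hx
  have h3 := (timeInv_mem hg h2).2
  refine ⟨h3, ?_⟩
  rw [gaugeCoord, gaugeInv, h3, hΦ.left_inv _ h1, expMap_logMap hx.2.2.1]

include hy hδ in
lemma gauge_isCoordinateSystem :
    IsCoordinateSystem {r | σ * r ∈ D} c' (gaugeSet D c K s0 c' Φ) (gaugeCoord K s0 Φi) := by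
  have hr : ContDiffOn ℝ 1 radial (radial ⁻¹' gaugeSet D c K s0 c' Φ) := fun p hp =>
    (contDiffAt_radial ((isOpenIn_gaugeSet hD hg hΦ).radial_subset hp).2.2).contDiffWithinAt
  have hr' : ContDiffOn ℝ 1 radial (radial ⁻¹' cylinder {r | σ * r ∈ D} c') := fun p hp => by
    refine (contDiffAt_radial ?_).contDiffWithinAt
    rw [preimage_cylinder] at hp
    exact hp.2.2
  refine ⟨gaugeCoord_mapsTo hD hy hΦ, ?_, gaugeInv K s0 Φ, gaugeInv_mapsTo hD hg hy hΦ hδ, ?_,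
    fun p hp => gaugeInv_gaugeCoord hD hg hΦ hp,
    fun x hx => (gaugeCoord_gaugeInv hD hg hy hΦ hδ hx).2⟩
  · have h1 : ContDiffOn ℝ 1 (timeMap K s0) (cDom D c) :=
      contDiffOn_fst.prodMk (((timeFn_smooth hD hg).of_le (by norm_num)).prodMk contDiffOn_snd.snd)
    exact (contDiffOn_expMap.comp_contDiffOn (hΦ.smooth_inv.comp (h1.mono fun p hp =>
        cyl_subset hp.1) fun p hp => hp.2)).comp hr fun p hp => hp
  · have h1 : ContDiffOn ℝ 1 logMap {x | x.2.1 < 0} := by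
      refine contDiffOn_fst.prodMk (ContDiffOn.prodMk (ContDiffOn.log (by fun_prop) fun x hx => ?_)
        contDiffOn_snd.snd)
      exact (neg_pos.2 hx).ne'
    exact ((timeInv_contDiffOn hD hg).comp (hΦ.smooth.comp (h1.mono fun x hx => hx.2.2.1) fun x
        hx => (logMap_mem hD hy hΦ hδ hx).1) fun x hx =>
            (logMap_mem hD hy hΦ hδ hx).2).comp hr' fun p hp => hp

lemma differential_gaugeCoord {p u : Amb} (hp : p ∈ gaugeSet D c K s0 c' Φ) (hu : IsTangent p u)
    {ζ : Amb} (hζ : fderiv ℝ Φ (Φi (timeMap K s0 p)) ζ = tDer D c K s0 p u) :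
    differential (gaugeCoord K s0 Φi) (gaugeSet D c K s0 c' Φ) p u
      = (ζ.1, (gaugeCoord K s0 Φi p).2.1 * ζ.2.1, ζ.2.2) := by
  obtain ⟨h1, h2⟩ := gaugeSet_spec hΦ hp
  have h3 := hΦ.hasFDerivAt_inv h1
  have h4 := hΦ.inv_fderiv h1 ζ
  rw [hζ] at h4
  rw [h2] at h3 h4
  rw [show gaugeCoord K s0 Φi = expMap ∘ Φi ∘ timeMap K s0 from rfl,
    (isOpenIn_gaugeSet hD hg hΦ).differential_eq hD hg.c_pos hp (HasFDerivAt.comp_hasFDerivWithinAt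
        p (hasFDerivAt_expMap _) (HasFDerivAt.comp_hasFDerivWithinAt p h3
            (hasFDeriv_timeMap hD hg (cyl_subset hp.1)))) hu]
  simp only [ContinuousLinearMap.comp_apply, h4]
  rfl

include hy in
lemma differential_gaugeField {p : Amb} (hp : p ∈ gaugeSet D c K s0 c' Φ) :
    differential (gaugeCoord K s0 Φi) (gaugeSet D c K s0 c' Φ) p (gaugeField D c K s0 Φ Φi p)
      = (1, 0, 0) := by
  rw [differential_gaugeCoord hD hg hΦ hp (gaugeField_tangent hy hΦ hp) (ζ := (1, 0, 0))
    (tDer_tInvDer hD hg (cyl_subset hp.1) _).symm]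
  simp

include hQ hy in
lemma gauge_metric_eq {p : Amb} (hp : p ∈ gaugeSet D c K s0 c' Φ) {u v ζ ζ' : Amb}
    (hu : IsTangent p u) (hv : IsTangent p v)
    (hζ : fderiv ℝ Φ (Φi (timeMap K s0 p)) ζ = tDer D c K s0 p u)
    (hζ' : fderiv ℝ Φ (Φi (timeMap K s0 p)) ζ' = tDer D c K s0 p v) :
    inner ℝ (Φi (timeMap K s0 p)).2.2 ζ.2.2 = 0 ∧
    g p u v = gaugeMetric (redM g Q K s0) rt Φ (Φi (timeMap K s0 p)) ζ ζ' := by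
  obtain ⟨h1, h2⟩ := gaugeSet_spec hΦ hp
  refine ⟨?_, ?_⟩
  · rw [← hΦ.inner_fderiv hy h1, hζ, h2]; exact hu
  · rw [metric_eq_conf hD hQ hg hp.1 hu hv, gaugeMetric,
      ContinuousLinearMap.bilinearComp_apply, hζ, hζ', h2]
    rfl

include hQ hε hy hδ in
lemma gauge_isHomotheticGauge :
    IsHomotheticGauge D c g K {r | σ * r ∈ D} c' (gaugeSet D c K s0 c' Φ) (gaugeCoord K s0 Φi)
      (coefP (gaugeMetric (redM g Q K s0) rt Φ))
      (coefH (gaugeMetric (redM g Q K s0) rt Φ))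
      (coefM (gaugeMetric (redM g Q K s0) rt Φ)) := by
  have hA := isRedMetric hD hQ hg
  have hn := redM_isNullAtZero hD hQ hg hε
  refine ⟨hΦ.pos, ?_, isOpenIn_gaugeSet hD hg hΦ,
    hypersurfaceZero_subset_gaugeSet hD hQ hg hy hΦ, gauge_isCoordinateSystem hD hg hy hΦ hδ,
    fun p hp => ?_, fun p hp u v hu hv => ?_, fun x hx => ?_, fun p hp => ?_, fun x hx hx0 => ?_⟩
  · rcases hΦ.sign with rfl | rfl
    · left; simp
    · right; simp
  · have hc := cyl_subset hp.1
    obtain ⟨h1, h2⟩ := gaugeSet_spec hΦ hp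
    rw [differential_gaugeCoord hD hg hΦ hp (hg.K_tangent p hp.1) (ζ := (0, 1, 0))]
    · simp
    · rw [hΦ.deriv_snd _ h1, K_eq_kap hg hp.1, tDer_apply, timeDer_s hD hg hc,
        mul_inv_cancel₀ (kap_ne hg hc)]
  · obtain ⟨h1, h2⟩ := gaugeSet_spec hΦ hp
    have hz := fun u => hΦ.fderiv_inv h1 (tDer D c K s0 p u)
    obtain ⟨h3, h4⟩ := gauge_metric_eq hD hQ hg hy hΦ hp hu hv (hz u) (hz v)
    obtain ⟨h5, -⟩ := gauge_metric_eq hD hQ hg hy hΦ hp hv hu (hz v) (hz u)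
    rw [differential_gaugeCoord hD hg hΦ hp hu (hz u),
      differential_gaugeCoord hD hg hΦ hp hv (hz v), h4, coefP, coefH, coefM]
    obtain ⟨e1, e2, e3, e4⟩ := hΦ.gaugeMetric_eq hA hy h1 (gaugeSet_norm hy hΦ hp)
    simp only [gaugeCoord, logMap_expMap]
    refine bilin_expand e1 (neg_ne_zero.2 (exp_ne_zero _)) e2 ?_ e4 h3 h5
    rw [e3, neg_sq, ← Real.exp_nat_mul]
    rfl
  · have hp := gaugeInv_mapsTo hD hg hy hΦ hδ hx
    obtain ⟨ht, hX⟩ := gaugeCoord_gaugeInv hD hg hy hΦ hδ hx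
    set p := gaugeInv K s0 Φ x
    obtain ⟨h1, -⟩ := logMap_mem hD hy hΦ hδ hx
    have hc := cyl_subset hp.1
    have hl : Φi (timeMap K s0 p) = logMap x := by rw [ht, hΦ.left_inv _ h1]
    obtain ⟨e1, e2, e3, e4⟩ := hΦ.gaugeMetric_eq hA hy h1 hx.2.2.2
    refine ⟨fun u v _ _ => e1 _ _, fun u hu hu0 => ?_⟩
    have hV := gaugeField_tangent hy hΦ hp
    have hVd := tDer_tInvDer hD hg hc (fderiv ℝ Φ (Φi (timeMap K s0 p)) (1, 0, 0))
    set U := tInvDer D c K s0 p (fderiv ℝ Φ (Φi (timeMap K s0 p)) (0, 0, u)) with hUd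
    have hU' := tDer_tInvDer hD hg hc (fderiv ℝ Φ (Φi (timeMap K s0 p)) (0, 0, u))
    have hU : IsTangent p U := by
      have h5 := hΦ.inner_fderiv hy h1 (0, 0, u)
      rw [← ht, ← hl] at h5
      exact h5.trans (by rw [hl]; exact hu)
    have e5 := (gauge_metric_eq hD hQ hg hy hΦ hp hU hU hU'.symm hU'.symm).2
    have e6 := (gauge_metric_eq hD hQ hg hy hΦ hp hV hV hVd.symm hVd.symm).2
    have e7 := (gauge_metric_eq hD hQ hg hy hΦ hp hV hU hVd.symm hU'.symm).2
    rw [hl] at e5 e6 e7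
    have hinj : ∀ ζ, tInvDer D c K s0 p (fderiv ℝ Φ (Φi (timeMap K s0 p)) ζ) = 0 → ζ = 0 :=
      fun ζ h0 => by
        have h6 := tDer_tInvDer hD hg hc (fderiv ℝ Φ (Φi (timeMap K s0 p)) ζ)
        rw [h0, map_zero, hl] at h6
        rw [← hΦ.inv_fderiv h1 ζ, ← h6, map_zero]
    have h7 := (hg.lorentzian p hp.1).pos_of_orthogonal hV hU (fun h0 => by
      simpa using hinj _ h0) (e6.trans e2) (e7.trans (e4 u hu)) fun a h0 => by
      rw [hUd, gaugeField, ← map_smul, ← map_smul, ← sub_eq_zero, ← map_sub, ← map_sub] at h0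
      have h8 := hinj _ h0
      exact hu0 (by simpa using (congrArg (fun v : Amb => v.2.2) h8 :))
    rw [e5] at h7
    exact h7
  · obtain ⟨h1, h2⟩ := gaugeSet_spec hΦ hp
    have h3 := hΦ.zero_iff _ h1
    rw [h2] at h3
    exact ⟨fun h => h3.1 h.1, fun h => ⟨h3.2 h, hp.1.2.2.1, hp.1.2.2.2⟩⟩
  · obtain ⟨h1, -⟩ := logMap_mem hD hy hΦ hδ hx
    obtain ⟨ρ, t, θ⟩ := x
    obtain rfl : ρ = 0 := hx0
    set τ := log (-t) with hτ
    have hm : ((0, τ, θ) : Amb) ∈ gDom c' := h1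
    have hθ := hx.2.2.2
    have hexp : t = -exp τ := by rw [hτ, exp_log (neg_pos.2 hx.2.2.1), neg_neg]
    have hv := fun v => by
      have h3 : HasDerivAt (fun a : ℝ => ((0, τ, θ) : Amb) + a • (0, 0, v)) (0, 0, v) 0 := by
        simpa using ((hasDerivAt_id (0 : ℝ)).smul_const ((0, 0, v) : Amb)).const_add (0, τ, θ)
      have h4 := HasFDerivAt.comp_hasDerivAt 0
        (by simpa using hΦ.hasFDerivAt hm) h3
      have h5 : (fun a : ℝ => ((0, τ, θ) : Amb) + a • (0, 0, v)) =ᶠ[𝓝 0]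
          Φ ∘ fun a : ℝ => ((0, τ, θ) : Amb) + a • (0, 0, v) := by
        have h6 :=
          h3.continuousAt.eventually ((isOpen_gDom c').mem_nhds (by simpa using hm))
        filter_upwards [h6] with a ha
        have h7 : ((0, τ, θ) : Amb) + a • (0, 0, v) = (0, τ, θ + a • v) := by simp
        simp only [Function.comp_apply]
        rw [h7] at ha ⊢
        exact (hΦ.apply_zero hQ.root hy ha).symm
      simpa using (h4.congr_of_eventuallyEq h5).unique h3
    have hG : ∀ u v, (∀ u' ∈ ({u, v} : Set Amb), fderiv ℝ Φ (0, τ, θ) u' = u') →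
        gaugeMetric (redM g Q K s0) rt Φ (0, τ, θ) u v
          = exp (2 * τ) * redM g Q K s0 (0, θ) u v := fun u v h => by
      rw [gaugeMetric, ContinuousLinearMap.bilinearComp_apply, h u (by simp), h v (by simp),
        hΦ.apply_zero hQ.root hy hm, hQ.root.zero]
      rfl
    have h2 := hΦ.deriv_snd _ hm
    have hP : coefP (gaugeMetric (redM g Q K s0) rt Φ) (0, t, θ)
        = redM g Q K s0 (0, θ) (0, 1, 0) (0, 1, 0) := by
      change (t ^ 2)⁻¹ * gaugeMetric (redM g Q K s0) rt Φ (0, τ, θ) _ _ = _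
      rw [hG _ _ (by simp [h2]), hexp, neg_sq, ← Real.exp_nat_mul, ← mul_assoc]
      push_cast
      rw [inv_mul_cancel₀ (exp_ne_zero _), one_mul]
    rw [hP]
    have e1 := fun u v =>
      hG (0, 0, u) (0, 0, v) (by simp [hv])
    refine hA.isNormSq hn hθ τ e1 fun v => ?_
    change -t⁻¹ * gaugeMetric (redM g Q K s0) rt Φ (0, τ, θ) (0, 1, 0) (0, 0, v) = _
    rw [hG _ _ (by simp [hv, h2]), hexp, two_mul, exp_add]
    have := exp_ne_zero τ
    simp only [inv_neg, neg_neg]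
    field_simp

end

/-! ## The geodesic equation in local coordinates -/

lemma sum_christoffel {ι : Type*} [Fintype ι] (I v : ι → ℝ) (a : ι → ι → ι → ℝ) :
    ∑ μ, ∑ ν, ((1 / 2) * ∑ σ, I σ * (a μ σ ν + a ν σ μ - a σ μ ν)) * v μ * v ν
      = ∑ σ, I σ * (∑ ν, (∑ μ, a μ σ ν * v μ) * v ν - 1 / 2 * ∑ μ, ∑ ν, a σ μ ν * v μ * v ν) := by
  have h1 : ∀ σ, ∑ μ, ∑ ν, a ν σ μ * v μ * v ν = ∑ μ, ∑ ν, a μ σ ν * v μ * v ν := fun σ => by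
    rw [Finset.sum_comm]
    exact Finset.sum_congr rfl fun μ _ => Finset.sum_congr rfl fun ν _ => by ring
  have h2 : ∀ σ, ∑ ν, (∑ μ, a μ σ ν * v μ) * v ν = ∑ μ, ∑ ν, a μ σ ν * v μ * v ν := fun σ => by
    simp [Finset.sum_mul]
    exact Finset.sum_comm
  have h3 : ∀ σ, I σ * (∑ ν, (∑ μ, a μ σ ν * v μ) * v ν
      - 1 / 2 * ∑ μ, ∑ ν, a σ μ ν * v μ * v ν)
      = ∑ μ, ∑ ν, (1 / 2) * (I σ * (a μ σ ν + a ν σ μ - a σ μ ν)) * v μ * v ν := fun σ => by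
    have h4 : ∑ μ, ∑ ν, (1 / 2) * (I σ * (a μ σ ν + a ν σ μ - a σ μ ν)) * v μ * v ν
        = I σ * (1 / 2) * (∑ μ, ∑ ν, a μ σ ν * v μ * v ν + ∑ μ, ∑ ν, a ν σ μ * v μ * v ν
          - ∑ μ, ∑ ν, a σ μ ν * v μ * v ν) := by
      simp [← Finset.sum_add_distrib, ← Finset.sum_sub_distrib, Finset.mul_sum]
      exact Finset.sum_congr rfl fun μ _ => Finset.sum_congr rfl fun ν _ => by ring
    rw [h4, h1, h2]
    ring
  rw [Finset.sum_congr rfl fun σ _ => h3 σ]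
  symm
  rw [Finset.sum_comm]
  refine Finset.sum_congr rfl fun μ _ => ?_
  rw [Finset.sum_comm]
  simp only [Finset.mul_sum, Finset.sum_mul]

/-- The quadratic form `Γ^l_{μν} v^μ v^ν`. -/
def SphereChart.gammaSum (φ : SphereChart) (D : Set ℝ) (c : ℝ) (g : BilinField)
    (z v : R4) (l : Fin 4) : ℝ := ∑ μ, ∑ ν, φ.christoffel D c g z l μ ν * v μ * v ν

lemma SphereChart.gammaSum_eq (φ : SphereChart) (D : Set ℝ) (c : ℝ) (g : BilinField)
    (z v : R4) (l : Fin 4) : φ.gammaSum D c g z v l = ∑ σ, (φ.metric g z)⁻¹ l σ *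
      (∑ ν, (∑ μ, φ.partial_ D c μ (fun z' => φ.metric g z' σ ν) z * v μ) * v ν
        - 1 / 2 * ∑ μ, ∑ ν, φ.partial_ D c σ (fun z' => φ.metric g z' μ ν) z * v μ * v ν) :=
  sum_christoffel _ v fun σ μ ν => φ.partial_ D c σ (fun z' => φ.metric g z' μ ν) z

lemma hasDerivWithinAt_of_mulVec {n : Type*} [Fintype n] [DecidableEq n] {M : ℝ → Matrix n n ℝ}
    {M' : Matrix n n ℝ} {v : ℝ → n → ℝ} {p' a : n → ℝ} {I : Set ℝ} {τ : ℝ}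
    (hM : ∀ μ ν, HasDerivWithinAt (fun τ => M τ μ ν) (M' μ ν) I τ) (hdet : IsUnit (M τ).det)
    (hv : ContinuousWithinAt v I τ)
    (hp : ∀ μ, HasDerivWithinAt (fun τ => ∑ ν, M τ μ ν * v τ ν) (p' μ) I τ)
    (ha : a = (M τ)⁻¹.mulVec (fun μ => p' μ - ∑ ν, M' μ ν * v τ ν)) :
    HasDerivWithinAt v a I τ := by
  rw [hasDerivWithinAt_iff_tendsto_slope]
  have h1 : ∀ μ, Tendsto (fun t => slope (fun τ => ∑ ν, M τ μ ν * v τ ν) τ t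
      - ∑ ν, slope (fun τ => M τ μ ν) τ t * v t ν) (𝓝[I \ {τ}] τ)
      (𝓝 (p' μ - ∑ ν, M' μ ν * v τ ν)) := fun μ =>
    (hasDerivWithinAt_iff_tendsto_slope.1 (hp μ)).sub (tendsto_finsetSum _ fun ν _ =>
      (hasDerivWithinAt_iff_tendsto_slope.1 (hM μ ν)).mul
        ((tendsto_pi_nhds.1 hv ν).mono_left (nhdsWithin_mono _ sdiff_subset)))
  have h2 : Tendsto (fun t => (M τ)⁻¹.mulVec fun μ => slope (fun τ => ∑ ν, M τ μ ν * v τ ν) τ t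
      - ∑ ν, slope (fun τ => M τ μ ν) τ t * v t ν) (𝓝[I \ {τ}] τ) (𝓝 a) := by
    rw [ha]
    exact ((Continuous.matrix_mulVec continuous_const continuous_id).tendsto _).comp
      (tendsto_pi_nhds.2 h1)
  refine h2.congr fun t => ?_
  have h3 : (fun μ => slope (fun τ => ∑ ν, M τ μ ν * v τ ν) τ t
      - ∑ ν, slope (fun τ => M τ μ ν) τ t * v t ν) = (M τ).mulVec (slope v τ t) := by
    funext μ
    simp [slope_def_module, Matrix.mulVec, dotProduct, smul_eq_mul, Pi.smul_apply,
      Pi.sub_apply, ← Finset.sum_sub_distrib, Finset.mul_sum]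
    exact Finset.sum_congr rfl fun ν _ => by ring
  rw [h3, Matrix.mulVec_mulVec, Matrix.nonsing_inv_mul _ hdet, Matrix.one_mulVec]

/-- The metric in the coordinates `(q, τ, θ)`. -/
def tMetric (A : ℝ × E3 → Bil) (rt : ℝ → ℝ) (x : Amb) : Bil := confM A (rt x.1, x.2)

/-- The derivative of `tMetric`. -/
def timeMetricDer (A : ℝ × E3 → Bil) (w rt : ℝ → ℝ) (x : Amb) : Amb →L[ℝ] Bil :=
  (fderiv ℝ (confM A) (rt x.1, x.2)).comp
    (((w (rt x.1))⁻¹ • ContinuousLinearMap.id ℝ ℝ).prodMap (ContinuousLinearMap.id ℝ (ℝ × E3)))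

lemma hasFDerivAt_tMetric {A : ℝ × E3 → Bil} {r0 : ℝ} (hA : IsRedMetric A r0)
    {w rt : ℝ → ℝ} (hrt : IsRoot w rt) {x : Amb} (h0 : x.1 ≠ 0)
    (hx : ((rt x.1, x.2) : Amb) ∈ redDom r0) :
    HasFDerivAt (tMetric A rt) (timeMetricDer A w rt x) x := by
  have h1 : HasFDerivAt (fun x => ((rt x.1, x.2)))
      (((w (rt x.1))⁻¹ • ContinuousLinearMap.id ℝ ℝ).prodMap (ContinuousLinearMap.id ℝ (ℝ × E3)))
      x := by
    exact (HasDerivAt.comp_hasFDerivAt x (hrt.deriv _ h0).2 (fst ℝ ℝ (ℝ × E3)).hasFDerivAt).prodMk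
        (snd ℝ ℝ (ℝ × E3)).hasFDerivAt
  exact HasFDerivAt.comp x (hA.hasFDerivAt_conf hx) h1

section

variable (φ : SphereChart)

include hg in
lemma SphereChart.isUnit_det {z : R4} (hz : z ∈ φ.dom D c) :
    IsUnit (φ.metric g z).det := by
  rw [isUnit_iff_ne_zero, ne_eq, ← Matrix.exists_mulVec_eq_zero_iff]
  rintro ⟨v, hv, h0⟩
  have hl := hg.lorentzian _ (φ.point_mem hz)
  have ht := φ.isTan_point hz.2.2.2 v
  refine hv (φ.fderiv_point_injective hz.2.2.2 ?_)
  rw [map_zero]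
  refine hl.nondeg ht fun u hu => ?_
  obtain ⟨v', rfl⟩ := φ.exists_fderiv hz.2.2.2 hu
  rw [hl.1 _ _ ht hu, φ.metric_sum]
  refine Finset.sum_eq_zero fun μ _ => ?_
  have h1 : ∑ ν, φ.metric g z μ ν * v ν = 0 := congrFun h0 μ
  have h2 : ∑ ν, φ.metric g z μ ν * v' μ * v ν = v' μ * ∑ ν, φ.metric g z μ ν * v ν := by
    rw [Finset.mul_sum]
    exact Finset.sum_congr rfl fun ν _ => by ring
  rw [h2, h1, mul_zero]

/-- The coordinates `(q, τ, θ)` as functions of local coordinates. -/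
def SphereChart.time (φ : SphereChart) (K : Amb → Amb) (s0 : ℝ) (z : R4) : Amb :=
  timeMap K s0 (φ.point z)

include hD hg

lemma fderiv_time {z : R4} (hz : z ∈ φ.dom D c) (h0 : z 0 ≠ 0) :
    ContDiffAt ℝ 2 (φ.time K s0) z ∧ ∀ u, fderiv ℝ (φ.time K s0) z u
      = tDer D c K s0 (φ.point z) (fderiv ℝ φ.point z u) := by
  have hn := φ.off_mem_nhds hD hz h0
  have hp : ContDiffAt ℝ 2 φ.point z := by
    exact (by fun_prop : ContDiffAt ℝ 2 (fun z : R4 => z 0) z).prodMk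
      ((by fun_prop : ContDiffAt ℝ 2 (fun z : R4 => z 1) z).prodMk (ContDiffAt.comp z
          ((φ.contDiffAt_χ hz.2.2.2).of_le two_le_infty) (contDiffAt_pi.2 fun i => by fin_cases i
              <;> (simp; fun_prop))))
  have hm : ∀ z' ∈ φ.dom D c ∩ {z | z 0 ≠ 0}, φ.point z' ∈ cDom D c :=
    fun z' hz' => cyl_subset (φ.point_mem hz'.1)
  refine ⟨?_, fun u => ?_⟩
  · exact ((contDiffOn_fst.prodMk (((timeFn_smooth hD hg).of_le two_le_infty).prodMk
        contDiffOn_snd.snd) _ (hm z ⟨hz, h0⟩)).comp z hp.contDiffWithinAt hm).contDiffAt hn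
  · change fderiv ℝ (timeMap K s0 ∘ φ.point) z u = _
    rw [((HasFDerivWithinAt.comp z (hasFDeriv_timeMap hD hg (hm z ⟨hz, h0⟩))
        (hp.differentiableAt (by norm_num)).hasFDerivAt.hasFDerivWithinAt hm).hasFDerivAt
            hn).fderiv]
    rfl

include hQ in
lemma metric_time {z : R4} (hz : z ∈ φ.dom D c) (h0 : z 0 ≠ 0) (u v : R4) :
    ∑ μ, ∑ ν, φ.metric g z μ ν * u μ * v ν = tMetric (redM g Q K s0) rt (φ.time K s0 z)
      (fderiv ℝ (φ.time K s0) z u) (fderiv ℝ (φ.time K s0) z v) := by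
  have h1 := (fderiv_time hD hg φ hz h0).2
  rw [← φ.metric_sum, h1, h1, metric_eq_conf hD hQ hg (φ.point_mem hz)
    (φ.isTan_point hz.2.2.2 u) (φ.isTan_point hz.2.2.2 v)]
  rfl

omit hD hg in
lemma sum_single_right (f : R4) (μ : Fin 4) (a : ℝ) :
    ∑ ν, f ν * (Pi.single μ a : R4) ν = f μ * a := by simp [Pi.single_apply]

include hQ in
theorem hasDerivWithinAt_momentum {z v : ℝ → R4} {I : Set ℝ} {τ : ℝ} {P' : Cov}
    (hz : ∀ τ ∈ I, z τ ∈ φ.dom D c) (hτ : τ ∈ I) (h0 : z τ 0 ≠ 0)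
    (hr : |rt (z τ 0)| < r0) (hd : HasDerivWithinAt z (v τ) I τ)
    (hP : HasDerivWithinAt (fun τ => tMetric (redM g Q K s0) rt (φ.time K s0 (z τ))
      (fderiv ℝ (φ.time K s0) (z τ) (v τ))) P' I τ) (μ : Fin 4) :
    HasDerivWithinAt (fun τ => ∑ ν, φ.metric g (z τ) μ ν * v τ ν)
      (1 / 2 * ∑ α, ∑ β, φ.partial_ D c μ (fun z' => φ.metric g z' α β) (z τ) * v τ α * v τ β
        + (P' (fderiv ℝ (φ.time K s0) (z τ) (Pi.single μ 1))
          - 1 / 2 * timeMetricDer (redM g Q K s0) w rt (φ.time K s0 (z τ))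
            (fderiv ℝ (φ.time K s0) (z τ) (Pi.single μ 1))
            (fderiv ℝ (φ.time K s0) (z τ) (v τ)) (fderiv ℝ (φ.time K s0) (z τ) (v τ)))) I τ := by
  set Z := φ.time K s0 with hZ
  set A' := redM g Q K s0 with hA'
  have hA := isRedMetric hD hQ hg
  have hzτ := hz τ hτ
  have hnear := φ.off_mem_nhds hD hzτ h0
  have hC := (fderiv_time hD hg φ hzτ h0).1
  have hZ2 : HasFDerivAt (fderiv ℝ Z) (fderiv ℝ (fderiv ℝ Z) (z τ)) (z τ) :=
    ((hC.fderiv_right (m := 1) (by norm_num)).differentiableAt (by norm_num)).hasFDerivAt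
  have hsymm2 : ∀ u u', fderiv ℝ (fderiv ℝ Z) (z τ) u u' = fderiv ℝ (fderiv ℝ Z) (z τ) u' u :=
    fun u u' => (hC.isSymmSndFDerivAt (by simp)).eq u u'
  have hmem : ((rt (Z (z τ)).1, (Z (z τ)).2) : Amb) ∈ redDom r0 :=
    ⟨hr, ne_of_norm (φ.point_mem hzτ).2.2.2⟩
  have hs : ∀ u u', tMetric A' rt (Z (z τ)) u u' = tMetric A' rt (Z (z τ)) u' u :=
    hA.conf_symm hmem
  set V := v τ with hV
  -- the derivative of the metric applied to a constant vector
  have hq :=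
    ((HasFDerivAt.comp (z τ) (hasFDerivAt_tMetric hA hQ.root h0 hmem)
        (hC.differentiableAt (by norm_num)).hasFDerivAt).clm_apply
      (hZ2.clm_apply (hasFDerivAt_const V _))).clm_apply (hZ2.clm_apply (hasFDerivAt_const V _))
  choose L hL hLs using fun α β => hasFDerivAt_metric hD hg φ hzτ h0 α β
  have hq' : HasFDerivAt (fun z' => tMetric A' rt (Z z') (fderiv ℝ Z z' V) (fderiv ℝ Z z' V))
      (∑ α, ∑ β, V β • V α • L α β) (z τ) := by
    refine HasFDerivAt.congr_of_eventuallyEq (f := fun z' =>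
      ∑ α, ∑ β, φ.metric g z' α β * V α * V β) ?_ ?_
    · exact HasFDerivAt.fun_sum fun α _ => HasFDerivAt.fun_sum fun β _ =>
        ((hL α β).mul_const (V α)).mul_const (V β)
    · filter_upwards [hnear] with z' hz'; exact (metric_time hD hQ hg φ hz'.1 hz'.2 V V).symm
  have h1 := DFunLike.congr_fun (hq.unique hq') (Pi.single μ 1)
  have h2 : (∑ α, ∑ β, V β • V α • L α β) (Pi.single μ 1)
      = ∑ α, ∑ β, φ.partial_ D c μ (fun z' => φ.metric g z' α β) (z τ) * V α * V β := by
    simp only [sum_apply, smul_apply, smul_eq_mul, hLs, sum_single_right, mul_one]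
    exact Finset.sum_congr rfl fun α _ => Finset.sum_congr rfl fun β _ => by ring
  rw [h2] at h1
  simp only [add_apply, ContinuousLinearMap.comp_apply, ContinuousLinearMap.flip_apply, zero_apply,
    map_zero, zero_add] at h1
  have hp : (fun τ => ∑ ν, φ.metric g (z τ) μ ν * v τ ν) =ᶠ[𝓝[I] τ] fun τ =>
      tMetric A' rt (Z (z τ)) (fderiv ℝ Z (z τ) (v τ)) (fderiv ℝ Z (z τ) (Pi.single μ 1)) := by
    filter_upwards [hd.continuousWithinAt.eventually hnear] with t ht
    rw [hA', hZ, ← metric_time hD hQ hg φ ht.1 ht.2]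
    simp only [sum_single_right, mul_one]
    exact Finset.sum_congr rfl fun ν _ => by
      rw [show φ.metric g (z t) μ ν = φ.metric g (z t) ν μ from
        (hg.lorentzian _ (φ.point_mem ht.1)).1 _ _ (φ.isTan_point ht.1.2.2.2 _)
          (φ.isTan_point ht.1.2.2.2 _)]
  have h3 := hP.clm_apply ((HasFDerivAt.comp_hasDerivWithinAt τ hZ2 hd).clm_apply
    (hasDerivWithinAt_const τ I (Pi.single μ 1 : R4)))
  refine (h3.congr_of_eventuallyEq hp (hp.self_of_nhdsWithin hτ)).congr_deriv ?_
  rw [← h1, ← hV]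
  simp only [map_zero, add_zero, hsymm2 V, Function.comp_apply]
  rw [hs (fderiv ℝ (fderiv ℝ Z) (z τ) (Pi.single μ 1) V)]
  ring

end

/-! ## The integral curves are weak geodesics -/

lemma confM_add (A : ℝ × E3 → Bil) (p : Amb) (a : ℝ) :
    confM A (p + (0, a, 0)) = exp (2 * a) • confM A p := by
  simp only [confM, smul_smul, ← exp_add, Prod.fst_add, Prod.snd_add, add_zero]
  ring_nf

lemma fderiv_confM_add (A : ℝ × E3 → Bil) (p : Amb) (a : ℝ) :
    fderiv ℝ (confM A) (p + (0, a, 0)) = exp (2 * a) • fderiv ℝ (confM A) p := by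
  rw [← fderiv_comp_add_right]
  simp [confM_add]
  have := invertibleOfNonzero (exp_ne_zero (2 * a))
  exact fderiv_const_smul_of_invertible (exp (2 * a))

/-- The derivative of the momentum along a geodesic. -/
def timeForce (A : ℝ × E3 → Bil) (w rt : ℝ → ℝ) (x ξ : Amb) : Cov :=
  (1 / 2 : ℝ) • ((timeMetricDer A w rt x).flip ξ).flip ξ

lemma timeForce_apply (A : ℝ × E3 → Bil) (w rt : ℝ → ℝ) (x ξ u : Amb) :
    timeForce A w rt x ξ u = 1 / 2 * timeMetricDer A w rt x u ξ ξ := rfl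

section

variable (φ : SphereChart)
include hD hQ hg

lemma hasDerivWithinAt_velocity {z v : ℝ → R4} {I : Set ℝ} {τ : ℝ}
    (hz : ∀ τ ∈ I, z τ ∈ φ.dom D c) (hτ : τ ∈ I) (h0 : z τ 0 ≠ 0)
    (hr : |rt (z τ 0)| < r0) (hd : HasDerivWithinAt z (v τ) I τ) (hv : ContinuousWithinAt v I τ)
    (hP : HasDerivWithinAt (fun τ => tMetric (redM g Q K s0) rt (φ.time K s0 (z τ))
      (fderiv ℝ (φ.time K s0) (z τ) (v τ)))
      (timeForce (redM g Q K s0) w rt (φ.time K s0 (z τ))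
        (fderiv ℝ (φ.time K s0) (z τ) (v τ))) I τ) :
    HasDerivWithinAt v (fun l => -φ.gammaSum D c g (z τ) (v τ) l) I τ := by
  choose L hL hLs using fun α β => hasFDerivAt_metric hD hg φ (hz τ hτ) h0 α β
  refine hasDerivWithinAt_of_mulVec
    (fun μ ν => HasFDerivAt.comp_hasDerivWithinAt τ (hL μ ν) hd) (φ.isUnit_det hg (hz τ hτ)) hv
    (hasDerivWithinAt_momentum hD hQ hg φ hz hτ h0 hr hd hP) ?_
  funext l
  rw [φ.gammaSum_eq, Matrix.mulVec, dotProduct, ← Finset.sum_neg_distrib]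
  refine Finset.sum_congr rfl fun σ _ => ?_
  rw [timeForce_apply, ← mul_neg]
  simp only [hLs]
  congr 1
  ring

lemma exists_gamma_weight {z v : ℝ → R4} {I : Set ℝ} (hz : ∀ τ ∈ I, z τ ∈ φ.dom D c)
    (hr : ∀ τ ∈ I, |rt (z τ 0)| < r0) (hzc : ContinuousOn z I) (hvc : ContinuousOn v I)
    (l : Fin 4) : ∃ E : ℝ → ℝ, ContinuousOn E I ∧ ∀ τ ∈ I, z τ 0 ≠ 0 →
      w (rt (z τ 0)) * φ.gammaSum D c g (z τ) (v τ) l = E τ := by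
  set R : ℝ → ℝ × (Fin 3 → ℝ) := fun τ => (rt (z τ 0), vecTail (z τ)) with hR
  set F : Fin 4 → Fin 4 → ℝ × (Fin 3 → ℝ) → ℝ := fun μ ν p =>
    φ.metric g (vecCons (Q p.1) p.2) μ ν with hF
  have hz0 := (continuous_apply 0).comp_continuousOn hzc
  have hRc : ContinuousOn R I := (hQ.root.cont.comp_continuousOn hz0).prodMk
    (continuousOn_pi.2 fun i => (continuous_apply i.succ).comp_continuousOn hzc)
  have hRm : MapsTo R I (substDom φ r0) := fun τ hτ => ⟨hr τ hτ, φ.tail_mem (hz τ hτ)⟩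
  have hRz : ∀ τ ∈ I, (vecCons (Q (R τ).1) (R τ).2 : R4) = z τ := fun τ hτ => by
    rw [hQ.left _ (hz τ hτ).1, SphereChart.vecCons_tail]
  have hreg := fun μ ν => hQ.metric_reg hD hg φ μ ν
  have hdF := fun μ ν =>
    (hreg μ ν).fderiv.cont.comp hRc hRm
  have hFc : ∀ μ ν, ContinuousOn (fun τ => φ.metric g (z τ) μ ν) I := fun μ ν =>
    ((hreg μ ν).contDiffOn.continuousOn.comp hRc hRm).congr fun τ hτ => by grind
  set d : Fin 4 → Fin 4 → Fin 4 → ℝ → ℝ := fun μ α β τ =>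
    Fin.cases (fderiv ℝ (F α β) (R τ) (1, 0))
      (fun i => w (rt (z τ 0)) * fderiv ℝ (F α β) (R τ) (0, Pi.single i 1)) μ with hd
  have hdc : ∀ μ α β, ContinuousOn (d μ α β) I := fun μ α β => by
    refine Fin.cases ?_ (fun i => ?_) μ
    · exact (hdF α β).clm_apply continuousOn_const
    · exact ((hQ.w_cont.comp hQ.root.cont).comp_continuousOn hz0).mul
          ((hdF α β).clm_apply continuousOn_const)
  have hde : ∀ τ ∈ I, z τ 0 ≠ 0 → ∀ μ α β, w (rt (z τ 0)) *
      φ.partial_ D c μ (fun z' => φ.metric g z' α β) (z τ) = d μ α β τ := by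
    intro τ hτ h0 μ α β
    have hF1 := (hreg α β).hasFDerivAt (isOpen_substDom φ r0) (hRm hτ)
    refine Fin.cases ?_ (fun i => ?_) μ
    · obtain ⟨hw0, hrt⟩ := hQ.root.deriv _ h0
      have h1 := HasFDerivAt.comp_hasDerivAt
        (f := fun q => (rt q, vecTail (z τ))) (z τ 0) hF1
        (hrt.prodMk (hasDerivAt_const _ _))
      have h2 : HasDerivAt (fun q => F α β (rt q, vecTail (z τ))) _ (z τ 0) :=
        (hasDerivAt_metric_q hD hg φ (hz τ hτ) h0 α β).congr_of_eventuallyEq (by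
          filter_upwards [hD.mem_nhds (hz τ hτ).1 h0] with q hq
          simp only [hF, hQ.left q hq])
      rw [h2.unique h1]
      have h3 : (((w (rt (z τ 0)))⁻¹, 0) : ℝ × (Fin 3 → ℝ)) = (w (rt (z τ 0)))⁻¹ • (1, 0) := by simp
      rw [h3, map_smul, smul_eq_mul, mul_inv_cancel_left₀ hw0]
      rfl
    · have h1 := HasFDerivAt.comp
        (vecTail (z τ)) hF1 (hasFDerivAt_prodMk_right _ _)
      have h2 : (F α β ∘ fun x : Fin 3 → ℝ => ((R τ).1, x))
          = fun x => φ.metric g (vecCons (z τ 0) x) α β := by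
        funext x
        simp only [hF, hR, Function.comp_apply, hQ.left _ (hz τ hτ).1]
      rw [h2] at h1
      rw [φ.partial_succ (hz τ hτ) h1.differentiableAt, h1.fderiv]
      rfl
  have hIc : ∀ σ, ContinuousOn (fun τ => (φ.metric g (z τ))⁻¹ l σ) I := fun σ τ hτ => by
    have h1 :=
      continuousWithinAt_pi.2 fun μ => continuousWithinAt_pi.2 fun ν => hFc μ ν τ hτ
    have h3 := (continuousAt_matrix_inv (φ.metric g (z τ)) (by
      rw [← (φ.isUnit_det hg (hz τ hτ)).unit_spec]
      exact NormedRing.inverse_continuousAt _)).tendsto.comp h1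
    exact tendsto_pi_nhds.1 (tendsto_pi_nhds.1 h3 l) σ
  have hvi := fun i =>
    (continuous_apply i).comp_continuousOn hvc
  refine ⟨fun τ => ∑ σ, (φ.metric g (z τ))⁻¹ l σ * (∑ ν, (∑ μ, d μ σ ν τ * v τ μ) * v τ ν
    - 1 / 2 * ∑ μ, ∑ ν, d σ μ ν τ * v τ μ * v τ ν), ?_, fun τ hτ h0 => ?_⟩
  · refine continuousOn_finsetSum _ fun σ _ => (hIc σ).mul (ContinuousOn.sub ?_ ?_)
    · exact continuousOn_finsetSum _ fun ν _ => (continuousOn_finsetSum _ fun μ _ =>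
        (hdc μ σ ν).mul (hvi μ)).mul (hvi ν)
    · exact continuousOn_const.mul (continuousOn_finsetSum _ fun μ _ =>
        continuousOn_finsetSum _ fun ν _ => ((hdc σ μ ν).mul (hvi μ)).mul (hvi ν))
  · simp only [← hde τ hτ h0, φ.gammaSum_eq, Finset.mul_sum, Finset.sum_mul, mul_sub]
    refine Finset.sum_congr rfl fun σ _ => ?_
    congr 1
    · exact Finset.sum_congr rfl fun μ _ => Finset.sum_congr rfl fun ν _ => by ring
    · exact Finset.sum_congr rfl fun μ _ => Finset.sum_congr rfl fun ν _ => by ring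

theorem weak_of_velocity {z v : ℝ → R4} {a b : ℝ} (hab : a < b)
    (hz : ∀ τ ∈ Icc a b, z τ ∈ φ.dom D c) (hr : ∀ τ ∈ Icc a b, |rt (z τ 0)| < r0)
    (hd : ∀ τ ∈ Icc a b, HasDerivWithinAt z (v τ) (Icc a b) τ) (hvc : ContinuousOn v (Icc a b))
    (h0 : ∀ τ ∈ Icc a b, v τ 0 ≠ 0)
    (hv : ∀ τ ∈ Icc a b, z τ 0 ≠ 0 →
      HasDerivWithinAt v (fun l => -φ.gammaSum D c g (z τ) (v τ) l) (Icc a b) τ) (l : Fin 4) :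
    (∀ τ ∈ Icc a b, z τ l = z a l + ∫ t in a..τ, v t l) ∧
    IntervalIntegrable (fun t => φ.gammaSum D c g (z t) (v t) l) MeasureTheory.volume a b ∧
    ∀ τ ∈ Icc a b, v τ l = v a l - ∫ t in a..τ, φ.gammaSum D c g (z t) (v t) l := by
  have hzc := fun τ hτ => (hd τ hτ).continuousWithinAt
  have hvi : ∀ i, ContinuousOn (fun τ => v τ i) (Icc a b) := fun i =>
    (continuous_apply i).comp_continuousOn hvc
  have hzi := fun i =>
    (continuous_apply i).comp_continuousOn hzc
  have hda := fun τ hτ i =>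
    (hasDerivWithinAt_pi.1 (hd τ (Ioo_subset_Icc_self hτ)) i).hasDerivAt
      (Icc_mem_nhds hτ.1 hτ.2)
  obtain ⟨σ, hσ, hpos⟩ := pos_or_neg isPreconnected_Icc (hvi 0) h0
  have hmono : StrictMonoOn (fun τ => σ * z τ 0) (Icc a b) := by
    refine strictMonoOn_of_deriv_pos (convex_Icc a b) (continuousOn_const.mul (hzi 0)) ?_
    intro τ hτ
    rw [interior_Icc] at hτ
    rw [((hda τ hτ 0).const_mul σ).deriv]
    exact hpos τ (Ioo_subset_Icc_self hτ)
  set s := {τ | τ ∈ Icc a b ∧ z τ 0 = 0} with hs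
  have hsc : s.Countable := (Set.Subsingleton.finite fun x hx y hy =>
    hmono.injOn hx.1 hy.1 (by simp only [hx.2, hy.2])).countable
  obtain ⟨E, hE, hEe⟩ := exists_gamma_weight hD hQ hg φ hz hr hzc hvc l
  have hint : IntervalIntegrable (fun t => φ.gammaSum D c g (z t) (v t) l)
      MeasureTheory.volume a b := by
    have h1 : MonotoneOn (fun τ => σ * rt (z τ 0)) (uIcc a b) := by
      rw [uIcc_of_le hab.le]
      intro x hx y hy hxy
      have h2 := hmono.monotoneOn hx hy hxy
      rcases hσ with rfl | rfl
      · simpa using hQ.root.mono.monotone (by simpa using h2)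
      · simpa using hQ.root.mono.monotone (by simpa using h2)
    have h3 : ContinuousOn (fun τ => E τ * (σ * v τ 0)⁻¹) (uIcc a b) := by
      rw [uIcc_of_le hab.le]
      exact hE.mul ((continuousOn_const.mul (hvi 0)).inv₀ fun τ hτ => (hpos τ hτ).ne')
    refine (h1.intervalIntegrable_deriv.continuousOn_mul h3).congr_ae ?_
    rw [uIoc_of_le hab.le]
    filter_upwards [MeasureTheory.ae_restrict_of_ae ((hsc.union (countable_singleton b)).ae_notMem
        _), MeasureTheory.ae_restrict_mem measurableSet_Ioc] with t ht1 ht2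
    have ht := Ioc_subset_Icc_self ht2
    have ht0 := fun h => ht1 (Or.inl ⟨ht, h⟩)
    obtain ⟨hw0, hrt⟩ := hQ.root.deriv _ ht0
    have h5 : HasDerivAt (fun τ => σ * rt (z τ 0)) (σ * ((w (rt (z t 0)))⁻¹ * v t 0)) t :=
      (HasDerivAt.comp t hrt (hda t ⟨ht2.1, lt_of_le_of_ne ht2.2 fun h =>
          ht1 (Or.inr h)⟩ 0)).const_mul σ
    rw [h5.deriv, ← hEe t ht ht0]
    have h7 := h0 t ht
    have h8 := left_ne_zero_of_mul (hpos t ht).ne'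
    field_simp
  have hftc : ∀ (f f' : ℝ → ℝ), ContinuousOn f (Icc a b) →
      (∀ x ∈ Ioo a b, z x 0 ≠ 0 → HasDerivAt f (f' x) x) →
      IntervalIntegrable f' MeasureTheory.volume a b → ∀ τ ∈ Icc a b,
      f τ = f a + ∫ t in a..τ, f' t := fun f f' hf hf' hi τ hτ => by
    rw [MeasureTheory.integral_eq_of_hasDerivAt_off_countable_of_le f f' hτ.1 hsc
      (hf.mono (Icc_subset_Icc_right hτ.2)) (fun x hx => ?_)
      (hi.mono_set (by rw [uIcc_of_le hτ.1, uIcc_of_le hab.le]; exact Icc_subset_Icc_right hτ.2))]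
    · ring
    · grind
  refine ⟨hftc _ _ (hzi l) (fun x hx _ => hda x hx l) ((hvi l).intervalIntegrable_of_Icc hab.le),
    hint, fun τ hτ => ?_⟩
  rw [hftc _ (fun t => -φ.gammaSum D c g (z t) (v t) l) (hvi l) (fun x hx hx0 => ?_) hint.neg τ hτ,
    intervalIntegral.integral_neg, sub_eq_add_neg]
  exact (hasDerivWithinAt_pi.1 (hv x (Ioo_subset_Icc_self hx) hx0) l).hasDerivAt
    (Icc_mem_nhds hx.1 hx.2)

end

lemma IsReducedGauge.tMetric_fst {A : ℝ × E3 → Bil} {w rt : ℝ → ℝ} {r0 δ δ' c' σ : ℝ}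
    {y : ℝ → E3 → St} {Φ Φi : Amb → Amb} (hA : IsRedMetric A r0)
    (hy : IsNullFlow A w r0 δ y) (hΦ : IsReducedGauge A y rt δ δ' c' σ Φ Φi) {x : Amb}
    (hx : x ∈ gDom c') (h1 : ‖x.2.2‖ = 1) :
    tMetric A rt (Φ x) (fderiv ℝ Φ x (1, 0, 0))
      = exp (2 * x.2.1) • (y (rt (Φ x).1) x.2.2).2.2 :=
  ContinuousLinearMap.ext fun u => hΦ.conf_fst hA hy hx h1 u

lemma timeForce_add {A : ℝ × E3 → Bil} {w rt : ℝ → ℝ} {r : ℝ} {Y : St} {x : Amb} {a : ℝ}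
    (hw : w r ≠ 0) (hξ : (stVel A r Y).1 ≠ 0)
    (hx : ((rt x.1, x.2) : Amb) = (r, Y.2.1) + (0, a, 0)) :
    exp (2 * a) • ((w r)⁻¹ * (stVel A r Y).1) • ((2 * (stVel A r Y).1)⁻¹ •
      forceCov (fderiv ℝ (confM A) (r, Y.2.1)) (w r) (stVel A r Y))
      = timeForce A w rt x (stVel A r Y) := by
  refine ContinuousLinearMap.ext fun u => ?_
  have h2 : timeMetricDer A w rt x u = exp (2 * a) •
      fderiv ℝ (confM A) (r, Y.2.1) ((w r)⁻¹ * u.1, u.2) := by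
    change fderiv ℝ (confM A) (rt x.1, x.2) ((w (rt x.1))⁻¹ * u.1, u.2) = _
    rw [hx, (by simpa using (congrArg Prod.fst hx) : rt x.1 = r), fderiv_confM_add]
    rfl
  rw [timeForce_apply, h2]
  simp only [smul_apply, forceCov_apply, smul_eq_mul,
      (Prod.ext (by simp [hw]) rfl : ((u.1, w r • u.2) : Amb) = w r • ((w r)⁻¹ * u.1, u.2)),
          map_smul]
  field_simp

section

include hD hg hΦ

lemma gauge_curve {J : Set ℝ} {γ : ℝ → Amb} (hJ : J.OrdConnected)
    (hγ : IsIntegralCurveIn (gaugeField D c K s0 Φ Φi) (gaugeSet D c K s0 c' Φ) γ J)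
    {a τ : ℝ} (ha : a ∈ J) (hτ : τ ∈ J) :
    Φi (timeMap K s0 (γ τ)) = Φi (timeMap K s0 (γ a)) + (τ - a, 0, 0) := by
  have hd : ∀ t ∈ J, HasDerivWithinAt (fun t => Φi (timeMap K s0 (γ t)) - (t, 0, 0)) 0 J t := by
    intro t ht
    obtain ⟨hm, hd⟩ := hγ t ht
    obtain ⟨h1, h2⟩ := gaugeSet_spec hΦ hm
    have hc := cyl_subset hm.1
    have h3 := hΦ.hasFDerivAt_inv h1
    have h4 := hΦ.inv_fderiv h1 (1, 0, 0)
    rw [h2] at h3 h4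
    have h5 := HasFDerivWithinAt.comp_hasDerivWithinAt t
      (HasFDerivAt.comp_hasFDerivWithinAt (γ t) h3 (hasFDeriv_timeMap hD hg hc))
      hd fun t ht => cyl_subset (hγ t ht).1.1
    rw [ContinuousLinearMap.comp_apply, gaugeField, tDer_tInvDer hD hg hc, h4] at h5
    exact (HasDerivWithinAt.sub h5 ((hasDerivAt_id t).prodMk
        (hasDerivAt_const _ _)).hasDerivWithinAt).congr_deriv (sub_self _)
  have h7 := (convex_iff_ordConnected.2 hJ).is_const_of_fderivWithin_eq_zero (𝕜 := ℝ)
    (fun t ht => (hd t ht).differentiableWithinAt)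
    (fun t ht => by
      by_cases hu : UniqueDiffWithinAt ℝ J t
      · rw [(hd t ht).hasFDerivWithinAt.fderivWithin hu]
        exact ContinuousLinearMap.ext fun r => by simp
      · exact fderivWithin_zero_of_not_uniqueDiffWithinAt hu) hτ ha
  refine (sub_eq_iff_eq_add.1 h7).trans ?_
  refine Prod.ext ?_ (by simp)
  simp only [Prod.fst_add, Prod.fst_sub]
  ring

include hQ hy in
theorem gaugeField_isWeaklyGeodesicField :
    IsWeaklyGeodesicField D c g (gaugeField D c K s0 Φ Φi) (gaugeSet D c K s0 c' Φ) := by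
  intro J γ hJ hγ
  refine ⟨fun τ hτ => (hγ τ hτ).1.1, fun τ hτ => (hγ τ hτ).2.continuousWithinAt,
    fun φ a b hab hsub z hz => ?_⟩
  obtain ⟨H, O, hO, hH, h1, h2⟩ := φ.exists_coord
  set V := gaugeField D c K s0 Φ Φi with hV
  have hγd := fun τ hτ =>
    (hγ τ (hsub hτ)).2.mono hsub
  have hγO : ∀ τ ∈ Icc a b, γ τ ∈ O := fun τ hτ => by
    rw [← (hz τ hτ).2]
    exact (h1 _ (hz τ hτ).1.2.2.2).1
  have hzH : ∀ τ ∈ Icc a b, z τ = H (γ τ) := fun τ hτ => by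
    rw [← (hz τ hτ).2, (h1 _ (hz τ hτ).1.2.2.2).2]
  have hzd :=
    fun τ hτ => (HasFDerivAt.comp_hasDerivWithinAt τ ((hH.differentiableOn (by simp)
      |>.differentiableAt (hO.mem_nhds (hγO τ hτ))).hasFDerivAt) (hγd τ hτ)).congr hzH (hzH τ hτ)
  set v : ℝ → R4 := fun τ => fderiv ℝ H (γ τ) (V (γ τ)) with hv
  have hvp := fun τ hτ => by
    exact (uniqueDiffOn_Icc hab τ hτ).eq_deriv _
      ((HasFDerivAt.comp_hasDerivWithinAt τ (φ.hasFDerivAt_point (hz τ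
          hτ).1.2.2.2).differentiableAt.hasFDerivAt (hzd τ hτ)).congr (fun t ht =>
              (hz t ht).2.symm) (hz τ hτ).2.symm) (hγd τ hτ)
  have hvc :=
    ((hH.continuousOn_fderiv_of_isOpen hO (by simp)).comp
      (fun τ hτ => (hγd τ hτ).continuousWithinAt) hγO).clm_apply
      ((gaugeField_continuousOn hD hg hΦ).comp (fun τ hτ => (hγd τ hτ).continuousWithinAt)
        fun τ hτ => (hγ τ (hsub hτ)).1)
  set x : ℝ → Amb := fun τ => Φi (timeMap K s0 (γ τ)) with hx
  have hxs : ∀ τ ∈ Icc a b, x τ ∈ gDom c' ∧ Φ (x τ) = timeMap K s0 (γ τ) := fun τ hτ =>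
    gaugeSet_spec hΦ (hγ τ (hsub hτ)).1
  have hxn := fun τ hτ => gaugeSet_norm hy hΦ (hγ τ (hsub hτ)).1
  have hx2 : ∀ τ ∈ Icc a b, (x τ).2 = (x a).2 := fun τ hτ => by
    simp only [hx, gauge_curve hD hg hΦ hJ hγ (hsub (left_mem_Icc.2 hab.le)) (hsub hτ),
        Prod.snd_add, Prod.mk_zero_zero, add_zero]
  have hq : ∀ τ ∈ Icc a b, (Φ (x τ)).1 = z τ 0 := fun τ hτ => by
    rw [(hxs τ hτ).2, ← (hz τ hτ).2]
    rfl
  have hδ : ∀ τ ∈ Icc a b, |rt (z τ 0)| < δ := fun τ hτ => by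
    rw [← hq τ hτ]
    exact hΦ.rt_lt (hxs τ hτ).1
  set θ := (x a).2.2 with hθ
  have hθ0 := ne_of_norm (hxn a (left_mem_Icc.2 hab.le))
  have hdir : ∀ τ ∈ Icc a b, fderiv ℝ Φ (x τ) (1, 0, 0)
      = stVel (redM g Q K s0) (rt (z τ 0)) (y (rt (z τ 0)) θ) := fun τ hτ => by
    rw [hΦ.deriv_fst _ (hxs τ hτ).1 (hxn τ hτ), geoVel, hq τ hτ, hx2 τ hτ]
  have hDZ : ∀ τ ∈ Icc a b, tDer D c K s0 (φ.point (z τ)) (fderiv ℝ φ.point (z τ) (v τ))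
      = stVel (redM g Q K s0) (rt (z τ 0)) (y (rt (z τ 0)) θ) := fun τ hτ => by
    rw [hvp τ hτ, (hz τ hτ).2, ← hdir τ hτ]
    exact tDer_tInvDer hD hg (cyl_subset (hγ τ (hsub hτ)).1.1) _
  have hv0 : ∀ τ ∈ Icc a b,
      v τ 0 = (stVel (redM g Q K s0) (rt (z τ 0)) (y (rt (z τ 0)) θ)).1 := fun τ hτ => by
    rw [← hDZ τ hτ, tDer_apply, φ.fderiv_point (hz τ hτ).1.2.2.2]
  have hv0' : ∀ τ ∈ Icc a b, v τ 0 ≠ 0 := fun τ hτ => by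
    rw [hv0 τ hτ]
    exact (hy.dom _ _ (hδ τ hτ) hθ0).2
  refine ⟨v, hvc, weak_of_velocity hD hQ hg φ hab (fun τ hτ => (hz τ hτ).1)
    (fun τ hτ => (hδ τ hτ).trans_le hy.le) hzd hvc hv0' fun τ hτ h0 => ?_⟩
  refine hasDerivWithinAt_velocity hD hQ hg φ (fun τ hτ => (hz τ hτ).1) hτ h0
    ((hδ τ hτ).trans_le hy.le) (hzd τ hτ) (hvc τ hτ) ?_
  obtain ⟨hw0, hrt⟩ := hQ.root.deriv _ h0
  have hZt : ∀ τ ∈ Icc a b, φ.time K s0 (z τ) = Φ (x τ) := fun τ hτ => by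
    rw [(hxs τ hτ).2, ← (hz τ hτ).2]
    rfl
  have hd0 : ∀ τ ∈ Icc a b, z τ 0 ≠ 0 → fderiv ℝ (φ.time K s0) (z τ) (v τ)
      = fderiv ℝ Φ (x τ) (1, 0, 0) := fun τ hτ h0 => by
    rw [(fderiv_time hD hg φ (hz τ hτ).1 h0).2, hDZ τ hτ, hdir τ hτ]
  have hP : HasDerivWithinAt (fun t => exp (2 * (x a).2.1) • (y (rt (z t 0)) θ).2.2)
      (timeForce (redM g Q K s0) w rt (φ.time K s0 (z τ))
        (fderiv ℝ (φ.time K s0) (z τ) (v τ))) (Icc a b) τ := by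
    refine ((HasDerivAt.scomp_hasDerivWithinAt τ (charField_mom (hy.ode _ _ (hδ τ hτ) hθ0))
        (HasDerivAt.comp_hasDerivWithinAt τ hrt ((hasDerivWithinAt_pi.1 (hzd τ hτ) 0).congr_deriv
            (hv0 τ hτ)))).const_smul (exp (2 * (x a).2.1))).congr_deriv ?_
    rw [hd0 τ hτ h0, hdir τ hτ]
    have h6 := timeForce_add (rt := rt)
      (x := φ.time K s0 (z τ)) hw0 (hy.dom _ _ (hδ τ hτ) hθ0).2 (by
        rw [hZt τ hτ]
        refine Prod.ext (by simp [hq τ hτ]) (Prod.ext ?_ ?_)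
        · simp only [hΦ.snd_eq (hxs τ hτ).1, hq τ hτ, hx2 τ hτ, Prod.snd_add, Prod.fst_add]
          exact add_comm _ _
        · simp only [hΦ.thd_eq (hxs τ hτ).1, hq τ hτ, hx2 τ hτ, Prod.snd_add, add_zero]
          rw [← hθ, show ‖θ‖ = 1 from hxn a (left_mem_Icc.2 hab.le), one_smul])
    exact h6
  have hcong : ∀ t ∈ Icc a b, z t 0 ≠ 0 → tMetric (redM g Q K s0) rt (φ.time K s0 (z t))
      (fderiv ℝ (φ.time K s0) (z t) (v t))
      = exp (2 * (x a).2.1) • (y (rt (z t 0)) θ).2.2 := fun t ht h0 => by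
    rw [hd0 t ht h0, hZt t ht, hΦ.tMetric_fst (isRedMetric hD hQ hg) hy (hxs t ht).1 (hxn t ht),
        hx2 t ht, hq t ht]
  refine hP.congr_of_eventuallyEq ?_ (hcong τ hτ h0)
  filter_upwards [(hasDerivWithinAt_pi.1 (hzd τ hτ) 0).continuousWithinAt.eventually_ne h0,
      self_mem_nhdsWithin] with t ht0 ht using hcong t ht ht0

end

/-! ## Weak geodesics that start in the null direction -/

lemma hasDerivWithinAt_of_ne {E : Type*} [NormedAddCommGroup E] [NormedSpace ℝ E] {f F : ℝ → E}
    {R : Set ℝ} (hR : R.OrdConnected) (hf : ContinuousOn f R) {a : ℝ} (ha : a ∈ R)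
    (hd : ∀ r ∈ R, r ≠ a → HasDerivWithinAt f (F r) R r) (hF : ContinuousWithinAt F R a) :
    HasDerivWithinAt f (F a) R a := by
  rw [hasDerivWithinAt_iff_isLittleO, Asymptotics.isLittleO_iff]
  intro ε hε
  obtain ⟨η, hη, hball⟩ := Metric.mem_nhdsWithin_iff.1
    (hF.eventually (Metric.closedBall_mem_nhds (F a) hε))
  filter_upwards [self_mem_nhdsWithin, mem_nhdsWithin_of_mem_nhds (Metric.ball_mem_nhds a hη)]
    with r hr hrb
  rcases eq_or_ne r a with rfl | hra
  · simp
  set S := {s | s ∈ R ∧ s ∈ Metric.ball a η ∧ 0 < (s - a) * (r - a)} with hS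
  have hr0 := mul_self_pos.2 (sub_ne_zero.2 hra)
  have hSc : Convex ℝ S := (convex_iff_ordConnected.2 hR).inter ((convex_ball a η).inter (by
    intro x hx y hy p q hp hq hpq
    have hx' : 0 < (x - a) * (r - a) := hx
    have hy' : 0 < (y - a) * (r - a) := hy
    change 0 < (p * x + q * y - a) * (r - a)
    have h1 : (p * x + q * y - a) * (r - a) = p * ((x - a) * (r - a)) + q *
        ((y - a) * (r - a)) := by
      linear_combination (a * (r - a)) * hpq
    rw [h1]
    rcases hp.eq_or_lt with rfl | hp
    · simp_all
    · positivity))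
  have hSr : r ∈ S := ⟨hr, hrb, hr0⟩
  have h1 : ∀ s ∈ S, ‖(f r - r • F a) - (f s - s • F a)‖ ≤ ε * ‖r - s‖ := fun s hs =>
    hSc.norm_image_sub_le_of_norm_hasDerivWithin_le (fun t ht => by
        have h2 := ((hd t ht.1 fun h => by simpa [h] using ht.2.2).mono
          (fun s hs => hs.1 : S ⊆ R)).sub ((hasDerivAt_id t).smul_const (F a)).hasDerivWithinAt
        rw [one_smul] at h2
        exact h2)
      (fun t ht => by
        have : dist (F t) (F a) ≤ ε := hball ⟨ht.2.1, ht.1⟩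
        rwa [dist_eq_norm] at this) hs hSr
  -- the points `a + t (r - a)` tend to `a`
  have h3 : Tendsto (fun t : ℝ => a + t * (r - a)) (𝓝[Ioc 0 1] 0) (𝓝[R] a) := by
    refine tendsto_nhdsWithin_iff.2 ⟨?_, eventually_mem_nhdsWithin.mono fun t ht => ?_⟩
    · have : ContinuousAt (fun t : ℝ => a + t * (r - a)) 0 := by fun_prop
      simpa using this.tendsto.mono_left nhdsWithin_le_nhds
    · have := (convex_iff_ordConnected.2 hR) ha hr (sub_nonneg.2 ht.2) ht.1.le (by ring)
      simp only [smul_eq_mul] at this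
      convert this using 1
      ring
  have hne : (𝓝[Ioc (0 : ℝ) 1] 0).NeBot := by rw [nhdsWithin_Ioc_eq_nhdsGT one_pos]; infer_instance
  have h4 : Tendsto (fun s : ℝ => ‖(f r - r • F a) - (f s - s • F a)‖) (𝓝[R] a)
      (𝓝 ‖(f r - r • F a) - (f a - a • F a)‖) :=
    (tendsto_const_nhds.sub ((hf a ha).sub (tendsto_nhdsWithin_of_tendsto_nhds
      ((by fun_prop : Continuous fun s : ℝ => s • F a).tendsto a)))).norm
  have h5 : Tendsto (fun s : ℝ => ε * ‖r - s‖) (𝓝[R] a) (𝓝 (ε * ‖r - a‖)) :=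
    tendsto_nhdsWithin_of_tendsto_nhds ((by fun_prop : Continuous fun s : ℝ =>
        ε * ‖r - s‖).tendsto a)
  have h6 := le_of_tendsto_of_tendsto (h4.comp h3) (h5.comp h3) (by
    have hb :=
      (h3.mono_right nhdsWithin_le_nhds).eventually (Metric.ball_mem_nhds a hη)
    filter_upwards [hb, h3.eventually self_mem_nhdsWithin, self_mem_nhdsWithin] with t h7 h8 h9
    refine h1 _ ⟨h8, h7, ?_⟩
    have := h9.1
    rw [add_sub_cancel_left, mul_assoc]
    positivity)
  refine le_of_eq_of_le ?_ h6
  rw [sub_smul]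
  congr 1
  abel

lemma exists_Icc_nhdsWithin {J U : Set ℝ} (hJ : J.OrdConnected) {τ : ℝ} (hτ : τ ∈ J)
    (hU : U ∈ 𝓝[J] τ) : ∃ a b, τ ∈ Icc a b ∧ Icc a b ⊆ J ∧ Icc a b ⊆ U ∧ Icc a b ∈ 𝓝[J] τ ∧
      (a < b ∨ 𝓝[J] τ = pure τ) := by
  have hU' : ((↑)) ⁻¹' U ∈ 𝓝 (⟨τ, hτ⟩ : J) := by
    rw [nhds_subtype_eq_comap_nhdsWithin]
    exact preimage_mem_comap hU
  obtain ⟨a, b, h1, h2, h3⟩ := exists_Icc_mem_subset_of_mem_nhds hU'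
  have h4 := hJ.out a.2 b.2
  have h5 : Icc (a : ℝ) b ∈ 𝓝[J] τ := by rw [← map_nhds_subtype_val ⟨τ, hτ⟩]; exact h2
  refine ⟨a, b, h1, h4, fun t ht => (h3 (show (⟨t, h4 ht⟩) ∈ Icc a b from ht)), h5, ?_⟩
  rcases (h1.1.trans h1.2).lt_or_eq with h | h
  · exact Or.inl h
  · refine Or.inr (le_antisymm (le_pure_iff.2 ?_) (pure_le_nhdsWithin hτ))
    rw [h, Icc_self] at h5
    grind

lemma continuousOn_invFunOn_of_isCompact {k : ℝ → ℝ} {I : Set ℝ} (hI : IsCompact I)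
    (hk : ContinuousOn k I) (hi : InjOn k I) : ContinuousOn (Function.invFunOn k I) (k '' I) := by
  refine continuousOn_iff_isClosed.2 fun t ht => ⟨k '' (I ∩ t),
    ((hI.inter_right ht).image_of_continuousOn (hk.mono inter_subset_left)).isClosed, ?_⟩
  ext r
  constructor
  · rintro ⟨h1, τ, hτ, rfl⟩
    rw [mem_preimage, hi.leftInvOn_invFunOn hτ] at h1
    grind
  · rintro ⟨⟨τ, ⟨hτ, ht⟩, rfl⟩, h1⟩; refine ⟨?_, h1⟩; rwa [mem_preimage, hi.leftInvOn_invFunOn hτ]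

/-- The action of the flow of `∂_x` on solutions. -/
def stShift (a b : ℝ) (Y : St) : St := (Y.1 + b, Y.2.1 + (a, 0), exp (2 * a) • Y.2.2)

section

variable {A : ℝ × E3 → Bil} (hA : IsRedMetric A r0)
include hA

lemma stVel_shift {r : ℝ} {Y : St} (hY : ((r, Y.2.1) : Amb) ∈ redDom r0) (a b : ℝ) :
    stVel A r (stShift a b Y) = stVel A r Y := by
  have h1 : ((r, Y.2.1 + (a, 0))) = (r, Y.2.1) + (0, a, 0) := by simp
  have h3 := hA.sharp_conf (by simpa [redDom] using hY : ((r, Y.2.1 + (a, 0))) ∈ redDom r0)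
      (stVel A r Y)
  rw [h1, confM_add, smul_apply, stVel, hA.conf_sharp hY, ← h1] at h3
  exact h3

lemma charField_shift {w : ℝ → ℝ} {r : ℝ} {Y : St} (hY : ((r, Y.2.1) : Amb) ∈ redDom r0)
    (a b : ℝ) : charField A w (r, stShift a b Y) = ((charField A w (r, Y)).1,
      (charField A w (r, Y)).2.1, exp (2 * a) • (charField A w (r, Y)).2.2) := by
  simp [charField, stVel_shift hA hY]
  simp only [stShift, (by simp : ((r, Y.2.1 + (a, 0))) = (r, Y.2.1) + (0, a, 0)), fderiv_confM_add]
  rw [smul_comm]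
  rfl

theorem geodesic_unique {w rt : ℝ → ℝ} (hw : Continuous w) (hrt : IsRoot w rt) {δ : ℝ}
    {y : ℝ → E3 → St} (hy : IsNullFlow A w r0 δ y) {x ξ : ℝ → Amb} {a b τ1 a0 : ℝ} {θ : E3}
    (hτ1 : τ1 ∈ Icc a b) (hx : ∀ τ ∈ Icc a b, HasDerivWithinAt x (ξ τ) (Icc a b) τ)
    (hξ : ContinuousOn ξ (Icc a b)) (hξ0 : ∀ τ ∈ Icc a b, (ξ τ).1 ≠ 0)
    (hP : ∀ τ ∈ Icc a b, (x τ).1 ≠ 0 → HasDerivWithinAt (fun τ => tMetric A rt (x τ) (ξ τ))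
      (timeForce A w rt (x τ) (ξ τ)) (Icc a b) τ)
    (hδ : ∀ τ ∈ Icc a b, |rt (x τ).1| < δ) (hne : ∀ τ ∈ Icc a b, (x τ).2.2 ≠ 0) (hθ : ‖θ‖ = 1)
    (h1 : (x τ1).2 = (y (rt (x τ1).1) θ).2.1 + (a0, 0))
    (h2 : ξ τ1 = stVel A (rt (x τ1).1) (y (rt (x τ1).1) θ)) :
    ∀ᶠ τ in 𝓝[Icc a b] τ1, (x τ).2 = (y (rt (x τ).1) θ).2.1 + (a0, 0) ∧
      ξ τ = stVel A (rt (x τ).1) (y (rt (x τ).1) θ) := by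
  have hθ0 := ne_of_norm hθ
  set I := Icc a b with hI
  have hxc : ContinuousOn x I := fun τ hτ => (hx τ hτ).continuousWithinAt
  obtain ⟨σ, hσ, hpos⟩ := pos_or_neg isPreconnected_Icc hξ.fst hξ0
  have hqinj : InjOn (fun τ => (x τ).1) I := by
    have : StrictMonoOn (fun τ => σ * (x τ).1) I := by
      refine strictMonoOn_of_deriv_pos (convex_Icc a b) (continuousOn_const.mul hxc.fst) ?_
      intro τ hτ
      have hτ' := interior_subset hτ
      have h3 : HasDerivAt (fun τ => (x τ).1) (ξ τ).1 τ := by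
        rw [interior_Icc] at hτ
        exact HasDerivWithinAt.hasDerivAt (hx τ hτ').fst (Icc_mem_nhds hτ.1 hτ.2)
      rw [(h3.const_mul σ).deriv]
      exact hpos τ hτ'
    intro τ hτ τ' hτ' h
    exact this.injOn hτ hτ' (congrArg (σ * ·) h)
  set k : ℝ → ℝ := fun τ => rt (x τ).1 with hk
  have hkc := hrt.cont.comp_continuousOn hxc.fst
  have hki : InjOn k I := fun τ hτ τ' hτ' h => hqinj hτ hτ' (hrt.mono.injective h)
  set ι := Function.invFunOn k I with hι
  have hιk : ∀ τ ∈ I, ι (k τ) = τ := fun τ hτ => hki.leftInvOn_invFunOn hτ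
  set R := k '' I with hR
  have hιc : ContinuousOn ι R := continuousOn_invFunOn_of_isCompact isCompact_Icc hkc hki
  have hιm : MapsTo ι R I := by rintro r ⟨τ, hτ, rfl⟩; rwa [hιk τ hτ]
  have hRo := (isPreconnected_Icc.image k hkc).ordConnected
  have hmem : ∀ τ ∈ I, ((k τ, (x τ).2) : Amb) ∈ redDom r0 := fun τ hτ =>
    ⟨(hδ τ hτ).trans_le hy.le, hne τ hτ⟩
  set P : ℝ → Cov := fun τ => tMetric A rt (x τ) (ξ τ) with hPd
  have hPc : ContinuousOn P I := by
    have h3 :=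
      hA.conf_reg.contDiffOn.continuousOn.comp (hkc.prodMk hxc.snd) hmem
    exact h3.clm_apply hξ
  set f : ℝ → St := fun r => (ι r, (x (ι r)).2, P (ι r)) with hf
  have hfk : ∀ τ ∈ I, f (k τ) = (τ, (x τ).2, P τ) := fun τ hτ => by simp only [hf, hιk τ hτ]
  have hvel : ∀ τ ∈ I, stVel A (k τ) (f (k τ)) = ξ τ := fun τ hτ => by
    rw [hfk τ hτ]
    exact hA.sharp_conf (hmem τ hτ) (ξ τ)
  have hfc := hιc.prodMk ((hxc.snd.comp hιc hιm).prodMk (hPc.comp hιc hιm))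
  have hdom : ∀ r ∈ R, (r, f r) ∈ charDom A r0 := by
    rintro r ⟨τ, hτ, rfl⟩
    refine ⟨?_, ?_⟩
    · rw [hfk τ hτ]; exact hmem τ hτ
    · rw [hvel τ hτ]; exact hξ0 τ hτ
  have hcont :=
    (hA.charField_reg hw).cont.comp (continuousOn_id.prodMk hfc) hdom
  have hd : ∀ r ∈ R, r ≠ 0 → HasDerivWithinAt f (charField A w (r, f r)) R r := by
    rintro r ⟨τ, hτ, rfl⟩ hr0
    have hq0 : (x τ).1 ≠ 0 := fun h => hr0 (by simp only [hk, h, hrt.zero])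
    obtain ⟨hw0, hrd⟩ := hrt.deriv _ hq0
    set m := (w (k τ))⁻¹ * (ξ τ).1 with hm
    have hm0 := mul_ne_zero (inv_ne_zero hw0) (hξ0 τ hτ)
    have h3 :=
      HasDerivAt.comp_hasDerivWithinAt τ hrd (hx τ hτ).fst
    have h4 : HasDerivWithinAt ι m⁻¹ R (k τ) := by
      have h5 : HasFDerivWithinAt k (ContinuousLinearEquiv.unitsEquivAut ℝ (Units.mk0 m hm0) :
          ℝ →L[ℝ] ℝ) I (ι (k τ)) := by rw [hιk τ hτ]; exact h3.hasFDerivWithinAt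
      have h6 := HasFDerivWithinAt.of_local_left_inverse
        (tendsto_nhdsWithin_iff.2 ⟨hιc _ ⟨τ, hτ, rfl⟩, eventually_mem_nhdsWithin.mono hιm⟩)
        h5 ⟨τ, hτ, rfl⟩ (eventually_mem_nhdsWithin.mono (by rintro r ⟨τ, hτ, rfl⟩; rw [hιk τ hτ]))
      refine h6.hasDerivWithinAt.congr_deriv ?_
      simp [ContinuousLinearEquiv.unitsEquivAut]
    have hc : ∀ {E : Type} [NormedAddCommGroup E] [NormedSpace ℝ E] {F : ℝ → E} {F' : E},
        HasDerivWithinAt F F' I τ → HasDerivWithinAt (F ∘ ι) (m⁻¹ • F') R (k τ) :=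
      fun hF => HasDerivWithinAt.scomp (k τ) (by rwa [hιk τ hτ]) h4 hιm
    have h7 := h4.prodMk ((hc (hx τ hτ).snd).prodMk (hc (hP τ hτ hq0)))
    refine h7.congr_deriv ?_
    have h8 := timeForce_add (rt := rt) (x := x τ) (a := 0) hw0
      (by rw [hvel τ hτ]; exact hξ0 τ hτ) (by rw [hfk τ hτ]; simp)
    rw [hvel τ hτ, mul_zero, exp_zero, one_smul] at h8
    simp only [charField, hvel τ hτ]
    have h9 : m⁻¹ = w (k τ) / (ξ τ).1 := by rw [hm]; field_simp
    refine Prod.ext h9 (Prod.ext (by rw [h9]) ?_)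
    change m⁻¹ • timeForce A w rt (x τ) (ξ τ) = _
    rw [← h8, smul_smul, inv_mul_cancel₀ hm0, one_smul]
  have hd' : ∀ r ∈ R, HasDerivWithinAt f (charField A w (r, f r)) R r := fun r hr => by
    rcases eq_or_ne r 0 with rfl | h0
    · exact hasDerivWithinAt_of_ne hRo hfc hr hd (hcont 0 hr)
    · exact hd r hr h0
  -- comparison with the null flow
  set Y := y (k τ1) θ with hY
  have hYd := hy.dom _ _ (hδ τ1 hτ1) hθ0
  have hshift : ∀ r ∈ R, HasDerivWithinAt (fun r => stShift a0 (τ1 - Y.1) (y r θ))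
      (charField A w (r, stShift a0 (τ1 - Y.1) (y r θ))) R r := by
    rintro r ⟨τ, hτ, rfl⟩
    have h3 := hy.ode _ _ (hδ τ hτ) hθ0
    rw [charField_shift hA (hy.dom _ _ (hδ τ hτ) hθ0).1]
    have e1 : HasDerivAt (fun r => (y r θ).1 + (τ1 - Y.1)) (charField A w (k τ,
        y (k τ) θ)).1 (k τ) :=
      HasDerivAt.add_const _ h3.fst
    have e2 : HasDerivAt (fun r => (y r θ).2.1 + (a0, 0)) (charField A w (k τ, y (k τ) θ)).2.1
        (k τ) := HasDerivAt.add_const _ h3.snd.fst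
    have e3 : HasDerivAt (fun r => exp (2 * a0) • (y r θ).2.2)
        (exp (2 * a0) • (charField A w (k τ, y (k τ) θ)).2.2) (k τ) :=
      HasDerivAt.fun_const_smul _ h3.snd.snd
    exact HasDerivAt.hasDerivWithinAt (e1.prodMk (e2.prodMk e3))
  have hinit : f (k τ1) = stShift a0 (τ1 - Y.1) Y := by
    rw [hfk τ1 hτ1]
    refine Prod.ext (by simp [stShift]) (Prod.ext h1 ?_)
    change confM A (k τ1, (x τ1).2) (ξ τ1) = exp (2 * a0) • Y.2.2
    have h3 : ((k τ1, Y.2.1 + (a0, 0)) : Amb) = (k τ1, Y.2.1) + (0, a0, 0) := by simp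
    rw [h1, h2]
    change confM A (k τ1, Y.2.1 + (a0, 0)) (stVel A (k τ1) Y) = _
    rw [h3, confM_add, smul_apply, stVel, hA.conf_sharp hYd.1]
  have huniq := ode_unique_locally (charField A w) (charDom A r0) hA.isOpen_charDom
    (hA.charField_reg hw) hRo ⟨τ1, hτ1, rfl⟩ hd' hshift hinit (hdom _ ⟨τ1, hτ1, rfl⟩)
  have hkt : Tendsto k (𝓝[I] τ1) (𝓝[R] (k τ1)) :=
    tendsto_nhdsWithin_iff.2 ⟨hkc τ1 hτ1, eventually_mem_nhdsWithin.mono fun τ hτ => ⟨τ, hτ, rfl⟩⟩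
  filter_upwards [hkt.eventually huniq, self_mem_nhdsWithin] with τ h3 hτ
  refine ⟨?_, ?_⟩
  · have h4 := hfk τ hτ; rw [h3] at h4; exact (congrArg (fun Y : St => Y.2.1) h4 :).symm
  · rw [← hvel τ hτ, h3, stVel_shift hA (hy.dom _ _ (hδ τ hτ) hθ0).1]

end

/-! ## Determinacy of the null geodesic field -/

lemma hasDerivWithinAt_of_integral {f F : ℝ → ℝ} {a b τ : ℝ}
    (hi : IntervalIntegrable f MeasureTheory.volume a b)
    (hF : ∀ τ ∈ Icc a b, F τ = F a + ∫ t in a..τ, f t) (hτ : τ ∈ Icc a b)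
    (hc : ContinuousWithinAt f (Icc a b) τ) : HasDerivWithinAt F (f τ) (Icc a b) τ := by
  have : Fact (τ ∈ Icc a b) := ⟨hτ⟩
  have hab := hτ.1.trans hτ.2
  have h1 := intervalIntegral.integral_hasDerivWithinAt_right (s := Icc a b) (hi.mono_set (by
      rw [uIcc_of_le hτ.1, uIcc_of_le hab]
      exact Icc_subset_Icc_right hτ.2)) ⟨Icc a b, self_mem_nhdsWithin,
    ((intervalIntegrable_iff_integrableOn_Icc_of_le hab).1 hi).aestronglyMeasurable⟩ hc
  exact (h1.const_add (F a)).congr hF (hF τ hτ)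

section

include hD hQ hg

lemma hasDerivWithinAt_timeMomentum (φ : SphereChart) {z v : ℝ → R4} {I : Set ℝ} {τ : ℝ}
    (hz : ∀ τ ∈ I, z τ ∈ φ.dom D c) (hτ : τ ∈ I) (h0 : z τ 0 ≠ 0) (hr : |rt (z τ 0)| < r0)
    (hd : HasDerivWithinAt z (v τ) I τ)
    (hv : HasDerivWithinAt v (fun l => -φ.gammaSum D c g (z τ) (v τ) l) I τ)
    (hu : UniqueDiffWithinAt ℝ I τ) :
    HasDerivWithinAt (fun τ => tMetric (redM g Q K s0) rt (φ.time K s0 (z τ))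
      (fderiv ℝ (φ.time K s0) (z τ) (v τ)))
      (timeForce (redM g Q K s0) w rt (φ.time K s0 (z τ))
        (fderiv ℝ (φ.time K s0) (z τ) (v τ))) I τ := by
  have hA := isRedMetric hD hQ hg
  have hzτ := hz τ hτ
  obtain ⟨hC, hDZ⟩ := fderiv_time hD hg φ hzτ h0
  set Z := φ.time K s0 with hZ
  set A' := redM g Q K s0 with hA'
  have hmem : ((rt (Z (z τ)).1, (Z (z τ)).2) : Amb) ∈ redDom r0 :=
    ⟨hr, ne_of_norm (φ.point_mem hzτ).2.2.2⟩
  have hZ1 :=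
    HasFDerivAt.comp_hasDerivWithinAt τ (hC.differentiableAt (by norm_num)).hasFDerivAt hd
  have hZ2 :=
    HasFDerivAt.comp_hasDerivWithinAt τ
      ((hC.fderiv_right (m := 1) (by norm_num)).differentiableAt (by norm_num)).hasFDerivAt hd
  have hG :=
    HasFDerivAt.comp_hasDerivWithinAt (l := tMetric A' rt) τ
      (hasFDerivAt_tMetric hA hQ.root h0 hmem) hZ1
  obtain ⟨P', hP⟩ : ∃ P', HasDerivWithinAt (fun τ => tMetric A' rt (Z (z τ))
      (fderiv ℝ Z (z τ) (v τ))) P' I τ := ⟨_, hG.clm_apply (hZ2.clm_apply hv)⟩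
  refine hP.congr_deriv ?_
  -- the values on coordinate vectors
  choose L hL hLs using fun α β => hasFDerivAt_metric hD hg φ hzτ h0 α β
  set a : R4 := fun l => -φ.gammaSum D c g (z τ) (v τ) l with ha
  have hMa : (φ.metric g (z τ)).mulVec a = fun σ => -(∑ ν, (∑ μ, φ.partial_ D c μ
      (fun z' => φ.metric g z' σ ν) (z τ) * v τ μ) * v τ ν - 1 / 2 * ∑ μ, ∑ ν,
      φ.partial_ D c σ (fun z' => φ.metric g z' μ ν) (z τ) * v τ μ * v τ ν) := by
    have h1 : a = (φ.metric g (z τ))⁻¹.mulVec fun σ => -(∑ ν, (∑ μ, φ.partial_ D c μ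
        (fun z' => φ.metric g z' σ ν) (z τ) * v τ μ) * v τ ν - 1 / 2 * ∑ μ, ∑ ν,
        φ.partial_ D c σ (fun z' => φ.metric g z' μ ν) (z τ) * v τ μ * v τ ν) := by
      funext l
      simp only [ha, φ.gammaSum_eq, Matrix.mulVec, dotProduct, ← Finset.sum_neg_distrib, mul_neg]
    rw [h1, Matrix.mulVec_mulVec, Matrix.mul_nonsing_inv _ (φ.isUnit_det hg hzτ), Matrix.one_mulVec]
  have hcoord : ∀ μ, P' (fderiv ℝ Z (z τ) (Pi.single μ 1))
      = timeForce A' w rt (Z (z τ)) (fderiv ℝ Z (z τ) (v τ))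
        (fderiv ℝ Z (z τ) (Pi.single μ 1)) := fun μ => by
    have h1 : HasDerivWithinAt (fun τ => ∑ ν, φ.metric g (z τ) μ ν * v τ ν)
        (∑ ν, (L μ ν (v τ) * v τ ν + φ.metric g (z τ) μ ν * a ν)) I τ :=
      HasDerivWithinAt.fun_sum fun ν _ => HasDerivWithinAt.mul
        (HasFDerivAt.comp_hasDerivWithinAt τ (hL μ ν) hd) (hasDerivWithinAt_pi.1 hv ν)
    have h2 := hu.eq_deriv _ h1 (hasDerivWithinAt_momentum hD hQ hg φ hz hτ h0 hr hd hP μ)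
    have h3 := congrFun hMa μ
    simp only [Matrix.mulVec, dotProduct] at h3
    rw [Finset.sum_add_distrib, h3] at h2
    simp only [hLs] at h2
    rw [timeForce_apply]
    linarith
  have hrange : ∀ u', P' (fderiv ℝ Z (z τ) u')
      = timeForce A' w rt (Z (z τ)) (fderiv ℝ Z (z τ) (v τ)) (fderiv ℝ Z (z τ) u') := fun u' => by
    rw [← Finset.univ_sum_single u']
    simp only [map_sum]
    refine Finset.sum_congr rfl fun μ _ => ?_
    have h1 : (Pi.single μ (u' μ) : R4) = u' μ • Pi.single μ 1 := by
      rw [← Pi.single_smul, smul_eq_mul, mul_one]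
    rw [h1, map_smul, map_smul, map_smul, hcoord]
  -- the value on the radial vector
  have hp := φ.point_mem hzτ
  set θ : E3 := (Z (z τ)).2.2 with hθ
  have hθ1 : ‖θ‖ = 1 := hp.2.2.2
  have hrad : P' (0, 0, θ)
      = timeForce A' w rt (Z (z τ)) (fderiv ℝ Z (z τ) (v τ)) (0, 0, θ) := by
    have h1 : HasDerivWithinAt (fun τ => ((0, 0, (Z (z τ)).2.2) : Amb))
        (0, 0, (fderiv ℝ Z (z τ) (v τ)).2.2) I τ :=
      HasFDerivAt.comp_hasDerivWithinAt τ
        (inclE ∘L snd ℝ ℝ E3 ∘L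
          snd ℝ ℝ (ℝ × E3)).hasFDerivAt hZ1
    have h2 : (fun τ => tMetric A' rt (Z (z τ)) (fderiv ℝ Z (z τ) (v τ))
        (0, 0, (Z (z τ)).2.2)) =ᶠ[𝓝[I] τ] fun _ => 0 := by
      have hn : ∀ᶠ t in 𝓝[I] τ, z t 0 ≠ 0 ∧ |rt (z t 0)| < r0 := by
        have hc := hd.continuousWithinAt
        have hc0 :=
          (continuous_apply 0).continuousAt.comp_continuousWithinAt hc
        exact (hc0.eventually_ne h0).and
          ((hQ.root.cont.abs.continuousAt.comp_continuousWithinAt hc0).eventually_lt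
            continuousWithinAt_const hr)
      filter_upwards [hn, self_mem_nhdsWithin] with t ht htI
      have h3 := φ.point_mem (hz t htI)
      have h4 := hA.radial (rt (z t 0), (Z (z t)).2.2) ht.2 (ne_of_norm h3.2.2.2)
        (fderiv ℝ Z (z t) (v t))
      have h5 : inner ℝ (Z (z t)).2.2 (fderiv ℝ Z (z t) (v t)).2.2 = (0 : ℝ) := by
        rw [(fderiv_time hD hg φ (hz t htI) ht.1).2]
        exact φ.isTan_point (hz t htI).2.2.2 _
      simp only at h4
      rw [h5, zero_div] at h4
      simp only [tMetric, confM, smul_apply, smul_eq_mul]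
      exact mul_eq_zero_of_right _ h4
    have h3 := hu.eq_deriv _ (hP.clm_apply h1)
      ((hasDerivWithinAt_const τ I (0 : ℝ)).congr_of_eventuallyEq h2 (h2.self_of_nhdsWithin hτ))
    have h4 := hA.fderiv_conf_radial hmem (fderiv ℝ Z (z τ) (v τ)) (fderiv ℝ Z (z τ) (v τ))
    have h5 := hA.conf_symm hmem (0, 0, (fderiv ℝ Z (z τ) (v τ)).2.2) (fderiv ℝ Z (z τ) (v τ))
    have h6 : timeMetricDer A' w rt (Z (z τ)) (0, 0, θ)
        = fderiv ℝ (confM A') (rt (Z (z τ)).1, (Z (z τ)).2) (0, 0, θ) := by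
      change fderiv ℝ (confM A') (rt (Z (z τ)).1, (Z (z τ)).2)
        ((w (rt (Z (z τ)).1))⁻¹ * 0, 0, θ) = _
      rw [mul_zero]
    rw [timeForce_apply, h6, h4, h5]
    simp only [tMetric] at h3
    linarith
  refine ContinuousLinearMap.ext fun u => ?_
  set b : ℝ := inner ℝ θ u.2.2 with hb
  have htan : IsTangent (φ.point (z τ)) (u - b • ((0, 0, θ) : Amb)) := by
    change inner ℝ θ (u.2.2 - b • θ) = (0 : ℝ)
    rw [inner_sub_right, inner_smul_right, real_inner_self_eq_norm_sq, hθ1, hb]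
    ring
  obtain ⟨u', hu'⟩ := φ.exists_fderiv hzτ.2.2.2
    (u := tInvDer D c K s0 (φ.point (z τ)) (u - b • ((0, 0, θ) : Amb))) htan
  have h1 := hrange u'
  rw [hDZ u', hu', tDer_tInvDer hD hg (cyl_subset hp), map_sub, map_sub,
    map_smul, map_smul, hrad] at h1
  exact sub_left_injective h1

include hy hΦ

theorem gaugeField_determined {J : Set ℝ} {γ : ℝ → Amb} (hJ : J.OrdConnected) (h0J : 0 ∈ J)
    (hB : ∀ τ ∈ J, γ τ ∈ gaugeSet D c K s0 c' Φ)
    (hd0 : HasDerivWithinAt γ (gaugeField D c K s0 Φ Φi (γ 0)) J 0)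
    (hw : IsWeakGeodesic D c g γ J) :
    IsIntegralCurveIn (gaugeField D c K s0 Φ Φi) (gaugeSet D c K s0 c' Φ) γ J := by
  have hA := isRedMetric hD hQ hg
  set V := gaugeField D c K s0 Φ Φi with hV
  obtain ⟨hcyl, hγc, hgeo⟩ := hw
  refine fun τ hτ => ⟨hB τ hτ, (isPreconnected_iff_ordConnected.2 hJ).induction₂
    (fun τ τ' => HasDerivWithinAt γ (V (γ τ)) J τ ↔ HasDerivWithinAt γ (V (γ τ')) J τ')
    (fun τ1 hτ1 => ?_) (fun _ _ _ _ _ _ => Iff.trans) (fun _ _ _ _ => Iff.symm) h0J hτ |>.1 hd0⟩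
  -- local coordinates
  obtain ⟨φ, z1, hz1, hp1⟩ := exists_chart (hcyl τ1 hτ1)
  obtain ⟨H, O, hO, hH, hH1, hH2⟩ := φ.exists_coord
  have hOn := hγc τ1 hτ1 (hO.mem_nhds (by
    rw [← hp1]
    exact (hH1 _ hz1.2.2.2).1))
  obtain ⟨a, b, hab1, habJ, habO, habn, hab | hab⟩ := exists_Icc_nhdsWithin hJ hτ1 hOn
  swap
  · rw [hab, eventually_pure]
  set z : ℝ → R4 := fun τ => H (γ τ) with hz
  have hzp : ∀ τ ∈ Icc a b, z τ ∈ φ.dom D c ∧ φ.point (z τ) = γ τ := fun τ hτ => by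
    have h1 := hcyl τ (habJ hτ)
    have h2 := hH2 _ (habO hτ) h1.2.2.2
    rw [← h2.1] at h1
    exact ⟨⟨h1.1, h1.2.1, h1.2.2.1, h2.2⟩, h2.1⟩
  obtain ⟨v, hvc, hv⟩ := hgeo φ a b hab habJ z hzp
  have hzd := fun τ hτ =>
    hasDerivWithinAt_pi.2 fun l => hasDerivWithinAt_of_integral
      (((continuous_apply l).comp_continuousOn hvc).intervalIntegrable_of_Icc hab.le) (hv l).1 hτ
      ((continuous_apply l).continuousAt.comp_continuousWithinAt (hvc τ hτ))
  have hzc := fun τ hτ => (hzd τ hτ).continuousWithinAt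
  have hz0c := (continuous_apply 0).comp_continuousOn hzc
  have hδ := fun τ hτ => by
    obtain ⟨h1, h2⟩ := gaugeSet_spec hΦ (hB τ (habJ hτ))
    have h3 := hΦ.rt_lt h1
    rwa [h2, ← (hzp τ hτ).2] at h3
  have hr := fun τ hτ => (hδ τ hτ).trans_le hy.le
  have hvd : ∀ τ ∈ Icc a b, z τ 0 ≠ 0 → HasDerivWithinAt v
      (fun l => -φ.gammaSum D c g (z τ) (v τ) l) (Icc a b) τ := fun τ hτ h0 =>
    hasDerivWithinAt_pi.2 fun l => by
      obtain ⟨E, hE, hEe⟩ := exists_gamma_weight hD hQ hg φ (fun τ hτ => (hzp τ hτ).1) hr hzc hvc l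
      have hwc :=
        (hQ.w_cont.comp hQ.root.cont).continuousAt.comp_continuousWithinAt (hz0c τ hτ)
      have h1 : ContinuousWithinAt (fun τ => φ.gammaSum D c g (z τ) (v τ) l) (Icc a b) τ := by
        have h2 : ∀ t ∈ Icc a b, z t 0 ≠ 0 →
            φ.gammaSum D c g (z t) (v t) l = (w (rt (z t 0)))⁻¹ * E t := fun t ht h0 => by
          rw [← hEe t ht h0, inv_mul_cancel_left₀ (hQ.root.deriv _ h0).1]
        refine ((hwc.inv₀ (hQ.root.deriv _ h0).1).mul (hE τ hτ)).congr_of_eventuallyEq ?_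
          (h2 τ hτ h0)
        filter_upwards [(hz0c τ hτ).eventually_ne h0, self_mem_nhdsWithin] with t ht htI
        exact h2 t htI ht
      refine hasDerivWithinAt_of_integral (hv l).2.1.neg (fun t ht => ?_) hτ
        h1.neg
      rw [(hv l).2.2 t ht, sub_eq_add_neg]
      congr 1
      exact intervalIntegral.integral_neg.symm
  -- the velocity
  set κ : ℝ → Amb := fun τ => fderiv ℝ φ.point (z τ) (v τ) with hκ
  have hκd := fun τ hτ =>
    HasDerivWithinAt.congr (HasFDerivAt.comp_hasDerivWithinAt τ
      (φ.hasFDerivAt_point (hzp τ hτ).1.2.2.2).differentiableAt.hasFDerivAt (hzd τ hτ))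
      (fun t ht => (hzp t ht).2.symm) (hzp τ hτ).2.symm
  have hκc : ContinuousOn κ (Icc a b) := by
    have hpair : ∀ {f : ℝ → R4}, ContinuousOn f (Icc a b) →
        ContinuousOn (fun τ => ![f τ 2, f τ 3]) (Icc a b) := fun hf =>
      (by fun_prop : Continuous fun z : R4 => ![z 2, z 3]).comp_continuousOn hf
    have h1 :=
      (φ.smooth.continuousOn_fderiv_of_isOpen φ.isOpen (by norm_num)).comp
        (hpair hzc) fun τ hτ => (hzp τ hτ).1.2.2.2
    have hvi := fun i => (continuous_apply i).comp_continuousOn hvc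
    refine ContinuousOn.congr ((hvi 0).prodMk ((hvi 1).prodMk
      (h1.clm_apply (hpair hvc)))) fun τ hτ => φ.fderiv_point (hzp τ hτ).1.2.2.2 _
  have hVc :=
    (gaugeField_continuousOn hD hg hΦ).comp (hγc.mono habJ) fun τ hτ => hB τ (habJ hτ)
  have hiff : ∀ᶠ τ in 𝓝[J] τ1, HasDerivWithinAt γ (V (γ τ)) J τ ↔ κ τ = V (γ τ) := by
    filter_upwards [eventually_eventually_nhdsWithin.2 habn, habn] with τ h1 hτ
    refine ⟨fun h => (uniqueDiffOn_Icc hab τ hτ).eq_deriv _ (hκd τ hτ) (h.mono habJ), fun h => ?_⟩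
    rw [← h]
    exact (hκd τ hτ).mono_of_mem_nhdsWithin h1
  have hnJ :=
    le_antisymm (nhdsWithin_le_iff.2 habn) (nhdsWithin_mono _ habJ)
  suffices h : ∀ᶠ τ in 𝓝[Icc a b] τ1, (κ τ1 = V (γ τ1) ↔ κ τ = V (γ τ)) by
    have h1 := hiff.self_of_nhdsWithin hτ1
    filter_upwards [hiff, hnJ ▸ h] with τ h2 h3
    rw [h1, h2, h3]
  by_cases h1 : κ τ1 = V (γ τ1)
  swap
  · filter_upwards [((hκc τ1 hab1).sub (hVc τ1 hab1)).eventually_ne (sub_ne_zero.2 h1)] with τ hτ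
    exact iff_of_false h1 (sub_ne_zero.1 hτ)
  simp only [h1, true_iff]
  -- the curve in the coordinates `(q, τ, θ)`
  have hcone := fun τ hτ =>
    cyl_subset (hcyl τ (habJ hτ))
  set x : ℝ → Amb := fun τ => timeMap K s0 (γ τ) with hx
  set ξ : ℝ → Amb := fun τ => tDer D c K s0 (γ τ) (κ τ) with hξ
  have hxz : ∀ τ ∈ Icc a b, φ.time K s0 (z τ) = x τ := fun τ hτ => by
    rw [SphereChart.time, (hzp τ hτ).2]
  have hxz0 : ∀ τ ∈ Icc a b, (x τ).1 = z τ 0 := fun τ hτ => by rw [← hxz τ hτ]; rfl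
  have hξz : ∀ τ ∈ Icc a b, z τ 0 ≠ 0 → fderiv ℝ (φ.time K s0) (z τ) (v τ) = ξ τ :=
    fun τ hτ h0 => by rw [(fderiv_time hD hg φ (hzp τ hτ).1 h0).2, (hzp τ hτ).2]
  have hxd : ∀ τ ∈ Icc a b, HasDerivWithinAt x (ξ τ) (Icc a b) τ := fun τ hτ =>
    HasFDerivWithinAt.comp_hasDerivWithinAt τ
      (hasFDeriv_timeMap hD hg (hcone τ hτ)) (hκd τ hτ) hcone
  have hξc :=
    hκc.fst.prodMk ((((timeDer_continuousOn hD hg).comp (hγc.mono habJ) hcone).clm_apply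
      hκc).prodMk hκc.snd.snd)
  have hP : ∀ τ ∈ Icc a b, (x τ).1 ≠ 0 → HasDerivWithinAt
      (fun τ => tMetric (redM g Q K s0) rt (x τ) (ξ τ))
      (timeForce (redM g Q K s0) w rt (x τ) (ξ τ)) (Icc a b) τ := fun τ hτ h0 => by
    rw [hxz0 τ hτ] at h0
    have h2 := hasDerivWithinAt_timeMomentum hD hQ hg φ (fun τ hτ => (hzp τ hτ).1) hτ h0
      (hr τ hτ) (hzd τ hτ) (hvd τ hτ h0) (uniqueDiffOn_Icc hab τ hτ)
    rw [hxz τ hτ, hξz τ hτ h0] at h2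
    refine h2.congr_of_eventuallyEq ?_ (by rw [hxz τ hτ, hξz τ hτ h0])
    filter_upwards [(hz0c τ hτ).eventually_ne h0, self_mem_nhdsWithin] with t ht htI
    rw [hxz t htI, hξz t htI ht]
  obtain ⟨hX, hX'⟩ := gaugeSet_spec hΦ (hB τ1 hτ1)
  have hX1 := gaugeSet_norm hy hΦ (hB τ1 hτ1)
  set X := Φi (timeMap K s0 (γ τ1)) with hXd
  have hinit : ξ τ1 = stVel (redM g Q K s0) (rt (x τ1).1) (y (rt (x τ1).1) X.2.2) := by
    simp only [hξ, h1, hV, gaugeField]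
    rw [tDer_tInvDer hD hg (hcone τ1 hab1), ← hXd, hΦ.deriv_fst _ hX hX1, hX']
    rfl
  have hpos : (x τ1).2 = (y (rt (x τ1).1) X.2.2).2.1 + (X.2.1, 0) := by
    have h2 := hΦ.snd_eq hX
    have h3 := hΦ.thd_eq hX
    rw [hX'] at h2 h3
    refine Prod.ext (h2.trans (add_comm _ _)) ?_
    rw [hX1, one_smul] at h3
    simpa using h3
  have hξ1 : (ξ τ1).1 ≠ 0 := by
    rw [hinit]
    refine (hy.dom _ _ ?_ (ne_of_norm hX1)).2
    rw [hxz0 τ1 hab1]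
    exact hδ τ1 hab1
  obtain ⟨a', b', h2, h3, h4, h5, -⟩ := exists_Icc_nhdsWithin ordConnected_Icc hab1
    ((hξc.fst τ1 hab1).eventually_ne hξ1)
  have h6 := geodesic_unique hA hQ.w_cont hQ.root hy h2 (fun τ hτ => (hxd τ (h3 hτ)).mono h3)
    (hξc.mono h3) (fun τ hτ => h4 hτ) (fun τ hτ h0 => (hP τ (h3 hτ) h0).mono h3)
    (fun τ hτ => by rw [hxz0 τ (h3 hτ)]; exact hδ τ (h3 hτ))
    (fun τ hτ => (hcone τ (h3 hτ)).2.2) hX1 hpos hinit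
  have h7 := nhdsWithin_le_iff.2 h5
  filter_upwards [h7 h6, self_mem_nhdsWithin] with τ h8 hτ
  obtain ⟨hXτ, hXτ'⟩ := gaugeSet_spec hΦ (hB τ (habJ hτ))
  have h9 : x τ = geoMap y rt ((x τ).1, X.2.1, X.2.2) := by
    refine Prod.ext rfl (h8.1.trans (Prod.ext (add_comm _ _) ?_))
    simp [geoMap, geoPos, hX1]
  have h10 : |(x τ).1| < δ' := by have := (hΦ.spec _ hXτ).1; rwa [hXτ'] at this
  have h11 := hΦ.spec_inv _ X.2.1 X.2.2 h10 hX.2.1 hX.2.2 (by rw [← h9]; exact (hB τ (habJ hτ)).2)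
  rw [← h9] at h11
  have h12 : (Φi (x τ)).2.2 = X.2.2 := by rw [h11]; rfl
  have h13 := hΦ.deriv_fst _ hXτ (by rw [show (Φi (timeMap K s0 (γ τ))).2.2 = X.2.2 from h12, hX1])
  rw [hXτ', show (Φi (timeMap K s0 (γ τ))).2.2 = X.2.2 from h12] at h13
  rw [hV, gaugeField, h13, show geoVel (redM g Q K s0) y rt ((timeMap K s0 (γ τ)).1, X.2.2)
    = ξ τ from h8.2.symm, tInvDer_tDer hD hg (hcone τ hτ)]

end

/-! ## Uniqueness of the gauge -/

section

variable {A A' : Set Amb} {f f' : Amb → Amb} (hA : ∀ p ∈ A, ‖p.2.2‖ = 1) (hA' : ∀ p ∈ A', ‖p.2.2‖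
  = 1) (hu : UniqueDiffOn ℝ (radial ⁻¹' A)) (hf : IsCkOn 1 f A) (hm : MapsTo f A A')
include hA hf

lemma IsCkOn.hasFDerivWithinAt {p : Amb} (hp : p ∈ A) : HasFDerivWithinAt (f ∘ radial)
    (fderivWithin ℝ (f ∘ radial) (radial ⁻¹' A) p) (radial ⁻¹' A) p :=
  (ContDiffOn.differentiableOn hf one_ne_zero p
    ((IsOpenIn.mem_radial (hA p hp)).2 hp)).hasFDerivWithinAt

lemma IsCkOn.continuousOn : ContinuousOn f A := by
  refine ((ContDiffOn.continuousOn hf).mono fun p hp =>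
    (IsOpenIn.mem_radial (hA p hp)).2 hp).congr fun p hp => ?_
  rw [Function.comp_apply, radial_of_norm (hA p hp)]

include hA' hu hm

lemma differential_tangent {p : Amb} (hp : p ∈ A) (u : Amb) :
    IsTangent (f p) (differential f A p u) := by
  have hpA := (IsOpenIn.mem_radial (hA p hp)).2 hp
  simpa [radial_of_norm (hA p hp), IsTangent, differential] using DFunLike.congr_fun ((hu p hpA).eq
      (HasFDerivAt.comp_hasFDerivWithinAt p (snd ℝ ℝ E3 ∘L snd ℝ ℝ (ℝ × E3)).hasFDerivAt
          (IsCkOn.hasFDerivWithinAt hA hf hp)).norm_sq ((hasFDerivWithinAt_const (1 : ℝ) p _).congr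
              (fun q hq => by rw [hA' _ (hm hq), one_pow]) (by rw [hA' _ (hm hpA), one_pow]) :
                  HasFDerivWithinAt (fun q => ‖(f (radial q)).2.2‖ ^ 2) (0 : Amb →L[ℝ] ℝ)
                      (radial ⁻¹' A) p)) u

lemma differential_left_inverse (hf' : IsCkOn 1 f' A') (hl : ∀ p ∈ A, f' (f p) = p) {p u : Amb}
    (hp : p ∈ A) (ht : IsTangent p u) :
    differential f' A' (f p) (differential f A p u) = u := by
  have hpA := (IsOpenIn.mem_radial (hA p hp)).2 hp
  obtain ⟨h3, h4⟩ := IsOpenIn.fderiv_radial (hA p hp) ht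
  have h5 := HasFDerivWithinAt.comp p
    (by rw [Function.comp_apply, radial_of_norm (hA p hp)];
        exact IsCkOn.hasFDerivWithinAt hA' hf' (hm hp)) (IsCkOn.hasFDerivWithinAt hA hf hp) fun q
            hq =>
      (IsOpenIn.mem_radial (hA' _ (hm hq))).2 (hm hq)
  have h6 : ∀ q ∈ radial ⁻¹' A, ((f' ∘ radial) ∘ (f ∘ radial)) q = radial q := fun q hq => by
    simp only [Function.comp_apply]
    rw [radial_of_norm (hA' _ (hm hq)), hl _ hq]
  have h7 := DFunLike.congr_fun ((hu p hpA).eq (h5.congr (fun q hq => (h6 q hq).symm)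
    (h6 p hpA).symm) h3.hasFDerivWithinAt) u
  rw [h4] at h7
  exact h7

end

/-- The data of a homothetic gauge that concern the null lines `∂_ρ`. -/
structure HasNullLines (D : Set ℝ) (c : ℝ) (g : BilinField) (K : Amb → Amb) (D' : Set ℝ) (c' : ℝ)
    (B : Set Amb) (X Ψ W : Amb → Amb) (dX : Amb → Amb →L[ℝ] Amb) : Prop where
  side : IsSide D'
  isOpenIn : IsOpenIn D c B
  mapsTo : MapsTo X B (cylinder D' c')
  mapsTo_inv : MapsTo Ψ (cylinder D' c') B
  left : ∀ p ∈ B, Ψ (X p) = p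
  right : ∀ x ∈ cylinder D' c', X (Ψ x) = x
  cont : ContinuousOn X B
  cont_inv : ContinuousOn Ψ (cylinder D' c')
  deriv : ∀ p ∈ B, HasFDerivWithinAt (X ∘ radial) (dX p) (cDom D c) p
  cont_deriv : ContinuousOn dX B
  cont_vec : ContinuousOn W B
  tangent : ∀ p ∈ B, IsTangent p (W p)
  deriv_vec : ∀ p ∈ B, dX p (W p) = (1, 0, 0)
  deriv_K : ∀ p ∈ B, dX p (K p) = (0, (X p).2.1, 0)
  inj : ∀ p ∈ B, ∀ u, IsTangent p u → dX p u = 0 → u = 0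
  grad : ∀ p ∈ B, ∀ u, IsTangent p u → g p (W p) u = 2 * (X p).2.1 * (dX p u).2.1
  pos : ∀ p ∈ B, ∀ u, IsTangent p u → (dX p u).1 = 0 → (dX p u).2.1 = 0 → 0 ≤ g p u u
  line : ∀ r t θ, (r, t, θ) ∈ cylinder D' c' → HasDerivWithinAt (fun r => Ψ (r, t, θ))
    (W (Ψ (r, t, θ))) (qInt D' c') r
  slice : ∀ x ∈ cylinder D' c', ∀ v, v.1 = 0 → IsTangent x v → ∃ u, IsTangent (Ψ x) u ∧
    dX (Ψ x) u = v ∧ HasDerivAt (fun a : ℝ => Ψ (radial (x + a • v))) u 0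

lemma mem_cyl {x : Amb} :
    x ∈ cylinder D c ↔ x.1 ∈ qInt D c ∧ x.2.1 < 0 ∧ ‖x.2.2‖ = 1 := by
  simp [cylinder, qInt, abs_lt]
  tauto

lemma IsSide.ordConnected_qInt (hD : IsSide D) (c : ℝ) : (qInt D c).OrdConnected := by
  refine OrdConnected.inter ?_ ordConnected_Ioo
  rcases hD with rfl | rfl | rfl
  · exact ordConnected_univ
  · exact ordConnected_Ici
  · exact ordConnected_Iic

lemma eventually_mem_cDom {x v : Amb} (hx : x ∈ cylinder D c)
    (hv : v.1 = 0) : ∀ᶠ a : ℝ in 𝓝 0, x + a • v ∈ cDom D c := by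
  filter_upwards [(by fun_prop : ContinuousAt (fun a : ℝ => (x + a • v).2) 0).eventually
      ((isOpen_Iio.prod isOpen_ne_zero).mem_nhds (by simpa using (cyl_subset hx).2))] with a ha
  exact ⟨by simpa [hv] using (cyl_subset hx).1, ha⟩

section

include hD hg

lemma IsHomotheticGauge.exists_nullLines {D' : Set ℝ} {c' : ℝ} {B : Set Amb} {X : Amb → Amb}
    {P : Amb → ℝ} {h : Amb → E3 →L[ℝ] ℝ} {m : Amb → E3 →L[ℝ] E3 →L[ℝ] ℝ}
    (hX : IsHomotheticGauge D c g K D' c' B X P h m) :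
    ∃ Ψ W, HasNullLines D c g K D' c' B X Ψ W
      (fun p => fderivWithin ℝ (X ∘ radial) (radial ⁻¹' B) p) := by
  obtain ⟨hm, hXc, Ψ, hmΨ, hΨc, hl, hr⟩ := hX.coordinates
  have hD' : IsSide D' := by
    rcases hX.side with rfl | rfl
    · exact hD
    · rcases hD with rfl | rfl | rfl
      · exact Or.inl (by simp)
      · exact Or.inr (Or.inr (by ext; simp))
      · exact Or.inr (Or.inl (by ext; simp))
  have hB := hX.isOpenIn
  have hn : ∀ p ∈ B, ‖p.2.2‖ = 1 := fun p hp => (hB.subset hp).2.2.2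
  have hn' : ∀ x ∈ cylinder D' c', ‖x.2.2‖ = 1 := fun x hx => hx.2.2.2
  have huB := hB.uniqueDiffOn hD hg.c_pos
  have huC : UniqueDiffOn ℝ (radial ⁻¹' cylinder D' c') := by
    rw [preimage_cylinder]
    exact uniqueDiff_cone hD' hX.c'_pos
  have hBm := fun p hp => (IsOpenIn.mem_radial (hn p hp)).2 hp
  have hCm := fun x hx =>
    (IsOpenIn.mem_radial (hn' x hx)).2 hx
  have hXcont := IsCkOn.continuousOn hn hXc
  have hback : ∀ x ∈ cylinder D' c', ∀ v, IsTangent x v → differential X B (Ψ x)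
      (differential Ψ (cylinder D' c') x v) = v := fun x hx v hv =>
    differential_left_inverse hn' hn huC hΨc hmΨ hXc hr hx hv
  have htan : ∀ p ∈ B, ∀ v, IsTangent p (differential Ψ (cylinder D' c') (X p) v) :=
    fun p hp v => by
      have h1 := differential_tangent hn' hn huC hΨc hmΨ (hm hp) v
      rwa [hl p hp] at h1
  have hvec : ∀ p ∈ B, differential X B p
      (differential Ψ (cylinder D' c') (X p) (1, 0, 0)) = (1, 0, 0) := fun p hp => by
    have h1 := hback _ (hm hp) (1, 0, 0) (inner_zero_right _)
    rwa [hl p hp] at h1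
  refine ⟨Ψ, fun p => differential Ψ (cylinder D' c') (X p) (1, 0, 0), hD', hB, hm, hmΨ, hl, hr,
    hXcont, IsCkOn.continuousOn hn' hΨc, fun p hp => ?_, ?_, ?_, fun p hp => htan p hp _, hvec,
    hX.K_eq, fun p hp u hu h0 => ?_, fun p hp u hu => ?_, fun p hp u hu h1 h2 => ?_,
    fun r t θ hx => ?_, fun x hx v hv0 hv => ⟨differential Ψ (cylinder D' c') x v, ?_,
      hback x hx v hv, ?_⟩⟩
  · have h1 := IsCkOn.hasFDerivWithinAt hn hXc hp
    rwa [HasFDerivWithinAt, hB.nhdsWithin (hBm p hp)] at h1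
  · exact (ContDiffOn.continuousOn_fderivWithin hXc huB le_rfl).mono hBm
  · exact (((ContDiffOn.continuousOn_fderivWithin hΨc huC le_rfl).mono hCm).comp hXcont
      hm).clm_apply continuousOn_const
  · have h1 := differential_left_inverse hn hn' huB hXc hm hΨc hl hp hu
    change fderivWithin ℝ (Ψ ∘ radial) (radial ⁻¹' cylinder D' c') (X p)
      (fderivWithin ℝ (X ∘ radial) (radial ⁻¹' B) p u) = u at h1
    rw [h0, map_zero] at h1
    exact h1.symm
  · rw [hX.metric_eq p hp _ u (htan p hp _) hu, hvec p hp]; simp [homotheticForm, differential]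
  · rw [hX.metric_eq p hp u u hu hu]
    have h3 := differential_tangent hn hn' huB hXc hm hp u
    have h4 := h1
    have h5 : (differential X B p u).2.1 = 0 := h2
    simp only [homotheticForm, h4, h5, mul_zero, zero_mul, add_zero, sub_zero, zero_add]
    rcases eq_or_ne (differential X B p u).2.2 0 with h6 | h6
    · simp [h6]
    · exact ((hX.riemannian _ (hm hp)).2 _ h3 h6).le
  · have h1 := IsCkOn.hasFDerivWithinAt hn' hΨc hx
    rw [preimage_cylinder] at h1
    have h2 : HasDerivAt (fun r : ℝ => ((r, t, θ) : Amb)) (1, 0, 0) r :=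
      (hasDerivAt_id r).prodMk (hasDerivAt_const _ _)
    have h3 := HasFDerivWithinAt.comp_hasDerivWithinAt (f := fun r : ℝ => ((r, t, θ) : Amb)) r h1
      (h2.hasDerivWithinAt) fun r' hr' => ⟨hr', (cyl_subset hx).2⟩
    have h4 : ∀ r' : ℝ, ((Ψ ∘ radial) ∘ fun r : ℝ => ((r, t, θ) : Amb)) r' = Ψ (r', t, θ) :=
      fun r' => congrArg Ψ (radial_of_norm hx.2.2.2)
    refine (h3.congr (fun r' _ => (h4 r').symm) (h4 r).symm).congr_deriv ?_
    rw [hr _ hx, differential, preimage_cylinder]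
  · exact differential_tangent hn' hn huC hΨc hmΨ hx v
  · have h1 := IsCkOn.hasFDerivWithinAt hn' hΨc hx
    have h2 : HasDerivAt (fun a : ℝ => x + a • v) v 0 := by
      simpa using ((hasDerivAt_id (0 : ℝ)).smul_const v).const_add x
    have h3 : {a : ℝ | x + a • v ∈ radial ⁻¹' cylinder D' c'} ∈ 𝓝 (0 : ℝ) := by
      rw [preimage_cylinder]
      exact eventually_mem_cDom hx hv0
    exact (HasFDerivWithinAt.comp_hasDerivWithinAt 0
      (by rwa [zero_smul, add_zero]) h2.hasDerivWithinAt fun a ha => ha).hasDerivAt h3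

omit hD in
lemma continuousOn_metric_K : ContinuousOn (fun p => g p (K p) (K p)) (cylinder D c) := by
  intro p hp
  obtain ⟨φ, z, hz, rfl⟩ := exists_chart hp
  obtain ⟨H, O, hO, hH, h1, h2⟩ := φ.exists_coord
  have hM : ContinuousOn (fun z => φ.metric g z 1 1) (φ.dom D c) := by
    refine (((hg.regular φ 1 1).2 0 (by norm_num)).eval_const (fun _ => 0)).congr fun z hz => ?_
    simp
    rw [SphereChart.vecCons_tail]
  have h0 := h1 z hz.2.2.2
  have hdom : ∀ p ∈ cylinder D c ∩ O, H p ∈ φ.dom D c ∧ φ.point (H p) = p := fun p hp => by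
    obtain ⟨h3, h4⟩ := h2 p hp.2 hp.1.2.2.2
    have h5 := hp.1
    rw [← h3] at h5
    exact ⟨⟨h5.1, h5.2.1, h5.2.2.1, h4⟩, h3⟩
  have he : ∀ p ∈ cylinder D c ∩ O, g p (K p) (K p) = kap K p ^ 2 * φ.metric g (H p) 1 1 :=
    fun p hp => by
      obtain ⟨h3, h4⟩ := hdom p hp
      have h6 : φ.frame (H p) 1 = (0, 1, 0) := by
        rw [SphereChart.frame, φ.fderiv_point h3.2.2.2]
        simp [(by simp : (![0, 0] : Fin 2 → ℝ) = 0)]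
      rw [SphereChart.metric, Matrix.of_apply, h6, h4,
          (by rw [K_eq_kap hg hp.1]; simp : K p = kap K p • ((0, 1, 0) : Amb))]
      simp only [map_smul, smul_apply]
      ring
  have h3 := ((((kap_contDiffOn hg).continuousOn.mono fun p hp => cyl_subset hp.1).pow 2).mul
      (hM.comp (hH.continuousOn.mono inter_subset_right) fun p hp => (hdom p hp).1) _ ⟨hp,
          h0.1⟩).congr he (he _ ⟨hp, h0.1⟩)
  rwa [ContinuousWithinAt, nhdsWithin_inter_of_mem' (nhdsWithin_le_nhds (hO.mem_nhds h0.1))] at h3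

end

lemma exists_mean_value {f f' : ℝ → ℝ} {s : Set ℝ} (hs : s.OrdConnected) {a b : ℝ} (ha : a ∈ s)
    (hb : b ∈ s) (hd : ∀ r ∈ uIcc a b, HasDerivWithinAt f (f' r) s r) :
    ∃ r ∈ uIcc a b, f b - f a = f' r * (b - a) := by
  have key : ∀ a b : ℝ, a ∈ s → b ∈ s → a < b →
      (∀ r ∈ uIcc a b, HasDerivWithinAt f (f' r) s r) →
      ∃ r ∈ uIcc a b, f b - f a = f' r * (b - a) := fun a b ha hb hab hd => by
    have hsub := hs.out ha hb
    rw [uIcc_of_le hab.le] at hd ⊢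
    obtain ⟨r, hr, h⟩ := exists_hasDerivAt_eq_slope f f' hab
      (fun r hr => ((hd r hr).mono hsub).continuousWithinAt)
      fun r hr => ((hd r (Ioo_subset_Icc_self hr)).mono hsub).hasDerivAt (Icc_mem_nhds hr.1 hr.2)
    refine ⟨r, Ioo_subset_Icc_self hr, ?_⟩
    rw [h, div_mul_cancel₀ _ (sub_ne_zero.2 hab.ne')]
  rcases lt_trichotomy a b with h | rfl | h
  · exact key a b ha hb h hd
  · simp
  · rw [uIcc_comm] at hd ⊢; obtain ⟨r, hr, h⟩ := key b a hb ha h hd; exact ⟨r, hr, by linarith⟩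

section

variable {D1 D2 : Set ℝ} {c1 c2 : ℝ} {B1 B2 : Set Amb} {X1 X2 Ψ1 Ψ2 W1 W2 : Amb → Amb} {dX1 dX2 :
  Amb → Amb →L[ℝ] Amb} (H1 : HasNullLines D c g K D1 c1 B1 X1 Ψ1 W1 dX1) (H2 : HasNullLines D c g
  K D2 c2 B2 X2 Ψ2 W2 dX2)

namespace IsOpenIn

lemma mem_nhdsWithin {B : Set Amb} (h : IsOpenIn D c B) {p : Amb} (hp : p ∈ B) :
    B ∈ 𝓝[cylinder D c] p := by
  obtain ⟨O, hO, rfl⟩ := h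
  exact Filter.inter_mem self_mem_nhdsWithin (mem_nhdsWithin_of_mem_nhds (hO.mem_nhds hp.2))

lemma nhdsWithin_eq {B : Set Amb} (h : IsOpenIn D c B) {p : Amb} (hp : p ∈ B) :
    𝓝[B] p = 𝓝[cylinder D c] p :=
  le_antisymm (nhdsWithin_mono _ h.subset) (nhdsWithin_le_iff.2 (h.mem_nhdsWithin hp))

end IsOpenIn

namespace HasNullLines

include H1

lemma eventually_line {x1 : Amb} (hx1 : x1 ∈ cylinder D1 c1) {G : Amb → Prop}
    (hG : ∀ᶠ p in 𝓝[cylinder D c] Ψ1 x1, G p) :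
    ∀ᶠ p in 𝓝[cylinder D c] Ψ1 x1, p ∈ B1 ∧ ∀ r ∈ uIcc x1.1 (X1 p).1,
      (r, (X1 p).2) ∈ cylinder D1 c1 ∧ G (Ψ1 (r, (X1 p).2)) := by
  have hp1 := H1.mapsTo_inv hx1
  obtain ⟨η, hη, hball⟩ := Metric.mem_nhdsWithin_iff.1 (((H1.cont_inv x1 hx1).tendsto_nhdsWithin
      fun x hx => H1.isOpenIn.subset (H1.mapsTo_inv hx)).eventually hG)
  have h2 : Tendsto X1 (𝓝[cylinder D c] Ψ1 x1) (𝓝 x1) := by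
    have := H1.cont _ hp1
    rwa [ContinuousWithinAt, H1.isOpenIn.nhdsWithin_eq hp1, H1.right _ hx1] at this
  filter_upwards [H1.isOpenIn.mem_nhdsWithin hp1, h2.eventually (Metric.ball_mem_nhds x1 hη)]
    with p hp hpb
  refine ⟨hp, fun r hr => ?_⟩
  have hXp := mem_cyl.1 (H1.mapsTo hp)
  have hm : (r, (X1 p).2) ∈ cylinder D1 c1 := mem_cyl.2
    ⟨(H1.side.ordConnected_qInt c1).uIcc_subset (mem_cyl.1 hx1).1 hXp.1 hr, hXp.2⟩
  refine ⟨hm, hball ⟨?_, hm⟩⟩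
  rw [Prod.dist_eq, max_lt_iff] at hpb
  rw [Metric.mem_ball, Prod.dist_eq, max_lt_iff]
  refine ⟨lt_of_le_of_lt ?_ hpb.1, hpb.2⟩
  exact abs_sub_left_of_mem_uIcc hr

include hg H2

lemma eventually_deriv {p : Amb} (hp1 : p ∈ B1) (hp2 : p ∈ B2) (hW : W1 p = W2 p) :
    ∀ᶠ p in 𝓝[cylinder D c] p, p ∈ B2 ∧ 0 < (dX2 p (W1 p)).1 ∧ 0 ≤ (dX2 p (W1 p)).2.1 := by
  have hB1 := H1.isOpenIn.mem_nhdsWithin hp1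
  have hB2 := H2.isOpenIn.mem_nhdsWithin hp2
  have hc : ContinuousWithinAt (fun p => dX2 p (W1 p)) (cylinder D c) p := by
    have h1 := H1.cont_vec p hp1
    have h2 := H2.cont_deriv p hp2
    rw [ContinuousWithinAt, H1.isOpenIn.nhdsWithin_eq hp1] at h1
    rw [ContinuousWithinAt, H2.isOpenIn.nhdsWithin_eq hp2] at h2
    exact ContinuousWithinAt.clm_apply h2 h1
  have ht : ∀ {X : Amb → Amb} {B : Set Amb}, IsOpenIn D c B → ContinuousOn X B → p ∈ B →
      ContinuousWithinAt (fun p => (X p).2.1) (cylinder D c) p := fun hB hX hp => by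
    have h1 := hX p hp
    rw [ContinuousWithinAt, hB.nhdsWithin_eq hp] at h1
    exact ContinuousWithinAt.fst (ContinuousWithinAt.snd h1)
  have ht1 := ht H1.isOpenIn H1.cont hp1
  have ht2 := ht H2.isOpenIn H2.cont hp2
  have hval : dX2 p (W1 p) = (1, 0, 0) := by rw [hW, H2.deriv_vec p hp2]
  have htn := (H2.mapsTo hp2).2.2.1
  have htn1 := (H1.mapsTo hp1).2.2.1
  have hE : ContinuousWithinAt (fun p => (dX2 p (W1 p)).2.1 * g p (K p) (K p)
      - 4 * (X1 p).2.1 ^ 2 * (X2 p).2.1) (cylinder D c) p :=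
    (hc.snd.fst.mul (continuousOn_metric_K hg p (H1.isOpenIn.subset hp1))).sub
      ((continuousWithinAt_const.mul (ht1.pow 2)).mul ht2)
  have hE0 : 0 < (dX2 p (W1 p)).2.1 * g p (K p) (K p) - 4 * (X1 p).2.1 ^ 2 * (X2 p).2.1 := by
    rw [hval]
    nlinarith [mul_pos (mul_pos_of_neg_of_neg htn1 htn1) (neg_pos.2 htn)]
  filter_upwards [hB1, hB2, hc.fst.eventually (lt_mem_nhds (show 0 < (dX2 p (W1 p)).1 by
    rw [hval]; exact one_pos)), hE.eventually (lt_mem_nhds hE0)] with q hq1 hq2 hα hβ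
  refine ⟨hq2, hα, ?_⟩
  have hqc := H1.isOpenIn.subset hq1
  have hs := (hg.lorentzian q hqc).1
  have hK := hg.K_tangent q hqc
  set α := (dX2 q (W1 q)).1 with hαd
  set β := (dX2 q (W1 q)).2.1 with hβd
  have t2 := (H2.mapsTo hq2).2.2.1
  set b := β / (X2 q).2.1 with hb
  have hbt : b * (X2 q).2.1 = β := div_mul_cancel₀ _ t2.ne
  have hT1 := H1.tangent q hq1
  have hT2 := H2.tangent q hq2
  have hT : IsTangent q (W1 q - α • W2 q - b • K q) := by
    simp only [IsTangent] at hT1 hT2 hK ⊢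
    simp [inner_sub_right, inner_smul_right, hT1, hT2, hK]
  have hd : dX2 q (W1 q - α • W2 q - b • K q) = dX2 q (W1 q) - α • (1, 0, 0)
      - b • (0, (X2 q).2.1, 0) := by
    rw [map_sub, map_sub, map_smul, map_smul, H2.deriv_vec q hq2, H2.deriv_K q hq2]
  have h1 := H2.pos q hq2 _ hT (by rw [hd]; simp [hαd]) (by rw [hd]; simp [hbt, hβd])
  have e1 : g q (W1 q) (W1 q) = 0 := by rw [H1.grad q hq1 _ hT1, H1.deriv_vec q hq1]; simp
  have e2 : g q (W2 q) (W2 q) = 0 := by rw [H2.grad q hq2 _ hT2, H2.deriv_vec q hq2]; simp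
  have e3 : g q (W2 q) (W1 q) = 2 * (X2 q).2.1 * β := H2.grad q hq2 _ hT1
  have e4 : g q (W1 q) (K q) = 2 * (X1 q).2.1 * (X1 q).2.1 := by
    rw [H1.grad q hq1 _ hK, H1.deriv_K q hq1]
  have e5 : g q (W2 q) (K q) = 2 * (X2 q).2.1 * (X2 q).2.1 := by
    rw [H2.grad q hq2 _ hK, H2.deriv_K q hq2]
  simp only [map_sub, map_smul, sub_apply, smul_apply, smul_eq_mul, hs _ _ hT1 hT2, hs _ _ hK hT1,
    hs _ _ hK hT2, e1, e2, e3, e4, e5] at h1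
  rw [← hbt] at h1 hβ
  set k := g q (K q) (K q)
  have h2 : 0 ≤ b * (b * k - 4 * (X1 q).2.1 ^ 2) := by nlinarith
  have h3 : b * k - 4 * (X1 q).2.1 ^ 2 < 0 := by by_contra h4; push Not at h4; nlinarith
  rw [← hbt]
  exact mul_nonneg_of_nonpos_of_nonpos (nonpos_of_mul_nonneg_left h2 h3) t2.le

variable {ρ t : ℝ} {θ : E3} (hx1 : (ρ, t, θ) ∈ cylinder D1 c1) (hx2 : (ρ, t, θ) ∈ cylinder D2 c2)
  (hs : ∀ t θ, t < 0 → ‖θ‖ = 1 → Ψ1 (ρ, t, θ) = Ψ2 (ρ, t, θ)) (hW : W1 (Ψ1 (ρ, t, θ)) = W2 (Ψ1 (ρ,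
  t, θ)))
include hx1 hx2 hs hW

omit hg hx1 hx2 hs hW in
lemma hasDerivWithinAt_line {r : ℝ} {y : ℝ × E3} (hr : (r, y) ∈ cylinder D1 c1)
    (hB : Ψ1 (r, y) ∈ B2) : HasDerivWithinAt (fun r => X2 (Ψ1 (r, y)))
      (dX2 (Ψ1 (r, y)) (W1 (Ψ1 (r, y)))) (qInt D1 c1) r := by
  have hm := mem_cyl.1 hr
  have h1 : ∀ r' ∈ qInt D1 c1, Ψ1 (r', y) ∈ cylinder D c := fun r' hr' =>
    H1.isOpenIn.subset (H1.mapsTo_inv (mem_cyl.2 ⟨hr', hm.2⟩))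
  have h2 : ∀ r' ∈ qInt D1 c1, X2 (Ψ1 (r', y)) = (X2 ∘ radial) (Ψ1 (r', y)) := fun r' hr' => by
    rw [Function.comp_apply, radial_of_norm (h1 r' hr').2.2.2]
  exact (HasFDerivWithinAt.comp_hasDerivWithinAt r
    (H2.deriv _ hB) (H1.line r y.1 y.2 hr)
    fun r' hr' => cyl_subset (h1 r' hr')).congr h2 (h2 r hm.1)

omit hg hW hx1 in
lemma apply_slice {p : Amb} (hp : p ∈ B1) (h : (X1 p).1 = ρ) : p ∈ B2 ∧ X2 p = X1 p := by
  have h1 := (H1.mapsTo hp).2.2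
  have h2 : X1 p = (ρ, (X1 p).2) := by rw [← h]
  have h3 : (ρ, (X1 p).2) ∈ cylinder D2 c2 := mem_cyl.2 ⟨(mem_cyl.1 hx2).1, h1⟩
  have h4 : p = Ψ2 (ρ, (X1 p).2) := by
    rw [← hs _ _ h1.1 h1.2]
    exact (H1.left p hp).symm.trans (congrArg Ψ1 h2)
  refine ⟨h4 ▸ H2.mapsTo_inv h3, ?_⟩
  rw [h2]
  conv_lhs => rw [h4, H2.right _ h3]

lemma eventually_compare : ∀ᶠ p in 𝓝[cylinder D c] Ψ1 (ρ, t, θ), p ∈ B1 ∧ p ∈ B2 ∧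
    ((X1 p).1 ≠ ρ → 0 < ((X1 p).1 - ρ) * ((X2 p).1 - ρ)) ∧
    0 ≤ ((X2 p).2.1 - (X1 p).2.1) * ((X1 p).1 - ρ) ∧ ((X1 p).1 = ρ → X2 p = X1 p) := by
  have hp1 := H1.mapsTo_inv hx1
  have hp2 : Ψ1 (ρ, t, θ) ∈ B2 := by rw [hs t θ hx1.2.2.1 hx1.2.2.2]; exact H2.mapsTo_inv hx2
  have hG := eventually_deriv hg H1 H2 hp1 hp2 hW
  filter_upwards [H1.eventually_line hx1 hG] with p hp
  obtain ⟨hp, hl⟩ := hp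
  have hpB2 := (hl _ right_mem_uIcc).2.1
  have hXp : ((X1 p).1, (X1 p).2) = X1 p := rfl
  rw [hXp, H1.left p hp] at hpB2
  have hd := fun r hr => hasDerivWithinAt_line H1 H2 (hl r hr).1 (hl r hr).2.1
  have hoc := H1.side.ordConnected_qInt c1
  have hρ := (mem_cyl.1 hx1).1
  have hm := mem_cyl.1 (H1.mapsTo hp)
  have hend : X2 (Ψ1 ((X1 p).1, (X1 p).2)) = X2 p := by rw [hXp, H1.left p hp]
  have hstart : X2 (Ψ1 (ρ, (X1 p).2)) = (ρ, (X1 p).2) := by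
    rw [hs _ _ hm.2.1 hm.2.2, H2.right (ρ, (X1 p).2) (mem_cyl.2 ⟨(mem_cyl.1 hx2).1, hm.2⟩)]
  obtain ⟨r, hr, h1⟩ := exists_mean_value (f := fun r => (X2 (Ψ1 (r, (X1 p).2))).1) hoc hρ hm.1
    fun r hr => HasFDerivAt.comp_hasDerivWithinAt r
      (fst ℝ ℝ (ℝ × E3)).hasFDerivAt (hd r hr)
  obtain ⟨r', hr', h2⟩ := exists_mean_value (f := fun r => (X2 (Ψ1 (r, (X1 p).2))).2.1) hoc hρ hm.1
    fun r hr => HasFDerivAt.comp_hasDerivWithinAt (l := fun x : Amb => x.2.1) r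
      covx.hasFDerivAt (hd r hr)
  rw [hend, hstart] at h1 h2
  refine ⟨hp, hpB2, fun hne => ?_, ?_, fun h => (apply_slice H1 H2 hx2 hs hp h).2⟩
  · rw [h1, mul_left_comm]; exact mul_pos (hl r hr).2.2.1 (mul_self_pos.2 (sub_ne_zero.2 hne))
  · rw [h2, mul_assoc]; exact mul_nonneg (hl r' hr').2.2.2 (mul_self_nonneg _)

include hD in
lemma eventually_eq : ∀ᶠ p in 𝓝[cylinder D c] Ψ1 (ρ, t, θ),
    p ∈ B1 ∧ p ∈ B2 ∧ W1 p = W2 p ∧ X2 p = X1 p := by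
  have he := hs t θ hx1.2.2.1 hx1.2.2.2
  have hc1 := eventually_compare hg H1 H2 hx1 hx2 hs hW
  have hc2 := eventually_compare hg H2 H1 hx2 hx1 (fun t θ ht hθ => (hs t θ ht hθ).symm)
    (by rw [← he, hW])
  rw [← he] at hc2
  have ht : ∀ᶠ p in 𝓝[cylinder D c] Ψ1 (ρ, t, θ), (X1 p).2.1 = (X2 p).2.1 := by
    filter_upwards [hc1, hc2] with p h1 h2
    by_cases h0 : (X1 p).1 = ρ
    · rw [h1.2.2.2.2 h0]
    · have h3 := h1.2.2.1 h0
      by_contra hne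
      have h4 := mul_nonneg h1.2.2.2.1 h2.2.2.2.1
      have h5 := mul_pos h3 (mul_self_pos.2 (sub_ne_zero.2 hne))
      nlinarith
  have hWe : ∀ᶠ p in 𝓝[cylinder D c] Ψ1 (ρ, t, θ), p ∈ B2 ∧ W1 p = W2 p := by
    filter_upwards [eventually_eventually_nhdsWithin.2 ht, hc1, self_mem_nhdsWithin]
      with p h1 h2 hp
    refine ⟨h2.2.1, ?_⟩
    have hpc := cyl_subset hp
    have hrad : Tendsto radial (𝓝[cDom D c] p) (𝓝[cylinder D c] p) := by
      refine tendsto_nhdsWithin_iff.2 ⟨?_, eventually_mem_nhdsWithin.mono fun q hq => radial_mem hq⟩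
      have := (contDiffAt_radial (n := 0) hpc.2.2).continuousAt.tendsto
      rw [radial_of_norm hp.2.2.2] at this
      exact this.mono_left nhdsWithin_le_nhds
    have hd : ∀ {X : Amb → Amb} {L : Amb →L[ℝ] Amb}, HasFDerivWithinAt (X ∘ radial) L
        (cDom D c) p → HasFDerivWithinAt (fun q => (X (radial q)).2.1) (covx.comp L)
        (cDom D c) p := fun h => HasFDerivAt.comp_hasFDerivWithinAt p
      covx.hasFDerivAt h
    have h3 :=
      (uniqueDiff_cone hD hg.c_pos p hpc).eq (hd (H1.deriv p h2.1))
        ((hd (H2.deriv p h2.2.1)).congr_of_eventuallyEq (hrad.eventually h1)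
          (by rw [radial_of_norm hp.2.2.2]; exact h1.self_of_nhdsWithin hp))
    have h4 := H1.tangent p h2.1
    have h5 := H2.tangent p h2.2.1
    have h6 : IsTangent p (W1 p - W2 p) := by
      simp only [IsTangent] at h4 h5 ⊢
      simp [inner_sub_right, h4, h5]
    refine sub_eq_zero.1 ((hg.lorentzian p hp).nondeg h6 fun u hu => ?_)
    rw [map_sub, sub_apply, H1.grad p h2.1 u hu, H2.grad p h2.2.1 u hu,
      h1.self_of_nhdsWithin hp, show (dX1 p u).2.1 = (dX2 p u).2.1 from DFunLike.congr_fun h3 u,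
      sub_self]
  filter_upwards [H1.eventually_line hx1 hWe] with p hp
  obtain ⟨hp, hl⟩ := hp
  have hXp : ((X1 p).1, (X1 p).2) = X1 p := rfl
  have h1 := (hl _ right_mem_uIcc).2
  rw [hXp, H1.left p hp] at h1
  refine ⟨hp, h1.1, h1.2, ?_⟩
  have hm := mem_cyl.1 (H1.mapsTo hp)
  have hsub := (H1.side.ordConnected_qInt c1).uIcc_subset (mem_cyl.1 hx1).1 hm.1
  have hd : ∀ r ∈ uIcc ρ (X1 p).1, HasDerivWithinAt
      (fun r => X2 (Ψ1 (r, (X1 p).2)) - (r, 0, 0)) 0 (uIcc ρ (X1 p).1) r := fun r hr => by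
    have h2 := (hasDerivWithinAt_line H1 H2 (hl r hr).1 (hl r hr).2.1).mono hsub
    rw [(hl r hr).2.2, H2.deriv_vec _ (hl r hr).2.1] at h2
    have h3 : HasDerivAt (fun r : ℝ => ((r, 0, 0) : Amb)) (1, 0, 0) r :=
      (hasDerivAt_id r).prodMk (hasDerivAt_const _ _)
    have h4 := HasDerivWithinAt.sub h2 h3.hasDerivWithinAt
    rw [sub_self] at h4
    exact h4
  have h2 := (convex_uIcc ρ (X1 p).1).norm_image_sub_le_of_norm_hasDerivWithin_le (C := 0) hd
    (fun _ _ => by simp) left_mem_uIcc right_mem_uIcc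
  rw [zero_mul, norm_le_zero_iff, sub_eq_zero, hXp, H1.left p hp, hs _ _ hm.2.1 hm.2.2,
    H2.right (ρ, (X1 p).2) (mem_cyl.2 ⟨(mem_cyl.1 hx2).1, hm.2⟩), sub_eq_iff_eq_add] at h2
  rw [h2, ← hXp]
  simp [hXp]

end HasNullLines

end

section

variable {D1 D2 : Set ℝ} {c1 c2 : ℝ} {B1 B2 : Set Amb} {X1 X2 Ψ1 Ψ2 W1 W2 : Amb → Amb} {dX1 dX2 :
  Amb → Amb →L[ℝ] Amb} (H1 : HasNullLines D c g K D1 c1 B1 X1 Ψ1 W1 dX1) (H2 : HasNullLines D c g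
  K D2 c2 B2 X2 Ψ2 W2 dX2)

namespace HasNullLines

include H1

lemma continuousOn_line : ContinuousOn (fun z : ℝ × E3 =>
    (Ψ1 (z.1, -1, z.2), W1 (Ψ1 (z.1, -1, z.2))))
    (qInt D1 c1 ×ˢ {θ | ‖θ‖ = 1}) := by
  have h1 : ContinuousOn (fun z => Ψ1 (z.1, -1, z.2)) (qInt D1 c1 ×ˢ {θ | ‖θ‖ = 1}) :=
    H1.cont_inv.comp (by fun_prop) fun z hz => mem_cyl.2 ⟨hz.1, by simp, hz.2⟩
  exact h1.prodMk (H1.cont_vec.comp h1 fun z hz => H1.mapsTo_inv (mem_cyl.2 ⟨hz.1, by simp, hz.2⟩))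

include hg in
lemma isIntegralCurveIn_K {ρ : ℝ} {θ : E3} (hρ : ρ ∈ qInt D1 c1) (hθ : ‖θ‖ = 1) :
    IsIntegralCurveIn K (cylinder D c) (fun a => Ψ1 (ρ, -exp a, θ)) univ := by
  intro a _
  obtain ⟨t, ht⟩ : ∃ t, t = -exp a := ⟨_, rfl⟩
  have hx : (ρ, t, θ) ∈ cylinder D1 c1 :=
    mem_cyl.2 ⟨hρ, ht ▸ neg_neg_of_pos (exp_pos a), hθ⟩
  have hB := H1.mapsTo_inv hx
  have hc := H1.isOpenIn.subset hB
  obtain ⟨u, hu, hdu, hd⟩ := H1.slice _ hx (0, 1, 0) rfl (inner_zero_right _)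
  have hK : K (Ψ1 (ρ, t, θ)) = t • u := by
    have h1 := hg.K_tangent _ hc
    refine sub_eq_zero.1 (H1.inj _ hB _ ?_ ?_)
    · simp only [IsTangent] at hu h1 ⊢; simp [inner_sub_right, inner_smul_right, hu, h1]
    · rw [map_sub, map_smul, hdu, H1.deriv_K _ hB, H1.right _ hx]; simp
  have h1 : HasDerivAt (fun b => -exp b - t) t a := by
    have := ((Real.hasDerivAt_exp a).neg).sub_const t
    rwa [← ht] at this
  have h3 : ∀ b : ℝ, radial ((ρ, t, θ) + (-exp b - t) • (0, 1, 0)) = (ρ, -exp b, θ) :=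
    fun b => by
      have h4 : ((ρ, t, θ) + (-exp b - t) • (0, 1, 0) : Amb) = (ρ, -exp b, θ) := by simp
      rw [h4, radial_of_norm (p := (ρ, -exp b, θ)) hθ]
  have hd' : HasDerivAt (fun b : ℝ => Ψ1 (radial ((ρ, t, θ) + b • (0, 1, 0)))) u (-exp a - t) := by
    rw [← ht, sub_self]
    exact hd
  have h2 : HasDerivAt (fun b => Ψ1 (radial ((ρ, t, θ) + (-exp b - t) • (0, 1, 0)))) (t • u) a :=
    HasDerivAt.scomp (g₁ := fun b : ℝ => Ψ1 (radial ((ρ, t, θ) + b • (0, 1, 0)))) a hd' h1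
  simp only [h3] at h2
  beta_reduce
  rw [← ht]
  refine ⟨hc, ?_⟩
  rw [hK]
  have h5 : HasDerivWithinAt (fun b => Ψ1 (ρ, -exp b, θ)) (t • u) univ a := h2.hasDerivWithinAt
  exact h5

include H2

include hD hg in
lemma inv_eq_of_neg_one {ρ t : ℝ} {θ : E3} (h₁ : ρ ∈ qInt D1 c1) (h₂ : ρ ∈ qInt D2 c2)
    (ht : t < 0) (hθ : ‖θ‖ = 1) (h : Ψ1 (ρ, -1, θ) = Ψ2 (ρ, -1, θ)) :
    Ψ1 (ρ, t, θ) = Ψ2 (ρ, t, θ) := by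
  have h3 := timeMap_flow hD hg (H1.isIntegralCurveIn_K hg h₁ hθ) (log (-t))
  have h4 := timeMap_flow hD hg (H2.isIntegralCurveIn_K hg h₂ hθ) (log (-t))
  simp only [exp_zero, exp_log (neg_pos.2 ht), neg_neg] at h3 h4
  refine timeMap_injOn hD hg ?_ ?_ (h3.trans (by rw [h, h4]))
  · exact cyl_subset (H1.isOpenIn.subset (H1.mapsTo_inv (mem_cyl.2 ⟨h₁, ht, hθ⟩)))
  · exact cyl_subset (H2.isOpenIn.subset (H2.mapsTo_inv (mem_cyl.2 ⟨h₂, ht, hθ⟩)))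

lemma exists_slice {x v : Amb} (hx1 : x ∈ cylinder D1 c1) (hx2 : x ∈ cylinder D2 c2)
    (hs : ∀ t θ, t < 0 → ‖θ‖ = 1 → Ψ1 (x.1, t, θ) = Ψ2 (x.1, t, θ)) (hv0 : v.1 = 0)
    (hv : IsTangent x v) :
    ∃ u, IsTangent (Ψ1 x) u ∧ dX1 (Ψ1 x) u = v ∧ dX2 (Ψ1 x) u = v := by
  have he := hs _ _ hx1.2.2.1 hx1.2.2.2
  obtain ⟨u, hu, h1, h2⟩ := H1.slice x hx1 v hv0 hv
  obtain ⟨u', hu', h1', h2'⟩ := H2.slice x hx2 v hv0 hv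
  have h3 : u = u' := by
    refine h2.unique (h2'.congr_of_eventuallyEq ?_)
    filter_upwards [eventually_mem_cDom hx1 hv0] with a ha
    have h4 := (radial_mem ha).2.2
    have h5 : radial (x + a • v) = (x.1, (radial (x + a • v)).2) :=
      Prod.ext (by simp [radial, hv0]) rfl
    rw [h5]
    exact hs _ _ h4.1 h4.2
  exact ⟨u, hu, h1, by rw [he, h3, h1']⟩

omit H2 in
include hD hg in
lemma vec_eq_zero {P : Amb → ℝ} {h : Amb → E3 →L[ℝ] ℝ} {m : Amb → E3 →L[ℝ] E3 →L[ℝ] ℝ}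
    (hX2 : IsHomotheticGauge D c g K D2 c2 B2 X2 P h m)
    (H2 : HasNullLines D c g K D2 c2 B2 X2 Ψ2 W2
      fun p => fderivWithin ℝ (X2 ∘ radial) (radial ⁻¹' B2) p)
    {x : Amb} (hx0 : x.1 = 0) (hx1 : x ∈ cylinder D1 c1) (hx2 : x ∈ cylinder D2 c2)
    (hs : ∀ t θ, t < 0 → ‖θ‖ = 1 → Ψ1 (x.1, t, θ) = Ψ2 (x.1, t, θ)) :
    W1 (Ψ1 x) = W2 (Ψ1 x) := by
  have he := hs _ _ hx1.2.2.1 hx1.2.2.2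
  have hB1 := H1.mapsTo_inv hx1
  have hB2 := H2.mapsTo_inv hx2
  rw [← he] at hB2
  have hXx : X2 (Ψ1 x) = x := by rw [he, H2.right x hx2]
  have hW1 := H1.tangent _ hB1
  have hform := hX2.metric_eq _ hB2 (W1 (Ψ1 x))
  have hgrad := H1.grad _ hB1
  rw [hXx] at hform
  rw [H1.right x hx1] at hgrad
  obtain ⟨⟨α, β, e⟩, hd⟩ : ∃ v, differential X2 B2 (Ψ1 x) (W1 (Ψ1 x)) = v := ⟨_, rfl⟩
  rw [hd] at hform
  have het : inner ℝ x.2.2 e = (0 : ℝ) := by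
    have h1 := differential_tangent (fun p hp => (hX2.isOpenIn.subset hp).2.2.2)
      (fun x hx => hx.2.2.2) (hX2.isOpenIn.uniqueDiffOn hD hg.c_pos) hX2.coordinates.2.1
          hX2.coordinates.1 hB2 (W1 (Ψ1 x))
    rw [hXx, hd] at h1
    exact h1
  have h1 : ∀ w, inner ℝ x.2.2 w = 0 → m x e w = β * h x w := fun w hw => by
    obtain ⟨u, hu, hu1, hu2⟩ := exists_slice H1 H2 hx1 hx2 hs (v := (0, 0, w)) rfl hw
    have h2 := hform u hW1 hu
    rw [hgrad u hu, hu1, show differential X2 B2 (Ψ1 x) u = (0, 0, w) from hu2] at h2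
    simp [homotheticForm] at h2
    linarith
  have h2 : P x * β + 2 * x.2.1 * α - h x e = 2 * x.2.1 := by
    obtain ⟨u, hu, hu1, hu2⟩ := exists_slice H1 H2 hx1 hx2 hs (v := (0, 1, 0)) rfl
      (inner_zero_right _)
    have h2 := hform u hW1 hu
    rw [hgrad u hu, hu1, show differential X2 B2 (Ψ1 x) u = (0, 1, 0) from hu2] at h2
    simp [homotheticForm] at h2
    linarith
  have h3 := hform _ hW1 hW1
  rw [hgrad _ hW1, H1.deriv_vec _ hB1, hd] at h3
  simp only [homotheticForm, mul_zero] at h3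
  obtain ⟨b, hb, hbh, hP⟩ := hX2.P_zero x hx2 hx0
  have heb : e = β • b := by
    by_contra hne
    have ht : inner ℝ x.2.2 (e - β • b) = (0 : ℝ) := by
      rw [inner_sub_right, inner_smul_right, het, hb]
      ring
    have h4 := (hX2.riemannian x hx2).2 _ ht (sub_ne_zero.2 hne)
    rw [map_sub, map_smul, (hX2.riemannian x hx2).1 _ _ ht het,
      (hX2.riemannian x hx2).1 _ _ ht hb, h1 _ ht, hbh _ ht, smul_eq_mul, sub_self] at h4
    exact lt_irrefl _ h4
  have h4 : h x e = β * P x := by rw [heb, map_smul, smul_eq_mul, ← hbh b hb, hP]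
  have h5 := h1 e het
  have ht := hx1.2.2.1.ne
  rw [h4] at h2 h5
  have hα : α = 1 := mul_left_cancel₀ (mul_ne_zero two_ne_zero ht) (by linarith)
  have hβ : β = 0 := by
    rw [h5, h4, hα] at h3
    have : x.2.1 * β = 0 := by linarith
    exact (mul_eq_zero.1 this).resolve_left ht
  have hW2 := H2.tangent _ hB2
  refine sub_eq_zero.1 (H2.inj _ hB2 _ ?_ ?_)
  · simp only [IsTangent] at hW1 hW2 ⊢; simp [inner_sub_right, hW1, hW2]
  · rw [map_sub, H2.deriv_vec _ hB2]
    change differential X2 B2 (Ψ1 x) (W1 (Ψ1 x)) - _ = 0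
    rw [hd, heb, hα, hβ]
    simp

include hD hg in
lemma inv_eq (h0 : ∀ θ, ‖θ‖ = 1 → Ψ1 (0, -1, θ) = Ψ2 (0, -1, θ) ∧
      W1 (Ψ1 (0, -1, θ)) = W2 (Ψ2 (0, -1, θ))) (hc1 : 0 < c1) (hc2 : 0 < c2)
    (hD1 : (0 : ℝ) ∈ D1) (hD2 : (0 : ℝ) ∈ D2) {ρ : ℝ} (h₁ : ρ ∈ qInt D1 c1) (h₂ : ρ ∈ qInt D2 c2) :
    ∀ t θ, t < 0 → ‖θ‖ = 1 → Ψ1 (ρ, t, θ) = Ψ2 (ρ, t, θ) := by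
  set R := qInt D1 c1 ∩ qInt D2 c2 with hR
  have hRo := (H1.side.ordConnected_qInt c1).inter (H2.side.ordConnected_qInt c2)
  set S : Set E3 := {θ | ‖θ‖ = 1} with hS
  have hSc : IsCompact S := by
    have : S = Metric.sphere 0 1 := by ext; simp [hS]
    rw [this]
    exact isCompact_sphere 0 1
  set Z1 : ℝ × E3 → Amb × Amb := fun z => (Ψ1 (z.1, -1, z.2), W1 (Ψ1 (z.1, -1, z.2))) with hZ1
  set Z2 : ℝ × E3 → Amb × Amb := fun z => (Ψ2 (z.1, -1, z.2), W2 (Ψ2 (z.1, -1, z.2))) with hZ2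
  have hc1 : ContinuousOn Z1 (R ×ˢ S) :=
    H1.continuousOn_line.mono (prod_mono inter_subset_left subset_rfl)
  have hc2 : ContinuousOn Z2 (R ×ˢ S) :=
    H2.continuousOn_line.mono (prod_mono inter_subset_right subset_rfl)
  have h0R : (0 : ℝ) ∈ R := ⟨⟨hD1, by simpa⟩, hD2, by simpa⟩
  have key := (isPreconnected_iff_ordConnected.2 hRo).induction₂
    (fun ρ ρ' => (∀ θ ∈ S, Z1 (ρ, θ) = Z2 (ρ, θ)) ↔ ∀ θ ∈ S, Z1 (ρ', θ) = Z2 (ρ', θ))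
    (fun ρ hρ => ?_) (fun _ _ _ _ _ _ => Iff.trans) (fun _ _ _ _ => Iff.symm) h0R ⟨h₁, h₂⟩
  · have h3 := key.1 fun θ hθ => Prod.ext (h0 θ hθ).1 (h0 θ hθ).2
    exact fun t θ ht hθ => inv_eq_of_neg_one hD hg H1 H2 h₁ h₂ ht hθ
      (congrArg Prod.fst (h3 θ hθ) :)
  by_cases hF : ∀ θ ∈ S, Z1 (ρ, θ) = Z2 (ρ, θ)
  · have hs : ∀ t θ, t < 0 → ‖θ‖ = 1 → Ψ1 (ρ, t, θ) = Ψ2 (ρ, t, θ) := fun t θ ht hθ =>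
      inv_eq_of_neg_one hD hg H1 H2 hρ.1 hρ.2 ht hθ (congrArg Prod.fst (hF θ hθ) :)
    have h3 : ∀ θ ∈ S, ∀ᶠ z : ℝ × E3 in 𝓝 (ρ, θ), z ∈ R ×ˢ S → Z1 z = Z2 z := fun θ hθ => by
      have hx1 : (ρ, -1, θ) ∈ cylinder D1 c1 := mem_cyl.2 ⟨hρ.1, by simp, hθ⟩
      have hx2 : (ρ, -1, θ) ∈ cylinder D2 c2 := mem_cyl.2 ⟨hρ.2, by simp, hθ⟩
      have hW : W1 (Ψ1 (ρ, -1, θ)) = W2 (Ψ1 (ρ, -1, θ)) := by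
        have h4 : W1 (Ψ1 (ρ, -1, θ)) = W2 (Ψ2 (ρ, -1, θ)) := (congrArg Prod.snd (hF θ hθ) :)
        rw [h4, hs _ _ hx1.2.2.1 hθ]
      have h4 := eventually_eq hD hg H1 H2 hx1 hx2 hs hW
      have h5 :=
        tendsto_nhdsWithin_iff.2 ⟨(hc1 (ρ, θ) ⟨hρ, hθ⟩).fst, eventually_mem_nhdsWithin.mono
          fun z hz => H1.isOpenIn.subset (H1.mapsTo_inv
            (mem_cyl.2 ⟨hz.1.1, by simp, hz.2⟩))⟩
      refine eventually_nhdsWithin_iff.1 ?_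
      filter_upwards [h5.eventually h4, self_mem_nhdsWithin] with z h6 hz
      have h7 : Ψ2 (z.1, -1, z.2) = Ψ1 (z.1, -1, z.2) := by
        have h8 := H2.left _ h6.2.1
        have h9 := h6.2.2.2.trans
          (H1.right _ (mem_cyl.2 ⟨hz.1.1, by simp, hz.2⟩))
        change Ψ2 (X2 (Ψ1 (z.1, -1, z.2))) = Ψ1 (z.1, -1, z.2) at h8
        rwa [h9] at h8
      refine Prod.ext h7.symm ?_
      change W1 (Ψ1 (z.1, -1, z.2)) = W2 (Ψ2 (z.1, -1, z.2))
      rw [h7]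
      exact h6.2.2.1
    have h4 := hSc.eventually_forall_of_forall_eventually
      (P := fun r θ => (r, θ) ∈ R ×ˢ S → Z1 (r, θ) = Z2 (r, θ)) h3
    filter_upwards [nhdsWithin_le_nhds h4, self_mem_nhdsWithin] with r hr hrR
    exact iff_of_true hF fun θ hθ => hr θ hθ ⟨hrR, hθ⟩
  · obtain ⟨θ, hθ, hne⟩ : ∃ θ ∈ S, Z1 (ρ, θ) ≠ Z2 (ρ, θ) := by push Not at hF; exact hF
    have hl : ∀ {Z : ℝ × E3 → Amb × Amb}, ContinuousOn Z (R ×ˢ S) →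
        Tendsto (fun r => Z (r, θ)) (𝓝[R] ρ) (𝓝 (Z (ρ, θ))) := fun hZ =>
      (hZ.comp (f := fun r : ℝ => (r, θ)) (by fun_prop) fun r hr => ⟨hr, hθ⟩) ρ hρ
    filter_upwards [((hl hc1).sub (hl hc2)).eventually_ne (sub_ne_zero.2 hne)] with r hr
    exact iff_of_false hF fun h => sub_ne_zero.1 hr (h θ hθ)

end HasNullLines

include hD hg

theorem IsHomotheticGauge.coefficients_eq {P1 P2 : Amb → ℝ} {h₁ h₂ : Amb → E3 →L[ℝ] ℝ}
    {m1 m2 : Amb → E3 →L[ℝ] E3 →L[ℝ] ℝ} (hX1 : IsHomotheticGauge D c g K D1 c1 B1 X1 P1 h₁ m1)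
    (hX2 : IsHomotheticGauge D c g K D2 c2 B2 X2 P2 h₂ m2) (heq : EqOn X1 X2 hypersurfaceZero)
    {x : Amb} (hx : x ∈ cylinder D1 c1 ∩ cylinder D2 c2) : P1 x = P2 x ∧
      (∀ w : E3, inner ℝ x.2.2 w = 0 → h₁ x w = h₂ x w) ∧
      ∀ w w' : E3, inner ℝ x.2.2 w = 0 → inner ℝ x.2.2 w' = 0 → m1 x w w' = m2 x w w' := by
  obtain ⟨Ψ1, W1, H1⟩ := hX1.exists_nullLines hD hg
  obtain ⟨Ψ2, W2, H2⟩ := hX2.exists_nullLines hD hg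
  have hD0 : ∀ {D : Set ℝ}, IsSide D → (0 : ℝ) ∈ D := by rintro D (rfl | rfl | rfl) <;> simp
  have hzero := fun t θ ht hθ => by
    have hm : ((0, t, θ) : Amb) ∈ cylinder D1 c1 := ⟨hD0 H1.side, by simpa using hX1.c'_pos, ht, hθ⟩
    have h3 := H1.right _ hm
    have h4 := (hX1.zero_iff _ (H1.mapsTo_inv hm)).2 (by rw [h3])
    have h5 := H2.left _ (hX2.zero_subset h4)
    rw [← heq h4, h3] at h5
    exact h5.symm
  have h0 : ∀ θ, ‖θ‖ = 1 → Ψ1 (0, -1, θ) = Ψ2 (0, -1, θ) ∧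
      W1 (Ψ1 (0, -1, θ)) = W2 (Ψ2 (0, -1, θ)) := fun θ hθ => by
    have h3 := H1.vec_eq_zero hD hg hX2 H2 (x := (0, -1, θ)) rfl
      ⟨hD0 H1.side, by simpa using hX1.c'_pos, by simp, hθ⟩
      ⟨hD0 H2.side, by simpa using hX2.c'_pos, by simp, hθ⟩ hzero
    have h4 := hzero (-1) θ (by simp) hθ
    exact ⟨h4, by rw [h3, h4]⟩
  have hs := HasNullLines.inv_eq hD hg H1 H2 h0 hX1.c'_pos hX2.c'_pos (hD0 H1.side) (hD0 H2.side)
    (mem_cyl.1 hx.1).1 (mem_cyl.1 hx.2).1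
  have he := hs _ _ hx.1.2.2.1 hx.1.2.2.2
  have hform : ∀ v v' : Amb, v.1 = 0 → IsTangent x v → v'.1 = 0 → IsTangent x v' →
      homotheticForm (P1 x) x.2.1 (h₁ x) (m1 x) v v'
        = homotheticForm (P2 x) x.2.1 (h₂ x) (m2 x) v v' := fun v v' hv0 hv hv0' hv' => by
    obtain ⟨u, hu, hu1, hu2⟩ := H1.exists_slice H2 hx.1 hx.2 hs hv0 hv
    obtain ⟨u', hu', hu₁', hu₂'⟩ := H1.exists_slice H2 hx.1 hx.2 hs hv0' hv'
    have h3 := hX1.metric_eq _ (H1.mapsTo_inv hx.1) u u' hu hu'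
    have h4 := hX2.metric_eq (Ψ1 x) (by rw [he]; exact H2.mapsTo_inv hx.2) u u' hu hu'
    rw [H1.right x hx.1] at h3
    rw [he, H2.right x hx.2, ← he] at h4
    rw [show differential X1 B1 (Ψ1 x) u = v from hu1,
      show differential X1 B1 (Ψ1 x) u' = v' from hu₁'] at h3
    rw [show differential X2 B2 (Ψ1 x) u = v from hu2,
      show differential X2 B2 (Ψ1 x) u' = v' from hu₂'] at h4
    rw [← h3, h4]
  have ht : IsTangent x (0, 1, 0) := inner_zero_right _
  refine ⟨?_, fun w hw => ?_, fun w w' hw hw' => ?_⟩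
  · simpa [homotheticForm] using hform (0, 1, 0) (0, 1, 0) rfl ht rfl ht
  · simpa [homotheticForm] using hform (0, 1, 0) (0, 0, w) rfl ht rfl hw
  · simpa [homotheticForm] using hform (0, 0, w) (0, 0, w') rfl hw rfl hw'

end

end

end Development

theorem proposition4p2 (D : Set ℝ) (hD : IsSide D) (Ct : ℝ) (hCt : 0 < Ct) (hCt1 : Ct < 1)
    (N : ℕ) (hN : 1 ≤ N) (A : ℝ) (hA : 0 < A) :
    ∃ ε₀ : ℝ, 0 < ε₀ ∧ ∀ ε : ℝ, 0 < ε → ε < ε₀ →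
      ∀ (c : ℝ) (g : BilinField) (K : Amb → Amb) (s₀ : ℝ),
        IsTwistedSelfSimilar D Ct N A ε c g K s₀ →
        -- existence, by the explicit procedure
        (∃ t₀ : Amb → ℝ,
          -- the coordinates `(t, θ)` on the null hypersurface and its induced metric
          (IsHomotheticTime K s₀ t₀ ∧
            (∀ t₁, IsHomotheticTime K s₀ t₁ → Set.EqOn t₁ t₀ hypersurfaceZero) ∧
            IsZeroCoordinates t₀ ∧ HasInducedForm g t₀) ∧
          ∃ V₀ : Amb → Amb,
            -- the vector field along the null hypersurface
            (IsNullTransversal D c g K s₀ V₀ ∧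
              ∀ V₁, IsNullTransversal D c g K s₀ V₁ → Set.EqOn V₁ V₀ hypersurfaceZero) ∧
            ∃ (B : Set Amb) (V : Amb → Amb),
              -- its weakly geodesic extension to a dilation invariant neighbourhood
              (IsOpenIn D c B ∧ hypersurfaceZero ⊆ B ∧ IsFlowInvariant D c K B ∧
                (∀ p ∈ B, IsTangent p (V p)) ∧ ContinuousOn V B ∧
                Set.EqOn V V₀ hypersurfaceZero ∧ IsWeaklyGeodesicField D c g V B ∧
                -- the extension is determined by its values on the null hypersurface
                ∀ (J : Set ℝ) (γ : ℝ → Amb), J.OrdConnected → 0 ∈ J →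
                  γ 0 ∈ hypersurfaceZero → (∀ τ ∈ J, γ τ ∈ B) →
                  HasDerivWithinAt γ (V₀ (γ 0)) J 0 → IsWeakGeodesic D c g γ J →
                  IsIntegralCurveIn V B γ J) ∧
              -- the coordinates `X = (ρ, t, θ)` with `V ρ = 1`, `V t = 0`, `V θ = 0`
              ∃ (D' : Set ℝ) (c' : ℝ) (X : Amb → Amb)
                (P : Amb → ℝ) (h : Amb → E3 →L[ℝ] ℝ) (m : Amb → E3 →L[ℝ] E3 →L[ℝ] ℝ),
                (∀ p ∈ hypersurfaceZero, X p = (0, t₀ p, p.2.2)) ∧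
                (∀ p ∈ B, differential X B p (V p) = (1, 0, 0)) ∧
                IsHomotheticGauge D c g K D' c' B X P h m) ∧
        -- uniqueness of the form of the metric, given the coordinates on the null hypersurface
        (∀ (D₁ : Set ℝ) (c₁ : ℝ) (B₁ : Set Amb) (X₁ : Amb → Amb)
          (P₁ : Amb → ℝ) (h₁ : Amb → E3 →L[ℝ] ℝ) (m₁ : Amb → E3 →L[ℝ] E3 →L[ℝ] ℝ)
          (D₂ : Set ℝ) (c₂ : ℝ) (B₂ : Set Amb) (X₂ : Amb → Amb)
          (P₂ : Amb → ℝ) (h₂ : Amb → E3 →L[ℝ] ℝ) (m₂ : Amb → E3 →L[ℝ] E3 →L[ℝ] ℝ),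
          IsHomotheticGauge D c g K D₁ c₁ B₁ X₁ P₁ h₁ m₁ →
          IsHomotheticGauge D c g K D₂ c₂ B₂ X₂ P₂ h₂ m₂ →
          Set.EqOn X₁ X₂ hypersurfaceZero →
          ∀ x ∈ cylinder D₁ c₁ ∩ cylinder D₂ c₂, P₁ x = P₂ x ∧
            (∀ w : E3, inner ℝ x.2.2 w = 0 → h₁ x w = h₂ x w) ∧
            ∀ w w' : E3, inner ℝ x.2.2 w = 0 → inner ℝ x.2.2 w' = 0 → m₁ x w w' = m₂ x w w') := by
  refine ⟨A⁻¹, inv_pos.2 hA, fun ε _ hεA c g K s₀ hg => ⟨?_, ?_⟩⟩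
  · have hε : A * ε < 1 := by
      have := mul_lt_mul_of_pos_left hεA hA
      rwa [mul_inv_cancel₀ hA.ne'] at this
    obtain ⟨w, rt, Q, r₀, hQ⟩ := exists_isSubst hD hCt hCt1 hg.c_pos
    have hR := isRedMetric (s0 := s₀) hD hQ hg
    have hn := redM_isNullAtZero hD hQ hg hε
    obtain ⟨δ, y, hy⟩ := hR.exists_nullFlow hn hQ.w_cont
    obtain ⟨δ', c', σ, Φ, Φi, hδ, hΦ⟩ := exists_reducedGauge hR hQ.root hy hg.c_pos
    have hz := gaugeField_zero hQ hy hΦ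
    refine ⟨zeroTime K s₀, ⟨zeroTime_isHomotheticTime hD hg,
      fun _ => homotheticTime_unique hD hg, zeroTime_isZeroCoordinates hD hg,
      zeroTime_hasInducedForm hD hQ hg hε⟩, zeroField D c g Q K s₀,
      ⟨zeroField_isNullTransversal hD hQ hg hε, fun V hV => ?_⟩,
      gaugeSet D c K s₀ c' Φ, gaugeField D c K s₀ Φ Φi,
      ⟨isOpenIn_gaugeSet hD hg hΦ, hypersurfaceZero_subset_gaugeSet hD hQ hg hy hΦ,
        gaugeSet_flowInvariant hD hg hΦ, fun p hp => gaugeField_tangent hy hΦ hp,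
        gaugeField_continuousOn hD hg hΦ, hz,
        gaugeField_isWeaklyGeodesicField hD hQ hg hy hΦ, fun J γ hJ h0 hγ hB hd hw => ?_⟩,
      {r | σ * r ∈ D}, c', gaugeCoord K s₀ Φi, _, _, _, fun p hp => ?_,
      fun p hp => differential_gaugeField hD hg hy hΦ hp,
      gauge_isHomotheticGauge hD hQ hg hε hy hΦ hδ⟩
    · refine nullTransversal_unique hD hg hε hV (zeroField_isNullTransversal hD hQ hg hε)
        fun θ hθ => ?_
      exact (hR.initMom_spec hn hθ).1
    · exact gaugeField_determined hD hQ hg hy hΦ hJ h0 hB (by rwa [hz hγ]) hw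
    · rw [gaugeCoord, gauge_inv_zero hQ hy hΦ hp, expMap, zeroTime]
  · exact fun _ _ _ _ _ _ _ _ _ _ _ _ _ _ hX₁ hX₂ heq _ hx => hX₁.coefficients_eq hD hg hX₂ heq hx
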